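/- **Setting (Combinatorial Semi-BwK).** There are $n\ge 1$ atoms, $d\ge1$ resources, a horizon $T$, a budget $0<B\le T$ (the same for each resource) and a family $\mathcal F$ of feasible actions, which are subsets $S$ of the set of atoms. In round $t$ each atom $e$ has an outcome vector $\vec o_{t,e}\in[0,\tfrac1n]^{d+1}$ (reward; consumption of each resource). If $S_t\in\mathcal F$ is chosen, the vectors $\vec o_{t,e}$, $e\in S_t$, are observed, and the reward $r_t(S_t)$ and consumptions $c_{t,i}(S_t)$ are the coordinates of $\sum_{e\in S_t}\vec o_{t,e}$. The game stops after the first round in which the total consumption of some resource exceeds $B$, or after round $T$; $\mathrm{REW}$ is the total reward of the rounds played (the stopping round included). Some action in $\mathcal F$ is a null action: its reward and consumption are zero in every round. - *Stochastic version:* the matrices $(\vec o_{t,e})_e$ are i.i.d. over rounds from a fixed distribution; one of the $d$ resources is a dummy resource, of which every action (the null action too) consumes $B/T$ per round, instead of the sum over atoms. $\mathrm{OPT}_{\mathrm{DP}}$ is the supremum of $\mathbb E[\mathrm{REW}]$ over all (randomized) policies with semi-bandit feedback. - *Adversarial version:* the $\vec o_{t,e}$ are arbitrary and fixed in advance, there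 is no dummy resource, and $\mathrm{OPT}_{\mathrm{FD}}$ is the maximum of $\mathbb E[\mathrm{REW}]$ over fixed distributions on $\mathcal F$, the actions being drawn i.i.d. from it. **The algorithm with parameter $T_0>0$** (and $B_0=B$). Put $\rho=T_0/B$ and $\mathcal L_t(S,i)=r_t(S)+1-\rho\,c_{t,i}(S)\in[1-\rho,2]$. In each round a primal algorithm chooses $S_t\in\mathcal F$ and, independently given the past, a dual algorithm chooses a resource $i_t$. - *Dual: Hedge* with rate $\sqrt{8\ln d/T}$ on the costs $(\mathcal L_t(S_t,i)-(1-\rho))/(1+\rho)\in[0,1]$ of all $i$. - *Primal: the algorithm of Neu (2016)* (follow the perturbed leader with geometric resampling, high-probability variant). $S$ is encoded by the $n$ coordinates $(e,\mathbf 1[e\in S])$ out of $2n$. Let $\Lambda=\ln(2nT)$, $\eta=\sqrt{\Lambda/(2nT)}$, $\beta=\sqrt{\Lambda/(2T)}$, $M=\lceil\sqrt{2T/(n\Lambda)}\rceil$. With cumulative loss estimates $\tilde L$ and fresh independent standard exponential perturbations $Z$, it plays the $S\in\mathcal F$ that minimizes $\sum_{x\in S}(\eta\tilde L(x)-Z(x))$,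 the sum being over the coordinates $x$ of $S$. The coordinate $(e,1)$ has loss $\ell=(1-n(r_{t,e}-\rho c_{t,i_t,e}))/(1+\rho)$, where $(r_{t,e};c_{t,1,e},\dots,c_{t,d,e})=\vec o_{t,e}$ (with $c_{t,i,e}=0$ for the dummy resource), and $(e,0)$ has loss $\ell=1/(1+\rho)$. For each coordinate $x$ of the chosen action, $\tilde L(x)$ grows by $\tfrac1\beta\ln(1+\beta K\ell)$, where $K$ is the index of the first of $M$ resampled actions (all with the current $\tilde L$ and fresh perturbations) that has the coordinate $x$, and $K=M$ if none has. In the stochastic version the algorithm is run with $T_0=T$. In the adversarial version, for a scale parameter $\kappa>1$, one draws $u$ uniformly from $[0,\log_\kappa(T/\sqrt T)]$ and runs it with $T_0=\sqrt T\,\kappa^u/(d+1)$. **Corollary 7.2.** Let $\mathrm{reg}=\sqrt{nT\ln T}$. - **(C1)** There is an absolute constant $C$ such that, in every stochastic instance with $T\ge1$, with probability at least $1-\tfrac1T$, $$\mathrm{OPT}_{\mathrm{DP}}-\mathrm{REW}\le C\cdot\tfrac TB\cdot\bigl(\mathrm{reg}+\sqrt{T\ln d}\bigr).$$ (For $d\le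 T^n$ the bracket is at most $2\,\mathrm{reg}$.) - **(C2)** For every $d$ there is a constant $C=C(d)$, which depends on nothing else, such that in every adversarial instance with $T\ge2$ and $\mathrm{OPT}_{\mathrm{FD}}>0$, and for every $\kappa>1$, $$\frac{\mathbb E[\mathrm{REW}]}{\mathrm{OPT}_{\mathrm{FD}}}\ \ge\ \frac{1-C\cdot\mathrm{reg}\cdot\bigl(\tfrac1{\mathrm{OPT}_{\mathrm{FD}}}+\tfrac1{dB}\bigr)}{\tfrac12(d+1)\ln T}.$$ In particular the regret term is polynomial in $n$ and does not depend on $|\mathcal F|$. -/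

import Mathlib

open MeasureTheory ProbabilityTheory

noncomputable section

namespace SemiBwK

/-! ### The problem: combinatorial semi-bandits with knapsacks

Atoms are `Fin n`, resources are `Fin d`, rounds are `0, …, T - 1`, actions are finite sets of atoms
from a feasible family `F`. -/

/-- Outcome vectors of all atoms in one round: coordinate `0` is the reward and coordinate `i.succ`
is the consumption of resource `i`. -/
abbrev Outcome (n d : ℕ) : Type := Fin n → Fin (d + 1) → ℝ

/-- All entries lie in `[0, 1/n]`. -/
def IsOutcome {n d : ℕ} (o : Outcome n d) : Prop :=
  ∀ e j, 0 ≤ o e j ∧ o e j ≤ 1 / (n : ℝ)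

/-- `S` is a null action for `o`: zero reward and zero consumption of every atomic resource. -/
def IsNullFor {n d : ℕ} (S : Finset (Fin n)) (o : Outcome n d) : Prop :=
  ∀ j, ∑ e ∈ S, o e j = 0

/-- Reward of action `S`. -/
def actionReward {n d : ℕ} (o : Outcome n d) (S : Finset (Fin n)) : ℝ :=
  ∑ e ∈ S, o e 0

/-- Consumption of resource `i` by action `S`. The vector `base` is a known consumption per round
that does not depend on the action: it is zero, except for a dummy resource. -/
def actionCost {n d : ℕ} (base : Fin d → ℝ) (o : Outcome n d) (S : Finset (Fin n)) (i : Fin d) : ℝ :=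
  base i + ∑ e ∈ S, o e i.succ

/-- Base consumption when `i₀` is the dummy resource: every action consumes `B/T` of it. -/
def dummyBase {d : ℕ} (T : ℕ) (B : ℝ) (i₀ : Fin d) : Fin d → ℝ :=
  fun i => if i = i₀ then B / T else 0

/-- Total reward of the action sequence `a`. A round is played (and its reward collected) iff no
resource has exceeded its budget `B` in the earlier rounds; thus the last round played is the first
one after which some resource is over budget, or round `T - 1`. -/
def totalReward {n d : ℕ} (T : ℕ) (B : ℝ) (base : Fin d → ℝ) (o : ℕ → Outcome n d)
    (a : ℕ → Finset (Fin n)) : ℝ :=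
  ∑ t ∈ Finset.range T,
    if ∀ i, ∑ s ∈ Finset.range t, actionCost base (o s) (a s) i ≤ B
    then actionReward (o t) (a t) else 0

/-! ### Benchmarks -/

/-- Expected total reward of the fixed distribution `p` over the feasible actions, on a
deterministic outcome sequence: the actions of the `T` rounds are i.i.d. from `p`. -/
def fixedDistReward {n d : ℕ} (T : ℕ) (B : ℝ) (F : Finset (Finset (Fin n)))
    (o : ℕ → Outcome n d) (p : F → ℝ) : ℝ :=
  ∑ a : Fin T → F, (∏ t, p (a t)) *
    totalReward T B 0 o (fun t => if h : t < T then (a ⟨t, h⟩ : Finset (Fin n)) else ∅)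

/-- The best fixed distribution benchmark (adversarial version, no dummy resource). -/
def OPTFD {n d : ℕ} (T : ℕ) (B : ℝ) (F : Finset (Finset (Fin n))) (o : ℕ → Outcome n d) : ℝ :=
  ⨆ p : stdSimplex ℝ F, fixedDistReward T B F o p

/-- Semi-bandit feedback: the outcome vectors of the chosen atoms, the others being hidden. -/
def observe {n d : ℕ} (S : Finset (Fin n)) (o : Outcome n d) : Outcome n d :=
  fun e j => if e ∈ S then o e j else 0

/-- A (randomized) dynamic policy: in round `t` it chooses a feasible action as a measurable function
of a random seed and of the feedback of the earlier rounds. (Its own earlier actions are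
determined by these data.) -/
structure DynPolicy (n d : ℕ) (F : Finset (Finset (Fin n))) where
  act : (t : ℕ) → ℝ → (Fin t → Outcome n d) → Finset (Fin n)
  act_mem : ∀ t s h, act t s h ∈ F
  measurable_act : ∀ t S, MeasurableSet {x : ℝ × (Fin t → Outcome n d) | act t x.1 x.2 = S}

/-- The actions played by a dynamic policy with seed `s` on the outcome sequence `o`. -/
def DynPolicy.play {n d : ℕ} {F : Finset (Finset (Fin n))} (π : DynPolicy n d F) (s : ℝ)
    (o : ℕ → Outcome n d) (t : ℕ) : Finset (Fin n) :=
  π.act t s (fun r : Fin t => observe (DynPolicy.play π s o r) (o r))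
termination_by t
decreasing_by exact r.2

/-- The uniform distribution on `[0, 1]`. -/
def unifLaw : Measure ℝ := volume.restrict (Set.Icc 0 1)

/-- The outcome matrices of all rounds: i.i.d. from `D`. -/
def outcomeLaw {n d : ℕ} (D : Measure (Outcome n d)) : Measure (ℕ → Outcome n d) :=
  Measure.infinitePi fun _ : ℕ => D

/-- The best dynamic policy benchmark (stochastic version, with dummy resource `i₀`). -/
def OPTDP {n d : ℕ} (T : ℕ) (B : ℝ) (F : Finset (Finset (Fin n))) (i₀ : Fin d)
    (D : Measure (Outcome n d)) : ℝ :=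
  ⨆ π : DynPolicy n d F,
    ∫ x : ℝ × (ℕ → Outcome n d), totalReward T B (dummyBase T B i₀) x.2 (π.play x.1 x.2)
      ∂(unifLaw.prod (outcomeLaw D))

/-! ### The primal algorithm: follow the perturbed leader with geometric resampling

This is the high-probability variant of the semi-bandit algorithm of Neu. It minimizes losses in
`[0,1]` per coordinate over a family of 0/1 vectors. An action `S` is encoded as the 0/1 vector on
`Fin n × Bool` whose support is `{(e, b) | b = decide (e ∈ S)}`: coordinate `(e, true)` is the atom
`e`, coordinate `(e, false)` stands for its absence. So all actions have exactly `n` of the `2 n`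
coordinates, and affine rescaling of the payoffs of the atoms to losses in `[0,1]` changes the loss of
all actions by the same affine map. -/

/-- `log (2 n T)`, the logarithmic factor in the tuning below. -/
def logFactor (n T : ℕ) : ℝ := Real.log (2 * n * T)

/-- Learning rate `η`. -/
def fplRate (n T : ℕ) : ℝ := √(logFactor n T / (2 * n * T))

/-- Parameter `β` of the biased loss estimates. -/
def fplBias (n T : ℕ) : ℝ := √(logFactor n T / (2 * T))

/-- Cap `M` on the number of resampling steps. -/
def fplCap (n T : ℕ) : ℕ := ⌈√(2 * T / (n * logFactor n T))⌉₊

/-- The perturbed leader: the action in `F` that minimizes `η * (cumulative loss estimate) -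
(perturbation)`; ties (a null event) are resolved by a fixed order on `F`. -/
def fplSelect {n : ℕ} (F : Finset (Finset (Fin n))) (η : ℝ) (est z : Fin n → Bool → ℝ) :
    Finset (Fin n) :=
  (F.toList.argmin fun S => ∑ e, (η * est e (decide (e ∈ S)) - z e (decide (e ∈ S)))).getD ∅

/-- Geometric resampling: the first `k ≥ 1` such that the leader with the fresh perturbation `z k`
contains the coordinate `(e, b)`, capped at `M`. -/
def resampleCount {n : ℕ} (F : Finset (Finset (Fin n))) (η : ℝ) (M : ℕ) (est : Fin n → Bool → ℝ)
    (z : ℕ → Fin n → Bool → ℝ) (e : Fin n) (b : Bool) : ℕ :=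
  sInf ({k | 1 ≤ k ∧ decide (e ∈ fplSelect F η est (z k)) = b} ∪ {M})

/-! ### The dual algorithm: Hedge -/

/-- Learning rate of Hedge for costs in `[0,1]`. -/
def hedgeRate (d T : ℕ) : ℝ := √(8 * Real.log d / T)

/-- Hedge distribution for the cumulative costs `cost`. -/
def hedgeProb {d : ℕ} (T : ℕ) (cost : Fin d → ℝ) (i : Fin d) : ℝ :=
  Real.exp (-(hedgeRate d T * cost i)) / ∑ j, Real.exp (-(hedgeRate d T * cost j))

/-- Sampling from a distribution `p` on `Fin d` by inversion, from a uniform seed `s ∈ [0,1]`. -/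
def drawIndex {d : ℕ} [NeZero d] (p : Fin d → ℝ) (s : ℝ) : Fin d :=
  ((List.finRange d).find? fun i => decide (s ≤ ∑ j ∈ Finset.Iic i, p j)).getD 0

/-! ### The repeated Lagrangian game

The parameter `ρ` is the ratio `T₀ / B₀`. -/

/-- Payoff of the Lagrangian game: `r(S) + 1 - (T₀/B₀) c_i(S)`. -/
def lagrangian {n d : ℕ} (ρ : ℝ) (base : Fin d → ℝ) (o : Outcome n d) (S : Finset (Fin n))
    (i : Fin d) : ℝ :=
  actionReward o S + 1 - ρ * actionCost base o S i

/-- Cost of resource `i` reported to Hedge: the Lagrangian payoff, rescaled from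
`[1 - ρ, 2]` to `[0, 1]`. -/
def dualCost {n d : ℕ} (ρ : ℝ) (base : Fin d → ℝ) (o : Outcome n d) (S : Finset (Fin n))
    (i : Fin d) : ℝ :=
  (lagrangian ρ base o S i - (1 - ρ)) / (1 + ρ)

/-- Lagrangian payoff of the atom `e` if the dual player chooses resource `i`. It lies in
`[-ρ/n, 1/n]`. -/
def atomPayoff {n d : ℕ} (ρ : ℝ) (o : Outcome n d) (i : Fin d) (e : Fin n) : ℝ :=
  o e 0 - ρ * o e i.succ

/-- Loss of the coordinate `(e, b)` of the encoded action: the payoff (that of the atom if `b`, zero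
otherwise), rescaled from `[-ρ/n, 1/n]` to `[0, 1]` with the sign reversed. -/
def coordLoss {n d : ℕ} (ρ : ℝ) (o : Outcome n d) (i : Fin d) (e : Fin n) (b : Bool) : ℝ :=
  (1 - n * (if b then atomPayoff ρ o i e else 0)) / (1 + ρ)

/-- The memory of the two algorithms: cumulative loss estimates of the primal algorithm and
cumulative costs of the dual algorithm. -/
structure State (n d : ℕ) where
  est : Fin n → Bool → ℝ
  cost : Fin d → ℝ

/-- Random seeds of a round: perturbations of the primal algorithm (number `0` for the choice of
the action, the others for resampling) and the uniform seed of the dual algorithm. -/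
abbrev RoundSeed (n : ℕ) : Type := (ℕ → Fin n → Bool → ℝ) × ℝ

/-- Law of the seeds of a round: all perturbations are independent standard exponentials. -/
def roundSeedLaw (n : ℕ) : Measure (RoundSeed n) :=
  (Measure.infinitePi fun _ : ℕ => Measure.pi fun _ : Fin n => Measure.pi fun _ : Bool =>
    expMeasure 1).prod unifLaw

/-- Law of the seeds of all rounds. -/
def seedLaw (n : ℕ) : Measure (ℕ → RoundSeed n) :=
  Measure.infinitePi fun _ : ℕ => roundSeedLaw n

/-- Action chosen by the primal algorithm. -/
def State.action {n d : ℕ} (T : ℕ) (F : Finset (Finset (Fin n))) (st : State n d)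
    (ω : RoundSeed n) : Finset (Fin n) :=
  fplSelect F (fplRate n T) st.est (ω.1 0)

/-- Resource chosen by the dual algorithm. -/
def State.resource {n d : ℕ} [NeZero d] (T : ℕ) (st : State n d) (ω : RoundSeed n) : Fin d :=
  drawIndex (hedgeProb T st.cost) ω.2

/-- One round of the game. The primal algorithm receives semi-bandit feedback: only the coordinates
of its action are updated, by the biased estimate `β⁻¹ log (1 + β K ℓ)`. The dual algorithm receives
full feedback. -/
def State.next {n d : ℕ} [NeZero d] (T : ℕ) (F : Finset (Finset (Fin n))) (ρ : ℝ)
    (base : Fin d → ℝ) (o : Outcome n d) (st : State n d) (ω : RoundSeed n) : State n d where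
  est := fun e b => st.est e b +
    if b = decide (e ∈ st.action T F ω) then
      Real.log (1 + fplBias n T *
        (resampleCount F (fplRate n T) (fplCap n T) st.est ω.1 e b *
          coordLoss ρ o (st.resource T ω) e b)) / fplBias n T
    else 0
  cost := fun i => st.cost i + dualCost ρ base o (st.action T F ω) i

/-- State before round `t`. -/
def state {n d : ℕ} [NeZero d] (T : ℕ) (F : Finset (Finset (Fin n))) (ρ : ℝ) (base : Fin d → ℝ)
    (o : ℕ → Outcome n d) (ω : ℕ → RoundSeed n) : ℕ → State n d
  | 0 => ⟨fun _ _ => 0, fun _ => 0⟩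
  | t + 1 => (state T F ρ base o ω t).next T F ρ base (o t) (ω t)

/-- Total reward of the algorithm (the repeated Lagrangian game with parameters `B₀ = B` and
`T₀`, stopped when a budget is exceeded), as a function of the outcomes and the seeds. -/
def lagrangeReward {n d : ℕ} [NeZero d] (T : ℕ) (B : ℝ) (F : Finset (Finset (Fin n))) (T₀ : ℝ)
    (base : Fin d → ℝ) (o : ℕ → Outcome n d) (ω : ℕ → RoundSeed n) : ℝ :=
  totalReward T B base o fun t => (state T F (T₀ / B) base o ω t).action T F (ω t)

/-! ### The two algorithms -/

/-- Stochastic version: joint law of outcomes and seeds. -/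
def stochLaw {n d : ℕ} (D : Measure (Outcome n d)) :
    Measure ((ℕ → Outcome n d) × (ℕ → RoundSeed n)) :=
  (outcomeLaw D).prod (seedLaw n)

/-- Stochastic version: total reward with `B₀ = B`, `T₀ = T` and dummy resource `i₀`. -/
def stochReward {n d : ℕ} [NeZero d] (T : ℕ) (B : ℝ) (F : Finset (Finset (Fin n))) (i₀ : Fin d)
    (x : (ℕ → Outcome n d) × (ℕ → RoundSeed n)) : ℝ :=
  lagrangeReward T B F T (dummyBase T B i₀) x.1 x.2

/-- Adversarial version: expected total reward when `u` is uniform on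
`[0, log_κ (G_max / G_min)]` with `[G_min, G_max] = [√T, T]`, the guess is `G_min * κ ^ u`, and
the game is run with `B₀ = B` and `T₀ = guess / (d + 1)`. -/
def advExpectedReward {n d : ℕ} [NeZero d] (T : ℕ) (B : ℝ) (F : Finset (Finset (Fin n))) (κ : ℝ)
    (o : ℕ → Outcome n d) : ℝ :=
  ∫ x : ℝ × (ℕ → RoundSeed n), lagrangeReward T B F (√(T : ℝ) * κ ^ x.1 / (d + 1)) 0 o x.2
    ∂((ProbabilityTheory.cond volume (Set.Icc 0 (Real.logb κ (T / √(T : ℝ))))).prod (seedLaw n))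

/-- The regret term `√(n T log T)`. -/
def reg (n T : ℕ) : ℝ := √(n * T * Real.log T)

end SemiBwK

end

/-!
The repeated Lagrangian game turns regret bounds of the two players into rewards.

*Good runs.* Follow the perturbed leader with geometric resampling has small regret by a potential
argument (`fpl_regret`), moment bounds for the loss estimates (`integral_roundGap_le`,
`lintegral_exp_lossEst_le`) and exponential supermartingales (`measure_sum_ge_le`). Hedge has small
regret deterministically (`hedge_regret`), and drawing the resource adds a martingale. Hence, outside
an event of probability `1 / T ^ 2`, a run is good (`seedLaw_not_goodRun_le`): on each prefix its
Lagrangian payoff against any fixed resource is at least that of any fixed action against the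
resources played, up to `runErr`. Prefixes are needed since the game stops at a random time. The
bound of the perturbed leader is polynomial in the number of atoms, since it works with coordinates
and not with actions.

*Stochastic version.* The expected reward of a dynamic policy is attained in the mean by a fixed
distribution that respects the budgets in the mean (`exists_fixed_distribution`). The payoff of this
distribution against the resources played concentrates (`outcomeLaw_mixGap_le`). At the stopping time
some resource, possibly the dummy one, is used up, so that the dual player collects the whole value
of the budget, and the regret bound at this time gives the claim (`reward_ge_of_goodRun`). If the
horizon is within a constant factor of the regret, the claim is trivial (`le_two_mul_reg`).

*Adversarial version.* The reward `Y` of a fixed distribution is the sum of its mean rewards in the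
rounds, weighted by the decreasing probabilities that the round is played, and the weighted
consumptions are at most `B + 1` (`exists_weights`). The log-uniform guess makes the expected reward an integral over
the logarithm of the guess `G` (`advExpectedReward_eq`). For a fixed guess a good run
has reward at least `min (G, (d + 1) Y - d G) / (d + 1)` up to the regret
(`Benchmark.gameValue_ge_min`). Integrating over the guesses below `Y` gives `Y / (d + 1)` up to the
regret times `log (Y / reg)`. This logarithm is not allowed in the bound, and it is removed by one of
the following arguments.

* Far from the horizon, the guesses above `Y` give an additional `Y` times a constant
  (`Benchmark.le_integral_above`), which exceeds the loss by `mul_log_div_le`.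
* If `n < log² T` and `T - Y` is at least of order `T / n`, the gain above `Y` still suffices.
* If `n < log² T` and `T - Y` is smaller, the benchmark must play the set of all atoms nearly always,
  since each missing atom costs `1 / n` of the reward. In the first half of the game it overdraws each
  budget at most slightly, and at some scale its cumulative consumptions leave a gap in which the
  guesses below `Y` yield a constant factor more than their share (`Benchmark.exists_gain`,
  `reward_ge_of_gap`).
* If `n ≥ log² T`, comparing with a thinned benchmark for small guesses improves the loss of each guess
  so much that no logarithm is left (`Benchmark.gameValue_ge_of_log_sq_le`).

If the optimum or the budget is within a constant factor of the regret, the lower bound claimed is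
not positive.
-/

open MeasureTheory ProbabilityTheory

noncomputable section

namespace SemiBwK

/-! ### Resampling one coordinate of a product measure -/

section Resample

variable {ι : Type*} [DecidableEq ι] {Ω : Type*} [MeasurableSpace Ω]

/-- Replacing one coordinate of an i.i.d. family by an independent copy does not change its law.
This plays the role of conditioning on the other coordinates throughout. -/
lemma measurePreserving_update_infinitePi (ν : ι → Measure Ω) [∀ i, IsProbabilityMeasure (ν i)]
    (k : ι) :
    MeasurePreserving (fun x : (ι → Ω) × Ω => Function.update x.1 k x.2)
      ((Measure.infinitePi ν).prod (ν k)) (Measure.infinitePi ν) := by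
  have hm : Measurable (fun x : (ι → Ω) × Ω => Function.update x.1 k x.2) := by
    rw [measurable_pi_iff]
    intro i
    by_cases h : i = k
    · subst h; simpa using measurable_snd
    · simp only [Function.update_of_ne h]; fun_prop
  refine ⟨hm, ?_⟩
  apply Measure.eq_infinitePi
  intro s t ht
  rw [Measure.map_apply hm (MeasurableSet.pi s.countable_toSet fun i _ => ht i)]
  by_cases hk : k ∈ s
  · have : (fun x : (ι → Ω) × Ω => Function.update x.1 k x.2) ⁻¹' (Set.pi s t)
        = (Set.pi (s.erase k : Finset ι) t) ×ˢ (t k) := by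
      ext x
      simp only [Set.mem_preimage, Set.mem_pi, Set.mem_prod, Finset.mem_coe, Finset.mem_erase]
      constructor
      · intro h
        refine ⟨fun i hi => ?_, ?_⟩
        · simpa [Function.update_of_ne hi.1] using h i hi.2
        · simpa using h k hk
      · rintro ⟨h1, h2⟩ i hi
        by_cases hik : i = k
        · subst hik; simpa using h2
        · simpa [Function.update_of_ne hik] using h1 i ⟨hik, hi⟩
    rw [this, Measure.prod_prod, Measure.infinitePi_pi _ (fun i _ => ht i),
      Finset.prod_erase_mul _ _ hk]
  · have : (fun x : (ι → Ω) × Ω => Function.update x.1 k x.2) ⁻¹' (Set.pi s t)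
        = (Set.pi (s : Set ι) t) ×ˢ Set.univ := by
      ext x
      simp only [Set.mem_preimage, Set.mem_pi, Set.mem_prod, Finset.mem_coe, Set.mem_univ,
        and_true]
      refine forall₂_congr fun i hi => ?_
      rw [Function.update_of_ne (by rintro rfl; exact hk hi)]
    rw [this, Measure.prod_prod, Measure.infinitePi_pi _ (fun i _ => ht i)]
    simp

lemma lintegral_infinitePi_update (ν : ι → Measure Ω) [∀ i, IsProbabilityMeasure (ν i)]
    (k : ι) {f : (ι → Ω) → ENNReal} (hf : Measurable f) :
    ∫⁻ ω, f ω ∂(Measure.infinitePi ν) =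
      ∫⁻ ω, ∫⁻ w, f (Function.update ω k w) ∂(ν k) ∂(Measure.infinitePi ν) := by
  have h := measurePreserving_update_infinitePi ν k
  rw [← h.lintegral_comp hf]
  exact lintegral_prod _ (hf.comp h.measurable).aemeasurable

lemma integral_infinitePi_update (ν : ι → Measure Ω) [∀ i, IsProbabilityMeasure (ν i)]
    (k : ι) {f : (ι → Ω) → ℝ} (hf : Measurable f) (hi : Integrable f (Measure.infinitePi ν)) :
    ∫ ω, f ω ∂(Measure.infinitePi ν) =
      ∫ ω, ∫ w, f (Function.update ω k w) ∂(ν k) ∂(Measure.infinitePi ν) := by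
  have h := measurePreserving_update_infinitePi ν k
  have h1 : ∫ ω, f ω ∂(Measure.infinitePi ν)
      = ∫ x, f (Function.update x.1 k x.2) ∂((Measure.infinitePi ν).prod (ν k)) := by
    conv_lhs => rw [← h.map_eq]
    rw [integral_map h.measurable.aemeasurable hf.aestronglyMeasurable]
  rw [h1, integral_prod]
  exact h.integrable_comp_of_integrable hi

lemma measurable_update_pair (k : ι) :
    Measurable (fun x : (ι → Ω) × Ω => Function.update x.1 k x.2) := by
  rw [measurable_pi_iff]
  intro i
  by_cases h : i = k
  · subst h; simpa using measurable_snd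
  · simp only [Function.update_of_ne h]; fun_prop

end Resample

/-! ### Exponential supermartingales -/

section Tail

variable {Ω : Type*} [MeasurableSpace Ω]

lemma lintegral_exp_sum_le (ν : Measure Ω) [IsProbabilityMeasure ν]
    (X : ℕ → (ℕ → Ω) → ℝ) (c : ℝ) (T : ℕ) (hX : ∀ t, Measurable (X t))
    (hadapt : ∀ s t ω w, s < t → X s (Function.update ω t w) = X s ω)
    (hexp : ∀ t < T, ∀ᵐ ω ∂(Measure.infinitePi fun _ : ℕ => ν),
      ∫⁻ w, ENNReal.ofReal (Real.exp (X t (Function.update ω t w))) ∂ν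
      ≤ ENNReal.ofReal (Real.exp c)) :
    ∀ k ≤ T, ∫⁻ ω, ENNReal.ofReal (Real.exp (∑ t ∈ Finset.range k, X t ω - k * c))
      ∂(Measure.infinitePi fun _ : ℕ => ν) ≤ 1 := by
  intro k
  induction k with
  | zero => simp
  | succ k ih =>
    intro hk
    rw [lintegral_infinitePi_update (fun _ : ℕ => ν) k (by fun_prop)]
    refine le_trans (lintegral_mono_ae ?_) (ih (by omega))
    filter_upwards [hexp k (by omega)] with ω hω
    have h1 : ∀ w, ENNReal.ofReal (Real.exp (∑ t ∈ Finset.range (k + 1),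
        X t (Function.update ω k w) - ((k + 1 : ℕ) : ℝ) * c))
        = ENNReal.ofReal (Real.exp (∑ t ∈ Finset.range k, X t ω - k * c - c)) *
          ENNReal.ofReal (Real.exp (X k (Function.update ω k w))) := by
      intro w
      rw [← ENNReal.ofReal_mul (Real.exp_pos _).le, ← Real.exp_add, Finset.sum_range_succ,
        Finset.sum_congr rfl fun t ht => hadapt t k ω w (Finset.mem_range.1 ht)]
      congr 2
      push_cast
      ring
    simp_rw [h1]
    rw [lintegral_const_mul _ (by
      have : Measurable (fun w => Function.update ω k w) :=
        (measurable_update_pair k).comp (measurable_const.prodMk measurable_id)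
      have := (hX k).comp this
      exact ENNReal.measurable_ofReal.comp (Real.measurable_exp.comp this))]
    refine le_trans (mul_le_mul_right hω _) ?_
    rw [← ENNReal.ofReal_mul (Real.exp_pos _).le, ← Real.exp_add]
    simp

/-- Tail bound for sums of an adapted sequence with conditional exponential moments at most
`exp c`. -/
lemma measure_sum_ge_le (ν : Measure Ω) [IsProbabilityMeasure ν]
    (X : ℕ → (ℕ → Ω) → ℝ) (c : ℝ) (T : ℕ) (hX : ∀ t, Measurable (X t))
    (hadapt : ∀ s t ω w, s < t → X s (Function.update ω t w) = X s ω)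
    (hexp : ∀ t < T, ∀ᵐ ω ∂(Measure.infinitePi fun _ : ℕ => ν),
      ∫⁻ w, ENNReal.ofReal (Real.exp (X t (Function.update ω t w))) ∂ν
      ≤ ENNReal.ofReal (Real.exp c)) (k : ℕ) (hk : k ≤ T) (a : ℝ) :
    (Measure.infinitePi fun _ : ℕ => ν) {ω | k * c + a < ∑ t ∈ Finset.range k, X t ω} ≤
      ENNReal.ofReal (Real.exp (-a)) := by
  have h := lintegral_exp_sum_le ν X c T hX hadapt hexp k hk
  have hm : Measurable fun ω => ENNReal.ofReal (Real.exp (∑ t ∈ Finset.range k, X t ω - k * c)) := by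
    fun_prop
  have h2 := mul_meas_ge_le_lintegral (μ := Measure.infinitePi fun _ : ℕ => ν) hm
    (ENNReal.ofReal (Real.exp a))
  have h3 : (Measure.infinitePi fun _ : ℕ => ν) {ω | k * c + a < ∑ t ∈ Finset.range k, X t ω} ≤
      (Measure.infinitePi fun _ : ℕ => ν) {ω | ENNReal.ofReal (Real.exp a) ≤
        ENNReal.ofReal (Real.exp (∑ t ∈ Finset.range k, X t ω - k * c))} := by
    refine measure_mono fun ω hω => ?_
    simp only [Set.mem_ofPred_eq] at hω ⊢
    exact ENNReal.ofReal_le_ofReal (Real.exp_le_exp.2 (by linarith))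
  have h4 : ENNReal.ofReal (Real.exp (-a)) * ENNReal.ofReal (Real.exp a) = 1 := by
    rw [← ENNReal.ofReal_mul (Real.exp_pos _).le, ← Real.exp_add]; simp
  calc _ ≤ _ := h3
    _ = ENNReal.ofReal (Real.exp (-a)) * (ENNReal.ofReal (Real.exp a) * _) := by
        rw [← mul_assoc, h4, one_mul]
    _ ≤ ENNReal.ofReal (Real.exp (-a)) * 1 := by
        gcongr; exact h2.trans h
    _ = _ := mul_one _

lemma integrable_of_abs_le {μ : Measure Ω} [IsFiniteMeasure μ] {f : Ω → ℝ} (hf : Measurable f)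
    (b : ℝ) (h : ∀ x, |f x| ≤ b) : Integrable f μ :=
  Integrable.of_bound hf.aestronglyMeasurable b (Filter.Eventually.of_forall h)

/-- Exponential moment bound by the first two moments, for a variable bounded above. -/
lemma lintegral_exp_le_of_moments {μ : Measure Ω} [IsProbabilityMeasure μ] {V : Ω → ℝ}
    (hV : Integrable V μ) (hV2 : Integrable (fun x => V x ^ 2) μ) {l m q : ℝ} (hl : 0 ≤ l)
    (hb : ∀ᵐ x ∂μ, l * V x ≤ 1) (hm : ∫ x, V x ∂μ ≤ m) (hq : ∫ x, V x ^ 2 ∂μ ≤ q) :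
    ∫⁻ x, ENNReal.ofReal (Real.exp (l * V x)) ∂μ ≤ ENNReal.ofReal (Real.exp (l * m + l ^ 2 * q)) := by
  have hexp : ∀ y : ℝ, y ≤ 1 → Real.exp y ≤ 1 + y + y ^ 2 := by
    intro y hy
    by_cases h : -1 ≤ y
    · have := Real.abs_exp_sub_one_sub_id_le (abs_le.2 ⟨h, hy⟩)
      have := (abs_le.1 this).2
      linarith
    · push Not at h
      have h1 : Real.exp y ≤ Real.exp 0 := Real.exp_le_exp.2 (by linarith)
      rw [Real.exp_zero] at h1
      nlinarith
  have hint : Integrable (fun x => 1 + l * V x + l ^ 2 * V x ^ 2) μ :=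
    ((integrable_const 1).add (hV.const_mul l)).add (hV2.const_mul (l ^ 2))
  calc ∫⁻ x, ENNReal.ofReal (Real.exp (l * V x)) ∂μ
      ≤ ∫⁻ x, ENNReal.ofReal (1 + l * V x + l ^ 2 * V x ^ 2) ∂μ := by
        refine lintegral_mono_ae ?_
        filter_upwards [hb] with x hx
        refine ENNReal.ofReal_le_ofReal ((hexp _ hx).trans (by rw [mul_pow]))
    _ = ENNReal.ofReal (∫ x, (1 + l * V x + l ^ 2 * V x ^ 2) ∂μ) := by
        rw [ofReal_integral_eq_lintegral_ofReal hint]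
        refine Filter.Eventually.of_forall fun x => ?_
        simp only [Pi.zero_apply]
        nlinarith [sq_nonneg (l * V x + 1), sq_nonneg (l * V x)]
    _ ≤ _ := by
        refine ENNReal.ofReal_le_ofReal ?_
        have e1 : ∫ x, (1 + l * V x + l ^ 2 * V x ^ 2) ∂μ
            = (∫ _, (1 : ℝ) ∂μ + ∫ x, l * V x ∂μ) + ∫ x, l ^ 2 * V x ^ 2 ∂μ := by
          rw [integral_add, integral_add]
          · exact integrable_const 1
          · exact hV.const_mul l
          · exact (integrable_const 1).add (hV.const_mul l)
          · exact hV2.const_mul (l ^ 2)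
        rw [e1, integral_const_mul, integral_const_mul]
        simp only [integral_const, smul_eq_mul, mul_one, probReal_univ]
        refine le_trans ?_ (Real.add_one_le_exp _)
        nlinarith [mul_le_mul_of_nonneg_left hm hl, mul_le_mul_of_nonneg_left hq (sq_nonneg l)]

end Tail

/-! ### Standard exponential perturbations -/

instance isProbabilityMeasure_expMeasure_one : IsProbabilityMeasure (expMeasure 1) :=
  isProbabilityMeasure_expMeasure one_pos

instance isProbabilityMeasure_unifLaw : IsProbabilityMeasure unifLaw :=
  ⟨by simp [unifLaw]⟩

/-- The law of the perturbations of one selection. -/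
def perturbLaw (n : ℕ) : Measure (Fin n → Bool → ℝ) :=
  Measure.pi fun _ : Fin n => Measure.pi fun _ : Bool => expMeasure 1

instance (n : ℕ) : IsProbabilityMeasure (perturbLaw n) := by
  unfold perturbLaw; infer_instance

lemma lintegral_expMeasure_one (f : ℝ → ENNReal) (hf : Measurable f) :
    ∫⁻ x, f x ∂(expMeasure 1) =
      ∫⁻ x, (if 0 ≤ x then ENNReal.ofReal (Real.exp (-x)) else 0) * f x := by
  have h : expMeasure 1 = volume.withDensity (exponentialPDF 1) := rfl
  rw [h, lintegral_withDensity_eq_lintegral_mul _ (by unfold exponentialPDF; fun_prop) hf]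
  refine lintegral_congr fun x => ?_
  rw [Pi.mul_apply, exponentialPDF_eq]
  split_ifs <;> simp

lemma lintegral_expMeasure_shift (v : ℝ) (hv : 0 ≤ v) (f : ℝ → ENNReal) (hf : Measurable f) :
    ∫⁻ x, f (x + v) ∂(expMeasure 1) ≤
      ENNReal.ofReal (Real.exp v) * ∫⁻ x, f x ∂(expMeasure 1) := by
  rw [lintegral_expMeasure_one _ (by fun_prop), lintegral_expMeasure_one _ hf,
    ← lintegral_const_mul _ (by
      refine Measurable.mul (Measurable.ite measurableSet_Ici ?_ measurable_const) hf
      fun_prop)]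
  rw [← lintegral_add_right_eq_self (fun x => ENNReal.ofReal (Real.exp v) *
    ((if 0 ≤ x then ENNReal.ofReal (Real.exp (-x)) else 0) * f x)) v]
  refine lintegral_mono fun x => ?_
  simp only
  rw [← mul_assoc]
  gcongr
  split_ifs with h1 h2
  · rw [← ENNReal.ofReal_mul (Real.exp_pos _).le, ← Real.exp_add]
    exact ENNReal.ofReal_le_ofReal (Real.exp_le_exp.2 (by linarith))
  · exact absurd (by linarith) h2
  · simp
  · simp

section PiShift

variable {ι : Type*} [Fintype ι] {Ω : Type*} [MeasurableSpace Ω]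

/-- If each coordinate map changes its law at most by a factor, so does their product. -/
lemma lintegral_pi_shift (ν : ι → Measure Ω) [∀ i, IsProbabilityMeasure (ν i)]
    (g : ι → Ω → Ω) (hg : ∀ i, Measurable (g i)) (c : ι → ENNReal)
    (h : ∀ i (f : Ω → ENNReal), Measurable f →
      ∫⁻ x, f (g i x) ∂(ν i) ≤ c i * ∫⁻ x, f x ∂(ν i))
    (f : (ι → Ω) → ENNReal) (hf : Measurable f) :
    ∫⁻ z, f (fun i => g i (z i)) ∂(Measure.pi ν) ≤ (∏ i, c i) * ∫⁻ z, f z ∂(Measure.pi ν) := by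
  classical
  have key : ∀ s : Finset ι, ∫⁻ z, f (fun i => if i ∈ s then g i (z i) else z i) ∂(Measure.pi ν)
      ≤ (∏ i ∈ s, c i) * ∫⁻ z, f z ∂(Measure.pi ν) := by
    intro s
    induction s using Finset.induction_on with
    | empty => simp
    | insert a s ha ih =>
      rw [Finset.prod_insert ha, mul_assoc]
      refine le_trans ?_ (mul_le_mul_right ih _)
      have m1 : ∀ s' : Finset ι, Measurable fun z : ι → Ω => f (fun i => if i ∈ s' then g i (z i) else z i) := by
        intro s'
        refine hf.comp (measurable_pi_iff.2 fun i => ?_)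
        have := hg i
        split_ifs <;> fun_prop
      rw [← Measure.infinitePi_eq_pi (μ := ν), lintegral_infinitePi_update ν a (m1 _),
        lintegral_infinitePi_update ν a (m1 s), ← lintegral_const_mul _ (by
          exact Measurable.lintegral_prod_right' (ν := ν a) ((m1 s).comp (measurable_update_pair a)))]
      refine lintegral_mono fun z => ?_
      have e1 : ∀ w, (fun i => if i ∈ insert a s then g i (Function.update z a w i)
          else Function.update z a w i)
          = Function.update (fun i => if i ∈ s then g i (z i) else z i) a (g a w) := by
        intro w; ext i
        by_cases hi : i = a
        · subst hi; simp
        · simp [hi]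
      have e2 : ∀ w, (fun i => if i ∈ s then g i (Function.update z a w i)
          else Function.update z a w i)
          = Function.update (fun i => if i ∈ s then g i (z i) else z i) a w := by
        intro w; ext i
        by_cases hi : i = a
        · subst hi; simp [ha]
        · simp [hi]
      simp_rw [e1, e2]
      exact h a (fun w => f (Function.update _ a w)) (hf.comp
        ((measurable_update_pair a).comp (measurable_const.prodMk measurable_id)))
  simpa using key Finset.univ

end PiShift

/-- Shifting the perturbations by a nonnegative vector `v` changes their law at most by the factor
`exp ‖v‖₁`. -/
lemma lintegral_perturbLaw_shift {n : ℕ} (v : Fin n → Bool → ℝ) (hv : ∀ e b, 0 ≤ v e b)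
    (f : (Fin n → Bool → ℝ) → ENNReal) (hf : Measurable f) :
    ∫⁻ z, f (fun e b => z e b + v e b) ∂(perturbLaw n) ≤
      ENNReal.ofReal (Real.exp (∑ e, ∑ b, v e b)) * ∫⁻ z, f z ∂(perturbLaw n) := by
  have h := lintegral_pi_shift (fun _ : Fin n => Measure.pi fun _ : Bool => expMeasure 1)
    (fun e z b => z b + v e b) (fun e => by fun_prop)
    (fun e => ENNReal.ofReal (Real.exp (∑ b, v e b))) (fun e f hf => by
      have h := lintegral_pi_shift (fun _ : Bool => expMeasure 1)
        (fun b x => x + v e b) (fun b => by fun_prop)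
        (fun b => ENNReal.ofReal (Real.exp (v e b)))
        (fun b f hf => lintegral_expMeasure_shift (v e b) (hv e b) f hf) f hf
      rwa [← ENNReal.ofReal_prod_of_nonneg (fun _ _ => (Real.exp_pos _).le), ← Real.exp_sum] at h)
    f hf
  rwa [← ENNReal.ofReal_prod_of_nonneg (fun _ _ => (Real.exp_pos _).le), ← Real.exp_sum] at h

lemma ae_nonneg_expMeasure_one : ∀ᵐ x ∂(expMeasure 1), 0 ≤ x := by
  rw [ae_iff]
  have : MeasurableSet {x : ℝ | ¬ 0 ≤ x} := measurableSet_Ici.compl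
  rw [← lintegral_indicator_one this, lintegral_expMeasure_one _ (by
    exact measurable_one.indicator this)]
  rw [lintegral_eq_zero_iff' (by
    refine Measurable.aemeasurable (Measurable.mul (Measurable.ite measurableSet_Ici ?_ measurable_const)
      (measurable_one.indicator this))
    fun_prop)]
  refine Filter.Eventually.of_forall fun x => ?_
  by_cases h : 0 ≤ x <;> simp [h]

lemma lintegral_id_expMeasure_one : ∫⁻ x, ENNReal.ofReal x ∂(expMeasure 1) ≤ 1 := by
  rw [lintegral_expMeasure_one _ (by fun_prop)]
  have h : ∀ x : ℝ, (if 0 ≤ x then ENNReal.ofReal (Real.exp (-x)) else 0) * ENNReal.ofReal x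
      = (Set.Ioi (0 : ℝ)).indicator (fun x => ENNReal.ofReal (Real.exp (-x) * x ^ ((2 : ℝ) - 1))) x := by
    intro x
    rcases lt_trichotomy x 0 with hx | hx | hx
    · rw [if_neg (by linarith), zero_mul, Set.indicator_of_notMem]
      simp [hx.le]
    · subst hx; simp
    · rw [if_pos hx.le, Set.indicator_of_mem (by simpa using hx), ENNReal.ofReal_mul (Real.exp_pos _).le]
      norm_num
  simp_rw [h]
  rw [lintegral_indicator measurableSet_Ioi, ← ofReal_integral_eq_lintegral_ofReal
    (Real.GammaIntegral_convergent (by norm_num))]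
  · rw [← Real.Gamma_eq_integral (by norm_num), Real.Gamma_two]; simp
  · refine (ae_restrict_iff' measurableSet_Ioi).2 (Filter.Eventually.of_forall fun x hx => ?_)
    have : (0 : ℝ) < x := hx
    simp only [Pi.zero_apply]
    positivity

lemma integrable_id_expMeasure_one : Integrable (fun x : ℝ => x) (expMeasure 1) := by
  refine ⟨measurable_id.aestronglyMeasurable, ?_⟩
  rw [hasFiniteIntegral_iff_ofReal ae_nonneg_expMeasure_one]
  exact lt_of_le_of_lt lintegral_id_expMeasure_one ENNReal.one_lt_top

lemma integral_id_expMeasure_one_le : ∫ x, x ∂(expMeasure 1) ≤ 1 := by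
  rw [integral_eq_lintegral_of_nonneg_ae ae_nonneg_expMeasure_one
    measurable_id.aestronglyMeasurable]
  exact ENNReal.toReal_le_of_le_ofReal zero_le_one (by simpa using lintegral_id_expMeasure_one)

lemma measurePreserving_eval_perturbLaw {n : ℕ} (e : Fin n) (b : Bool) :
    MeasurePreserving (fun z : Fin n → Bool → ℝ => z e b) (perturbLaw n) (expMeasure 1) :=
  (measurePreserving_eval (fun _ : Bool => expMeasure 1) b).comp
    (measurePreserving_eval (fun _ : Fin n => Measure.pi fun _ : Bool => expMeasure 1) e)

lemma integrable_perturbLaw {n : ℕ} (e : Fin n) (b : Bool) :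
    Integrable (fun z : Fin n → Bool → ℝ => z e b) (perturbLaw n) :=
  (measurePreserving_eval_perturbLaw e b).integrable_comp_of_integrable integrable_id_expMeasure_one

lemma integral_perturbLaw_le {n : ℕ} (e : Fin n) (b : Bool) :
    ∫ z, z e b ∂(perturbLaw n) ≤ 1 := by
  have h := measurePreserving_eval_perturbLaw e b
  have := integral_id_expMeasure_one_le
  rw [← h.map_eq, integral_map h.measurable.aemeasurable (by fun_prop)] at this
  exact this

lemma ae_nonneg_perturbLaw {n : ℕ} : ∀ᵐ z ∂(perturbLaw n), ∀ e b, 0 ≤ z e b := by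
  rw [ae_all_iff]; intro e; rw [ae_all_iff]; intro b
  exact (measurePreserving_eval_perturbLaw e b).quasiMeasurePreserving.ae ae_nonneg_expMeasure_one

/-! ### The perturbed leader -/

/-- Perturbed cumulative loss of an action. -/
def perturbedLoss {n : ℕ} (η : ℝ) (est z : Fin n → Bool → ℝ) (S : Finset (Fin n)) : ℝ :=
  ∑ e, (η * est e (decide (e ∈ S)) - z e (decide (e ∈ S)))

lemma fplSelect_mem_argmin {n : ℕ} {F : Finset (Finset (Fin n))} (hF : F.Nonempty) (η : ℝ)
    (est z : Fin n → Bool → ℝ) :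
    fplSelect F η est z ∈ F.toList.argmin (perturbedLoss η est z) := by
  have h : F.toList.argmin (perturbedLoss η est z) ≠ none := by
    rw [Ne, List.argmin_eq_none]; simpa using hF.ne_empty
  obtain ⟨S, hS⟩ := Option.ne_none_iff_exists'.1 h
  have : fplSelect F η est z = S := by
    unfold fplSelect
    change (F.toList.argmin (perturbedLoss η est z)).getD ∅ = S
    rw [hS]; rfl
  rw [this, hS]; rfl

lemma fplSelect_mem {n : ℕ} {F : Finset (Finset (Fin n))} (hF : F.Nonempty) (η : ℝ)
    (est z : Fin n → Bool → ℝ) : fplSelect F η est z ∈ F := by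
  simpa using List.argmin_mem (fplSelect_mem_argmin hF η est z)

lemma perturbedLoss_fplSelect_le {n : ℕ} {F : Finset (Finset (Fin n))} (η : ℝ)
    (est z : Fin n → Bool → ℝ) {S : Finset (Fin n)} (hS : S ∈ F) :
    perturbedLoss η est z (fplSelect F η est z) ≤ perturbedLoss η est z S :=
  List.le_of_mem_argmin (by simpa using hS) (fplSelect_mem_argmin ⟨S, hS⟩ η est z)

/-- Raising the estimates by `v` and the perturbations by `η v` does not change the leader. -/
lemma fplSelect_shift {n : ℕ} (F : Finset (Finset (Fin n))) (η : ℝ) (est v z : Fin n → Bool → ℝ) :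
    fplSelect F η (fun e b => est e b + v e b) (fun e b => z e b + η * v e b) =
      fplSelect F η est z := by
  unfold fplSelect
  congr 2
  ext S
  refine Finset.sum_congr rfl fun e _ => ?_
  ring

lemma measurableSet_argmin_eq {α ι : Type*} [MeasurableSpace α] [Countable ι] (l : List ι)
    (f : α → ι → ℝ) (hf : ∀ i, Measurable fun a => f a i) (x : Option ι) :
    MeasurableSet {a | l.argmin (f a) = x} := by
  induction l using List.reverseRecOn generalizing x with
  | nil => simp
  | append_singleton l i ih =>
    have : {a | (l ++ [i]).argmin (f a) = x} = ⋃ y : Option ι, {a | l.argmin (f a) = y} ∩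
        {a | (Option.casesOn y (some i) fun c => if f a i < f a c then some i else some c) = x} := by
      ext a
      simp only [List.argmin_concat, Set.mem_ofPred_eq, Set.mem_iUnion, Set.mem_inter_iff,
        exists_eq_left']
    rw [this]
    refine MeasurableSet.iUnion fun y => (ih y).inter ?_
    cases y with
    | none => simp
    | some c =>
      have h1 : MeasurableSet {a | f a i < f a c} := measurableSet_lt (hf i) (hf c)
      have : {a | (if f a i < f a c then some i else some c) = x} =
          ({a | f a i < f a c} ∩ {_a | some i = x}) ∪ ({a | f a i < f a c}ᶜ ∩ {_a | some c = x}) := by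
        ext a
        by_cases h : f a i < f a c <;> simp [h]
      simp only [this]
      exact (h1.inter (MeasurableSet.const _)).union (h1.compl.inter (MeasurableSet.const _))

lemma measurable_fplSelect {α : Type*} [MeasurableSpace α] {n : ℕ} (F : Finset (Finset (Fin n)))
    (η : ℝ) {est z : α → Fin n → Bool → ℝ} (he : Measurable est) (hz : Measurable z) :
    Measurable fun a => fplSelect F η (est a) (z a) := by
  refine measurable_to_countable' fun S => ?_
  have : (fun a => fplSelect F η (est a) (z a)) ⁻¹' {S} = ⋃ y : {y : Option (Finset (Fin n)) // y.getD ∅ = S},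
      {a | F.toList.argmin (perturbedLoss η (est a) (z a)) = y.1} := by
    ext a
    simp only [Set.mem_preimage, Set.mem_singleton_iff, Set.mem_iUnion, Subtype.exists,
      Set.mem_ofPred_eq, exists_prop, exists_eq_right']
    rfl
  rw [this]
  refine MeasurableSet.iUnion fun y => measurableSet_argmin_eq _ _ (fun S => ?_) _
  unfold perturbedLoss
  fun_prop

/-- Coordinate `x` of the 0/1 vector that encodes `S`. -/
def coordInd {n : ℕ} (S : Finset (Fin n)) (x : Fin n × Bool) : ℝ :=
  if x.2 = decide (x.1 ∈ S) then 1 else 0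

lemma coordInd_nonneg {n : ℕ} (S : Finset (Fin n)) (x : Fin n × Bool) : 0 ≤ coordInd S x := by
  unfold coordInd; split_ifs <;> simp

lemma coordInd_le_one {n : ℕ} (S : Finset (Fin n)) (x : Fin n × Bool) : coordInd S x ≤ 1 := by
  unfold coordInd; split_ifs <;> simp

lemma sum_coordInd_mul {n : ℕ} (S : Finset (Fin n)) (f : Fin n × Bool → ℝ) :
    ∑ x, coordInd S x * f x = ∑ e, f (e, decide (e ∈ S)) := by
  rw [Fintype.sum_prod_type]
  refine Finset.sum_congr rfl fun e _ => ?_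
  by_cases h : e ∈ S <;> simp [coordInd, h]

lemma sum_coordInd {n : ℕ} (S : Finset (Fin n)) : ∑ x, coordInd S x = n := by
  have := sum_coordInd_mul S (fun _ => 1)
  simpa using this

lemma measurable_coordInd {n : ℕ} (x : Fin n × Bool) :
    Measurable fun S : Finset (Fin n) => coordInd S x := measurable_of_countable _

/-- Probability that the perturbed leader has the coordinate `x`. -/
def coordProb {n : ℕ} (F : Finset (Finset (Fin n))) (η : ℝ) (est : Fin n → Bool → ℝ)
    (x : Fin n × Bool) : ℝ :=
  ∫ z, coordInd (fplSelect F η est z) x ∂(perturbLaw n)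

lemma measurable_coordInd_fplSelect {n : ℕ} (F : Finset (Finset (Fin n))) (η : ℝ)
    (est : Fin n → Bool → ℝ) (x : Fin n × Bool) :
    Measurable fun z => coordInd (fplSelect F η est z) x :=
  (measurable_coordInd x).comp (measurable_fplSelect F η measurable_const measurable_id)

lemma integrable_coordInd {n : ℕ} (F : Finset (Finset (Fin n))) (η : ℝ)
    (est : Fin n → Bool → ℝ) (x : Fin n × Bool) :
    Integrable (fun z => coordInd (fplSelect F η est z) x) (perturbLaw n) :=
  integrable_of_abs_le (measurable_coordInd_fplSelect F η est x) 1 fun z =>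
    abs_le.2 ⟨by linarith [coordInd_nonneg (fplSelect F η est z) x], coordInd_le_one _ _⟩

lemma coordProb_nonneg {n : ℕ} (F : Finset (Finset (Fin n))) (η : ℝ) (est : Fin n → Bool → ℝ)
    (x : Fin n × Bool) : 0 ≤ coordProb F η est x :=
  integral_nonneg fun _ => coordInd_nonneg _ _

lemma coordProb_le_one {n : ℕ} (F : Finset (Finset (Fin n))) (η : ℝ) (est : Fin n → Bool → ℝ)
    (x : Fin n × Bool) : coordProb F η est x ≤ 1 := by
  have := integral_mono (integrable_coordInd F η est x) (integrable_const (1 : ℝ))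
    (fun z => coordInd_le_one (fplSelect F η est z) x)
  simpa [coordProb] using this

lemma measurable_coordProb {α : Type*} [MeasurableSpace α] {n : ℕ} (F : Finset (Finset (Fin n)))
    (η : ℝ) {est : α → Fin n → Bool → ℝ} (he : Measurable est) (x : Fin n × Bool) :
    Measurable fun a => coordProb F η (est a) x := by
  have h : Measurable fun p : α × (Fin n → Bool → ℝ) => coordInd (fplSelect F η (est p.1) p.2) x :=
    (measurable_coordInd x).comp (measurable_fplSelect F η (he.comp measurable_fst) measurable_snd)
  exact (StronglyMeasurable.integral_prod_right' (ν := perturbLaw n) h.stronglyMeasurable).measurable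

/-! ### Geometric resampling -/

/-- Law of the perturbations of one round. -/
def resampleLaw (n : ℕ) : Measure (ℕ → Fin n → Bool → ℝ) :=
  Measure.infinitePi fun _ : ℕ => perturbLaw n

instance (n : ℕ) : IsProbabilityMeasure (resampleLaw n) := by
  unfold resampleLaw; infer_instance

lemma lt_resampleCount_iff {n : ℕ} (F : Finset (Finset (Fin n))) (η : ℝ) (M : ℕ)
    (est : Fin n → Bool → ℝ) (z : ℕ → Fin n → Bool → ℝ) (e : Fin n) (b : Bool) (k : ℕ) :
    k < resampleCount F η M est z e b ↔
      k < M ∧ ∀ j, 1 ≤ j → j ≤ k → decide (e ∈ fplSelect F η est (z j)) ≠ b := by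
  unfold resampleCount
  set A := {k | 1 ≤ k ∧ decide (e ∈ fplSelect F η est (z k)) = b} ∪ {M}
  have hne : A.Nonempty := ⟨M, Or.inr rfl⟩
  constructor
  · intro h
    refine ⟨lt_of_lt_of_le h (Nat.sInf_le (Or.inr rfl)), fun j hj hjk hb => ?_⟩
    exact absurd (lt_of_lt_of_le h (Nat.sInf_le (Or.inl ⟨hj, hb⟩))) (by omega)
  · rintro ⟨h1, h2⟩
    rcases Nat.sInf_mem hne with h | h
    · by_contra hc
      exact h2 _ h.1 (by omega) h.2
    · have : sInf A = M := h
      omega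

lemma resampleCount_le {n : ℕ} (F : Finset (Finset (Fin n))) (η : ℝ) (M : ℕ)
    (est : Fin n → Bool → ℝ) (z : ℕ → Fin n → Bool → ℝ) (e : Fin n) (b : Bool) :
    resampleCount F η M est z e b ≤ M := Nat.sInf_le (Or.inr rfl)

lemma resampleCount_congr {n : ℕ} (F : Finset (Finset (Fin n))) (η : ℝ) (M : ℕ)
    (est : Fin n → Bool → ℝ) (z z' : ℕ → Fin n → Bool → ℝ) (h : ∀ j, 1 ≤ j → z j = z' j)
    (e : Fin n) (b : Bool) :
    resampleCount F η M est z e b = resampleCount F η M est z' e b := by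
  refine eq_of_forall_lt_iff fun k => ?_
  rw [lt_resampleCount_iff, lt_resampleCount_iff]
  refine and_congr Iff.rfl (forall_congr' fun j => forall_congr' fun hj => ?_)
  rw [h j hj]

lemma measurable_resampleCount {α : Type*} [MeasurableSpace α] {n : ℕ}
    (F : Finset (Finset (Fin n))) (η : ℝ) (M : ℕ) {est : α → Fin n → Bool → ℝ}
    {z : α → ℕ → Fin n → Bool → ℝ} (he : Measurable est) (hz : Measurable z) (e : Fin n) (b : Bool) :
    Measurable fun a => resampleCount F η M (est a) (z a) e b := by
  refine measurable_of_Ioi fun k => ?_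
  have : (fun a => resampleCount F η M (est a) (z a) e b) ⁻¹' Set.Ioi k =
      {_a | k < M} ∩ ⋂ j : ℕ, {a | 1 ≤ j → j ≤ k → fplSelect F η (est a) (z a j) ∈
        {S : Finset (Fin n) | decide (e ∈ S) ≠ b}} := by
    ext a
    simp only [Set.mem_preimage, Set.mem_Ioi, lt_resampleCount_iff, Set.mem_inter_iff,
      Set.mem_ofPred_eq, Set.mem_iInter]
  rw [this]
  refine (MeasurableSet.const _).inter (MeasurableSet.iInter fun j => ?_)
  have h1 : Measurable fun a => fplSelect F η (est a) (z a j) :=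
    measurable_fplSelect F η he ((measurable_pi_apply j).comp hz)
  have h2 : MeasurableSet {a | fplSelect F η (est a) (z a j) ∈
        {S : Finset (Fin n) | decide (e ∈ S) ≠ b}} := h1 (Set.to_countable _).measurableSet
  by_cases hj : 1 ≤ j ∧ j ≤ k
  · simpa [hj.1, hj.2] using h2
  · have : {a | 1 ≤ j → j ≤ k → fplSelect F η (est a) (z a j) ∈
        {S : Finset (Fin n) | decide (e ∈ S) ≠ b}} = Set.univ := by
      ext a
      simp only [Set.mem_ofPred_eq, Set.mem_univ, iff_true]
      intro h1 h2; exact absurd ⟨h1, h2⟩ hj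
    rw [this]; exact MeasurableSet.univ

lemma coordInd_eq_zero_iff {n : ℕ} (S : Finset (Fin n)) (x : Fin n × Bool) :
    coordInd S x = 0 ↔ decide (x.1 ∈ S) ≠ x.2 := by
  unfold coordInd
  split_ifs with h
  · simp [h]
  · simp only [true_iff]; exact fun h' => h h'.symm

lemma perturbLaw_real_not_coord {n : ℕ} (F : Finset (Finset (Fin n))) (η : ℝ)
    (est : Fin n → Bool → ℝ) (x : Fin n × Bool) :
    (perturbLaw n).real {z | decide (x.1 ∈ fplSelect F η est z) ≠ x.2} =
      1 - coordProb F η est x := by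
  have hm := measurable_coordInd_fplSelect F η est x
  have hs : MeasurableSet {z | decide (x.1 ∈ fplSelect F η est z) ≠ x.2} := by
    have : {z | decide (x.1 ∈ fplSelect F η est z) ≠ x.2} =
        (fun z => coordInd (fplSelect F η est z) x) ⁻¹' {0} := by
      ext z; simp [coordInd_eq_zero_iff]
    rw [this]; exact hm (measurableSet_singleton 0)
  rw [← integral_indicator_one hs]
  have : ∀ z, ({z | decide (x.1 ∈ fplSelect F η est z) ≠ x.2}.indicator 1 z : ℝ) =
      1 - coordInd (fplSelect F η est z) x := by
    intro z
    by_cases h : decide (x.1 ∈ fplSelect F η est z) = x.2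
    · simp [Set.indicator, h, coordInd]
    · simp [Set.indicator, h, coordInd, Ne.symm h]
  simp_rw [this]
  rw [integral_sub (integrable_const _) (integrable_coordInd F η est x)]
  simp [coordProb]

/-- The resampling count is geometric, capped at `M`. -/
lemma resampleLaw_real_lt_count {n : ℕ} (F : Finset (Finset (Fin n))) (η : ℝ) (M : ℕ)
    (est : Fin n → Bool → ℝ) (x : Fin n × Bool) (k : ℕ) (hk : k < M) :
    (resampleLaw n).real {z | k < resampleCount F η M est z x.1 x.2} =
      (1 - coordProb F η est x) ^ k := by
  have hs : {z : ℕ → Fin n → Bool → ℝ | k < resampleCount F η M est z x.1 x.2} =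
      Set.pi (Finset.Icc 1 k) fun _ => {z | decide (x.1 ∈ fplSelect F η est z) ≠ x.2} := by
    ext z
    simp only [Set.mem_ofPred_eq, lt_resampleCount_iff, hk, true_and, Set.mem_pi, Finset.mem_coe,
      Finset.mem_Icc, and_imp]
  have hm : MeasurableSet {z | decide (x.1 ∈ fplSelect F η est z) ≠ x.2} := by
    have : {z | decide (x.1 ∈ fplSelect F η est z) ≠ x.2} =
        (fun z => coordInd (fplSelect F η est z) x) ⁻¹' {0} := by
      ext z; simp [coordInd_eq_zero_iff]
    rw [this]; exact measurable_coordInd_fplSelect F η est x (measurableSet_singleton 0)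
  rw [hs, Measure.real, resampleLaw, Measure.infinitePi_pi _ (fun _ _ => hm),
    Finset.prod_const, Nat.card_Icc, ENNReal.toReal_pow, Nat.add_sub_cancel,
    ← perturbLaw_real_not_coord]
  rfl

lemma integral_comp_resampleCount {n : ℕ} (F : Finset (Finset (Fin n))) (η : ℝ) (M : ℕ)
    (est : Fin n → Bool → ℝ) (x : Fin n × Bool) (φ : ℕ → ℝ) :
    ∫ z, φ (resampleCount F η M est z x.1 x.2) ∂(resampleLaw n) =
      φ 0 + ∑ k ∈ Finset.range M, (φ (k + 1) - φ k) * (1 - coordProb F η est x) ^ k := by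
  have hm : ∀ k : ℕ, MeasurableSet {z : ℕ → Fin n → Bool → ℝ | k < resampleCount F η M est z x.1 x.2} := fun k =>
    measurable_resampleCount F η M measurable_const measurable_id x.1 x.2 measurableSet_Ioi
  have h : ∀ z, φ (resampleCount F η M est z x.1 x.2) = φ 0 + ∑ k ∈ Finset.range M,
      (φ (k + 1) - φ k) * {z : ℕ → Fin n → Bool → ℝ | k < resampleCount F η M est z x.1 x.2}.indicator 1 z := by
    intro z
    have hle := resampleCount_le F η M est z x.1 x.2
    set K := resampleCount F η M est z x.1 x.2 with hK
    have h1 : ∑ k ∈ Finset.range M, (φ (k + 1) - φ k) *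
        {z : ℕ → Fin n → Bool → ℝ | k < resampleCount F η M est z x.1 x.2}.indicator 1 z
        = ∑ k ∈ Finset.range K, (φ (k + 1) - φ k) := by
      rw [← Finset.sum_subset (Finset.range_mono hle)]
      · refine Finset.sum_congr rfl fun k hk => ?_
        rw [Set.indicator_of_mem (by simpa [← hK] using hk)]; simp
      · intro k _ hk
        rw [Set.indicator_of_notMem (by simpa [← hK] using hk)]; simp
    rw [h1, Finset.sum_range_sub]; ring
  have hint : ∀ k, Integrable ({z : ℕ → Fin n → Bool → ℝ |
      k < resampleCount F η M est z x.1 x.2}.indicator (1 : (ℕ → Fin n → Bool → ℝ) → ℝ)) (resampleLaw n) := fun k =>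
    (integrable_const (1 : ℝ)).indicator (hm k)
  simp_rw [h]
  rw [integral_add (integrable_const _) (integrable_finsetSum _ fun k _ => (hint k).const_mul _),
    integral_finsetSum _ fun k _ => (hint k).const_mul _]
  congr 1
  · simp
  refine Finset.sum_congr rfl fun k hk => ?_
  rw [integral_const_mul, integral_indicator_one (hm k),
    resampleLaw_real_lt_count F η M est x k (Finset.mem_range.1 hk)]

/-- Resampling estimates the inverse of the probability of a coordinate. -/
lemma coordProb_mul_integral_count {n : ℕ} (F : Finset (Finset (Fin n))) (η : ℝ) (M : ℕ)
    (est : Fin n → Bool → ℝ) (x : Fin n × Bool) :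
    coordProb F η est x * ∫ z, (resampleCount F η M est z x.1 x.2 : ℝ) ∂(resampleLaw n) =
      1 - (1 - coordProb F η est x) ^ M := by
  rw [integral_comp_resampleCount F η M est x (fun k => (k : ℝ))]
  have := mul_neg_geom_sum (1 - coordProb F η est x) M
  rw [sub_sub_cancel] at this
  rw [← this]
  simp

lemma sq_coordProb_mul_integral_count_sq_le {n : ℕ} (F : Finset (Finset (Fin n))) (η : ℝ) (M : ℕ)
    (est : Fin n → Bool → ℝ) (x : Fin n × Bool) :
    coordProb F η est x ^ 2 * ∫ z, (resampleCount F η M est z x.1 x.2 : ℝ) ^ 2 ∂(resampleLaw n) ≤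
      2 := by
  rw [integral_comp_resampleCount F η M est x (fun k => (k : ℝ) ^ 2)]
  set p := coordProb F η est x
  have hp0 : 0 ≤ p := coordProb_nonneg _ _ _ _
  have hp1 : p ≤ 1 := coordProb_le_one _ _ _ _
  have hq0 : 0 ≤ 1 - p := by linarith
  have key : ∀ M : ℕ, p * ∑ k ∈ Finset.range M, (2 * (k : ℝ) + 1) * (1 - p) ^ k +
      2 * M * (1 - p) ^ M ≤ 2 * ∑ k ∈ Finset.range M, (1 - p) ^ k := by
    intro M
    induction M with
    | zero => simp
    | succ M ih =>
      rw [Finset.sum_range_succ, Finset.sum_range_succ, pow_succ]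
      push_cast
      have : 0 ≤ (1 - p) ^ M := pow_nonneg hq0 M
      nlinarith [mul_nonneg this hp0]
  have h1 := key M
  have h2 : p * ∑ k ∈ Finset.range M, (1 - p) ^ k = 1 - (1 - p) ^ M := by
    have := mul_neg_geom_sum (1 - p) M
    rwa [sub_sub_cancel] at this
  have h3 : ∀ k : ℕ, ((k + 1 : ℕ) : ℝ) ^ 2 - (k : ℝ) ^ 2 = 2 * k + 1 := by
    intro k; push_cast; ring
  simp_rw [h3]
  have h4 : 0 ≤ (1 - p) ^ M := pow_nonneg hq0 M
  have h5 : p * ∑ k ∈ Finset.range M, (2 * (k : ℝ) + 1) * (1 - p) ^ k ≤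
      2 * ∑ k ∈ Finset.range M, (1 - p) ^ k := by
    have : 0 ≤ 2 * (M : ℝ) * (1 - p) ^ M := by positivity
    linarith
  have h6 := mul_le_mul_of_nonneg_left h5 hp0
  calc _ = p * (p * ∑ k ∈ Finset.range M, (2 * (k : ℝ) + 1) * (1 - p) ^ k) := by
        simp; ring
    _ ≤ p * (2 * ∑ k ∈ Finset.range M, (1 - p) ^ k) := h6
    _ = 2 * (1 - (1 - p) ^ M) := by rw [← h2]; ring
    _ ≤ 2 := by linarith

/-- Loss of mass through the cap on the number of resampling steps. -/
lemma mul_one_sub_pow_le {p : ℝ} (h0 : 0 ≤ p) (h1 : p ≤ 1) {M : ℕ} (hM : 1 ≤ M) :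
    p * (1 - p) ^ M ≤ 1 / M := by
  have hq : 0 ≤ 1 - p := by linarith
  have h2 : p * ∑ k ∈ Finset.range M, (1 - p) ^ k = 1 - (1 - p) ^ M := by
    have := mul_neg_geom_sum (1 - p) M
    rwa [sub_sub_cancel] at this
  have h3 : (M : ℝ) * (1 - p) ^ M ≤ ∑ k ∈ Finset.range M, (1 - p) ^ k := by
    have := Finset.card_nsmul_le_sum (Finset.range M) (fun k => (1 - p) ^ k) ((1 - p) ^ M)
      (fun k hk => pow_le_pow_of_le_one hq (by linarith) (Finset.mem_range.1 hk).le)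
    simpa using this
  have hM' : (0 : ℝ) < M := by exact_mod_cast hM
  rw [le_div_iff₀ hM']
  have h4 := mul_le_mul_of_nonneg_left h3 h0
  have h5 : 0 ≤ (1 - p) ^ M := pow_nonneg hq M
  nlinarith

/-! ### The potential of the perturbed leader -/

lemma perturbedLoss_eq {n : ℕ} (η : ℝ) (est z : Fin n → Bool → ℝ) (S : Finset (Fin n)) :
    perturbedLoss η est z S = ∑ x, coordInd S x * (η * est x.1 x.2 - z x.1 x.2) := by
  rw [sum_coordInd_mul]; rfl

lemma integrable_perturbedLoss {n : ℕ} (F : Finset (Finset (Fin n))) (η : ℝ)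
    (est est' : Fin n → Bool → ℝ) :
    Integrable (fun z => perturbedLoss η est' z (fplSelect F η est z)) (perturbLaw n) := by
  simp_rw [perturbedLoss_eq]
  refine integrable_finsetSum _ fun x _ => ?_
  refine Integrable.bdd_mul (c := 1) ((integrable_const _).sub (integrable_perturbLaw x.1 x.2))
    (measurable_coordInd_fplSelect F η est x).aestronglyMeasurable
    (Filter.Eventually.of_forall fun z => ?_)
  rw [Real.norm_eq_abs, abs_le]
  exact ⟨by linarith [coordInd_nonneg (fplSelect F η est z) x], coordInd_le_one _ _⟩

/-- Expected perturbed loss of the perturbed leader: the potential function of the analysis. -/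
def fplPotential {n : ℕ} (F : Finset (Finset (Fin n))) (η : ℝ) (est : Fin n → Bool → ℝ) : ℝ :=
  ∫ z, perturbedLoss η est z (fplSelect F η est z) ∂(perturbLaw n)

/-- Stability of the perturbed leader: increasing the estimates by `v` decreases no selection
probability by more than the factor `exp (-η ‖v‖₁)`. -/
lemma coordProb_le_exp_mul {n : ℕ} (F : Finset (Finset (Fin n))) {η : ℝ} (hη : 0 ≤ η)
    (est v : Fin n → Bool → ℝ) (hv : ∀ e b, 0 ≤ v e b) (x : Fin n × Bool) :
    coordProb F η est x ≤ Real.exp (η * ∑ y : Fin n × Bool, v y.1 y.2) *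
      coordProb F η (fun e b => est e b + v e b) x := by
  have h := lintegral_perturbLaw_shift (fun e b => η * v e b) (fun e b => mul_nonneg hη (hv e b))
    (fun z => ENNReal.ofReal (coordInd (fplSelect F η (fun e b => est e b + v e b) z) x))
    (measurable_coordInd_fplSelect F η _ x).ennreal_ofReal
  simp_rw [fplSelect_shift] at h
  rw [← ofReal_integral_eq_lintegral_ofReal (integrable_coordInd F η _ x)
      (Filter.Eventually.of_forall fun _ => coordInd_nonneg _ _),
    ← ofReal_integral_eq_lintegral_ofReal (integrable_coordInd F η _ x)
      (Filter.Eventually.of_forall fun _ => coordInd_nonneg _ _),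
    ← ENNReal.ofReal_mul (Real.exp_pos _).le] at h
  replace h := (ENNReal.ofReal_le_ofReal_iff (mul_nonneg (Real.exp_pos _).le
    (integral_nonneg fun _ => coordInd_nonneg _ _))).1 h
  rw [Fintype.sum_prod_type, Finset.mul_sum]
  simp_rw [Finset.mul_sum]
  exact h

/-- One step of the potential argument. The increase of the potential is at least the loss of the
leader after the update, and shifting the exponential perturbations changes the selection
probabilities at most by the factor in front. -/
lemma fplPotential_step {n : ℕ} {F : Finset (Finset (Fin n))} (hF : F.Nonempty) {η : ℝ}
    (hη : 0 ≤ η) (est v : Fin n → Bool → ℝ) (hv : ∀ e b, 0 ≤ v e b) :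
    η * (Real.exp (-(η * ∑ y : Fin n × Bool, v y.1 y.2)) *
        ∑ x : Fin n × Bool, coordProb F η est x * v x.1 x.2) ≤
      fplPotential F η (fun e b => est e b + v e b) - fplPotential F η est := by
  set est' : Fin n → Bool → ℝ := fun e b => est e b + v e b with hest'
  have h1 : fplPotential F η est ≤
      ∫ z, perturbedLoss η est z (fplSelect F η est' z) ∂(perturbLaw n) :=
    integral_mono (integrable_perturbedLoss F η est est) (integrable_perturbedLoss F η est' est)
      fun z => perturbedLoss_fplSelect_le η est z (fplSelect_mem hF η est' z)
  have h2 : ∫ z, perturbedLoss η est z (fplSelect F η est' z) ∂(perturbLaw n) =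
      fplPotential F η est' - ∑ x : Fin n × Bool, coordProb F η est' x * (η * v x.1 x.2) := by
    have e1 : ∀ z, perturbedLoss η est z (fplSelect F η est' z) =
        perturbedLoss η est' z (fplSelect F η est' z) -
          ∑ x : Fin n × Bool, coordInd (fplSelect F η est' z) x * (η * v x.1 x.2) := by
      intro z
      rw [perturbedLoss_eq, perturbedLoss_eq, ← Finset.sum_sub_distrib]
      refine Finset.sum_congr rfl fun x _ => ?_
      simp only [hest']; ring
    simp_rw [e1]
    rw [integral_sub (integrable_perturbedLoss F η est' est') (integrable_finsetSum _ fun x _ =>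
      (integrable_coordInd F η est' x).mul_const _), integral_finsetSum _ fun x _ =>
      (integrable_coordInd F η est' x).mul_const _]
    simp_rw [integral_mul_const]
    rfl
  have h3 : ∀ x : Fin n × Bool, Real.exp (-(η * ∑ y : Fin n × Bool, v y.1 y.2)) *
      coordProb F η est x ≤ coordProb F η est' x := by
    intro x
    have := mul_le_mul_of_nonneg_left (coordProb_le_exp_mul F hη est v hv x)
      (Real.exp_pos (-(η * ∑ y : Fin n × Bool, v y.1 y.2))).le
    rwa [← mul_assoc, ← Real.exp_add, neg_add_cancel, Real.exp_zero, one_mul] at this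
  have h4 : η * (Real.exp (-(η * ∑ y : Fin n × Bool, v y.1 y.2)) *
        ∑ x : Fin n × Bool, coordProb F η est x * v x.1 x.2) ≤
      ∑ x : Fin n × Bool, coordProb F η est' x * (η * v x.1 x.2) := by
    rw [Finset.mul_sum, Finset.mul_sum]
    refine Finset.sum_le_sum fun x _ => ?_
    have := mul_le_mul_of_nonneg_right (h3 x) (mul_nonneg hη (hv x.1 x.2))
    linarith
  linarith

lemma fplPotential_le {n : ℕ} {F : Finset (Finset (Fin n))} (η : ℝ) (est : Fin n → Bool → ℝ)
    {S : Finset (Fin n)} (hS : S ∈ F) :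
    fplPotential F η est ≤ η * ∑ e, est e (decide (e ∈ S)) := by
  have h0 : Integrable (fun z : Fin n → Bool → ℝ => perturbedLoss η est z S) (perturbLaw n) := by
    unfold perturbedLoss
    exact integrable_finsetSum _ fun e _ => (integrable_const _).sub (integrable_perturbLaw _ _)
  have h1 : fplPotential F η est ≤ ∫ z, perturbedLoss η est z S ∂(perturbLaw n) :=
    integral_mono (integrable_perturbedLoss F η est est) h0
      fun z => perturbedLoss_fplSelect_le η est z hS
  refine h1.trans ?_
  have h2 : ∫ z, perturbedLoss η est z S ∂(perturbLaw n) ≤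
      ∫ _z, η * ∑ e, est e (decide (e ∈ S)) ∂(perturbLaw n) := by
    refine integral_mono_ae h0 (integrable_const _) ?_
    filter_upwards [ae_nonneg_perturbLaw (n := n)] with z hz
    unfold perturbedLoss
    rw [Finset.mul_sum]
    exact Finset.sum_le_sum fun e _ => by linarith [hz e (decide (e ∈ S))]
  simpa using h2

lemma neg_le_fplPotential_zero {n : ℕ} (F : Finset (Finset (Fin n))) (η : ℝ) :
    -(2 * n : ℝ) ≤ fplPotential F η (fun _ _ => 0) := by
  have h0 : Integrable (fun z : Fin n → Bool → ℝ => -∑ x : Fin n × Bool, z x.1 x.2)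
      (perturbLaw n) := (integrable_finsetSum _ fun x _ => integrable_perturbLaw _ _).neg
  have h1 : ∫ z, -∑ x : Fin n × Bool, z x.1 x.2 ∂(perturbLaw n) ≤
      fplPotential F η (fun _ _ => 0) := by
    refine integral_mono_ae h0 (integrable_perturbedLoss F η _ _) ?_
    filter_upwards [ae_nonneg_perturbLaw (n := n)] with z hz
    rw [perturbedLoss_eq, ← Finset.sum_neg_distrib]
    refine Finset.sum_le_sum fun x _ => ?_
    have := mul_le_mul_of_nonneg_right (coordInd_le_one (fplSelect F η (fun _ _ => 0) z) x)
      (hz x.1 x.2)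
    linarith
  refine le_trans ?_ h1
  rw [integral_neg, integral_finsetSum _ fun x _ => integrable_perturbLaw _ _, neg_le_neg_iff]
  calc _ ≤ ∑ x : Fin n × Bool, (1 : ℝ) :=
        Finset.sum_le_sum fun x _ => integral_perturbLaw_le x.1 x.2
    _ = 2 * n := by simp [mul_comm]

/-- Regret of the perturbed leader on arbitrary nonnegative loss vectors `v t`, up to the
stability factors. -/
lemma fpl_regret {n : ℕ} {F : Finset (Finset (Fin n))} {η : ℝ} (hη : 0 < η)
    (L v : ℕ → Fin n → Bool → ℝ) (k : ℕ) (hv : ∀ t < k, ∀ e b, 0 ≤ v t e b)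
    (h0 : L 0 = fun _ _ => 0) (hs : ∀ t, L (t + 1) = fun e b => L t e b + v t e b) {S : Finset (Fin n)}
    (hS : S ∈ F) :
    ∑ t ∈ Finset.range k, Real.exp (-(η * ∑ y : Fin n × Bool, v t y.1 y.2)) *
        ∑ x : Fin n × Bool, coordProb F η (L t) x * v t x.1 x.2 ≤
      ∑ e, L k e (decide (e ∈ S)) + 2 * n / η := by
  have h1 : η * ∑ t ∈ Finset.range k, Real.exp (-(η * ∑ y : Fin n × Bool, v t y.1 y.2)) *
        ∑ x : Fin n × Bool, coordProb F η (L t) x * v t x.1 x.2 ≤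
      fplPotential F η (L k) - fplPotential F η (L 0) := by
    rw [Finset.mul_sum, ← Finset.sum_range_sub (fun t => fplPotential F η (L t))]
    refine Finset.sum_le_sum fun t ht => ?_
    rw [hs t]
    exact fplPotential_step ⟨S, hS⟩ hη.le (L t) (v t) (hv t (Finset.mem_range.1 ht))
  have h2 := fplPotential_le η (L k) hS
  have h3 := neg_le_fplPotential_zero F η
  rw [h0] at h1
  have h4 : ∑ e, L k e (decide (e ∈ S)) + 2 * n / η =
      (η * ∑ e, L k e (decide (e ∈ S)) + 2 * n) / η := by field_simp
  rw [h4, le_div_iff₀ hη]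
  linarith

/-! ### Moments of the loss estimates of one round -/

/-- Estimate of the losses `ℓ` of one round from the feedback on the coordinates of the leader. -/
def lossEst {n : ℕ} (F : Finset (Finset (Fin n))) (η β : ℝ) (M : ℕ) (est ℓ : Fin n → Bool → ℝ)
    (z : ℕ → Fin n → Bool → ℝ) (e : Fin n) (b : Bool) : ℝ :=
  if b = decide (e ∈ fplSelect F η est (z 0)) then
    Real.log (1 + β * (resampleCount F η M est z e b * ℓ e b)) / β else 0

section Round

variable {n : ℕ} (F : Finset (Finset (Fin n))) (η β : ℝ) (M : ℕ) (est ℓ : Fin n → Bool → ℝ)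

lemma lossEst_eq (z : ℕ → Fin n → Bool → ℝ) (x : Fin n × Bool) :
    lossEst F η β M est ℓ z x.1 x.2 = coordInd (fplSelect F η est (z 0)) x *
      (Real.log (1 + β * (resampleCount F η M est z x.1 x.2 * ℓ x.1 x.2)) / β) := by
  unfold lossEst coordInd
  split_ifs <;> simp

variable {F η β M est ℓ}

lemma lossEst_nonneg (hβ : 0 < β) (hℓ : ∀ e b, 0 ≤ ℓ e b) (z : ℕ → Fin n → Bool → ℝ) (e : Fin n)
    (b : Bool) : 0 ≤ lossEst F η β M est ℓ z e b := by
  unfold lossEst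
  split_ifs
  · have : 0 ≤ β * (resampleCount F η M est z e b * ℓ e b) :=
      mul_nonneg hβ.le (mul_nonneg (Nat.cast_nonneg _) (hℓ e b))
    exact div_nonneg (Real.log_nonneg (by linarith)) hβ.le
  · exact le_rfl

lemma lossEst_le (hβ : 0 < β) (hℓ : ∀ e b, 0 ≤ ℓ e b) (hℓ1 : ∀ e b, ℓ e b ≤ 1)
    (z : ℕ → Fin n → Bool → ℝ) (x : Fin n × Bool) :
    lossEst F η β M est ℓ z x.1 x.2 ≤
      coordInd (fplSelect F η est (z 0)) x * resampleCount F η M est z x.1 x.2 := by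
  rw [lossEst_eq]
  refine mul_le_mul_of_nonneg_left ?_ (coordInd_nonneg _ _)
  have hK : (0 : ℝ) ≤ resampleCount F η M est z x.1 x.2 := Nat.cast_nonneg _
  have h0 : 0 ≤ β * (resampleCount F η M est z x.1 x.2 * ℓ x.1 x.2) :=
    mul_nonneg hβ.le (mul_nonneg hK (hℓ _ _))
  rw [div_le_iff₀ hβ]
  have h1 := Real.log_le_sub_one_of_pos (show 0 < 1 + β * (resampleCount F η M est z x.1 x.2 * ℓ x.1 x.2) by linarith)
  have h2 := mul_le_mul_of_nonneg_left (hℓ1 x.1 x.2) hK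
  nlinarith

lemma le_lossEst (hβ : 0 < β) (hℓ : ∀ e b, 0 ≤ ℓ e b) (hℓ1 : ∀ e b, ℓ e b ≤ 1)
    (z : ℕ → Fin n → Bool → ℝ) (x : Fin n × Bool) :
    coordInd (fplSelect F η est (z 0)) x * (resampleCount F η M est z x.1 x.2 * ℓ x.1 x.2 -
      β / 2 * (resampleCount F η M est z x.1 x.2 : ℝ) ^ 2) ≤ lossEst F η β M est ℓ z x.1 x.2 := by
  rw [lossEst_eq]
  refine mul_le_mul_of_nonneg_left ?_ (coordInd_nonneg _ _)
  have hK : (0 : ℝ) ≤ resampleCount F η M est z x.1 x.2 := Nat.cast_nonneg _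
  set K : ℝ := ((resampleCount F η M est z x.1 x.2 : ℕ) : ℝ)
  have hy : 0 ≤ K * ℓ x.1 x.2 := mul_nonneg hK (hℓ _ _)
  have hy2 : K * ℓ x.1 x.2 ≤ K := by nlinarith [hℓ1 x.1 x.2]
  set y := K * ℓ x.1 x.2
  have h0 : 0 ≤ β * y := mul_nonneg hβ.le hy
  have h1 := Real.le_log_one_add_of_nonneg h0
  rw [le_div_iff₀ hβ]
  refine le_trans ?_ h1
  rw [le_div_iff₀ (by linarith)]
  have : y ^ 2 ≤ K ^ 2 := by gcongr
  have h5 : (y - β / 2 * K ^ 2) * β ≤ (y - β / 2 * y ^ 2) * β := by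
    gcongr
  calc (y - β / 2 * K ^ 2) * β * (β * y + 2) ≤ (y - β / 2 * y ^ 2) * β * (β * y + 2) := by
        gcongr
    _ ≤ 2 * (β * y) := by nlinarith [pow_nonneg h0 3]

lemma measurable_lossEst {α : Type*} [MeasurableSpace α] (F : Finset (Finset (Fin n))) (η β : ℝ)
    (M : ℕ) {est ℓ : α → Fin n → Bool → ℝ} {z : α → ℕ → Fin n → Bool → ℝ} (he : Measurable est)
    (hℓ : Measurable ℓ) (hz : Measurable z) (e : Fin n) (b : Bool) :
    Measurable fun a => lossEst F η β M (est a) (ℓ a) (z a) e b := by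
  have h := fun a => lossEst_eq F η β M (est a) (ℓ a) (z a) (e, b)
  simp only at h
  simp_rw [h]
  have h1 : Measurable fun a => coordInd (fplSelect F η (est a) (z a 0)) (e, b) :=
    (measurable_coordInd _).comp (measurable_fplSelect F η he ((measurable_pi_apply 0).comp hz))
  have h2 : Measurable fun a => (resampleCount F η M (est a) (z a) e b : ℝ) :=
    (measurable_from_nat (f := fun k : ℕ => (k : ℝ))).comp (measurable_resampleCount F η M he hz e b)
  fun_prop

lemma integral_resampleLaw_mul (f : (Fin n → Bool → ℝ) → ℝ) (g : (ℕ → Fin n → Bool → ℝ) → ℝ)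
    (hf : Measurable f) (hg : Measurable g) (bf bg : ℝ) (hbf : ∀ z, |f z| ≤ bf)
    (hbg : ∀ z, |g z| ≤ bg) (h : ∀ z w, g (Function.update z 0 w) = g z) :
    ∫ z, f (z 0) * g z ∂(resampleLaw n) =
      (∫ w, f w ∂(perturbLaw n)) * ∫ z, g z ∂(resampleLaw n) := by
  have hm : Measurable fun z : ℕ → Fin n → Bool → ℝ => f (z 0) * g z := by fun_prop
  unfold resampleLaw
  rw [integral_infinitePi_update (fun _ : ℕ => perturbLaw n) 0 hm
    (integrable_of_abs_le hm (bf * bg) fun z => by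
      rw [abs_mul]
      exact mul_le_mul (hbf _) (hbg _) (abs_nonneg _) ((abs_nonneg _).trans (hbf (z 0))))]
  simp_rw [Function.update_self, h, integral_mul_const, integral_const_mul]

lemma integral_resampleLaw_coordInd (F : Finset (Finset (Fin n))) (η : ℝ) (M : ℕ)
    (est : Fin n → Bool → ℝ) (f : (Fin n → Bool → ℝ) → ℝ) (hf : Measurable f)
    (hbf : ∀ z, |f z| ≤ 1) (x y : Fin n × Bool) (φ : ℕ → ℕ → ℝ) :
    ∫ z, f (z 0) * φ (resampleCount F η M est z x.1 x.2) (resampleCount F η M est z y.1 y.2)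
      ∂(resampleLaw n) = (∫ w, f w ∂(perturbLaw n)) *
      ∫ z, φ (resampleCount F η M est z x.1 x.2) (resampleCount F η M est z y.1 y.2)
        ∂(resampleLaw n) := by
  refine integral_resampleLaw_mul f _ hf ?_ 1
    (∑ i ∈ Finset.range (M + 1), ∑ j ∈ Finset.range (M + 1), |φ i j|) hbf ?_ ?_
  · have h1 : Measurable fun p : ℕ × ℕ => φ p.1 p.2 := measurable_of_countable _
    exact h1.comp ((measurable_resampleCount F η M measurable_const measurable_id x.1 x.2).prodMk
      (measurable_resampleCount F η M measurable_const measurable_id y.1 y.2))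
  · intro z
    have hx := Finset.mem_range_succ_iff.2 (resampleCount_le F η M est z x.1 x.2)
    have hy := Finset.mem_range_succ_iff.2 (resampleCount_le F η M est z y.1 y.2)
    refine le_trans ?_ (Finset.single_le_sum (f := fun i => ∑ j ∈ Finset.range (M + 1), |φ i j|)
      (fun i _ => Finset.sum_nonneg fun j _ => abs_nonneg _) hx)
    exact Finset.single_le_sum (f := fun j => |φ (resampleCount F η M est z x.1 x.2) j|)
      (fun j _ => abs_nonneg _) hy
  · intro z w
    have : ∀ u : Fin n × Bool, resampleCount F η M est (Function.update z 0 w) u.1 u.2 =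
        resampleCount F η M est z u.1 u.2 := fun u =>
      resampleCount_congr F η M est _ _ (fun j hj => by
        rw [Function.update_of_ne (by omega)]) u.1 u.2
    rw [this, this]

lemma integrable_resampleLaw_coordInd (F : Finset (Finset (Fin n))) (η : ℝ) (M : ℕ)
    (est : Fin n → Bool → ℝ) (f : (Fin n → Bool → ℝ) → ℝ) (hf : Measurable f)
    (hbf : ∀ z, |f z| ≤ 1) (x y : Fin n × Bool) (φ : ℕ → ℕ → ℝ) :
    Integrable (fun z => f (z 0) * φ (resampleCount F η M est z x.1 x.2)
      (resampleCount F η M est z y.1 y.2)) (resampleLaw n) := by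
  refine integrable_of_abs_le ?_
    (∑ i ∈ Finset.range (M + 1), ∑ j ∈ Finset.range (M + 1), |φ i j|) ?_
  · have h1 : Measurable fun p : ℕ × ℕ => φ p.1 p.2 := measurable_of_countable _
    exact (hf.comp (measurable_pi_apply 0)).mul (h1.comp
      ((measurable_resampleCount F η M measurable_const measurable_id x.1 x.2).prodMk
      (measurable_resampleCount F η M measurable_const measurable_id y.1 y.2)))
  · intro z
    have hx := Finset.mem_range_succ_iff.2 (resampleCount_le F η M est z x.1 x.2)
    have hy := Finset.mem_range_succ_iff.2 (resampleCount_le F η M est z y.1 y.2)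
    rw [abs_mul]
    refine le_trans (mul_le_of_le_one_left (abs_nonneg _) (hbf _)) ?_
    refine le_trans ?_ (Finset.single_le_sum (f := fun i => ∑ j ∈ Finset.range (M + 1), |φ i j|)
      (fun i _ => Finset.sum_nonneg fun j _ => abs_nonneg _) hx)
    exact Finset.single_le_sum (f := fun j => |φ (resampleCount F η M est z x.1 x.2) j|)
      (fun j _ => abs_nonneg _) hy

/-- The overestimate of a loss, scaled by `β`, has exponential moment at most one. The logarithm in
the loss estimate is chosen for this. -/
lemma lintegral_exp_lossEst_le (hβ : 0 < β) (hℓ : ∀ e b, 0 ≤ ℓ e b) (x : Fin n × Bool) :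
    ∫⁻ z, ENNReal.ofReal (Real.exp (β * (lossEst F η β M est ℓ z x.1 x.2 - ℓ x.1 x.2)))
      ∂(resampleLaw n) ≤ 1 := by
  set f := fun w => coordInd (fplSelect F η est w) x with hfdef
  have hf : Measurable f := measurable_coordInd_fplSelect F η est x
  have hbf : ∀ z, |f z| ≤ 1 := fun z =>
    abs_le.2 ⟨by linarith [coordInd_nonneg (fplSelect F η est z) x], coordInd_le_one _ _⟩
  have hI := integrable_resampleLaw_coordInd F η M est f hf hbf x x (fun i _ => (i : ℝ))
  have hE := integral_resampleLaw_coordInd F η M est f hf hbf x x (fun i _ => (i : ℝ))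
  have hp : ∫ w, f w ∂(perturbLaw n) = coordProb F η est x := rfl
  rw [hp, coordProb_mul_integral_count] at hE
  have h1 : ∀ z, Real.exp (β * (lossEst F η β M est ℓ z x.1 x.2 - ℓ x.1 x.2)) =
      Real.exp (-(β * ℓ x.1 x.2)) * (1 + β * ℓ x.1 x.2 *
        (f (z 0) * (resampleCount F η M est z x.1 x.2 : ℝ))) := by
    intro z
    rw [mul_sub, sub_eq_neg_add, Real.exp_add]
    congr 1
    unfold lossEst
    have : 0 ≤ β * (resampleCount F η M est z x.1 x.2 * ℓ x.1 x.2) :=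
      mul_nonneg hβ.le (mul_nonneg (Nat.cast_nonneg _) (hℓ _ _))
    split_ifs with h
    · rw [mul_div_cancel₀ _ hβ.ne', Real.exp_log (by linarith)]
      simp only [hfdef, coordInd]; rw [if_pos h]; ring
    · simp only [hfdef, coordInd]; rw [if_neg h]; simp
  simp_rw [h1]
  have hint : Integrable (fun z => Real.exp (-(β * ℓ x.1 x.2)) * (1 + β * ℓ x.1 x.2 *
        (f (z 0) * (resampleCount F η M est z x.1 x.2 : ℝ)))) (resampleLaw n) :=
    ((integrable_const _).add (hI.const_mul _)).const_mul _
  rw [← ofReal_integral_eq_lintegral_ofReal hint (Filter.Eventually.of_forall fun z => by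
    simp only [Pi.zero_apply]
    have : 0 ≤ f (z 0) := coordInd_nonneg _ _
    have := hℓ x.1 x.2
    positivity)]
  rw [integral_const_mul, integral_add (integrable_const _) (hI.const_mul _), integral_const_mul, hE]
  simp only [integral_const, probReal_univ, smul_eq_mul, mul_one]
  rw [ENNReal.ofReal_le_one]
  have h3 : 0 ≤ (1 - coordProb F η est x) ^ M :=
    pow_nonneg (by linarith [coordProb_le_one F η est x]) M
  have h4 : 0 ≤ β * ℓ x.1 x.2 := mul_nonneg hβ.le (hℓ _ _)
  calc _ ≤ Real.exp (-(β * ℓ x.1 x.2)) * Real.exp (β * ℓ x.1 x.2) := by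
        gcongr
        have := Real.add_one_le_exp (β * ℓ x.1 x.2)
        nlinarith
    _ = 1 := by rw [← Real.exp_add]; simp

/-- Loss of the action of one round minus the (discounted) expected estimate that enters the
regret bound of the perturbed leader. -/
def roundGap (F : Finset (Finset (Fin n))) (η β : ℝ) (M : ℕ) (est ℓ : Fin n → Bool → ℝ)
    (z : ℕ → Fin n → Bool → ℝ) : ℝ :=
  ∑ e, ℓ e (decide (e ∈ fplSelect F η est (z 0))) -
    Real.exp (-(η * ∑ y : Fin n × Bool, lossEst F η β M est ℓ z y.1 y.2)) *
      ∑ x : Fin n × Bool, coordProb F η est x * lossEst F η β M est ℓ z x.1 x.2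

lemma measurable_roundGap {α : Type*} [MeasurableSpace α] (F : Finset (Finset (Fin n))) (η β : ℝ)
    (M : ℕ) {est ℓ : α → Fin n → Bool → ℝ} {z : α → ℕ → Fin n → Bool → ℝ} (he : Measurable est)
    (hℓ : Measurable ℓ) (hz : Measurable z) :
    Measurable fun a => roundGap F η β M (est a) (ℓ a) (z a) := by
  unfold roundGap
  have h1 := fun x : Fin n × Bool => measurable_lossEst F η β M he hℓ hz x.1 x.2
  have h2 := fun x : Fin n × Bool => measurable_coordProb F η he x
  have h3 : ∀ a, ∑ e, ℓ a e (decide (e ∈ fplSelect F η (est a) (z a 0))) =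
      ∑ x : Fin n × Bool, coordInd (fplSelect F η (est a) (z a 0)) x * ℓ a x.1 x.2 := by
    intro a; rw [sum_coordInd_mul]
  simp_rw [h3]
  have h4 := fun x : Fin n × Bool =>
    (measurable_coordInd x).comp (measurable_fplSelect F η he ((measurable_pi_apply 0).comp hz))
  simp only [Function.comp_def] at h4
  fun_prop

lemma sum_loss_nonneg (hℓ : ∀ e b, 0 ≤ ℓ e b) (S : Finset (Fin n)) :
    0 ≤ ∑ e, ℓ e (decide (e ∈ S)) := Finset.sum_nonneg fun _ _ => hℓ _ _

lemma sum_loss_le (hℓ1 : ∀ e b, ℓ e b ≤ 1) (S : Finset (Fin n)) :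
    ∑ e, ℓ e (decide (e ∈ S)) ≤ n := by
  calc _ ≤ ∑ e : Fin n, (1 : ℝ) := Finset.sum_le_sum fun e _ => hℓ1 _ _
    _ = n := by simp

lemma discounted_nonneg (hβ : 0 < β) (hℓ : ∀ e b, 0 ≤ ℓ e b) (z : ℕ → Fin n → Bool → ℝ) :
    0 ≤ Real.exp (-(η * ∑ y : Fin n × Bool, lossEst F η β M est ℓ z y.1 y.2)) *
      ∑ x : Fin n × Bool, coordProb F η est x * lossEst F η β M est ℓ z x.1 x.2 :=
  mul_nonneg (Real.exp_pos _).le (Finset.sum_nonneg fun _ _ =>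
    mul_nonneg (coordProb_nonneg _ _ _ _) (lossEst_nonneg hβ hℓ _ _ _))

lemma roundGap_le (hβ : 0 < β) (hℓ : ∀ e b, 0 ≤ ℓ e b) (hℓ1 : ∀ e b, ℓ e b ≤ 1)
    (z : ℕ → Fin n → Bool → ℝ) : roundGap F η β M est ℓ z ≤ n := by
  unfold roundGap
  linarith [discounted_nonneg (F := F) (η := η) (M := M) (est := est) hβ hℓ z,
    sum_loss_le hℓ1 (fplSelect F η est (z 0))]

lemma roundGap_sq_le (hη : 0 ≤ η) (hβ : 0 < β) (hℓ : ∀ e b, 0 ≤ ℓ e b) (hℓ1 : ∀ e b, ℓ e b ≤ 1)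
    (z : ℕ → Fin n → Bool → ℝ) :
    roundGap F η β M est ℓ z ^ 2 ≤ (n : ℝ) ^ 2 + n * ∑ x : Fin n × Bool,
      coordProb F η est x ^ 2 * (coordInd (fplSelect F η est (z 0)) x *
        (resampleCount F η M est z x.1 x.2 : ℝ) ^ 2) := by
  have ha0 := sum_loss_nonneg hℓ (fplSelect F η est (z 0))
  have ha1 := sum_loss_le hℓ1 (fplSelect F η est (z 0))
  have hU0 := discounted_nonneg (F := F) (η := η) (M := M) (est := est) hβ hℓ z
  have hexp : Real.exp (-(η * ∑ y : Fin n × Bool, lossEst F η β M est ℓ z y.1 y.2)) ≤ 1 := by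
    rw [Real.exp_le_one_iff, neg_nonpos]
    exact mul_nonneg hη (Finset.sum_nonneg fun _ _ => lossEst_nonneg hβ hℓ _ _ _)
  have hW : ∑ x : Fin n × Bool, coordProb F η est x * lossEst F η β M est ℓ z x.1 x.2 ≤
      ∑ x : Fin n × Bool, coordInd (fplSelect F η est (z 0)) x *
        (coordProb F η est x * resampleCount F η M est z x.1 x.2) := by
    refine Finset.sum_le_sum fun x _ => ?_
    have := mul_le_mul_of_nonneg_left (lossEst_le (F := F) (η := η) (M := M) (est := est) hβ hℓ hℓ1 z x)
      (coordProb_nonneg F η est x)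
    linarith
  have hW0 : 0 ≤ ∑ x : Fin n × Bool, coordProb F η est x * lossEst F η β M est ℓ z x.1 x.2 :=
    Finset.sum_nonneg fun _ _ =>
      mul_nonneg (coordProb_nonneg _ _ _ _) (lossEst_nonneg hβ hℓ _ _ _)
  have hCS : (∑ x : Fin n × Bool, coordInd (fplSelect F η est (z 0)) x *
        (coordProb F η est x * resampleCount F η M est z x.1 x.2)) ^ 2 ≤
      n * ∑ x : Fin n × Bool, coordProb F η est x ^ 2 * (coordInd (fplSelect F η est (z 0)) x *
        (resampleCount F η M est z x.1 x.2 : ℝ) ^ 2) := by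
    rw [sum_coordInd_mul]
    have h := sq_sum_le_card_mul_sum_sq (s := (Finset.univ : Finset (Fin n))) (f := fun e =>
      coordProb F η est (e, decide (e ∈ fplSelect F η est (z 0))) *
      (resampleCount F η M est z e (decide (e ∈ fplSelect F η est (z 0))) : ℝ))
    rw [Finset.card_univ, Fintype.card_fin] at h
    refine h.trans (le_of_eq ?_)
    congr 1
    rw [← sum_coordInd_mul (fplSelect F η est (z 0)) (fun x => (coordProb F η est x *
      (resampleCount F η M est z x.1 x.2 : ℝ)) ^ 2)]
    refine Finset.sum_congr rfl fun x _ => ?_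
    ring
  unfold roundGap
  set a := ∑ e, ℓ e (decide (e ∈ fplSelect F η est (z 0)))
  set E := Real.exp (-(η * ∑ y : Fin n × Bool, lossEst F η β M est ℓ z y.1 y.2))
  set W := ∑ x : Fin n × Bool, coordProb F η est x * lossEst F η β M est ℓ z x.1 x.2
  have h1 : E * W ≤ W := mul_le_of_le_one_left hW0 hexp
  have h2 : (E * W) ^ 2 ≤ _ := (pow_le_pow_left₀ hU0 (h1.trans hW) 2).trans hCS
  have h3 : a ^ 2 ≤ (n : ℝ) ^ 2 := pow_le_pow_left₀ ha0 ha1 2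
  nlinarith [mul_nonneg ha0 hU0]

lemma integral_roundGap_sq_le (hη : 0 ≤ η) (hβ : 0 < β) (hℓ : ∀ e b, 0 ≤ ℓ e b)
    (hℓ1 : ∀ e b, ℓ e b ≤ 1) :
    Integrable (fun z => roundGap F η β M est ℓ z ^ 2) (resampleLaw n) ∧
    ∫ z, roundGap F η β M est ℓ z ^ 2 ∂(resampleLaw n) ≤ 3 * (n : ℝ) ^ 2 := by
  have hf := fun x => measurable_coordInd_fplSelect F η est x
  have hbf : ∀ x z, |coordInd (fplSelect F η est z) x| ≤ 1 := fun x z =>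
    abs_le.2 ⟨by linarith [coordInd_nonneg (fplSelect F η est z) x], coordInd_le_one _ _⟩
  have hI := fun x => integrable_resampleLaw_coordInd F η M est _ (hf x) (hbf x) x x
    (fun i _ => (i : ℝ) ^ 2)
  have hE := fun x => integral_resampleLaw_coordInd F η M est _ (hf x) (hbf x) x x
    (fun i _ => (i : ℝ) ^ 2)
  have hint : Integrable (fun z => (n : ℝ) ^ 2 + n * ∑ x : Fin n × Bool,
      coordProb F η est x ^ 2 * (coordInd (fplSelect F η est (z 0)) x *
        (resampleCount F η M est z x.1 x.2 : ℝ) ^ 2)) (resampleLaw n) :=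
    (integrable_const _).add ((integrable_finsetSum _ fun x _ => (hI x).const_mul _).const_mul _)
  have hm : Measurable (fun z => roundGap F η β M est ℓ z) :=
    measurable_roundGap F η β M measurable_const measurable_const measurable_id
  have hint2 : Integrable (fun z => roundGap F η β M est ℓ z ^ 2) (resampleLaw n) := by
    refine hint.mono' (hm.pow_const 2).aestronglyMeasurable (Filter.Eventually.of_forall fun z => ?_)
    rw [Real.norm_eq_abs, abs_of_nonneg (sq_nonneg _)]
    exact roundGap_sq_le hη hβ hℓ hℓ1 z
  refine ⟨hint2, ?_⟩
  refine (integral_mono hint2 hint fun z => roundGap_sq_le hη hβ hℓ hℓ1 z).trans ?_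
  rw [integral_add (integrable_const _) ((integrable_finsetSum _ fun x _ =>
    (hI x).const_mul _).const_mul _), integral_const_mul,
    integral_finsetSum _ fun x _ => (hI x).const_mul _]
  simp_rw [integral_const_mul, hE]
  have h1 : ∑ x : Fin n × Bool, coordProb F η est x ^ 2 *
      ((∫ w, coordInd (fplSelect F η est w) x ∂(perturbLaw n)) *
        ∫ z, (resampleCount F η M est z x.1 x.2 : ℝ) ^ 2 ∂(resampleLaw n)) ≤
      ∑ x : Fin n × Bool, coordProb F η est x * 2 := by
    refine Finset.sum_le_sum fun x _ => ?_
    have h2 := mul_le_mul_of_nonneg_left (sq_coordProb_mul_integral_count_sq_le F η M est x)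
      (coordProb_nonneg F η est x)
    calc _ = coordProb F η est x * (coordProb F η est x ^ 2 *
        ∫ z, (resampleCount F η M est z x.1 x.2 : ℝ) ^ 2 ∂(resampleLaw n)) := by
          unfold coordProb; ring
      _ ≤ _ := h2
  have h3 : ∑ x : Fin n × Bool, coordProb F η est x = n := by
    unfold coordProb
    rw [← integral_finsetSum _ fun x _ => integrable_coordInd F η est x]
    simp_rw [sum_coordInd]
    simp
  rw [← Finset.sum_mul, h3] at h1
  have h4 := mul_le_mul_of_nonneg_left h1 (Nat.cast_nonneg (α := ℝ) n)
  simp only [integral_const, probReal_univ, smul_eq_mul, one_mul]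
  nlinarith

/-- Two coordinates: the resampling counts compensate for the probabilities, up to the joint
probability of the coordinates. -/
lemma sum_joint_le (F : Finset (Finset (Fin n))) (η : ℝ) (M : ℕ) (est : Fin n → Bool → ℝ)
    (y : Fin n × Bool) :
    ∑ x : Fin n × Bool, coordProb F η est x * ((∫ w, coordInd (fplSelect F η est w) x *
        coordInd (fplSelect F η est w) y ∂(perturbLaw n)) *
      ∫ z, (resampleCount F η M est z x.1 x.2 : ℝ) * (resampleCount F η M est z y.1 y.2 : ℝ)
        ∂(resampleLaw n)) ≤ 2 * n := by
  have hf := fun x => measurable_coordInd_fplSelect F η est x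
  have hJi : ∀ x, Integrable (fun w => coordInd (fplSelect F η est w) x *
        coordInd (fplSelect F η est w) y) (perturbLaw n) := fun x =>
    integrable_of_abs_le ((hf x).mul (hf y)) 1 fun z => by
      rw [abs_of_nonneg (mul_nonneg (coordInd_nonneg _ _) (coordInd_nonneg _ _))]
      exact mul_le_one₀ (coordInd_le_one _ _) (coordInd_nonneg _ _) (coordInd_le_one _ _)
  have hJ0 : ∀ x, 0 ≤ ∫ w, coordInd (fplSelect F η est w) x *
        coordInd (fplSelect F η est w) y ∂(perturbLaw n) := fun x =>
    integral_nonneg fun w => mul_nonneg (coordInd_nonneg _ _) (coordInd_nonneg _ _)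
  have hJy : ∀ x, ∫ w, coordInd (fplSelect F η est w) x *
        coordInd (fplSelect F η est w) y ∂(perturbLaw n) ≤ coordProb F η est y := fun x =>
    integral_mono (hJi x) (integrable_coordInd F η est y) fun w =>
      mul_le_of_le_one_left (coordInd_nonneg _ _) (coordInd_le_one _ _)
  have hJs : ∑ x : Fin n × Bool, ∫ w, coordInd (fplSelect F η est w) x *
        coordInd (fplSelect F η est w) y ∂(perturbLaw n) = n * coordProb F η est y := by
    rw [← integral_finsetSum _ fun x _ => hJi x]
    simp_rw [← Finset.sum_mul, sum_coordInd]
    rw [integral_const_mul]; rfl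
  rcases (coordProb_nonneg F η est y).eq_or_lt with hy | hy
  · have : ∀ x, ∫ w, coordInd (fplSelect F η est w) x *
        coordInd (fplSelect F η est w) y ∂(perturbLaw n) = 0 := fun x =>
      le_antisymm ((hJy x).trans hy.symm.le) (hJ0 x)
    simp [this]
  · have hK : ∀ x : Fin n × Bool, coordProb F η est x * coordProb F η est y *
        ∫ z, (resampleCount F η M est z x.1 x.2 : ℝ) * (resampleCount F η M est z y.1 y.2 : ℝ)
        ∂(resampleLaw n) ≤ 2 := by
      intro x
      have i1 := fun u : Fin n × Bool => integrable_resampleLaw_coordInd F η M est (fun _ => 1)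
        measurable_const (by simp) u u (fun i _ => (i : ℝ) ^ 2)
      have i2 := integrable_resampleLaw_coordInd F η M est (fun _ => 1)
        measurable_const (by simp) x y (fun i j => (i : ℝ) * j)
      simp only [one_mul] at i1 i2
      rw [← integral_const_mul]
      calc _ ≤ ∫ z, (1 / 2 * (coordProb F η est x ^ 2 * (resampleCount F η M est z x.1 x.2 : ℝ) ^ 2)
            + 1 / 2 * (coordProb F η est y ^ 2 * (resampleCount F η M est z y.1 y.2 : ℝ) ^ 2))
            ∂(resampleLaw n) := by
            refine integral_mono (i2.const_mul _) ((((i1 x).const_mul _).const_mul _).add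
              (((i1 y).const_mul _).const_mul _)) fun z => ?_
            simp only
            -- The two counts are dependent, hence the inequality of the means.
            nlinarith [sq_nonneg (coordProb F η est x * (resampleCount F η M est z x.1 x.2 : ℝ) -
              coordProb F η est y * (resampleCount F η M est z y.1 y.2 : ℝ))]
        _ ≤ 2 := by
            rw [integral_add (((i1 x).const_mul _).const_mul _) (((i1 y).const_mul _).const_mul _)]
            simp_rw [integral_const_mul]
            linarith [sq_coordProb_mul_integral_count_sq_le F η M est x,
              sq_coordProb_mul_integral_count_sq_le F η M est y]
    have h1 : ∀ x : Fin n × Bool, coordProb F η est x * ((∫ w, coordInd (fplSelect F η est w) x *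
        coordInd (fplSelect F η est w) y ∂(perturbLaw n)) *
      ∫ z, (resampleCount F η M est z x.1 x.2 : ℝ) * (resampleCount F η M est z y.1 y.2 : ℝ)
        ∂(resampleLaw n)) ≤ (∫ w, coordInd (fplSelect F η est w) x *
        coordInd (fplSelect F η est w) y ∂(perturbLaw n)) * (2 / coordProb F η est y) := by
      intro x
      have h2 : coordProb F η est x *
          ∫ z, (resampleCount F η M est z x.1 x.2 : ℝ) * (resampleCount F η M est z y.1 y.2 : ℝ)
          ∂(resampleLaw n) ≤ 2 / coordProb F η est y :=
        (le_div_iff₀ hy).2 (by linarith [hK x])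
      have := mul_le_mul_of_nonneg_left h2 (hJ0 x)
      linarith
    refine (Finset.sum_le_sum fun x _ => h1 x).trans ?_
    rw [← Finset.sum_mul, hJs]
    refine le_of_eq ?_
    field_simp

lemma integral_roundGap_le (hη : 0 ≤ η) (hβ : 0 < β) (hM : 1 ≤ M) (hℓ : ∀ e b, 0 ≤ ℓ e b)
    (hℓ1 : ∀ e b, ℓ e b ≤ 1) :
    ∫ z, roundGap F η β M est ℓ z ∂(resampleLaw n) ≤
      2 * n * (1 / M + β) + 4 * η * (n : ℝ) ^ 2 := by
  have hf := fun x => measurable_coordInd_fplSelect F η est x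
  have hbf : ∀ x z, |coordInd (fplSelect F η est z) x| ≤ 1 := fun x z =>
    abs_le.2 ⟨by linarith [coordInd_nonneg (fplSelect F η est z) x], coordInd_le_one _ _⟩
  have hbf2 : ∀ x y z, |coordInd (fplSelect F η est z) x * coordInd (fplSelect F η est z) y| ≤ 1 := by
    intro x y z
    rw [abs_mul]; exact mul_le_one₀ (hbf x z) (abs_nonneg _) (hbf y z)
  have I0 := fun x => integrable_resampleLaw_coordInd F η M est _ (hf x) (hbf x) x x
    (fun _ _ => (1 : ℝ))
  have E0 := fun x => integral_resampleLaw_coordInd F η M est _ (hf x) (hbf x) x x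
    (fun _ _ => (1 : ℝ))
  have I1 := fun x => integrable_resampleLaw_coordInd F η M est _ (hf x) (hbf x) x x
    (fun i _ => (i : ℝ))
  have E1 := fun x => integral_resampleLaw_coordInd F η M est _ (hf x) (hbf x) x x
    (fun i _ => (i : ℝ))
  have I2 := fun x => integrable_resampleLaw_coordInd F η M est _ (hf x) (hbf x) x x
    (fun i _ => (i : ℝ) ^ 2)
  have E2 := fun x => integral_resampleLaw_coordInd F η M est _ (hf x) (hbf x) x x
    (fun i _ => (i : ℝ) ^ 2)
  have I3 := fun x y => integrable_resampleLaw_coordInd F η M est _ ((hf x).mul (hf y))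
    (hbf2 x y) x y (fun i j => (i : ℝ) * j)
  have E3 := fun x y => integral_resampleLaw_coordInd F η M est _ ((hf x).mul (hf y))
    (hbf2 x y) x y (fun i j => (i : ℝ) * j)
  simp only [Pi.mul_apply] at I3 E3
  simp only [mul_one] at I0 E0
  simp only [integral_const, probReal_univ, smul_eq_mul, mul_one] at E0
  set p := coordProb F η est with hp
  have hpE : ∀ x, ∫ w, coordInd (fplSelect F η est w) x ∂(perturbLaw n) = p x := fun x => rfl
  -- a pointwise upper bound with explicit expectation
  have hpt : ∀ z, roundGap F η β M est ℓ z ≤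
      ∑ x : Fin n × Bool, (ℓ x.1 x.2 * coordInd (fplSelect F η est (z 0)) x -
        (p x * ℓ x.1 x.2 * (coordInd (fplSelect F η est (z 0)) x *
          (resampleCount F η M est z x.1 x.2 : ℝ)) -
        p x * (β / 2) * (coordInd (fplSelect F η est (z 0)) x *
          (resampleCount F η M est z x.1 x.2 : ℝ) ^ 2))) +
      η * ∑ y : Fin n × Bool, ∑ x : Fin n × Bool, p x *
        (coordInd (fplSelect F η est (z 0)) x * coordInd (fplSelect F η est (z 0)) y *
          ((resampleCount F η M est z x.1 x.2 : ℝ) * (resampleCount F η M est z y.1 y.2 : ℝ))) := by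
    intro z
    unfold roundGap
    set Y := ∑ y : Fin n × Bool, lossEst F η β M est ℓ z y.1 y.2 with hY
    set W := ∑ x : Fin n × Bool, coordProb F η est x * lossEst F η β M est ℓ z x.1 x.2 with hW
    have hW0 : 0 ≤ W := Finset.sum_nonneg fun _ _ =>
      mul_nonneg (coordProb_nonneg _ _ _ _) (lossEst_nonneg hβ hℓ _ _ _)
    have h1 : (1 - η * Y) * W ≤ Real.exp (-(η * Y)) * W :=
      mul_le_mul_of_nonneg_right (by linarith [Real.add_one_le_exp (-(η * Y))]) hW0
    have h2 : ∑ x : Fin n × Bool, (p x * ℓ x.1 x.2 * (coordInd (fplSelect F η est (z 0)) x *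
          (resampleCount F η M est z x.1 x.2 : ℝ)) -
        p x * (β / 2) * (coordInd (fplSelect F η est (z 0)) x *
          (resampleCount F η M est z x.1 x.2 : ℝ) ^ 2)) ≤ W := by
      refine Finset.sum_le_sum fun x _ => ?_
      have := mul_le_mul_of_nonneg_left (le_lossEst (F := F) (η := η) (M := M) (est := est) hβ hℓ hℓ1 z x)
        (coordProb_nonneg F η est x)
      rw [← hp] at this
      linarith
    have h3 : Y * W ≤ ∑ y : Fin n × Bool, ∑ x : Fin n × Bool, p x *
        (coordInd (fplSelect F η est (z 0)) x * coordInd (fplSelect F η est (z 0)) y *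
          ((resampleCount F η M est z x.1 x.2 : ℝ) * (resampleCount F η M est z y.1 y.2 : ℝ))) := by
      rw [hY, hW, Finset.sum_mul]
      refine Finset.sum_le_sum fun y _ => ?_
      rw [Finset.mul_sum]
      refine Finset.sum_le_sum fun x _ => ?_
      have hx := lossEst_le (F := F) (η := η) (M := M) (est := est) hβ hℓ hℓ1 z x
      have hy := lossEst_le (F := F) (η := η) (M := M) (est := est) hβ hℓ hℓ1 z y
      have h0x := lossEst_nonneg (F := F) (η := η) (M := M) (est := est) hβ hℓ z x.1 x.2
      have h0y := lossEst_nonneg (F := F) (η := η) (M := M) (est := est) hβ hℓ z y.1 y.2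
      have h4 := mul_le_mul hx hy h0y (h0x.trans hx)
      have h5 := mul_le_mul_of_nonneg_left h4 (coordProb_nonneg F η est x)
      rw [← hp] at h5 ⊢
      calc _ = p x * (lossEst F η β M est ℓ z x.1 x.2 * lossEst F η β M est ℓ z y.1 y.2) := by ring
        _ ≤ _ := h5
        _ = _ := by ring
    have h4 : ∑ e, ℓ e (decide (e ∈ fplSelect F η est (z 0))) =
        ∑ x : Fin n × Bool, ℓ x.1 x.2 * coordInd (fplSelect F η est (z 0)) x := by
      rw [← sum_coordInd_mul (fplSelect F η est (z 0)) (fun x => ℓ x.1 x.2)]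
      exact Finset.sum_congr rfl fun x _ => mul_comm _ _
    rw [Finset.sum_sub_distrib, h4]
    have h5 := mul_le_mul_of_nonneg_left h3 hη
    nlinarith
  have hm : Measurable (fun z => roundGap F η β M est ℓ z) :=
    measurable_roundGap F η β M measurable_const measurable_const measurable_id
  have hVint : Integrable (fun z => roundGap F η β M est ℓ z) (resampleLaw n) := by
    refine (memLp_one_iff_integrable.1 ?_)
    exact MemLp.mono_exponent ((memLp_two_iff_integrable_sq hm.aestronglyMeasurable).2
      (integral_roundGap_sq_le (F := F) (M := M) (est := est) hη hβ hℓ hℓ1).1) (by norm_num)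
  have ic : ∀ x : Fin n × Bool, Integrable (fun z => ℓ x.1 x.2 * coordInd (fplSelect F η est (z 0)) x -
        (p x * ℓ x.1 x.2 * (coordInd (fplSelect F η est (z 0)) x *
          (resampleCount F η M est z x.1 x.2 : ℝ)) -
        p x * (β / 2) * (coordInd (fplSelect F η est (z 0)) x *
          (resampleCount F η M est z x.1 x.2 : ℝ) ^ 2))) (resampleLaw n) := fun x =>
    ((I0 x).const_mul _).sub (((I1 x).const_mul _).sub ((I2 x).const_mul _))
  have ia : Integrable (fun z => ∑ x : Fin n × Bool, (ℓ x.1 x.2 * coordInd (fplSelect F η est (z 0)) x -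
        (p x * ℓ x.1 x.2 * (coordInd (fplSelect F η est (z 0)) x *
          (resampleCount F η M est z x.1 x.2 : ℝ)) -
        p x * (β / 2) * (coordInd (fplSelect F η est (z 0)) x *
          (resampleCount F η M est z x.1 x.2 : ℝ) ^ 2)))) (resampleLaw n) :=
    integrable_finsetSum _ fun x _ => ic x
  have ib : Integrable (fun z => η * ∑ y : Fin n × Bool, ∑ x : Fin n × Bool, p x *
        (coordInd (fplSelect F η est (z 0)) x * coordInd (fplSelect F η est (z 0)) y *
          ((resampleCount F η M est z x.1 x.2 : ℝ) * (resampleCount F η M est z y.1 y.2 : ℝ))))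
      (resampleLaw n) :=
    (integrable_finsetSum _ fun y _ => integrable_finsetSum _ fun x _ =>
      (I3 x y).const_mul _).const_mul _
  refine (integral_mono hVint (ia.add ib) hpt).trans ?_
  simp only [Pi.add_apply]
  rw [integral_add ia ib, integral_finsetSum _ fun x _ => ic x, integral_const_mul,
    integral_finsetSum _ fun y _ => integrable_finsetSum _ fun x _ => (I3 x y).const_mul _]
  have ha : ∀ x : Fin n × Bool, ∫ z, (ℓ x.1 x.2 * coordInd (fplSelect F η est (z 0)) x -
        (p x * ℓ x.1 x.2 * (coordInd (fplSelect F η est (z 0)) x *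
          (resampleCount F η M est z x.1 x.2 : ℝ)) -
        p x * (β / 2) * (coordInd (fplSelect F η est (z 0)) x *
          (resampleCount F η M est z x.1 x.2 : ℝ) ^ 2))) ∂(resampleLaw n) ≤ 1 / M + β := by
    intro x
    have id : Integrable (fun z => p x * ℓ x.1 x.2 * (coordInd (fplSelect F η est (z 0)) x *
          (resampleCount F η M est z x.1 x.2 : ℝ)) -
        p x * (β / 2) * (coordInd (fplSelect F η est (z 0)) x *
          (resampleCount F η M est z x.1 x.2 : ℝ) ^ 2)) (resampleLaw n) :=
      ((I1 x).const_mul _).sub ((I2 x).const_mul _)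
    rw [integral_sub ((I0 x).const_mul _) id,
      integral_sub ((I1 x).const_mul _) ((I2 x).const_mul _)]
    simp_rw [integral_const_mul]
    rw [E0 x, E1 x, E2 x, hpE x]
    have h1 := coordProb_mul_integral_count F η M est x
    have h2 := sq_coordProb_mul_integral_count_sq_le F η M est x
    have h3 := mul_one_sub_pow_le (coordProb_nonneg F η est x) (coordProb_le_one F η est x) hM
    rw [← hp] at h1 h2 h3
    have hp0 : 0 ≤ p x := coordProb_nonneg F η est x
    have hp1 : p x ≤ 1 := coordProb_le_one F η est x
    have h4 : 0 ≤ p x * (1 - p x) ^ M := mul_nonneg hp0 (pow_nonneg (by linarith) M)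
    rw [h1]
    have h5 : ℓ x.1 x.2 * (p x * (1 - p x) ^ M) ≤ p x * (1 - p x) ^ M :=
      mul_le_of_le_one_left h4 (hℓ1 _ _)
    have h6 := mul_le_mul_of_nonneg_left h2 hβ.le
    nlinarith
  have hb : ∀ y : Fin n × Bool, ∫ z, ∑ x : Fin n × Bool, p x *
        (coordInd (fplSelect F η est (z 0)) x * coordInd (fplSelect F η est (z 0)) y *
          ((resampleCount F η M est z x.1 x.2 : ℝ) * (resampleCount F η M est z y.1 y.2 : ℝ)))
          ∂(resampleLaw n) ≤ 2 * n := by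
    intro y
    rw [integral_finsetSum _ fun x _ => (I3 x y).const_mul _]
    simp_rw [integral_const_mul, E3]
    exact sum_joint_le F η M est y
  have hA := Finset.sum_le_sum fun x (_ : x ∈ (Finset.univ : Finset (Fin n × Bool))) => ha x
  have hB := Finset.sum_le_sum fun x (_ : x ∈ (Finset.univ : Finset (Fin n × Bool))) => hb x
  have hc : (Fintype.card (Fin n × Bool) : ℝ) = 2 * n := by simp [mul_comm]
  rw [Finset.sum_const, nsmul_eq_mul, Finset.card_univ, hc] at hA hB
  have := mul_le_mul_of_nonneg_left hB hη
  nlinarith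

/-- Exponential moment of the gap of one round, conditionally on the past. -/
lemma lintegral_exp_roundGap_le (hη : 0 ≤ η) (hβ : 0 < β) (hM : 1 ≤ M) (hℓ : ∀ e b, 0 ≤ ℓ e b)
    (hℓ1 : ∀ e b, ℓ e b ≤ 1) {l : ℝ} (hl : 0 ≤ l) (hln : l * n ≤ 1) :
    ∫⁻ z, ENNReal.ofReal (Real.exp (l * roundGap F η β M est ℓ z)) ∂(resampleLaw n) ≤
      ENNReal.ofReal (Real.exp (l * (2 * n * (1 / M + β) + 4 * η * (n : ℝ) ^ 2) +
        l ^ 2 * (3 * (n : ℝ) ^ 2))) := by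
  have hm : Measurable (fun z => roundGap F η β M est ℓ z) :=
    measurable_roundGap F η β M measurable_const measurable_const measurable_id
  obtain ⟨h1, h2⟩ := integral_roundGap_sq_le (F := F) (M := M) (est := est) hη hβ hℓ hℓ1
  have hVint : Integrable (fun z => roundGap F η β M est ℓ z) (resampleLaw n) :=
    memLp_one_iff_integrable.1 (MemLp.mono_exponent
      ((memLp_two_iff_integrable_sq hm.aestronglyMeasurable).2 h1) (by norm_num))
  refine lintegral_exp_le_of_moments hVint h1 hl (Filter.Eventually.of_forall fun z => ?_)
    (integral_roundGap_le hη hβ hM hℓ hℓ1) h2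
  exact (mul_le_mul_of_nonneg_left (roundGap_le hβ hℓ hℓ1 z) hl).trans hln

end Round

/-! ### Hedge -/

lemma hedgeProb_nonneg {d : ℕ} (T : ℕ) (cost : Fin d → ℝ) (i : Fin d) :
    0 ≤ hedgeProb T cost i :=
  div_nonneg (Real.exp_pos _).le (Finset.sum_nonneg fun _ _ => (Real.exp_pos _).le)

lemma hedgeWeight_pos {d : ℕ} [NeZero d] (T : ℕ) (cost : Fin d → ℝ) :
    0 < ∑ j, Real.exp (-(hedgeRate d T * cost j)) :=
  Finset.sum_pos (fun _ _ => Real.exp_pos _) ⟨0, Finset.mem_univ _⟩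

lemma sum_hedgeProb {d : ℕ} [NeZero d] (T : ℕ) (cost : Fin d → ℝ) :
    ∑ i, hedgeProb T cost i = 1 := by
  unfold hedgeProb
  rw [← Finset.sum_div, div_self (hedgeWeight_pos T cost).ne']

lemma measurable_hedgeProb {d : ℕ} (T : ℕ) (i : Fin d) :
    Measurable fun cost : Fin d → ℝ => hedgeProb T cost i := by
  unfold hedgeProb; fun_prop

/-- The total weight as a potential: each round multiplies it at most by `exp (-r m + r ^ 2 / 2)`,
where `m` is the expected cost of the round. -/
lemma hedge_weight_le {d : ℕ} [NeZero d] (T : ℕ) (c : ℕ → Fin d → ℝ) (k : ℕ)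
    (h0 : ∀ t < k, ∀ i, 0 ≤ c t i) (h1 : ∀ t < k, ∀ i, c t i ≤ 1) :
    ∑ i, Real.exp (-(hedgeRate d T * ∑ s ∈ Finset.range k, c s i)) ≤
      d * Real.exp (-(hedgeRate d T * ∑ t ∈ Finset.range k, ∑ i,
        hedgeProb T (fun j => ∑ s ∈ Finset.range t, c s j) i * c t i) +
        hedgeRate d T ^ 2 / 2 * k) := by
  set r := hedgeRate d T with hr
  have hr0 : 0 ≤ r := Real.sqrt_nonneg _
  induction k with
  | zero => simp
  | succ k ih =>
    have ih' := ih (fun t ht => h0 t (by omega)) (fun t ht => h1 t (by omega))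
    set C : Fin d → ℝ := fun j => ∑ s ∈ Finset.range k, c s j
    set w := hedgeProb T C with hw
    set m := ∑ i, w i * c k i
    have hW := hedgeWeight_pos T C
    rw [← hr] at hW
    have hexp : ∀ y : ℝ, 0 ≤ y → Real.exp (-y) ≤ 1 - y + y ^ 2 / 2 := by
      intro y hy
      have h2 := Real.quadratic_le_exp_of_nonneg hy
      have h3 : 0 < 1 + y + y ^ 2 / 2 := by positivity
      rw [Real.exp_neg]
      refine (inv_anti₀ h3 h2).trans ?_
      rw [inv_le_iff_one_le_mul₀ h3]
      nlinarith [sq_nonneg (y ^ 2)]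
    have key : ∑ i, Real.exp (-(r * ∑ s ∈ Finset.range (k + 1), c s i)) ≤
        (∑ i, Real.exp (-(r * C i))) * Real.exp (-(r * m) + r ^ 2 / 2) := by
      have e1 : ∀ i, Real.exp (-(r * ∑ s ∈ Finset.range (k + 1), c s i)) ≤
          (∑ j, Real.exp (-(r * C j))) * (w i * (1 - r * c k i + r ^ 2 / 2)) := by
        intro i
        rw [Finset.sum_range_succ, mul_add, neg_add, Real.exp_add]
        have : (∑ j, Real.exp (-(r * C j))) * (w i * (1 - r * c k i + r ^ 2 / 2)) =
            Real.exp (-(r * C i)) * (1 - r * c k i + r ^ 2 / 2) := by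
          rw [hw, hedgeProb, ← hr, ← mul_assoc, mul_div_cancel₀ _ hW.ne']
        rw [this]
        have hc0 := h0 k (by omega) i
        have hc1 := h1 k (by omega) i
        refine mul_le_mul_of_nonneg_left ((hexp _ (mul_nonneg hr0 hc0)).trans ?_) (Real.exp_pos _).le
        have : (r * c k i) ^ 2 ≤ r ^ 2 := by
          rw [mul_pow]; exact mul_le_of_le_one_right (sq_nonneg _) (pow_le_one₀ hc0 hc1)
        linarith
      refine (Finset.sum_le_sum fun i _ => e1 i).trans ?_
      rw [← Finset.mul_sum]
      refine mul_le_mul_of_nonneg_left ?_ hW.le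
      have e2 : ∑ i, w i * (1 - r * c k i + r ^ 2 / 2) = 1 - r * m + r ^ 2 / 2 := by
        have := sum_hedgeProb T C
        rw [← hw] at this
        have e3 : ∀ i, w i * (1 - r * c k i + r ^ 2 / 2) =
            w i * (1 + r ^ 2 / 2) - r * (w i * c k i) := fun i => by ring
        simp_rw [e3]
        rw [Finset.sum_sub_distrib, ← Finset.sum_mul, this, ← Finset.mul_sum]
        ring
      rw [e2]
      linarith [Real.add_one_le_exp (-(r * m) + r ^ 2 / 2)]
    refine key.trans ((mul_le_mul_of_nonneg_right ih' (Real.exp_pos _).le).trans (le_of_eq ?_))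
    rw [Finset.sum_range_succ, mul_assoc, ← Real.exp_add]
    congr 2
    push_cast
    ring

/-- Regret of Hedge, for every prefix of the horizon. -/
lemma hedge_regret {d : ℕ} [NeZero d] {T : ℕ} (hT : 1 ≤ T) (c : ℕ → Fin d → ℝ) (k : ℕ)
    (hk : k ≤ T) (h0 : ∀ t < k, ∀ i, 0 ≤ c t i) (h1 : ∀ t < k, ∀ i, c t i ≤ 1) (j : Fin d) :
    ∑ t ∈ Finset.range k, ∑ i, hedgeProb T (fun j => ∑ s ∈ Finset.range t, c s j) i * c t i ≤
      ∑ t ∈ Finset.range k, c t j + 2 * √(T * Real.log d) := by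
  have hT' : (1 : ℝ) ≤ T := by exact_mod_cast hT
  have hk' : (k : ℝ) ≤ T := by exact_mod_cast hk
  rcases Nat.lt_or_ge 1 d with hd | hd
  · have h := hedge_weight_le T c k h0 h1
    set m := ∑ t ∈ Finset.range k, ∑ i,
      hedgeProb T (fun j => ∑ s ∈ Finset.range t, c s j) i * c t i
    set Cj := ∑ t ∈ Finset.range k, c t j
    set r := hedgeRate d T
    have hd0 : (0 : ℝ) < d := by exact_mod_cast (by omega : 0 < d)
    have hlog : 0 < Real.log d := Real.log_pos (by exact_mod_cast hd)
    have h2 : Real.exp (-(r * Cj)) ≤ d * Real.exp (-(r * m) + r ^ 2 / 2 * k) :=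
      (Finset.single_le_sum (f := fun i => Real.exp (-(r * ∑ s ∈ Finset.range k, c s i)))
        (fun _ _ => (Real.exp_pos _).le) (Finset.mem_univ j)).trans h
    rw [← Real.exp_log hd0, ← Real.exp_add, Real.exp_le_exp] at h2
    have hr2 : r ^ 2 = 8 * Real.log d / T := Real.sq_sqrt (by positivity)
    have hrpos : 0 < r := Real.sqrt_pos.2 (by positivity)
    set q := √(T * Real.log d)
    have hq2 : q ^ 2 = T * Real.log d := Real.sq_sqrt (by positivity)
    have hq0 : 0 ≤ q := Real.sqrt_nonneg _
    have hTpos : (0 : ℝ) < T := by linarith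
    have hrT : (r * T) ^ 2 = 8 * q ^ 2 := by
      rw [mul_pow, hr2, hq2]; field_simp
    have hrT0 : 0 ≤ r * T := by positivity
    have h6 : 2.5 * q ≤ r * T := by
      refine abs_le_of_sq_le_sq' (by nlinarith [sq_nonneg q]) hrT0 |>.2
    have h7 : r ^ 2 / 2 * k ≤ r ^ 2 / 2 * T := by gcongr
    have h8 : r * (m - Cj) * T ≤ q ^ 2 + (r * T) ^ 2 / 2 := by
      have : r * (m - Cj) ≤ Real.log d + r ^ 2 / 2 * T := by linarith
      have := mul_le_mul_of_nonneg_right this hTpos.le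
      rw [hq2]
      calc _ ≤ _ := this
        _ = _ := by ring
    have h9 : (r * T) * (m - Cj) ≤ (r * T) * (2 * q) := by
      calc _ = r * (m - Cj) * T := by ring
        _ ≤ q ^ 2 + (r * T) ^ 2 / 2 := h8
        _ ≤ (r * T) * (2 * q) := by nlinarith
    have h10 := le_of_mul_le_mul_left h9 (by positivity)
    linarith
  · have hd1 : d = 1 := le_antisymm hd (Nat.one_le_iff_ne_zero.2 (NeZero.ne d))
    subst hd1
    have : ∀ t, ∑ i, hedgeProb T (fun j => ∑ s ∈ Finset.range t, c s j) i * c t i = c t j := by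
      intro t
      have h := sum_hedgeProb T (fun j => ∑ s ∈ Finset.range t, c s j)
      rw [Fin.sum_univ_one] at h ⊢
      rw [h, one_mul, Subsingleton.elim j 0]
    simp_rw [this]
    simp

/-! ### Sampling by inversion -/

lemma measurable_drawIndex {α : Type*} [MeasurableSpace α] {d : ℕ} [NeZero d]
    {p : α → Fin d → ℝ} {s : α → ℝ} (hp : Measurable p) (hs : Measurable s) :
    Measurable fun a => drawIndex (p a) (s a) := by
  have h : Measurable fun a => (fun i : Fin d => decide (s a ≤ ∑ j ∈ Finset.Iic i, p a j)) := by
    refine measurable_pi_iff.2 fun i => measurable_to_bool ?_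
    have : (fun a => decide (s a ≤ ∑ j ∈ Finset.Iic i, p a j)) ⁻¹' {true} =
        {a | s a ≤ ∑ j ∈ Finset.Iic i, p a j} := by ext a; simp
    rw [this]
    exact measurableSet_le hs (by fun_prop)
  exact (measurable_of_countable fun v : Fin d → Bool =>
    ((List.finRange d).find? v).getD 0).comp h

/-- The index `i` is drawn only from seeds in the `i`-th of the consecutive intervals of lengths
`p`. -/
lemma drawIndex_mem {d : ℕ} [NeZero d] {p : Fin d → ℝ} (hsum : ∑ i, p i = 1) {s : ℝ}
    (hs0 : 0 ≤ s) (hs1 : s ≤ 1) (i : Fin d) (h : drawIndex p s = i) :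
    s ∈ Set.Icc (∑ j ∈ Finset.Iio i, p j) (∑ j ∈ Finset.Iio i, p j + p i) := by
  unfold drawIndex at h
  have hsplit : ∀ i : Fin d, ∑ j ∈ Finset.Iic i, p j = ∑ j ∈ Finset.Iio i, p j + p i := by
    intro i
    rw [← Finset.Iio_insert, Finset.sum_insert (by simp), add_comm]
  cases hf : (List.finRange d).find? (fun i => decide (s ≤ ∑ j ∈ Finset.Iic i, p j)) with
  | none =>
    exfalso
    rw [List.find?_eq_none] at hf
    have hd : 0 < d := Nat.pos_of_ne_zero (NeZero.ne d)
    have := hf ⟨d - 1, by omega⟩ (List.mem_finRange _)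
    have huniv : Finset.Iic (⟨d - 1, by omega⟩ : Fin d) = Finset.univ := by
      ext j; simp [Fin.le_def]; omega
    rw [huniv, hsum] at this
    simp at this
    linarith
  | some i' =>
    rw [hf] at h
    simp only [Option.getD_some] at h
    subst h
    rw [List.find?_eq_some_iff_getElem] at hf
    obtain ⟨h1, k, hk, hki, h2⟩ := hf
    simp only [decide_eq_true_eq] at h1
    refine ⟨?_, by rwa [hsplit] at h1⟩
    simp only [List.getElem_finRange] at hki h2
    by_cases hi : i'.1 = 0
    · have : Finset.Iio i' = ∅ := by
        ext j; simp [Fin.lt_def, hi]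
      simpa [this] using hs0
    · have hkk : i'.1 = k := by rw [← hki]; rfl
      have h3 := h2 (k - 1) (by omega)
      have h4 : Finset.Iio i' = Finset.Iic (⟨k - 1, by omega⟩ : Fin d) := by
        ext j
        rw [Finset.mem_Iio, Finset.mem_Iic, Fin.lt_def, Fin.le_def]
        change j.1 < i'.1 ↔ j.1 ≤ k - 1
        omega
      rw [h4]
      simp only [Bool.not_eq_true', decide_eq_false_iff_not, not_le] at h3
      exact h3.le

lemma integral_drawIndex_le {d : ℕ} [NeZero d] {p : Fin d → ℝ} (hp : ∀ i, 0 ≤ p i)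
    (hsum : ∑ i, p i = 1) (c : Fin d → ℝ) (hc : ∀ i, 0 ≤ c i) :
    ∫ s, c (drawIndex p s) ∂unifLaw ≤ ∑ i, p i * c i := by
  have hm : Measurable fun s => drawIndex p s := measurable_drawIndex measurable_const measurable_id
  have hms : ∀ i, MeasurableSet {s | drawIndex p s = i} := fun i => hm (measurableSet_singleton i)
  have h1 : ∀ s, c (drawIndex p s) = ∑ i, {s | drawIndex p s = i}.indicator (1 : ℝ → ℝ) s * c i := by
    intro s
    rw [Finset.sum_eq_single (drawIndex p s)]
    · simp
    · intro i _ hi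
      rw [Set.indicator_of_notMem (by simpa using hi.symm), zero_mul]
    · simp
  have hi : ∀ i, Integrable ({s | drawIndex p s = i}.indicator (1 : ℝ → ℝ)) unifLaw := fun i =>
    (integrable_const (1 : ℝ)).indicator (hms i)
  simp_rw [h1]
  rw [integral_finsetSum _ fun i _ => (hi i).mul_const _]
  refine Finset.sum_le_sum fun i _ => ?_
  rw [integral_mul_const, integral_indicator_one (hms i)]
  refine mul_le_mul_of_nonneg_right ?_ (hc i)
  rw [Measure.real, unifLaw, Measure.restrict_apply (hms i)]
  refine ENNReal.toReal_le_of_le_ofReal (hp i) ?_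
  refine (measure_mono (t := Set.Icc (∑ j ∈ Finset.Iio i, p j) (∑ j ∈ Finset.Iio i, p j + p i))
    fun s hs => drawIndex_mem hsum hs.2.1 hs.2.2 i hs.1).trans ?_
  rw [Real.volume_Icc]
  simp

lemma lintegral_exp_drawIndex_le {d : ℕ} [NeZero d] {p : Fin d → ℝ} (hp : ∀ i, 0 ≤ p i)
    (hsum : ∑ i, p i = 1) (c : Fin d → ℝ) (hc : ∀ i, 0 ≤ c i) (hc1 : ∀ i, c i ≤ 1) {l : ℝ}
    (hl : 0 ≤ l) (hl1 : l ≤ 1) :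
    ∫⁻ s, ENNReal.ofReal (Real.exp (l * (c (drawIndex p s) - ∑ i, p i * c i))) ∂unifLaw ≤
      ENNReal.ofReal (Real.exp (l ^ 2)) := by
  have hm : Measurable fun s => c (drawIndex p s) :=
    (measurable_of_countable c).comp (measurable_drawIndex measurable_const measurable_id)
  have hq0 : 0 ≤ ∑ i, p i * c i := Finset.sum_nonneg fun i _ => mul_nonneg (hp i) (hc i)
  have hq1 : ∑ i, p i * c i ≤ 1 := by
    rw [← hsum]; exact Finset.sum_le_sum fun i _ => mul_le_of_le_one_right (hp i) (hc1 i)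
  have hV : ∀ s, |c (drawIndex p s) - ∑ i, p i * c i| ≤ 1 := fun s =>
    abs_le.2 ⟨by linarith [hc (drawIndex p s)], by linarith [hc1 (drawIndex p s)]⟩
  have hi := integrable_of_abs_le (μ := unifLaw) (hm.sub_const (∑ i, p i * c i)) 1 hV
  have hV2 : ∀ s, (c (drawIndex p s) - ∑ i, p i * c i) ^ 2 ≤ 1 := fun s => by
    rw [← sq_abs]; exact pow_le_one₀ (abs_nonneg _) (hV s)
  have hi2 := integrable_of_abs_le (μ := unifLaw) ((hm.sub_const (∑ i, p i * c i)).pow_const 2) 1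
    fun s => by rw [abs_of_nonneg (sq_nonneg _)]; exact hV2 s
  have h := lintegral_exp_le_of_moments hi hi2 (m := 0) (q := 1) hl
    (Filter.Eventually.of_forall fun s => ?_) ?_ ?_
  · simpa using h
  · nlinarith [(abs_le.1 (hV s)).2]
  · have hci : Integrable (fun s => c (drawIndex p s)) unifLaw :=
      integrable_of_abs_le hm 1 fun s => abs_le.2 ⟨by linarith [hc (drawIndex p s)], hc1 _⟩
    rw [integral_sub hci (integrable_const _)]
    have := integral_drawIndex_le hp hsum c hc
    simp only [integral_const, probReal_univ, smul_eq_mul, one_mul]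
    linarith
  · refine (integral_mono hi2 (integrable_const 1) hV2).trans ?_
    simp

/-! ### The run of the algorithm as a random process -/

instance (n : ℕ) : IsProbabilityMeasure (roundSeedLaw n) := by
  unfold roundSeedLaw; infer_instance

instance (n : ℕ) : IsProbabilityMeasure (seedLaw n) := by
  unfold seedLaw; infer_instance

instance {n d : ℕ} (D : Measure (Outcome n d)) [IsProbabilityMeasure D] :
    IsProbabilityMeasure (outcomeLaw D) := by
  unfold outcomeLaw; infer_instance

lemma roundSeedLaw_eq (n : ℕ) : roundSeedLaw n = (resampleLaw n).prod unifLaw := rfl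

section Measurability

variable {n d : ℕ} {α : Type*} [MeasurableSpace α]

lemma measurable_comp_countable {β γ : Type*} [MeasurableSpace β]
    [MeasurableSpace γ] [Countable β] [MeasurableSingletonClass β] {f : β → α → γ}
    (hf : ∀ b, Measurable (f b)) {g : α → β} (hg : Measurable g) : Measurable fun a => f (g a) a :=
  (measurable_from_prod_countable_left (f := fun p : α × β => f p.2 p.1) hf).comp
    (measurable_id.prodMk hg)

lemma measurable_actionReward {o : α → Outcome n d} {A : α → Finset (Fin n)} (ho : Measurable o)
    (hA : Measurable A) : Measurable fun a => actionReward (o a) (A a) :=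
  measurable_comp_countable (f := fun S a => actionReward (o a) S)
    (fun S => by unfold actionReward; fun_prop) hA

lemma measurable_actionCost (base : Fin d → ℝ) {o : α → Outcome n d} {A : α → Finset (Fin n)}
    (ho : Measurable o) (hA : Measurable A) (i : Fin d) :
    Measurable fun a => actionCost base (o a) (A a) i :=
  measurable_comp_countable (f := fun S a => actionCost base (o a) S i)
    (fun S => by unfold actionCost; fun_prop) hA

lemma measurable_actionCost_resource (base : Fin d → ℝ) {o : α → Outcome n d}
    {A : α → Finset (Fin n)} {i : α → Fin d}
    (ho : Measurable o) (hA : Measurable A) (hi : Measurable i) :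
    Measurable fun a => actionCost base (o a) (A a) (i a) :=
  measurable_comp_countable (f := fun i a => actionCost base (o a) (A a) i)
    (fun i => measurable_actionCost base ho hA i) hi

lemma measurable_coordLoss {ρ : α → ℝ} {o : α → Outcome n d} {i : α → Fin d} (hρ : Measurable ρ)
    (ho : Measurable o) (hi : Measurable i) :
    Measurable fun a => coordLoss (ρ a) (o a) (i a) := by
  refine measurable_pi_iff.2 fun e => measurable_pi_iff.2 fun b => ?_
  refine measurable_comp_countable (f := fun i a => coordLoss (ρ a) (o a) i e b) (fun i => ?_) hi
  unfold coordLoss atomPayoff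
  cases b <;> simp <;> fun_prop

lemma measurable_dualCost {ρ : α → ℝ} (base : Fin d → ℝ) {o : α → Outcome n d}
    {A : α → Finset (Fin n)} (hρ : Measurable ρ) (ho : Measurable o) (hA : Measurable A)
    (i : Fin d) : Measurable fun a => dualCost (ρ a) base (o a) (A a) i := by
  have h1 := measurable_actionReward ho hA
  have h2 := measurable_actionCost base ho hA i
  unfold dualCost lagrangian
  fun_prop

lemma measurable_totalReward (T : ℕ) (B : ℝ) (base : Fin d → ℝ)
    {o : α → ℕ → Outcome n d} {A : α → ℕ → Finset (Fin n)} (ho : Measurable o)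
    (hA : ∀ t, Measurable fun a => A a t) : Measurable fun a => totalReward T B base (o a) (A a) := by
  have hot : ∀ t, Measurable fun a => o a t := fun t => (measurable_pi_apply t).comp ho
  unfold totalReward
  refine Finset.measurable_sum _ fun t _ => Measurable.ite ?_
    (measurable_actionReward (hot t) (hA t)) measurable_const
  rw [Set.ofPred_forall]
  exact MeasurableSet.iInter fun i => measurableSet_le
    (Finset.measurable_sum _ fun s _ => measurable_actionCost base (hot s) (hA s) i) measurable_const

end Measurability

section Run

variable {n d : ℕ} [NeZero d]

/-- The action played by the algorithm in round `t`. -/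
def runAction (T : ℕ) (F : Finset (Finset (Fin n))) (ρ : ℝ) (base : Fin d → ℝ)
    (o : ℕ → Outcome n d) (ω : ℕ → RoundSeed n) (t : ℕ) : Finset (Fin n) :=
  (state T F ρ base o ω t).action T F (ω t)

/-- The resource chosen by the dual algorithm in round `t`. -/
def runResource (T : ℕ) (F : Finset (Finset (Fin n))) (ρ : ℝ) (base : Fin d → ℝ)
    (o : ℕ → Outcome n d) (ω : ℕ → RoundSeed n) (t : ℕ) : Fin d :=
  (state T F ρ base o ω t).resource T (ω t)

/-- Losses of the coordinates in round `t`. -/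
def runLoss (T : ℕ) (F : Finset (Finset (Fin n))) (ρ : ℝ) (base : Fin d → ℝ)
    (o : ℕ → Outcome n d) (ω : ℕ → RoundSeed n) (t : ℕ) : Fin n → Bool → ℝ :=
  coordLoss ρ (o t) (runResource T F ρ base o ω t)

/-- Loss estimates of round `t`. -/
def runEst (T : ℕ) (F : Finset (Finset (Fin n))) (ρ : ℝ) (base : Fin d → ℝ)
    (o : ℕ → Outcome n d) (ω : ℕ → RoundSeed n) (t : ℕ) : Fin n → Bool → ℝ :=
  lossEst F (fplRate n T) (fplBias n T) (fplCap n T) (state T F ρ base o ω t).est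
    (runLoss T F ρ base o ω t) (ω t).1

lemma state_succ_est (T : ℕ) (F : Finset (Finset (Fin n))) (ρ : ℝ) (base : Fin d → ℝ)
    (o : ℕ → Outcome n d) (ω : ℕ → RoundSeed n) (t : ℕ) :
    (state T F ρ base o ω (t + 1)).est =
      fun e b => (state T F ρ base o ω t).est e b + runEst T F ρ base o ω t e b := rfl

lemma state_succ_cost (T : ℕ) (F : Finset (Finset (Fin n))) (ρ : ℝ) (base : Fin d → ℝ)
    (o : ℕ → Outcome n d) (ω : ℕ → RoundSeed n) (t : ℕ) :
    (state T F ρ base o ω (t + 1)).cost =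
      fun i => (state T F ρ base o ω t).cost i +
        dualCost ρ base (o t) (runAction T F ρ base o ω t) i := rfl

lemma state_est_eq_sum (T : ℕ) (F : Finset (Finset (Fin n))) (ρ : ℝ) (base : Fin d → ℝ)
    (o : ℕ → Outcome n d) (ω : ℕ → RoundSeed n) (t : ℕ) (e : Fin n) (b : Bool) :
    (state T F ρ base o ω t).est e b = ∑ s ∈ Finset.range t, runEst T F ρ base o ω s e b := by
  induction t with
  | zero => rfl
  | succ t ih => rw [Finset.sum_range_succ, ← ih, state_succ_est]

lemma state_cost_eq_sum (T : ℕ) (F : Finset (Finset (Fin n))) (ρ : ℝ) (base : Fin d → ℝ)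
    (o : ℕ → Outcome n d) (ω : ℕ → RoundSeed n) (t : ℕ) :
    (state T F ρ base o ω t).cost =
      fun i => ∑ s ∈ Finset.range t, dualCost ρ base (o s) (runAction T F ρ base o ω s) i := by
  induction t with
  | zero => rfl
  | succ t ih =>
    rw [state_succ_cost, ih]
    funext i
    rw [Finset.sum_range_succ]

lemma state_congr (T : ℕ) (F : Finset (Finset (Fin n))) (ρ : ℝ) (base : Fin d → ℝ)
    {o o' : ℕ → Outcome n d} {ω ω' : ℕ → RoundSeed n} (t : ℕ) (ho : ∀ s < t, o s = o' s)
    (hω : ∀ s < t, ω s = ω' s) : state T F ρ base o ω t = state T F ρ base o' ω' t := by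
  induction t with
  | zero => rfl
  | succ t ih =>
    have := ih (fun s hs => ho s (by omega)) (fun s hs => hω s (by omega))
    simp only [state]
    rw [this, ho t (by omega), hω t (by omega)]

lemma state_update_seed (T : ℕ) (F : Finset (Finset (Fin n))) (ρ : ℝ) (base : Fin d → ℝ)
    (o : ℕ → Outcome n d) (ω : ℕ → RoundSeed n) (t k : ℕ) (h : t ≤ k) (w : RoundSeed n) :
    state T F ρ base o (Function.update ω k w) t = state T F ρ base o ω t :=
  state_congr T F ρ base t (fun _ _ => rfl) fun s hs => Function.update_of_ne (by omega) _ _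

lemma state_update_outcome (T : ℕ) (F : Finset (Finset (Fin n))) (ρ : ℝ) (base : Fin d → ℝ)
    (o : ℕ → Outcome n d) (ω : ℕ → RoundSeed n) (t k : ℕ) (h : t ≤ k) (w : Outcome n d) :
    state T F ρ base (Function.update o k w) ω t = state T F ρ base o ω t :=
  state_congr T F ρ base t (fun s hs => Function.update_of_ne (by omega) _ _) fun _ _ => rfl

variable {α : Type*} [MeasurableSpace α]

/-- The run is measurable in all the data, including the parameter `ρ`. -/
lemma measurable_state (T : ℕ) (F : Finset (Finset (Fin n))) {ρ : α → ℝ} (base : Fin d → ℝ)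
    {o : α → ℕ → Outcome n d} {ω : α → ℕ → RoundSeed n} (hρ : Measurable ρ) (ho : Measurable o)
    (hω : Measurable ω) (t : ℕ) :
    Measurable (fun a => (state T F (ρ a) base (o a) (ω a) t).est) ∧
      Measurable (fun a => (state T F (ρ a) base (o a) (ω a) t).cost) ∧
      Measurable (fun a => runAction T F (ρ a) base (o a) (ω a) t) ∧
      Measurable (fun a => runResource T F (ρ a) base (o a) (ω a) t) := by
  have hωt : ∀ t, Measurable fun a => ω a t := fun t => (measurable_pi_apply t).comp hω
  have hot : ∀ t, Measurable fun a => o a t := fun t => (measurable_pi_apply t).comp ho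
  have step : ∀ t, Measurable (fun a => (state T F (ρ a) base (o a) (ω a) t).est) →
      Measurable (fun a => (state T F (ρ a) base (o a) (ω a) t).cost) →
      Measurable (fun a => runAction T F (ρ a) base (o a) (ω a) t) ∧
      Measurable (fun a => runResource T F (ρ a) base (o a) (ω a) t) := by
    intro t he hc
    refine ⟨measurable_fplSelect F _ he ((measurable_pi_apply 0).comp
      (measurable_fst.comp (hωt t))), measurable_drawIndex ?_ (measurable_snd.comp (hωt t))⟩
    exact measurable_pi_iff.2 fun i => (measurable_hedgeProb T i).comp hc
  induction t with
  | zero =>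
    have h1 : Measurable (fun a => (state T F (ρ a) base (o a) (ω a) 0).est) := measurable_const
    have h2 : Measurable (fun a => (state T F (ρ a) base (o a) (ω a) 0).cost) := measurable_const
    exact ⟨h1, h2, step 0 h1 h2⟩
  | succ t ih =>
    obtain ⟨h1, h2, h3, h4⟩ := ih
    have h5 : Measurable (fun a => (state T F (ρ a) base (o a) (ω a) (t + 1)).est) := by
      simp only [state_succ_est]
      refine measurable_pi_iff.2 fun e => measurable_pi_iff.2 fun b => ?_
      have h6 := measurable_lossEst F (fplRate n T) (fplBias n T) (fplCap n T) h1
        (measurable_coordLoss hρ (hot t) h4) (measurable_fst.comp (hωt t)) e b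
      exact (by fun_prop : Measurable fun a => (state T F (ρ a) base (o a) (ω a) t).est e b).add h6
    have h6 : Measurable (fun a => (state T F (ρ a) base (o a) (ω a) (t + 1)).cost) := by
      simp only [state_succ_cost]
      refine measurable_pi_iff.2 fun i => ?_
      have := measurable_dualCost base hρ (hot t) h3 i
      exact (by fun_prop : Measurable fun a => (state T F (ρ a) base (o a) (ω a) t).cost i).add this
    exact ⟨h5, h6, step (t + 1) h5 h6⟩

lemma lagrangeReward_eq (T : ℕ) (B : ℝ) (F : Finset (Finset (Fin n))) (T₀ : ℝ)
    (base : Fin d → ℝ) (o : ℕ → Outcome n d) (ω : ℕ → RoundSeed n) :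
    lagrangeReward T B F T₀ base o ω = totalReward T B base o (runAction T F (T₀ / B) base o ω) :=
  rfl

end Run

/-! ### Total reward and stopping -/

section Stopping

variable {n d : ℕ}

lemma actionReward_nonneg {o : Outcome n d} (ho : IsOutcome o) (S : Finset (Fin n)) :
    0 ≤ actionReward o S := Finset.sum_nonneg fun e _ => (ho e 0).1

lemma sum_outcome_le_one {o : Outcome n d} (ho : IsOutcome o) (S : Finset (Fin n))
    (j : Fin (d + 1)) : ∑ e ∈ S, o e j ≤ S.card / n := by
  calc ∑ e ∈ S, o e j ≤ ∑ e ∈ S, 1 / (n : ℝ) := Finset.sum_le_sum fun e _ => (ho e j).2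
    _ = S.card / n := by rw [Finset.sum_const, nsmul_eq_mul]; ring

lemma card_div_le_one (hn : 1 ≤ n) (S : Finset (Fin n)) : (S.card : ℝ) / n ≤ 1 := by
  have : S.card ≤ n := by simpa using Finset.card_le_univ S
  rw [div_le_one (by exact_mod_cast hn)]
  exact_mod_cast this

lemma actionReward_le_one (hn : 1 ≤ n) {o : Outcome n d} (ho : IsOutcome o) (S : Finset (Fin n)) :
    actionReward o S ≤ 1 := (sum_outcome_le_one ho S 0).trans (card_div_le_one hn S)

/-- The play stops at some round `τ`, after which a budget is exceeded unless `τ = T`. -/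
lemma exists_stopping (T : ℕ) (B : ℝ) (base : Fin d → ℝ) (o : ℕ → Outcome n d)
    (a : ℕ → Finset (Fin n)) (hc : ∀ t < T, ∀ i, 0 ≤ actionCost base (o t) (a t) i) :
    ∃ τ ≤ T, totalReward T B base o a = ∑ t ∈ Finset.range τ, actionReward (o t) (a t) ∧
      (∀ t < τ, ∀ i, ∑ s ∈ Finset.range t, actionCost base (o s) (a s) i ≤ B) ∧
      (τ = T ∨ ∃ i, B < ∑ s ∈ Finset.range τ, actionCost base (o s) (a s) i) := by
  classical
  by_cases h : ∃ k, k < T ∧ ∃ i, B < ∑ s ∈ Finset.range k, actionCost base (o s) (a s) i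
  · set τ := Nat.find h with hτ
    obtain ⟨h1, i, h2⟩ := Nat.find_spec h
    have h3 : ∀ t < τ, ∀ i, ∑ s ∈ Finset.range t, actionCost base (o s) (a s) i ≤ B := by
      intro t ht i
      by_contra hc
      push Not at hc
      exact Nat.find_min h ht ⟨by omega, i, hc⟩
    refine ⟨τ, h1.le, ?_, h3, Or.inr ⟨i, h2⟩⟩
    unfold totalReward
    rw [← Finset.sum_subset (Finset.range_mono h1.le)]
    · exact Finset.sum_congr rfl fun t ht => if_pos (h3 t (Finset.mem_range.1 ht))
    · intro t ht ht'
      rw [if_neg]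
      push Not
      refine ⟨i, lt_of_lt_of_le h2 (Finset.sum_le_sum_of_subset_of_nonneg
        (Finset.range_mono (by simpa using ht')) fun s hs _ => hc s ?_ i)⟩
      have := Finset.mem_range.1 hs
      have := Finset.mem_range.1 ht
      omega
  · push Not at h
    refine ⟨T, le_rfl, ?_, h, Or.inl rfl⟩
    exact Finset.sum_congr rfl fun t ht => if_pos (h t (Finset.mem_range.1 ht))

lemma totalReward_nonneg (T : ℕ) (B : ℝ) (base : Fin d → ℝ) {o : ℕ → Outcome n d}
    (ho : ∀ t < T, IsOutcome (o t)) (a : ℕ → Finset (Fin n)) : 0 ≤ totalReward T B base o a :=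
  Finset.sum_nonneg fun t ht => by
    split_ifs
    · exact actionReward_nonneg (ho t (Finset.mem_range.1 ht)) _
    · exact le_rfl

lemma totalReward_le (hn : 1 ≤ n) (T : ℕ) (B : ℝ) (base : Fin d → ℝ) {o : ℕ → Outcome n d}
    (ho : ∀ t < T, IsOutcome (o t)) (a : ℕ → Finset (Fin n)) : totalReward T B base o a ≤ T := by
  calc totalReward T B base o a ≤ ∑ t ∈ Finset.range T, (1 : ℝ) := by
        refine Finset.sum_le_sum fun t ht => ?_
        split_ifs
        · exact actionReward_le_one hn (ho t (Finset.mem_range.1 ht)) _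
        · exact zero_le_one
    _ = T := by simp

end Stopping

/-! ### Regret of a run against fixed actions and resources -/

lemma logFactor_pos {n T : ℕ} (hn : 1 ≤ n) (hT : 1 ≤ T) : 0 < logFactor n T := by
  unfold logFactor
  have h1 : (1 : ℝ) ≤ n := by exact_mod_cast hn
  have h2 : (1 : ℝ) ≤ T := by exact_mod_cast hT
  exact Real.log_pos (by nlinarith)

lemma coordLoss_mem {n d : ℕ} (hn : 1 ≤ n) {ρ : ℝ} (hρ : 0 ≤ ρ) {o : Outcome n d}
    (ho : IsOutcome o) (i : Fin d) (e : Fin n) (b : Bool) :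
    0 ≤ coordLoss ρ o i e b ∧ coordLoss ρ o i e b ≤ 1 := by
  have hn' : (0 : ℝ) < n := by exact_mod_cast hn
  have h1 := ho e 0
  have h2 := ho e i.succ
  have key : ∀ x : ℝ, 0 ≤ x → x ≤ 1 / n → 0 ≤ n * x ∧ n * x ≤ 1 := by
    intro x hx hx1
    refine ⟨by positivity, ?_⟩
    rw [le_div_iff₀ hn'] at hx1
    linarith
  obtain ⟨a1, a2⟩ := key _ h1.1 h1.2
  obtain ⟨b1, b2⟩ := key _ h2.1 h2.2
  have b3 : 0 ≤ ρ * (n * o e i.succ) := mul_nonneg hρ b1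
  have b4 : ρ * (n * o e i.succ) ≤ ρ := mul_le_of_le_one_right hρ b2
  unfold coordLoss atomPayoff
  rw [le_div_iff₀ (by linarith), div_le_iff₀ (by linarith)]
  cases b
  · simp; exact hρ
  · simp only [if_true]
    constructor <;> nlinarith

/-- The loss of an encoded action is an affine function of its Lagrangian payoff, the same for all
actions. -/
lemma sum_coordLoss {n d : ℕ} {ρ : ℝ} (o : Outcome n d) (base : Fin d → ℝ)
    (i : Fin d) (S : Finset (Fin n)) :
    ∑ e, coordLoss ρ o i e (decide (e ∈ S)) =
      n * (1 - (actionReward o S - ρ * actionCost base o S i) - ρ * base i) / (1 + ρ) := by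
  unfold coordLoss
  rw [← Finset.sum_div]
  congr 1
  rw [Finset.sum_sub_distrib, ← Finset.mul_sum]
  have : ∑ e, (if decide (e ∈ S) = true then atomPayoff ρ o i e else 0) =
      actionReward o S - ρ * ∑ e ∈ S, o e i.succ := by
    simp only [decide_eq_true_eq, Finset.sum_ite_mem, Finset.univ_inter]
    unfold atomPayoff actionReward
    rw [Finset.sum_sub_distrib, Finset.mul_sum]
  rw [this]
  unfold actionCost
  simp only [Finset.sum_const, Finset.card_univ, Fintype.card_fin, nsmul_eq_mul]
  ring

lemma dualCost_eq {n d : ℕ} {ρ : ℝ} {base : Fin d → ℝ} (o : Outcome n d) (S : Finset (Fin n)) (i : Fin d) :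
    dualCost ρ base o S i = (actionReward o S - ρ * actionCost base o S i + ρ) / (1 + ρ) := by
  unfold dualCost lagrangian
  congr 1; ring

lemma dualCost_mem {n d : ℕ} {ρ : ℝ} {base : Fin d → ℝ} (hn : 1 ≤ n) (hρ : 0 ≤ ρ) {o : Outcome n d} (ho : IsOutcome o)
    {S : Finset (Fin n)} {i : Fin d} (h0 : 0 ≤ actionCost base o S i)
    (h1 : actionCost base o S i ≤ 1) :
    0 ≤ dualCost ρ base o S i ∧ dualCost ρ base o S i ≤ 1 := by
  rw [dualCost_eq, le_div_iff₀ (by linarith), div_le_iff₀ (by linarith)]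
  have a1 := actionReward_nonneg ho S
  have a2 := actionReward_le_one hn ho S
  constructor <;> nlinarith [mul_nonneg hρ h0, mul_le_of_le_one_right hρ h1]

/-- Regret bound for the first `k` rounds. Only the last term grows with `k`. -/
def runErr (ρ : ℝ) (n d T k : ℕ) : ℝ :=
  (1 + ρ) * (2 * √(2 * n * T / logFactor n T) + 12 * √(T * logFactor n T) +
    2 * √(T * Real.log d) + k * (12 * √(n * logFactor n T / T)))

/-- A run in which both algorithms have small regret, on all prefixes, against all fixed actions
and resources. -/
def GoodRun {n d : ℕ} [NeZero d] (T : ℕ) (F : Finset (Finset (Fin n))) (ρ : ℝ) (base : Fin d → ℝ)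
    (o : ℕ → Outcome n d) (ω : ℕ → RoundSeed n) : Prop :=
  ∀ k ≤ T, ∀ S ∈ F, ∀ i,
    ∑ t ∈ Finset.range k, (actionReward (o t) S -
        ρ * actionCost base (o t) S (runResource T F ρ base o ω t)) - runErr ρ n d T k ≤
      ∑ t ∈ Finset.range k, (actionReward (o t) (runAction T F ρ base o ω t) -
        ρ * actionCost base (o t) (runAction T F ρ base o ω t) i)

section Tuning

variable {n T : ℕ}

lemma fplRate_pos (hn : 1 ≤ n) (hT : 1 ≤ T) : 0 < fplRate n T := by
  have h := logFactor_pos hn hT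
  exact Real.sqrt_pos.2 (by positivity)

lemma fplBias_pos (hn : 1 ≤ n) (hT : 1 ≤ T) : 0 < fplBias n T := by
  have h := logFactor_pos hn hT
  exact Real.sqrt_pos.2 (by positivity)

lemma one_le_fplCap (hn : 1 ≤ n) (hT : 1 ≤ T) : 1 ≤ fplCap n T := by
  have h := logFactor_pos hn hT
  exact Nat.one_le_iff_ne_zero.2 (Nat.ceil_pos.2 (Real.sqrt_pos.2 (by positivity))).ne'

/-- The tuning makes the sum of all error terms of the primal algorithm small. -/
lemma tuning_bound (hn : 1 ≤ n) (hT : 1 ≤ T) (k : ℕ) :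
    2 / fplRate n T + 3 * logFactor n T / fplBias n T +
      k * (2 * (1 / (fplCap n T : ℝ) + fplBias n T) + 4 * fplRate n T * n +
        3 * √(logFactor n T / T)) + 3 * √(T * logFactor n T) +
      (k * √(logFactor n T / T) + 3 * √(T * logFactor n T)) ≤
    2 * √(2 * n * T / logFactor n T) + 12 * √(T * logFactor n T) +
      k * (12 * √(n * logFactor n T / T)) := by
  have hΛ := logFactor_pos hn hT
  have h1 : (1 : ℝ) ≤ n := by exact_mod_cast hn
  have h2 : (1 : ℝ) ≤ T := by exact_mod_cast hT
  set Λ := logFactor n T with hΛd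
  have e1 : 2 / fplRate n T = 2 * √(2 * n * T / Λ) := by
    unfold fplRate
    rw [div_eq_mul_inv, ← Real.sqrt_inv, inv_div]
  have hs2 : √2 ≤ 3 / 2 := by
    rw [Real.sqrt_le_left (by norm_num)]; norm_num
  have e2 : 3 * Λ / fplBias n T ≤ 9 / 2 * √(T * Λ) := by
    unfold fplBias
    have hb : 0 < √(Λ / (2 * T)) := Real.sqrt_pos.2 (by positivity)
    rw [← hΛd, div_le_iff₀ hb, mul_assoc, ← Real.sqrt_mul (by positivity)]
    have : T * Λ * (Λ / (2 * T)) = Λ ^ 2 / 2 := by field_simp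
    rw [this, Real.sqrt_div (by positivity), Real.sqrt_sq hΛ.le, ← mul_div_assoc,
      le_div_iff₀ (by positivity)]
    nlinarith
  set g := √(n * Λ / T) with hg
  have hg0 : 0 ≤ g := Real.sqrt_nonneg _
  have e3 : 1 / (fplCap n T : ℝ) ≤ g := by
    have h3 : √(T / (n * Λ)) ≤ fplCap n T := by
      refine le_trans (Real.sqrt_le_sqrt ?_) (Nat.le_ceil _)
      rw [← hΛd]
      gcongr
      linarith
    have h4 : 0 < √(T / (n * Λ)) := Real.sqrt_pos.2 (by positivity)
    calc 1 / (fplCap n T : ℝ) ≤ 1 / √(T / (n * Λ)) := one_div_le_one_div_of_le h4 h3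
      _ = g := by rw [one_div, ← Real.sqrt_inv, inv_div]
  have e4 : √(Λ / T) ≤ g := by
    refine Real.sqrt_le_sqrt ?_
    gcongr
    nlinarith
  have e5 : fplBias n T ≤ 3 / 4 * g := by
    rw [hg]
    unfold fplBias
    rw [← hΛd, Real.sqrt_le_left (by positivity), mul_pow, Real.sq_sqrt (by positivity),
      div_le_iff₀ (by positivity)]
    have : (3 / 4) ^ 2 * (n * Λ / T) * (2 * T) = 9 / 8 * (n * Λ) := by field_simp; ring
    rw [this]; nlinarith
  have e6 : fplRate n T * n ≤ 3 / 4 * g := by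
    rw [hg]
    unfold fplRate
    rw [← hΛd, ← Real.sqrt_sq (show (0 : ℝ) ≤ n by linarith), ← Real.sqrt_mul (by positivity),
      Real.sqrt_sq (show (0 : ℝ) ≤ n by linarith),
      Real.sqrt_le_left (by positivity), mul_pow, Real.sq_sqrt (by positivity)]
    have : Λ / (2 * n * T) * (n : ℝ) ^ 2 = 1 / 2 * (n * Λ / T) := by field_simp
    rw [this]
    have : 0 ≤ n * Λ / T := by positivity
    nlinarith
  have hk : (0 : ℝ) ≤ k := Nat.cast_nonneg _
  have e7 : (k : ℝ) * (2 * (1 / (fplCap n T : ℝ) + fplBias n T) + 4 * fplRate n T * n +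
        3 * √(Λ / T)) + k * √(Λ / T) ≤ k * (12 * g) := by
    rw [← mul_add]
    refine mul_le_mul_of_nonneg_left ?_ hk
    linarith
  have e8 : 0 ≤ √(T * Λ) := Real.sqrt_nonneg _
  rw [e1]
  linarith

end Tuning

section GoodRunProof

variable {n d : ℕ} [NeZero d] {T : ℕ} {F : Finset (Finset (Fin n))} {ρ : ℝ} {base : Fin d → ℝ}
  {o : ℕ → Outcome n d}

/-- Deviation of the primal algorithm in round `t`. -/
def runGap (T : ℕ) (F : Finset (Finset (Fin n))) (ρ : ℝ) (base : Fin d → ℝ)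
    (o : ℕ → Outcome n d) (ω : ℕ → RoundSeed n) (t : ℕ) : ℝ :=
  roundGap F (fplRate n T) (fplBias n T) (fplCap n T) (state T F ρ base o ω t).est
    (runLoss T F ρ base o ω t) (ω t).1

/-- Deviation of the dual algorithm in round `t`: cost of the chosen resource minus its expectation
under the Hedge distribution. -/
def runDualGap (T : ℕ) (F : Finset (Finset (Fin n))) (ρ : ℝ) (base : Fin d → ℝ)
    (o : ℕ → Outcome n d) (ω : ℕ → RoundSeed n) (t : ℕ) : ℝ :=
  dualCost ρ base (o t) (runAction T F ρ base o ω t) (runResource T F ρ base o ω t) -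
    ∑ i, hedgeProb T (state T F ρ base o ω t).cost i *
      dualCost ρ base (o t) (runAction T F ρ base o ω t) i

/-- Both regret bounds combined, from bounds on the three kinds of deviations. -/
lemma regret_of_deviations (hn : 1 ≤ n) (hT : 1 ≤ T) (hρ : 0 ≤ ρ) (ho : ∀ t < T, IsOutcome (o t))
    (hcost : ∀ t < T, ∀ S ∈ F, ∀ i, 0 ≤ actionCost base (o t) S i ∧ actionCost base (o t) S i ≤ 1)
    (ω : ℕ → RoundSeed n) (k : ℕ) (hk : k ≤ T)
    (h1 : ∑ t ∈ Finset.range k, runGap T F ρ base o ω t ≤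
      k * (2 * n * (1 / (fplCap n T : ℝ) + fplBias n T) + 4 * fplRate n T * (n : ℝ) ^ 2 +
        3 * n * √(logFactor n T / T)) + 3 * n * √(T * logFactor n T))
    (h2 : ∀ x : Fin n × Bool, ∑ t ∈ Finset.range k, (runEst T F ρ base o ω t x.1 x.2 -
      runLoss T F ρ base o ω t x.1 x.2) ≤ 3 * logFactor n T / fplBias n T)
    (h3 : ∑ t ∈ Finset.range k, runDualGap T F ρ base o ω t ≤
      k * √(logFactor n T / T) + 3 * √(T * logFactor n T))
    {S : Finset (Fin n)} (hS : S ∈ F) (i : Fin d) :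
    ∑ t ∈ Finset.range k, (actionReward (o t) S -
        ρ * actionCost base (o t) S (runResource T F ρ base o ω t)) - runErr ρ n d T k ≤
      ∑ t ∈ Finset.range k, (actionReward (o t) (runAction T F ρ base o ω t) -
        ρ * actionCost base (o t) (runAction T F ρ base o ω t) i) := by
  have hF : F.Nonempty := ⟨S, hS⟩
  have hη := fplRate_pos hn hT
  have hβ := fplBias_pos hn hT
  have hn' : (0 : ℝ) < n := by exact_mod_cast hn
  have hA : ∀ t, runAction T F ρ base o ω t ∈ F := fun t => fplSelect_mem hF _ _ _
  set A := runAction T F ρ base o ω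
  set I := runResource T F ρ base o ω
  have hP := fpl_regret (F := F) hη (fun t => (state T F ρ base o ω t).est)
    (runEst T F ρ base o ω) k (fun t ht e b => lossEst_nonneg hβ (fun e b =>
      (coordLoss_mem hn hρ (ho t (lt_of_lt_of_le ht hk)) _ e b).1) _ e b) rfl
    (fun t => state_succ_est T F ρ base o ω t) hS
  have hP2 : ∑ e, (state T F ρ base o ω k).est e (decide (e ∈ S)) ≤
      ∑ t ∈ Finset.range k, ∑ e, runLoss T F ρ base o ω t e (decide (e ∈ S)) +
        n * (3 * logFactor n T / fplBias n T) := by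
    rw [Finset.sum_comm]
    calc _ ≤ ∑ e : Fin n, (∑ t ∈ Finset.range k, runLoss T F ρ base o ω t e (decide (e ∈ S)) +
          3 * logFactor n T / fplBias n T) := by
          refine Finset.sum_le_sum fun e _ => ?_
          rw [state_est_eq_sum]
          have := h2 (e, decide (e ∈ S))
          rw [Finset.sum_sub_distrib] at this
          simp only at this
          linarith
      _ = _ := by rw [Finset.sum_add_distrib]; simp
  have hP3 : ∑ t ∈ Finset.range k, runGap T F ρ base o ω t =
      ∑ t ∈ Finset.range k, ∑ e, runLoss T F ρ base o ω t e (decide (e ∈ A t)) -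
      ∑ t ∈ Finset.range k, Real.exp (-(fplRate n T * ∑ y : Fin n × Bool,
        runEst T F ρ base o ω t y.1 y.2)) * ∑ x : Fin n × Bool,
          coordProb F (fplRate n T) (state T F ρ base o ω t).est x *
            runEst T F ρ base o ω t x.1 x.2 := by
    rw [← Finset.sum_sub_distrib]; rfl
  have hloss : ∀ S : Finset (Fin n), ∑ t ∈ Finset.range k, ∑ e, runLoss T F ρ base o ω t e (decide (e ∈ S)) =
      n / (1 + ρ) * ∑ t ∈ Finset.range k, (1 - (actionReward (o t) S -
        ρ * actionCost base (o t) S (I t)) - ρ * base (I t)) := by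
    intro S
    rw [Finset.mul_sum]
    refine Finset.sum_congr rfl fun t _ => ?_
    unfold runLoss
    rw [sum_coordLoss (o t) base]
    ring
  have hlossA : ∑ t ∈ Finset.range k, ∑ e, runLoss T F ρ base o ω t e (decide (e ∈ A t)) =
      n / (1 + ρ) * ∑ t ∈ Finset.range k, (1 - (actionReward (o t) (A t) -
        ρ * actionCost base (o t) (A t) (I t)) - ρ * base (I t)) := by
    rw [Finset.mul_sum]
    refine Finset.sum_congr rfl fun t _ => ?_
    unfold runLoss
    rw [sum_coordLoss (o t) base]
    ring
  rw [hloss S] at hP2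
  rw [hlossA] at hP3
  have hsplit : ∀ f : ℕ → ℝ, ∑ t ∈ Finset.range k, (1 - f t - ρ * base (I t)) =
      ∑ t ∈ Finset.range k, (1 - ρ * base (I t)) - ∑ t ∈ Finset.range k, f t := by
    intro f; rw [← Finset.sum_sub_distrib]; exact Finset.sum_congr rfl fun t _ => by ring
  rw [hsplit] at hP2 hP3
  set U := ∑ t ∈ Finset.range k, (1 - ρ * base (I t))
  set PS := ∑ t ∈ Finset.range k, (actionReward (o t) S - ρ * actionCost base (o t) S (I t))
  set PA := ∑ t ∈ Finset.range k, (actionReward (o t) (A t) - ρ * actionCost base (o t) (A t) (I t))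
  have hprimal : PS - PA ≤ (1 + ρ) * (2 / fplRate n T + 3 * logFactor n T / fplBias n T +
      k * (2 * (1 / (fplCap n T : ℝ) + fplBias n T) + 4 * fplRate n T * n +
        3 * √(logFactor n T / T)) + 3 * √(T * logFactor n T)) := by
    have h4 : n / (1 + ρ) * (PS - PA) ≤ n * (2 / fplRate n T + 3 * logFactor n T / fplBias n T +
      k * (2 * (1 / (fplCap n T : ℝ) + fplBias n T) + 4 * fplRate n T * n +
        3 * √(logFactor n T / T)) + 3 * √(T * logFactor n T)) := by
      have : 2 * (n : ℝ) / fplRate n T = n * (2 / fplRate n T) := by ring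
      rw [this] at hP
      nlinarith
    rw [div_mul_eq_mul_div, div_le_iff₀ (by linarith)] at h4
    refine le_of_mul_le_mul_left (h4.trans (le_of_eq ?_)) hn'
    ring
  have hD := hedge_regret hT (fun t => dualCost ρ base (o t) (A t)) k hk
    (fun t ht i => (dualCost_mem hn hρ (ho t (by omega)) (hcost t (by omega) _ (hA t) i).1
      (hcost t (by omega) _ (hA t) i).2).1)
    (fun t ht i => (dualCost_mem hn hρ (ho t (by omega)) (hcost t (by omega) _ (hA t) i).1
      (hcost t (by omega) _ (hA t) i).2).2) i
  have hD2 : ∑ t ∈ Finset.range k, runDualGap T F ρ base o ω t =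
      ∑ t ∈ Finset.range k, dualCost ρ base (o t) (A t) (I t) -
      ∑ t ∈ Finset.range k, ∑ i, hedgeProb T (fun j => ∑ s ∈ Finset.range t,
        dualCost ρ base (o s) (A s) j) i * dualCost ρ base (o t) (A t) i := by
    rw [← Finset.sum_sub_distrib]
    refine Finset.sum_congr rfl fun t _ => ?_
    unfold runDualGap
    rw [state_cost_eq_sum]
  have hdc : ∀ J : ℕ → Fin d, ∑ t ∈ Finset.range k, dualCost ρ base (o t) (A t) (J t) =
      (∑ t ∈ Finset.range k, (actionReward (o t) (A t) - ρ * actionCost base (o t) (A t) (J t)) +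
        k * ρ) / (1 + ρ) := by
    intro J
    simp_rw [dualCost_eq]
    rw [← Finset.sum_div, Finset.sum_add_distrib]
    simp
  rw [hdc (fun _ => i)] at hD
  rw [hdc I] at hD2
  have hdual : PA - ∑ t ∈ Finset.range k, (actionReward (o t) (A t) -
        ρ * actionCost base (o t) (A t) i) ≤ (1 + ρ) * (2 * √(T * Real.log d) +
      (k * √(logFactor n T / T) + 3 * √(T * logFactor n T))) := by
    have h5 : (PA + k * ρ) / (1 + ρ) - (∑ t ∈ Finset.range k, (actionReward (o t) (A t) -
        ρ * actionCost base (o t) (A t) i) + k * ρ) / (1 + ρ) ≤ 2 * √(T * Real.log d) +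
      (k * √(logFactor n T / T) + 3 * √(T * logFactor n T)) := by linarith
    rw [← sub_div, div_le_iff₀ (by linarith)] at h5
    linarith
  have htune := mul_le_mul_of_nonneg_left (tuning_bound hn hT k) (show 0 ≤ 1 + ρ by linarith)
  unfold runErr
  linarith

lemma measurable_resource (T : ℕ) (st : State n d) :
    Measurable fun w : RoundSeed n => st.resource T w :=
  measurable_drawIndex measurable_const measurable_snd

lemma lintegral_exp_runGap_le (hn : 1 ≤ n) (hT : 1 ≤ T) (hρ : 0 ≤ ρ) {v : Outcome n d}
    (hv : IsOutcome v) (st : State n d) {l : ℝ} (hl0 : 0 ≤ l) (hl1 : l * n ≤ 1) :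
    ∫⁻ w, ENNReal.ofReal (Real.exp (l * roundGap F (fplRate n T) (fplBias n T) (fplCap n T) st.est
        (coordLoss ρ v (st.resource T w)) w.1)) ∂(roundSeedLaw n) ≤
      ENNReal.ofReal (Real.exp (l * (2 * n * (1 / (fplCap n T : ℝ) + fplBias n T) +
        4 * fplRate n T * (n : ℝ) ^ 2) + l ^ 2 * (3 * (n : ℝ) ^ 2))) := by
  have hm := measurable_roundGap F (fplRate n T) (fplBias n T) (fplCap n T)
    (measurable_const (a := st.est)) (measurable_coordLoss (α := RoundSeed n)
      (measurable_const (a := ρ)) (measurable_const (a := v)) (measurable_resource T st))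
    measurable_fst
  have hE := (Real.measurable_exp.comp (hm.const_mul l)).ennreal_ofReal
  simp only [Function.comp_def] at hE
  rw [roundSeedLaw_eq, lintegral_prod_symm' _ hE]
  refine (lintegral_mono (g := fun _ => ENNReal.ofReal (Real.exp (l * (2 * n *
    (1 / (fplCap n T : ℝ) + fplBias n T) + 4 * fplRate n T * (n : ℝ) ^ 2) +
      l ^ 2 * (3 * (n : ℝ) ^ 2)))) fun s => ?_).trans (by simp)
  simp only [State.resource]
  exact lintegral_exp_roundGap_le (fplRate_pos hn hT).le (fplBias_pos hn hT) (one_le_fplCap hn hT)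
    (fun e b => (coordLoss_mem hn hρ hv _ e b).1) (fun e b => (coordLoss_mem hn hρ hv _ e b).2)
    hl0 hl1

lemma lintegral_exp_runEst_le (hn : 1 ≤ n) (hT : 1 ≤ T) (hρ : 0 ≤ ρ) {v : Outcome n d}
    (hv : IsOutcome v) (st : State n d) (x : Fin n × Bool) :
    ∫⁻ w, ENNReal.ofReal (Real.exp (fplBias n T * (lossEst F (fplRate n T) (fplBias n T)
        (fplCap n T) st.est (coordLoss ρ v (st.resource T w)) w.1 x.1 x.2 -
          coordLoss ρ v (st.resource T w) x.1 x.2))) ∂(roundSeedLaw n) ≤ 1 := by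
  have hc := measurable_coordLoss (α := RoundSeed n)
      (measurable_const (a := ρ)) (measurable_const (a := v)) (measurable_resource T st)
  have hm := measurable_lossEst F (fplRate n T) (fplBias n T) (fplCap n T)
    (measurable_const (a := st.est)) hc measurable_fst x.1 x.2
  have hc' : Measurable fun w : RoundSeed n => coordLoss ρ v (st.resource T w) x.1 x.2 :=
    (measurable_pi_apply x.2).comp ((measurable_pi_apply x.1).comp hc)
  have hE := (Real.measurable_exp.comp ((hm.sub hc').const_mul (fplBias n T))).ennreal_ofReal
  simp only [Function.comp_def, Pi.sub_apply] at hE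
  rw [roundSeedLaw_eq, lintegral_prod_symm' _ hE]
  refine (lintegral_mono (g := fun _ => 1) fun s => ?_).trans (by simp)
  simp only [State.resource]
  exact lintegral_exp_lossEst_le (fplBias_pos hn hT)
    (fun e b => (coordLoss_mem hn hρ hv _ e b).1) x

lemma seedLaw_runGap_le (hn : 1 ≤ n) (hT : 1 ≤ T) (hρ : 0 ≤ ρ) (ho : ∀ t < T, IsOutcome (o t))
    {l : ℝ} (hl0 : 0 ≤ l) (hl1 : l * n ≤ 1) {k : ℕ} (hk : k ≤ T) (a : ℝ) :
    seedLaw n {ω | k * (l * (2 * n * (1 / (fplCap n T : ℝ) + fplBias n T) +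
        4 * fplRate n T * (n : ℝ) ^ 2) + l ^ 2 * (3 * (n : ℝ) ^ 2)) + a <
      ∑ t ∈ Finset.range k, l * runGap T F ρ base o ω t} ≤ ENNReal.ofReal (Real.exp (-a)) := by
  have hst := fun t => measurable_state T F (α := ℕ → RoundSeed n) (ρ := fun _ => ρ) base
    (o := fun _ => o) (ω := fun ω => ω) measurable_const measurable_const measurable_id t
  have hloss : ∀ t, Measurable fun ω => runLoss T F ρ base o ω t := fun t =>
    measurable_coordLoss measurable_const measurable_const (hst t).2.2.2
  have hs1 : ∀ t, Measurable fun ω : ℕ → RoundSeed n => (ω t).1 := fun t => by fun_prop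
  refine measure_sum_ge_le (roundSeedLaw n) (fun t ω => l * runGap T F ρ base o ω t) _ T
    (fun t => (measurable_roundGap F _ _ _ (hst t).1 (hloss t) (hs1 t)).const_mul l)
    (fun s t ω w hst => ?_) (fun t ht => Filter.Eventually.of_forall fun ω => ?_) k hk a
  · simp only [runGap, runLoss, runResource]
    rw [state_update_seed _ _ _ _ _ _ _ _ hst.le, Function.update_of_ne hst.ne]
  · simp only [runGap, runLoss, runResource]
    rw [lintegral_congr fun w => by
      rw [state_update_seed _ _ _ _ _ _ _ _ le_rfl, Function.update_self]]
    exact lintegral_exp_runGap_le hn hT hρ (ho t ht) _ hl0 hl1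

lemma seedLaw_runEst_le (hn : 1 ≤ n) (hT : 1 ≤ T) (hρ : 0 ≤ ρ) (ho : ∀ t < T, IsOutcome (o t))
    (x : Fin n × Bool) {k : ℕ} (hk : k ≤ T) (a : ℝ) :
    seedLaw n {ω | k * 0 + a < ∑ t ∈ Finset.range k, fplBias n T *
      (runEst T F ρ base o ω t x.1 x.2 - runLoss T F ρ base o ω t x.1 x.2)} ≤
      ENNReal.ofReal (Real.exp (-a)) := by
  have hst := fun t => measurable_state T F (α := ℕ → RoundSeed n) (ρ := fun _ => ρ) base
    (o := fun _ => o) (ω := fun ω => ω) measurable_const measurable_const measurable_id t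
  have hloss : ∀ t, Measurable fun ω => runLoss T F ρ base o ω t := fun t =>
    measurable_coordLoss measurable_const measurable_const (hst t).2.2.2
  have hs1 : ∀ t, Measurable fun ω : ℕ → RoundSeed n => (ω t).1 := fun t => by fun_prop
  have hl' : ∀ t, Measurable fun ω => runLoss T F ρ base o ω t x.1 x.2 := fun t =>
    (measurable_pi_apply x.2).comp ((measurable_pi_apply x.1).comp (hloss t))
  refine measure_sum_ge_le (roundSeedLaw n) (fun t ω => fplBias n T *
      (runEst T F ρ base o ω t x.1 x.2 - runLoss T F ρ base o ω t x.1 x.2)) 0 T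
    (fun t => ((measurable_lossEst F _ _ _ (hst t).1 (hloss t) (hs1 t) x.1 x.2).sub
      (hl' t)).const_mul _)
    (fun s t ω w hst => ?_) (fun t ht => Filter.Eventually.of_forall fun ω => ?_) k hk a
  · simp only [runEst, runLoss, runResource]
    rw [state_update_seed _ _ _ _ _ _ _ _ hst.le, Function.update_of_ne hst.ne]
  · simp only [runEst, runLoss, runResource]
    rw [lintegral_congr fun w => by
      rw [state_update_seed _ _ _ _ _ _ _ _ le_rfl, Function.update_self]]
    exact (lintegral_exp_runEst_le hn hT hρ (ho t ht) _ x).trans (by simp)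

lemma seedLaw_runDualGap_le (hn : 1 ≤ n) (hρ : 0 ≤ ρ) (ho : ∀ t < T, IsOutcome (o t))
    (hF : F.Nonempty)
    (hcost : ∀ t < T, ∀ S ∈ F, ∀ i, 0 ≤ actionCost base (o t) S i ∧ actionCost base (o t) S i ≤ 1)
    {μ : ℝ} (hμ0 : 0 ≤ μ) (hμ1 : μ ≤ 1) {k : ℕ} (hk : k ≤ T) (a : ℝ) :
    seedLaw n {ω | k * μ ^ 2 + a < ∑ t ∈ Finset.range k, μ * runDualGap T F ρ base o ω t} ≤
      ENNReal.ofReal (Real.exp (-a)) := by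
  have hst := fun t => measurable_state T F (α := ℕ → RoundSeed n) (ρ := fun _ => ρ) base
    (o := fun _ => o) (ω := fun ω => ω) measurable_const measurable_const measurable_id t
  exact measure_sum_ge_le (roundSeedLaw n)
    (fun t ω => μ * runDualGap T F ρ base o ω t) (μ ^ 2) T
    (fun t => by
      have h1 := fun i => measurable_dualCost (α := ℕ → RoundSeed n) (ρ := fun _ => ρ) base
        measurable_const (o := fun _ => o t) measurable_const (hst t).2.2.1 i
      have h2 := measurable_comp_countable h1 (hst t).2.2.2
      have h3 := fun i => (measurable_hedgeProb T i).comp (hst t).2.1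
      simp only [Function.comp_def] at h3
      unfold runDualGap
      fun_prop)
    (fun s t ω w hst => by
      simp only [runDualGap, runAction, runResource]
      rw [state_update_seed _ _ _ _ _ _ _ _ hst.le, Function.update_of_ne hst.ne])
    (fun t ht => Filter.Eventually.of_forall fun ω => by
      rw [roundSeedLaw_eq]
      simp only [runDualGap, runAction, runResource]
      rw [lintegral_congr fun w => by
        rw [state_update_seed _ _ _ _ _ _ _ _ le_rfl, Function.update_self]]
      refine (lintegral_prod_le _).trans ?_
      refine (lintegral_mono (g := fun _ => ENNReal.ofReal (Real.exp (μ ^ 2))) fun z => ?_).trans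
        (by simp)
      have hmem : ∀ i, 0 ≤ dualCost ρ base (o t) (fplSelect F (fplRate n T)
          (state T F ρ base o ω t).est (z 0)) i ∧ dualCost ρ base (o t) (fplSelect F (fplRate n T)
          (state T F ρ base o ω t).est (z 0)) i ≤ 1 := fun i =>
        dualCost_mem hn hρ (ho t ht) (hcost t ht _ (fplSelect_mem hF _ _ _) i).1
          (hcost t ht _ (fplSelect_mem hF _ _ _) i).2
      exact lintegral_exp_drawIndex_le (hedgeProb_nonneg T _) (sum_hedgeProb T _)
        (dualCost ρ base (o t) (fplSelect F (fplRate n T) (state T F ρ base o ω t).est (z 0)))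
        (fun i => (hmem i).1) (fun i => (hmem i).2) hμ0 hμ1) k hk a

lemma seedLaw_not_goodRun_le (hn : 1 ≤ n) (hT : 2 ≤ T) (hρ : 0 ≤ ρ) (ho : ∀ t < T, IsOutcome (o t))
    (hF : F.Nonempty)
    (hcost : ∀ t < T, ∀ S ∈ F, ∀ i, 0 ≤ actionCost base (o t) S i ∧ actionCost base (o t) S i ≤ 1)
    (hΛT : logFactor n T ≤ T) :
    seedLaw n {ω | ¬ GoodRun T F ρ base o ω} ≤ ENNReal.ofReal (1 / (T : ℝ) ^ 2) := by
  have hT1 : 1 ≤ T := by omega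
  have hΛ := logFactor_pos hn hT1
  have hβ := fplBias_pos hn hT1
  have hn' : (1 : ℝ) ≤ n := by exact_mod_cast hn
  have hT' : (2 : ℝ) ≤ T := by exact_mod_cast hT
  set Λ := logFactor n T with hΛd
  set μ := √(Λ / T) with hμ
  have hμ0 : 0 < μ := Real.sqrt_pos.2 (by positivity)
  have hμ1 : μ ≤ 1 := by
    rw [hμ, Real.sqrt_le_one]; exact (div_le_one (by linarith)).2 hΛT
  have hΛμ : Λ / μ = √(T * Λ) := by
    rw [div_eq_iff hμ0.ne', hμ, ← Real.sqrt_mul (by positivity)]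
    have : T * Λ * (Λ / T) = Λ ^ 2 := by field_simp
    rw [this, Real.sqrt_sq hΛ.le]
  set c1 : ℝ := 2 * n * (1 / (fplCap n T : ℝ) + fplBias n T) + 4 * fplRate n T * (n : ℝ) ^ 2
  -- At this scale the variance term `k l ^ 2 (3 n ^ 2)` and the tail `3 Λ` are of the same order.
  set l := μ / n with hl
  have hl0 : 0 < l := by positivity
  have hl1 : l * n ≤ 1 := by rw [hl, div_mul_cancel₀ _ (by linarith)]; exact hμ1
  -- There are `(T + 1) (2 n + 2)` events, one for each prefix and each coordinate or player, each of
  -- probability at most `exp (-3 Λ) = (2 n T) ^ (-3)`.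
  have hsub : {ω | ¬ GoodRun T F ρ base o ω} ⊆ ⋃ k ∈ Finset.range (T + 1),
      ({ω | k * (l * c1 + l ^ 2 * (3 * (n : ℝ) ^ 2)) + 3 * Λ <
          ∑ t ∈ Finset.range k, l * runGap T F ρ base o ω t} ∪
        (⋃ x ∈ (Finset.univ : Finset (Fin n × Bool)), {ω | k * 0 + 3 * Λ < ∑ t ∈ Finset.range k,
          fplBias n T * (runEst T F ρ base o ω t x.1 x.2 - runLoss T F ρ base o ω t x.1 x.2)}) ∪
        {ω | k * μ ^ 2 + 3 * Λ < ∑ t ∈ Finset.range k, μ * runDualGap T F ρ base o ω t}) := by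
    intro ω hω
    by_contra hcon
    simp only [Set.mem_iUnion, Set.mem_union, Finset.mem_univ, Finset.mem_range,
      not_exists, not_or, Set.mem_ofPred_eq, not_lt, exists_prop, true_and, not_and] at hcon
    refine hω fun k hk S hS i => ?_
    obtain ⟨⟨q1, q2⟩, q3⟩ := hcon k (by omega)
    refine regret_of_deviations hn hT1 hρ ho hcost ω k hk ?_ ?_ ?_ hS i
    · rw [← Finset.mul_sum] at q1
      have : l * (∑ t ∈ Finset.range k, runGap T F ρ base o ω t) ≤
          l * (k * (c1 + 3 * n * μ) + 3 * n * √(T * Λ)) := by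
        refine q1.trans (le_of_eq ?_)
        rw [← hΛμ, hl]
        field_simp
      exact le_of_mul_le_mul_left this hl0
    · intro x
      have := q2 x
      rw [← Finset.mul_sum, mul_zero, zero_add] at this
      rw [le_div_iff₀ hβ]; linarith
    · rw [← Finset.mul_sum] at q3
      have : μ * (∑ t ∈ Finset.range k, runDualGap T F ρ base o ω t) ≤
          μ * (k * μ + 3 * √(T * Λ)) := by
        refine q3.trans (le_of_eq ?_)
        rw [← hΛμ]
        field_simp
      exact le_of_mul_le_mul_left this hμ0
  have hδ : Real.exp (-(3 * Λ)) = 1 / (2 * n * T) ^ 3 := by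
    have h0 : (0 : ℝ) < 2 * n * T := by positivity
    rw [Real.exp_neg, mul_comm, show Λ * 3 = Λ * (3 : ℕ) by norm_num, Real.exp_mul,
      Real.rpow_natCast, hΛd, logFactor, Real.exp_log h0, one_div]
  set δ := ENNReal.ofReal (Real.exp (-(3 * Λ))) with hδd
  have hbound : seedLaw n {ω | ¬ GoodRun T F ρ base o ω} ≤
      ∑ k ∈ Finset.range (T + 1), (δ + ∑ x : Fin n × Bool, δ + δ) := by
    refine (measure_mono hsub).trans ((measure_biUnion_finset_le _ _).trans ?_)
    refine Finset.sum_le_sum fun k hk => ?_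
    have hk' : k ≤ T := by simpa [Nat.lt_succ_iff] using hk
    refine (measure_union_le _ _).trans (add_le_add ((measure_union_le _ _).trans
      (add_le_add (seedLaw_runGap_le hn hT1 hρ ho hl0.le hl1 hk' (3 * Λ)) ((measure_biUnion_finset_le _ _).trans
        (Finset.sum_le_sum fun x _ => seedLaw_runEst_le hn hT1 hρ ho x hk' (3 * Λ))))) (seedLaw_runDualGap_le hn hρ ho hF hcost hμ0.le hμ1 hk' (3 * Λ)))
  refine hbound.trans ?_
  simp only [Finset.sum_const, Finset.card_range, Finset.card_univ, nsmul_eq_mul,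
    Fintype.card_prod, Fintype.card_fin, Fintype.card_bool]
  have hcast : ((T + 1 : ℕ) : ENNReal) * (δ + ((n * 2 : ℕ) : ENNReal) * δ + δ) =
      ENNReal.ofReal ((T + 1) * ((1 + n * 2 + 1) * Real.exp (-(3 * Λ)))) := by
    rw [ENNReal.ofReal_mul (by positivity), ENNReal.ofReal_mul (by positivity), ← hδd]
    have e1 : ENNReal.ofReal ((T : ℝ) + 1) = ((T + 1 : ℕ) : ENNReal) := by
      rw [← ENNReal.ofReal_natCast]; push_cast; rfl
    have e2 : ENNReal.ofReal (1 + (n : ℝ) * 2 + 1) = 1 + ((n * 2 : ℕ) : ENNReal) + 1 := by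
      rw [ENNReal.ofReal_add (by positivity) (by norm_num), ENNReal.ofReal_add (by norm_num)
        (by positivity), ENNReal.ofReal_one, ← ENNReal.ofReal_natCast]
      push_cast; rfl
    rw [e1, e2]
    ring
  rw [hcast]
  refine ENNReal.ofReal_le_ofReal ?_
  rw [hδ]
  rw [mul_one_div, ← mul_div_assoc, div_le_div_iff₀ (by positivity) (by positivity)]
  have h1 : ((T : ℝ) + 1) * (1 + n * 2 + 1) ≤ (2 * T) * (4 * n) :=
    mul_le_mul (by linarith) (by linarith) (by linarith) (by linarith)
  have h2 : (1 : ℝ) ≤ n ^ 2 := one_le_pow₀ hn'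
  calc ((T : ℝ) + 1) * (1 + n * 2 + 1) * (T : ℝ) ^ 2 ≤ (2 * T) * (4 * n) * (T : ℝ) ^ 2 := by gcongr
    _ = 8 * (T : ℝ) ^ 3 * n * 1 := by ring
    _ ≤ 8 * (T : ℝ) ^ 3 * n * n ^ 2 := by gcongr
    _ = 1 * (2 * n * T) ^ 3 := by ring

end GoodRunProof

/-! ### Policies in the stochastic version -/

section Budget

/-- A nonnegative sequence with terms at most `1`, summed over the times at which the partial sum is
within the budget. -/
lemma sum_alive_le {B : ℝ} (hB : 0 ≤ B) (c : ℕ → ℝ) (T : ℕ) (h0 : ∀ t < T, 0 ≤ c t)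
    (h1 : ∀ t < T, c t ≤ 1) (alive : ℕ → Prop) [DecidablePred alive]
    (ha : ∀ t < T, alive t → ∑ s ∈ Finset.range t, c s ≤ B) :
    ∑ t ∈ Finset.range T, (if alive t then c t else 0) ≤ B + 1 := by
  have key : ∀ k ≤ T, ∑ t ∈ Finset.range k, (if alive t then c t else 0) ≤ B + 1 := by
    intro k
    induction k with
    | zero => intro _; simp; linarith
    | succ k ih =>
      intro hk
      rw [Finset.sum_range_succ]
      by_cases h : alive k
      · rw [if_pos h]
        have h2 : ∑ t ∈ Finset.range k, (if alive t then c t else 0) ≤ ∑ t ∈ Finset.range k, c t := by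
          refine Finset.sum_le_sum fun t ht => ?_
          have := h0 t (by have := Finset.mem_range.1 ht; omega)
          split_ifs <;> linarith
        linarith [ha k (by omega) h, h1 k (by omega)]
      · rw [if_neg h, add_zero]
        exact ih (by omega)
  exact key T le_rfl

end Budget

variable {n d : ℕ}

/-- Expected reward of an action in one round. -/
def meanReward (D : Measure (Outcome n d)) (S : Finset (Fin n)) : ℝ := ∫ v, actionReward v S ∂D

/-- Expected consumption of a resource by an action in one round. -/
def meanCost (base : Fin d → ℝ) (D : Measure (Outcome n d)) (S : Finset (Fin n)) (i : Fin d) : ℝ :=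
  ∫ v, actionCost base v S i ∂D

lemma integrable_outcome {D : Measure (Outcome n d)} [IsProbabilityMeasure D]
    (hD : ∀ᵐ v ∂D, IsOutcome v) (e : Fin n) (j : Fin (d + 1)) : Integrable (fun v => v e j) D :=
  Integrable.of_bound (by fun_prop : Measurable fun v : Outcome n d => v e j).aestronglyMeasurable
    (1 / (n : ℝ)) (hD.mono fun v hv => by
    rw [Real.norm_eq_abs, abs_of_nonneg (hv e j).1]; exact (hv e j).2)

lemma integrable_actionReward {D : Measure (Outcome n d)} [IsProbabilityMeasure D]
    (hD : ∀ᵐ v ∂D, IsOutcome v) (S : Finset (Fin n)) : Integrable (fun v => actionReward v S) D :=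
  integrable_finsetSum _ fun e _ => integrable_outcome hD e 0

lemma integrable_actionCost (base : Fin d → ℝ) {D : Measure (Outcome n d)} [IsProbabilityMeasure D]
    (hD : ∀ᵐ v ∂D, IsOutcome v) (S : Finset (Fin n)) (i : Fin d) :
    Integrable (fun v => actionCost base v S i) D :=
  (integrable_const _).add (integrable_finsetSum _ fun e _ => integrable_outcome hD e i.succ)

lemma ae_outcomeLaw {D : Measure (Outcome n d)} [IsProbabilityMeasure D] {p : Outcome n d → Prop}
    (h : ∀ᵐ v ∂D, p v) : ∀ᵐ o ∂(outcomeLaw D), ∀ t, p (o t) := by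
  rw [ae_all_iff]
  exact fun t => (measurePreserving_eval_infinitePi (fun _ : ℕ => D) t).quasiMeasurePreserving.ae h

/-- The outcome of a round is independent of events that do not depend on it. -/
lemma integral_event_mul_outcome {D : Measure (Outcome n d)} [IsProbabilityMeasure D]
    {f : Outcome n d → ℝ} (hf : Measurable f) (hi : Integrable f D) (t : ℕ)
    {E : Set (ℕ → Outcome n d)} (hE : MeasurableSet E)
    (hEt : ∀ o w, Function.update o t w ∈ E ↔ o ∈ E) :
    ∫ o, E.indicator (fun o => f (o t)) o ∂(outcomeLaw D) =
      (outcomeLaw D).real E * ∫ v, f v ∂D := by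
  have hm : Measurable fun o : ℕ → Outcome n d => f (o t) := hf.comp (measurable_pi_apply t)
  have hi2 : Integrable (fun o : ℕ → Outcome n d => f (o t)) (outcomeLaw D) :=
    (measurePreserving_eval_infinitePi (fun _ : ℕ => D) t).integrable_comp_of_integrable hi
  unfold outcomeLaw
  rw [integral_infinitePi_update _ t (hm.indicator hE) (hi2.indicator hE)]
  have : ∀ o : ℕ → Outcome n d, ∫ w, E.indicator (fun o => f (o t)) (Function.update o t w) ∂D =
      E.indicator (fun _ => ∫ v, f v ∂D) o := by
    intro o
    by_cases h : o ∈ E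
    · rw [Set.indicator_of_mem h]
      refine integral_congr_ae (Filter.Eventually.of_forall fun w => ?_)
      simp only
      rw [Set.indicator_of_mem ((hEt o w).2 h), Function.update_self]
    · rw [Set.indicator_of_notMem h, ← integral_zero (Outcome n d) ℝ (μ := D)]
      refine integral_congr_ae (Filter.Eventually.of_forall fun w => ?_)
      simp only
      rw [Set.indicator_of_notMem (fun h' => h ((hEt o w).1 h'))]
  simp_rw [this]
  rw [integral_indicator_const _ hE, smul_eq_mul]

section Policy

variable {F : Finset (Finset (Fin n))} (π : DynPolicy n d F)

lemma DynPolicy.play_mem (s : ℝ) (o : ℕ → Outcome n d) (t : ℕ) : π.play s o t ∈ F := by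
  rw [DynPolicy.play]; exact π.act_mem _ _ _

lemma DynPolicy.play_congr (s : ℝ) {o o' : ℕ → Outcome n d} (t : ℕ) (h : ∀ r < t, o r = o' r) :
    π.play s o t = π.play s o' t := by
  induction t using Nat.strong_induction_on with
  | _ t ih =>
    rw [DynPolicy.play, DynPolicy.play]
    congr 1
    funext r
    rw [ih r r.2 fun q hq => h q (hq.trans r.2), h r r.2]

lemma measurable_observe {α : Type*} [MeasurableSpace α] {S : α → Finset (Fin n)}
    {o : α → Outcome n d} (hS : Measurable S) (ho : Measurable o) :
    Measurable fun a => observe (S a) (o a) := by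
  refine measurable_comp_countable (f := fun S a => observe S (o a)) (fun S => ?_) hS
  refine measurable_pi_iff.2 fun e => measurable_pi_iff.2 fun j => ?_
  unfold observe
  by_cases h : e ∈ S
  · simp only [h, if_true]; fun_prop
  · simp only [h, if_false]; fun_prop

lemma DynPolicy.measurable_play (t : ℕ) :
    Measurable fun x : ℝ × (ℕ → Outcome n d) => π.play x.1 x.2 t := by
  induction t using Nat.strong_induction_on with
  | _ t ih =>
    refine measurable_to_countable' fun S => ?_
    have h2 : Measurable fun x : ℝ × (ℕ → Outcome n d) =>
        (x.1, fun r : Fin t => observe (π.play x.1 x.2 r) (x.2 r)) :=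
      measurable_fst.prodMk (measurable_pi_iff.2 fun r => measurable_observe (ih r r.2)
        ((measurable_pi_apply _).comp measurable_snd))
    have h3 := h2 (π.measurable_act t S)
    convert h3 using 1
    ext x
    simp only [Set.mem_preimage, Set.mem_singleton_iff, Set.mem_ofPred_eq]
    rw [DynPolicy.play]

end Policy

/-- A process of feasible actions that depend only on the earlier outcomes has the same expected
payoffs as some fixed distribution over actions that respects the budget in expectation, up to the
overshoot in the last round. -/
lemma exists_fixed_distribution {F : Finset (Finset (Fin n))} {S₀ : Finset (Fin n)} (hS₀ : S₀ ∈ F)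
    {D : Measure (Outcome n d)} [IsProbabilityMeasure D] {T : ℕ} (hn : 1 ≤ n) (hT : 1 ≤ T) {B : ℝ}
    (hB : 0 < B) (i₀ : Fin d) (hD : ∀ᵐ v ∂D, IsOutcome v) (hD0 : ∀ᵐ v ∂D, IsNullFor S₀ v)
    (hDd : ∀ᵐ v ∂D, ∀ e, v e i₀.succ = 0) (a : (ℕ → Outcome n d) → ℕ → Finset (Fin n))
    (ham : ∀ t, Measurable fun o => a o t) (haF : ∀ o t, a o t ∈ F)
    (hadapt : ∀ t o o', (∀ r < t, o r = o' r) → a o t = a o' t) :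
    ∃ p : Finset (Fin n) → ℝ, (∀ S, 0 ≤ p S) ∧ ∑ S ∈ F, p S = 1 ∧
      ∫ o, totalReward T B (dummyBase T B i₀) o (a o) ∂(outcomeLaw D) =
        T * ∑ S ∈ F, p S * meanReward D S ∧
      ∀ i, T * ∑ S ∈ F, p S * meanCost (dummyBase T B i₀) D S i ≤ B + 1 := by
  classical
  set base := dummyBase T B i₀ with hbase
  have hT' : (0 : ℝ) < T := by exact_mod_cast hT
  let alive : ℕ → (ℕ → Outcome n d) → Prop := fun t o =>
    ∀ i, ∑ s ∈ Finset.range t, actionCost base (o s) (a o s) i ≤ B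
  let E : ℕ → Finset (Fin n) → Set (ℕ → Outcome n d) := fun t S => {o | alive t o ∧ a o t = S}
  have haliveM : ∀ t, MeasurableSet {o | alive t o} := by
    intro t
    simp only [alive]
    rw [Set.ofPred_forall]
    exact MeasurableSet.iInter fun i => measurableSet_le
      (Finset.measurable_sum _ fun s _ => measurable_actionCost base (measurable_pi_apply s) (ham s) i)
      measurable_const
  have hEM : ∀ t S, MeasurableSet (E t S) := fun t S =>
    (haliveM t).inter (ham t (measurableSet_singleton S))
  have hup : ∀ t s (o : ℕ → Outcome n d) w, s ≤ t → a (Function.update o t w) s = a o s :=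
    fun t s o w h => hadapt s _ _ fun r hr => Function.update_of_ne (by omega) _ _
  have hEt : ∀ t S o w, Function.update o t w ∈ E t S ↔ o ∈ E t S := by
    intro t S o w
    simp only [E, alive, Set.mem_ofPred_eq]
    rw [hup t t o w le_rfl]
    refine and_congr_left fun _ => forall_congr' fun i => ?_
    rw [Finset.sum_congr rfl fun s hs => ?_]
    have := Finset.mem_range.1 hs
    rw [hup t s o w this.le, Function.update_of_ne this.ne]
  -- splitting a sum over the rounds played according to the actions
  have hsplit : ∀ f : Finset (Fin n) → Outcome n d → ℝ, (∀ S, Measurable (f S)) →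
      (∀ S, Integrable (f S) D) →
      ∫ o, ∑ t ∈ Finset.range T, (if alive t o then f (a o t) (o t) else 0) ∂(outcomeLaw D) =
        ∑ t ∈ Finset.range T, ∑ S ∈ F, (outcomeLaw D).real (E t S) * ∫ v, f S v ∂D := by
    intro f hf hfi
    have hint : ∀ t S, Integrable ((E t S).indicator fun o => f S (o t)) (outcomeLaw D) :=
      fun t S => ((measurePreserving_eval_infinitePi (fun _ : ℕ => D) t).integrable_comp_of_integrable
        (hfi S)).indicator (hEM t S)
    have heq : ∀ o, ∑ t ∈ Finset.range T, (if alive t o then f (a o t) (o t) else 0) =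
        ∑ t ∈ Finset.range T, ∑ S ∈ F, (E t S).indicator (fun o => f S (o t)) o := by
      intro o
      refine Finset.sum_congr rfl fun t _ => ?_
      rw [Finset.sum_eq_single_of_mem (a o t) (haF o t)]
      · simp only [Set.indicator_apply, E, Set.mem_ofPred_eq, and_true]
      · intro S _ hS
        rw [Set.indicator_of_notMem]
        exact fun h => hS h.2.symm
    simp_rw [heq]
    rw [integral_finsetSum _ fun t _ => integrable_finsetSum _ fun S _ => hint t S]
    refine Finset.sum_congr rfl fun t _ => ?_
    rw [integral_finsetSum _ fun S _ => hint t S]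
    exact Finset.sum_congr rfl fun S _ =>
      integral_event_mul_outcome (hf S) (hfi S) t (hEM t S) (hEt t S)
  set q : Finset (Fin n) → ℝ := fun S => ∑ t ∈ Finset.range T, (outcomeLaw D).real (E t S) with hq
  have hq0 : ∀ S, 0 ≤ q S := fun S => Finset.sum_nonneg fun t _ => measureReal_nonneg
  have hqsum : ∑ S ∈ F, q S ≤ T := by
    have h1 := hsplit (fun _ _ => 1) (fun _ => measurable_const) (fun _ => integrable_const _)
    simp only [integral_const, probReal_univ, smul_eq_mul, mul_one] at h1
    rw [Finset.sum_comm] at h1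
    rw [← h1]
    have h2 : ∀ o : ℕ → Outcome n d, ∑ t ∈ Finset.range T, (if alive t o then (1 : ℝ) else 0) ≤ T :=
      fun o => (Finset.sum_le_sum (g := fun _ => 1) fun t _ => by split_ifs <;> norm_num).trans
        (by simp)
    calc _ ≤ ∫ o : ℕ → Outcome n d, (T : ℝ) ∂(outcomeLaw D) := by
          refine integral_mono_of_nonneg (Filter.Eventually.of_forall fun o => ?_)
            (integrable_const _) (Filter.Eventually.of_forall h2)
          exact Finset.sum_nonneg fun t _ => by split_ifs <;> norm_num
      _ = T := by simp
  have hrest : ∀ g : Finset (Fin n) → ℝ,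
      T * ∑ S ∈ F, (q S / T + if S = S₀ then 1 - (∑ S ∈ F, q S) / T else 0) * g S =
        ∑ S ∈ F, q S * g S + (T - ∑ S ∈ F, q S) * g S₀ := by
    intro g
    simp_rw [add_mul]
    rw [Finset.sum_add_distrib, mul_add, Finset.mul_sum]
    congr 1
    · exact Finset.sum_congr rfl fun S _ => by field_simp
    · simp only [ite_mul, zero_mul, Finset.sum_ite_eq', hS₀, if_true]
      field_simp
  have hr0 : meanReward D S₀ = 0 := by
    unfold meanReward
    rw [integral_congr_ae (hD0.mono fun v hv => hv 0 :
      (fun v => actionReward v S₀) =ᵐ[D] fun _ => (0 : ℝ))]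
    simp
  refine ⟨fun S => q S / T + if S = S₀ then 1 - (∑ S ∈ F, q S) / T else 0, ?_, ?_, ?_, ?_⟩
  · intro S
    have h1 : (∑ S ∈ F, q S) / T ≤ 1 := (div_le_one hT').2 hqsum
    have h2 : 0 ≤ q S / T := div_nonneg (hq0 S) hT'.le
    simp only
    split_ifs <;> linarith
  · have := hrest fun _ => 1
    simp only [mul_one] at this
    have h2 : (T : ℝ) * ∑ S ∈ F, (q S / T + if S = S₀ then 1 - (∑ S ∈ F, q S) / T else 0) = T * 1 := by
      rw [this]; ring
    exact mul_left_cancel₀ hT'.ne' h2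
  · rw [hrest, hr0, mul_zero, add_zero]
    have := hsplit (fun S v => actionReward v S)
      (fun S => by unfold actionReward; fun_prop) (integrable_actionReward hD)
    rw [Finset.sum_comm] at this
    simp_rw [hq, Finset.sum_mul]
    refine Eq.trans ?_ this
    refine integral_congr_ae (Filter.Eventually.of_forall fun o => Finset.sum_congr rfl fun t _ => ?_)
    congr
  · intro i
    rw [hrest]
    by_cases hi : i = i₀
    · have hc : ∀ S, meanCost base D S i = B / T := by
        intro S
        unfold meanCost
        rw [integral_congr_ae (hDd.mono fun v hv => ?_ : _ =ᵐ[D] fun _ => B / T)]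
        · simp
        · simp only [actionCost, hbase, dummyBase, hi, if_true]
          rw [Finset.sum_eq_zero fun e _ => hv e, add_zero]
      simp_rw [hc]
      rw [← Finset.sum_mul, ← add_mul]
      have : (∑ S ∈ F, q S + (T - ∑ S ∈ F, q S)) * (B / T) = B := by field_simp; ring
      rw [this]; linarith
    · have hb : base i = 0 := by simp [hbase, dummyBase, hi]
      have hc0 : meanCost base D S₀ i = 0 := by
        unfold meanCost
        rw [integral_congr_ae (hD0.mono fun v hv => ?_ : _ =ᵐ[D] fun _ => (0 : ℝ))]
        · simp
        · simp only [actionCost, hb, zero_add]; exact hv i.succ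
      rw [hc0, mul_zero, add_zero]
      have := hsplit (fun S v => actionCost base v S i)
        (fun S => by unfold actionCost; fun_prop) (fun S => integrable_actionCost base hD S i)
      rw [Finset.sum_comm] at this
      have h2 : ∑ S ∈ F, q S * meanCost base D S i = ∫ o, ∑ t ∈ Finset.range T,
          (if alive t o then actionCost base (o t) (a o t) i else 0) ∂(outcomeLaw D) := by
        rw [this]
        simp_rw [hq, Finset.sum_mul]
        rfl
      rw [h2]
      have hcost : ∀ᵐ o ∂(outcomeLaw D), ∀ t, 0 ≤ actionCost base (o t) (a o t) i ∧
          actionCost base (o t) (a o t) i ≤ 1 := by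
        filter_upwards [ae_outcomeLaw hD] with o ho t
        unfold actionCost
        rw [hb, zero_add]
        exact ⟨Finset.sum_nonneg fun e _ => (ho t e _).1,
          (sum_outcome_le_one (ho t) _ _).trans (card_div_le_one hn _)⟩
      calc _ ≤ ∫ o : ℕ → Outcome n d, (B + 1 : ℝ) ∂(outcomeLaw D) := by
            refine integral_mono_of_nonneg (hcost.mono fun o ho => ?_)
              (integrable_const _) (hcost.mono fun o ho => ?_)
            · exact Finset.sum_nonneg fun t _ => by split_ifs; exacts [(ho t).1, le_rfl]
            · exact sum_alive_le hB.le _ T (fun t _ => (ho t).1) (fun t _ => (ho t).2)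
                (fun t => alive t o) fun t _ h => h i
        _ = B + 1 := by simp

/-! ### The stochastic version -/

section Stochastic

variable {n d : ℕ} {T : ℕ} {B : ℝ} {F : Finset (Finset (Fin n))} {i₀ : Fin d}
  {D : Measure (Outcome n d)}

lemma actionCost_dummyBase_mem (hn : 1 ≤ n) (hT : 1 ≤ T) (hB : 0 < B) (hBT : B ≤ T)
    {v : Outcome n d} (hv : IsOutcome v) (hv0 : ∀ e, v e i₀.succ = 0) (S : Finset (Fin n))
    (i : Fin d) : 0 ≤ actionCost (dummyBase T B i₀) v S i ∧
      actionCost (dummyBase T B i₀) v S i ≤ 1 := by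
  have hT' : (0 : ℝ) < T := by exact_mod_cast hT
  unfold actionCost dummyBase
  by_cases h : i = i₀
  · subst h
    rw [if_pos rfl, Finset.sum_eq_zero fun e _ => hv0 e, add_zero]
    exact ⟨by positivity, (div_le_one hT').2 hBT⟩
  · rw [if_neg h, zero_add]
    exact ⟨Finset.sum_nonneg fun e _ => (hv e _).1,
      (sum_outcome_le_one hv _ _).trans (card_div_le_one hn _)⟩

/-- Lagrangian payoff (up to an additive constant) of a fixed distribution `p` over actions. -/
def mixPayoff (F : Finset (Finset (Fin n))) (p : Finset (Fin n) → ℝ) (ρ : ℝ) (base : Fin d → ℝ)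
    (v : Outcome n d) (i : Fin d) : ℝ :=
  ∑ S ∈ F, p S * (actionReward v S - ρ * actionCost base v S i)

lemma measurable_mixPayoff (p : Finset (Fin n) → ℝ) (ρ : ℝ) (base : Fin d → ℝ) (i : Fin d) :
    Measurable fun v : Outcome n d => mixPayoff F p ρ base v i := by
  unfold mixPayoff actionReward actionCost
  fun_prop

lemma integral_mixPayoff [IsProbabilityMeasure D] (hD : ∀ᵐ v ∂D, IsOutcome v) (p : Finset (Fin n) → ℝ) (ρ : ℝ)
    (base : Fin d → ℝ) (i : Fin d) : ∫ v, mixPayoff F p ρ base v i ∂D =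
      ∑ S ∈ F, p S * (meanReward D S - ρ * meanCost base D S i) := by
  have h1 := fun S => integrable_actionReward hD S
  have h2 := fun S => (integrable_actionCost base hD S i).const_mul ρ
  unfold mixPayoff
  have h3 : ∀ S, Integrable (fun v => p S * (actionReward v S - ρ * actionCost base v S i)) D :=
    fun S => ((h1 S).sub (h2 S)).const_mul (p S)
  rw [integral_finsetSum _ fun S _ => h3 S]
  refine Finset.sum_congr rfl fun S _ => ?_
  rw [integral_const_mul, integral_sub (h1 S) (h2 S), integral_const_mul]
  rfl

lemma mixPayoff_mem (hn : 1 ≤ n) {p : Finset (Fin n) → ℝ} (hp : ∀ S, 0 ≤ p S)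
    (hp1 : ∑ S ∈ F, p S = 1) {ρ : ℝ} (hρ : 0 ≤ ρ) {base : Fin d → ℝ} {v : Outcome n d}
    (hv : IsOutcome v) {i : Fin d}
    (hc : ∀ S, 0 ≤ actionCost base v S i ∧ actionCost base v S i ≤ 1) :
    -ρ ≤ mixPayoff F p ρ base v i ∧ mixPayoff F p ρ base v i ≤ 1 := by
  unfold mixPayoff
  have h1 : ∀ S, -ρ ≤ actionReward v S - ρ * actionCost base v S i ∧
      actionReward v S - ρ * actionCost base v S i ≤ 1 := fun S => by
    have := actionReward_nonneg hv S
    have := actionReward_le_one hn hv S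
    have := mul_nonneg hρ (hc S).1
    have := mul_le_of_le_one_right hρ (hc S).2
    constructor <;> linarith
  constructor
  · calc -ρ = ∑ S ∈ F, p S * -ρ := by rw [← Finset.sum_mul, hp1, one_mul]
      _ ≤ _ := Finset.sum_le_sum fun S _ => mul_le_mul_of_nonneg_left (h1 S).1 (hp S)
  · calc _ ≤ ∑ S ∈ F, p S * 1 :=
          Finset.sum_le_sum fun S _ => mul_le_mul_of_nonneg_left (h1 S).2 (hp S)
      _ = 1 := by rw [← Finset.sum_mul, hp1, one_mul]

variable [NeZero d]

/-- Deviation of the payoff of a fixed distribution from its mean in round `t`, rescaled. -/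
def mixGap (T : ℕ) (F : Finset (Finset (Fin n))) (p : Finset (Fin n) → ℝ) (ρ : ℝ)
    (base : Fin d → ℝ) (D : Measure (Outcome n d)) (o : ℕ → Outcome n d) (ω : ℕ → RoundSeed n)
    (t : ℕ) : ℝ :=
  (∫ v, mixPayoff F p ρ base v (runResource T F ρ base o ω t) ∂D -
    mixPayoff F p ρ base (o t) (runResource T F ρ base o ω t)) / (1 + ρ)

lemma measurable_mixGap (p : Finset (Fin n) → ℝ) (ρ : ℝ) (base : Fin d → ℝ) {α : Type*}
    [MeasurableSpace α] {o : α → ℕ → Outcome n d} {ω : α → ℕ → RoundSeed n} (ho : Measurable o)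
    (hω : Measurable ω) (t : ℕ) : Measurable fun a => mixGap T F p ρ base D (o a) (ω a) t := by
  have hi := (measurable_state T F (ρ := fun _ : α => ρ) base measurable_const ho hω t).2.2.2
  have hot : Measurable fun a => o a t := (measurable_pi_apply t).comp ho
  refine measurable_comp_countable (f := fun i a => (∫ v, mixPayoff F p ρ base v i ∂D -
    mixPayoff F p ρ base (o a t) i) / (1 + ρ)) (fun i => ?_) hi
  have := (measurable_mixPayoff (F := F) p ρ base i).comp hot
  simp only [Function.comp_def] at this
  fun_prop

variable [IsProbabilityMeasure D]

/-- The outcomes concentrate, for every realization of the seeds. -/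
lemma outcomeLaw_mixGap_le (hn : 1 ≤ n) (hT : 1 ≤ T) (hB : 0 < B) (hBT : B ≤ T)
    (hD : ∀ᵐ v ∂D, IsOutcome v) (hDd : ∀ᵐ v ∂D, ∀ e, v e i₀.succ = 0)
    {p : Finset (Fin n) → ℝ} (hp : ∀ S, 0 ≤ p S) (hp1 : ∑ S ∈ F, p S = 1) {ρ : ℝ} (hρ : 0 ≤ ρ)
    (ω : ℕ → RoundSeed n) {μ : ℝ} (hμ0 : 0 ≤ μ) (hμ1 : μ ≤ 1) {k : ℕ} (hk : k ≤ T) (a : ℝ) :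
    outcomeLaw D {o | k * μ ^ 2 + a < ∑ t ∈ Finset.range k,
      μ * mixGap T F p ρ (dummyBase T B i₀) D o ω t} ≤ ENNReal.ofReal (Real.exp (-a)) := by
  set base := dummyBase T B i₀
  refine measure_sum_ge_le D (fun t o => μ * mixGap T F p ρ base D o ω t) (μ ^ 2) T
    (fun t => (measurable_mixGap p ρ base measurable_id measurable_const t).const_mul μ)
    (fun s t o w hst => ?_) (fun t ht => Filter.Eventually.of_forall fun o => ?_) k hk a
  · simp only [mixGap, runResource]
    rw [state_update_outcome _ _ _ _ _ _ _ _ hst.le, Function.update_of_ne hst.ne]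
  · simp only [mixGap, runResource]
    rw [lintegral_congr fun w => by
      rw [state_update_outcome _ _ _ _ _ _ _ _ le_rfl, Function.update_self]]
    set i := (state T F ρ base o ω t).resource T (ω t)
    have hmem : ∀ᵐ v ∂D, -ρ ≤ mixPayoff F p ρ base v i ∧ mixPayoff F p ρ base v i ≤ 1 := by
      filter_upwards [hD, hDd] with v hv hv0
      exact mixPayoff_mem hn hp hp1 hρ hv fun S => actionCost_dummyBase_mem hn hT hB hBT hv hv0 S i
    have hm := measurable_mixPayoff (F := F) p ρ base i
    have hi : Integrable (fun v => mixPayoff F p ρ base v i) D :=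
      Integrable.of_bound hm.aestronglyMeasurable (1 + ρ) (hmem.mono fun v hv => by
        rw [Real.norm_eq_abs, abs_le]; constructor <;> linarith [hv.1, hv.2])
    set m := ∫ v, mixPayoff F p ρ base v i ∂D with hmd
    have hm1 : m ≤ 1 := by
      calc m ≤ ∫ _, (1 : ℝ) ∂D := integral_mono_ae hi (integrable_const _)
            (hmem.mono fun v hv => hv.2)
        _ = 1 := by simp
    have hm0 : -ρ ≤ m := by
      calc -ρ = ∫ _, -ρ ∂D := by simp
        _ ≤ m := integral_mono_ae (integrable_const _) hi (hmem.mono fun v hv => hv.1)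
    have hV : Measurable fun v => (m - mixPayoff F p ρ base v i) / (1 + ρ) := by fun_prop
    have hVb : ∀ᵐ v ∂D, |(m - mixPayoff F p ρ base v i) / (1 + ρ)| ≤ 1 := by
      filter_upwards [hmem] with v hv
      rw [abs_div, abs_of_pos (by linarith : 0 < 1 + ρ), div_le_one (by linarith), abs_le]
      constructor <;> linarith [hv.1, hv.2]
    have hV2 : ∀ᵐ v ∂D, ((m - mixPayoff F p ρ base v i) / (1 + ρ)) ^ 2 ≤ 1 :=
      hVb.mono fun v hv => by rwa [sq_le_one_iff_abs_le_one]
    have hint2 : Integrable (fun v => ((m - mixPayoff F p ρ base v i) / (1 + ρ)) ^ 2) D :=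
      Integrable.of_bound (hV.pow_const 2).aestronglyMeasurable 1 (hV2.mono fun v hv => by
        rw [Real.norm_eq_abs, abs_of_nonneg (sq_nonneg _)]; exact hv)
    have := lintegral_exp_le_of_moments (μ := D) (l := μ) (m := 0) (q := 1)
      (Integrable.of_bound hV.aestronglyMeasurable 1 hVb) hint2 hμ0
      (hVb.mono fun v hv => (mul_le_of_le_one_right hμ0 (abs_le.1 hv).2).trans hμ1)
      (by rw [integral_div, integral_sub (integrable_const _) hi]; simp [hmd])
      (by
        calc _ ≤ ∫ _, (1 : ℝ) ∂D := integral_mono_ae hint2 (integrable_const _) hV2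
          _ = 1 := by simp)
    simpa using this

/-- On good runs, the reward is at least that of a distribution that respects the budget. -/
lemma reward_ge_of_goodRun (hn : 1 ≤ n) (hT : 1 ≤ T) (hB : 0 < B) (hBT : B ≤ T)
    (hD : ∀ᵐ v ∂D, IsOutcome v)
    {p : Finset (Fin n) → ℝ} (hp : ∀ S, 0 ≤ p S) (hp1 : ∑ S ∈ F, p S = 1)
    (hpc : ∀ i, T * ∑ S ∈ F, p S * meanCost (dummyBase T B i₀) D S i ≤ B + 1)
    {o : ℕ → Outcome n d} {ω : ℕ → RoundSeed n} (ho : ∀ t, IsOutcome (o t))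
    (ho0 : ∀ t e, o t e i₀.succ = 0) (hgood : GoodRun T F (T / B) (dummyBase T B i₀) o ω)
    {δ : ℝ} (hδ : ∀ k ≤ T, ∑ t ∈ Finset.range k,
      mixGap T F p (T / B) (dummyBase T B i₀) D o ω t ≤ δ) :
    T * ∑ S ∈ F, p S * meanReward D S - T / B - runErr (T / B) n d T T - (1 + T / B) * δ ≤
      lagrangeReward T B F T (dummyBase T B i₀) o ω := by
  have hT' : (0 : ℝ) < T := by exact_mod_cast hT
  set base := dummyBase T B i₀ with hbase
  set ρ := (T : ℝ) / B with hρd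
  have hρ : 0 ≤ ρ := by positivity
  have hρB : ρ * B = T := by rw [hρd]; field_simp
  have hcost := fun t S i => actionCost_dummyBase_mem hn hT hB hBT (ho t) (ho0 t) S i
  rw [lagrangeReward_eq]
  set A := runAction T F ρ base o ω
  obtain ⟨τ, hτ, hrew, -, hend⟩ := exists_stopping T B base o A fun t _ i => (hcost t _ i).1
  -- At the end some resource is used up; if all rounds are played, it is the dummy resource.
  obtain ⟨i, hi⟩ : ∃ i, B ≤ ∑ s ∈ Finset.range τ, actionCost base (o s) (A s) i := by
    rcases hend with h | ⟨i, h⟩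
    · refine ⟨i₀, ?_⟩
      rw [h, Finset.sum_congr rfl fun s _ => show actionCost base (o s) (A s) i₀ = B / T by
        simp only [actionCost, hbase, dummyBase, if_true]
        rw [Finset.sum_eq_zero fun e _ => ho0 s e, add_zero]]
      simp only [Finset.sum_const, Finset.card_range, nsmul_eq_mul]
      rw [mul_div_cancel₀ _ hT'.ne']
    · exact ⟨i, h.le⟩
  have hmix : ∑ t ∈ Finset.range τ, mixPayoff F p ρ base (o t) (runResource T F ρ base o ω t) -
      runErr ρ n d T τ ≤ ∑ t ∈ Finset.range τ, (actionReward (o t) (A t) -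
        ρ * actionCost base (o t) (A t) i) := by
    have h1 : ∑ t ∈ Finset.range τ, mixPayoff F p ρ base (o t) (runResource T F ρ base o ω t) =
        ∑ S ∈ F, p S * ∑ t ∈ Finset.range τ, (actionReward (o t) S -
          ρ * actionCost base (o t) S (runResource T F ρ base o ω t)) := by
      unfold mixPayoff
      rw [Finset.sum_comm]
      exact Finset.sum_congr rfl fun S _ => (Finset.mul_sum _ _ _).symm
    have h2 : ∑ S ∈ F, p S * ∑ t ∈ Finset.range τ, (actionReward (o t) S -
          ρ * actionCost base (o t) S (runResource T F ρ base o ω t)) ≤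
        ∑ S ∈ F, p S * (∑ t ∈ Finset.range τ, (actionReward (o t) (A t) -
          ρ * actionCost base (o t) (A t) i) + runErr ρ n d T τ) :=
      Finset.sum_le_sum fun S hS => mul_le_mul_of_nonneg_left
        (by have := hgood τ hτ S hS i; linarith) (hp S)
    rw [← Finset.sum_mul, hp1, one_mul] at h2
    rw [h1]; linarith
  have hgap := hδ τ hτ
  unfold mixGap at hgap
  rw [← Finset.sum_div, div_le_iff₀ (by linarith), Finset.sum_sub_distrib] at hgap
  have hrbar1 : ∑ S ∈ F, p S * meanReward D S ≤ 1 := by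
    calc _ ≤ ∑ S ∈ F, p S * 1 := Finset.sum_le_sum fun S _ => mul_le_mul_of_nonneg_left (by
            calc meanReward D S ≤ ∫ _, (1 : ℝ) ∂D := integral_mono_ae
                  (integrable_actionReward hD S) (integrable_const _)
                  (hD.mono fun v hv => actionReward_le_one hn hv S)
              _ = 1 := by simp) (hp S)
      _ = 1 := by rw [← Finset.sum_mul, hp1, one_mul]
  set rbar := ∑ S ∈ F, p S * meanReward D S
  have hmean : ∀ j, rbar - 1 - 1 / B ≤ ∫ v, mixPayoff F p ρ base v j ∂D := by
    intro j
    rw [integral_mixPayoff hD]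
    simp_rw [mul_sub]
    rw [Finset.sum_sub_distrib]
    have h1 : ∑ S ∈ F, p S * (ρ * meanCost base D S j) =
        (T * ∑ S ∈ F, p S * meanCost base D S j) / B := by
      rw [Finset.mul_sum, Finset.sum_div]
      exact Finset.sum_congr rfl fun S _ => by rw [hρd]; ring
    have h2 : (T * ∑ S ∈ F, p S * meanCost base D S j) / B ≤ (B + 1) / B := by
      gcongr; exact hpc j
    rw [add_div, div_self hB.ne'] at h2
    linarith
  have hsum : τ * (rbar - 1 - 1 / B) ≤ ∑ t ∈ Finset.range τ,
      ∫ v, mixPayoff F p ρ base v (runResource T F ρ base o ω t) ∂D := by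
    calc τ * (rbar - 1 - 1 / B) = ∑ t ∈ Finset.range τ, (rbar - 1 - 1 / B) := by
          rw [Finset.sum_const, Finset.card_range, nsmul_eq_mul]
      _ ≤ _ := Finset.sum_le_sum fun t _ => hmean _
  rw [Finset.sum_sub_distrib, ← Finset.mul_sum, ← hrew] at hmix
  have hτ' : (τ : ℝ) ≤ T := by exact_mod_cast hτ
  have hBi : ρ * B ≤ ρ * ∑ s ∈ Finset.range τ, actionCost base (o s) (A s) i :=
    mul_le_mul_of_nonneg_left hi hρ
  have hτB : (τ : ℝ) * (1 / B) ≤ T / B := by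
    rw [mul_one_div]; gcongr
  have hτr : (T : ℝ) * (rbar - 1) ≤ τ * (rbar - 1) := by nlinarith
  have hErr : runErr ρ n d T τ ≤ runErr ρ n d T T := by
    unfold runErr
    gcongr
  nlinarith

end Stochastic

section StochasticBound

lemma log_two_gt_half : (1 : ℝ) / 2 < Real.log 2 := by
  have := Real.log_two_gt_d9; linarith

lemma half_lt_log {T : ℕ} (hT : 2 ≤ T) : (1 : ℝ) / 2 < Real.log T :=
  log_two_gt_half.trans_le (Real.log_le_log (by norm_num) (by exact_mod_cast hT))

lemma logFactor_le {n T : ℕ} (hn : 1 ≤ n) (hT : 2 ≤ T) (hnT : n ≤ T) :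
    logFactor n T ≤ 3 * Real.log T := by
  have hT' : (2 : ℝ) ≤ T := by exact_mod_cast hT
  have hnT' : (n : ℝ) ≤ T := by exact_mod_cast hnT
  unfold logFactor
  rw [show 3 * Real.log (T : ℝ) = Real.log ((T : ℝ) ^ 3) by rw [Real.log_pow]; norm_num]
  refine Real.log_le_log (by positivity) ?_
  nlinarith [mul_le_mul hT' hnT' (by linarith) (by linarith)]

/-- The regret term is at least a constant times the horizon, unless the horizon is larger than the
number of atoms and the logarithmic factor. -/
lemma le_two_mul_reg {n T : ℕ} (hn : 1 ≤ n) (hT : 2 ≤ T) (h : T ≤ n ∨ (T : ℝ) < logFactor n T) :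
    (T : ℝ) ≤ 2 * reg n T := by
  have hT' : (2 : ℝ) ≤ T := by exact_mod_cast hT
  have hn' : (1 : ℝ) ≤ n := by exact_mod_cast hn
  have hlog := half_lt_log hT
  have h1 : (T : ℝ) / 4 ≤ n * Real.log T := by
    rcases le_or_gt T n with h1 | h1
    · have : (T : ℝ) ≤ n := by exact_mod_cast h1
      nlinarith
    · have h2 := h.resolve_left (by omega)
      have h3 := logFactor_le hn hT h1.le
      nlinarith
  unfold reg
  have h2 : (T : ℝ) / 2 ≤ √(n * T * Real.log T) := by
    rw [Real.le_sqrt' (by positivity)]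
    nlinarith
  linarith

lemma one_le_reg {n T : ℕ} (hn : 1 ≤ n) (hT : 2 ≤ T) : 1 ≤ reg n T := by
  have hT' : (2 : ℝ) ≤ T := by exact_mod_cast hT
  have hn' : (1 : ℝ) ≤ n := by exact_mod_cast hn
  have hlog := half_lt_log hT
  unfold reg
  rw [Real.one_le_sqrt]
  nlinarith [mul_le_mul hn' hT' (by linarith) (by linarith)]

lemma sqrt_mul_logFactor_le {n T : ℕ} (hn : 1 ≤ n) (hT : 2 ≤ T) (hnT : n ≤ T) :
    √(n * T * logFactor n T) ≤ 2 * reg n T := by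
  have hT' : (2 : ℝ) ≤ T := by exact_mod_cast hT
  have hn' : (1 : ℝ) ≤ n := by exact_mod_cast hn
  have hlog := half_lt_log hT
  have h := logFactor_le hn hT hnT
  unfold reg
  rw [Real.sqrt_le_left (by positivity), mul_pow, Real.sq_sqrt (by positivity)]
  have : 0 ≤ (n : ℝ) * T := by positivity
  nlinarith

/-- The error of the first `k` rounds, in terms of the regret term. -/
lemma runErr_le {n d T k : ℕ} (hn : 1 ≤ n) (hT : 2 ≤ T) (hnT : n ≤ T) {ρ : ℝ} (hρ : 0 ≤ ρ)
    (hk : k ≤ T) : runErr ρ n d T k ≤ (1 + ρ) * (52 * reg n T + 2 * √(T * Real.log d)) := by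
  have hT' : (2 : ℝ) ≤ T := by exact_mod_cast hT
  have hn' : (1 : ℝ) ≤ n := by exact_mod_cast hn
  have hΛ := logFactor_pos hn (by omega : 1 ≤ T)
  have hlog := half_lt_log hT
  have h1 := sqrt_mul_logFactor_le hn hT hnT
  have hΛ1 : 1 ≤ logFactor n T := by
    have h4 : (1 : ℝ) ≤ Real.log 4 := by
      rw [show (4 : ℝ) = 2 ^ 2 by norm_num, Real.log_pow]
      have := log_two_gt_half
      push_cast; linarith
    refine h4.trans (Real.log_le_log (by norm_num) ?_)
    nlinarith [mul_le_mul hn' hT' (by linarith) (by linarith)]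
  have h2 : √(2 * n * T / logFactor n T) ≤ 2 * reg n T := by
    unfold reg
    rw [Real.sqrt_le_left (by positivity), mul_pow, Real.sq_sqrt (by positivity)]
    calc 2 * n * T / logFactor n T ≤ 2 * n * T := div_le_self (by positivity) hΛ1
      _ ≤ 2 ^ 2 * (n * T * Real.log T) := by
        have : 0 ≤ (n : ℝ) * T := by positivity
        nlinarith
  have h3 : √(T * logFactor n T) ≤ √(n * T * logFactor n T) := by
    refine Real.sqrt_le_sqrt (mul_le_mul_of_nonneg_right ?_ hΛ.le)
    nlinarith
  have h4 : k * (12 * √(n * logFactor n T / T)) ≤ 12 * √(n * T * logFactor n T) := by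
    have h5 : (T : ℝ) * √(n * logFactor n T / T) = √(n * T * logFactor n T) := by
      nth_rw 1 [← Real.sqrt_sq (show (0 : ℝ) ≤ T by linarith)]
      rw [← Real.sqrt_mul (by positivity)]
      congr 1
      field_simp
    have h6 : (k : ℝ) ≤ T := by exact_mod_cast hk
    have h7 : 0 ≤ √(n * logFactor n T / T) := Real.sqrt_nonneg _
    nlinarith
  unfold runErr
  refine mul_le_mul_of_nonneg_left ?_ (by linarith)
  linarith

variable {n d : ℕ} {T : ℕ} {B : ℝ} {F : Finset (Finset (Fin n))}
  {S₀ : Finset (Fin n)} {i₀ : Fin d} {D : Measure (Outcome n d)}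

lemma ae_stochLaw_outcome {p : (ℕ → Outcome n d) → Prop} (h : ∀ᵐ o ∂(outcomeLaw D), p o) :
    ∀ᵐ x ∂(stochLaw D), p x.1 :=
  Measure.quasiMeasurePreserving_fst.ae h

lemma OPTDP_le [IsProbabilityMeasure D] (hn : 1 ≤ n) (hS₀ : S₀ ∈ F) (hD : ∀ᵐ v ∂D, IsOutcome v) :
    OPTDP T B F i₀ D ≤ T := by
  have : Nonempty (DynPolicy n d F) := ⟨⟨fun _ _ _ => S₀, fun _ _ _ => hS₀, fun t S => by
    by_cases h : S₀ = S <;> simp [h]⟩⟩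
  have : IsProbabilityMeasure unifLaw := inferInstance
  refine ciSup_le fun π => ?_
  have hae : ∀ᵐ x ∂(unifLaw.prod (outcomeLaw D)), ∀ t, IsOutcome (x.2 t) :=
    Measure.quasiMeasurePreserving_snd.ae (ae_outcomeLaw hD)
  calc _ ≤ ∫ _, (T : ℝ) ∂(unifLaw.prod (outcomeLaw D)) := by
        refine integral_mono_of_nonneg (hae.mono fun x hx => ?_) (integrable_const _)
          (hae.mono fun x hx => ?_)
        · exact totalReward_nonneg T B _ (fun t _ => hx t) _
        · exact totalReward_le hn T B _ (fun t _ => hx t) _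
    _ = T := by simp

variable [NeZero d]

lemma measurableSet_goodRun (ρ : ℝ) (base : Fin d → ℝ) :
    MeasurableSet {x : (ℕ → Outcome n d) × (ℕ → RoundSeed n) | GoodRun T F ρ base x.1 x.2} := by
  have hst := fun t => measurable_state T F (α := (ℕ → Outcome n d) × (ℕ → RoundSeed n))
    (ρ := fun _ => ρ) base measurable_const measurable_fst measurable_snd t
  have hot : ∀ t, Measurable fun x : (ℕ → Outcome n d) × (ℕ → RoundSeed n) => x.1 t :=
    fun t => (measurable_pi_apply t).comp measurable_fst
  unfold GoodRun
  simp only [Set.ofPred_forall]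
  refine MeasurableSet.iInter fun k => MeasurableSet.iInter fun _ => MeasurableSet.iInter fun S =>
    MeasurableSet.iInter fun _ => MeasurableSet.iInter fun i => measurableSet_le ?_ ?_
  · refine (Finset.measurable_sum _ fun t _ => ?_).sub measurable_const
    exact (measurable_actionReward (hot t) measurable_const).sub
      ((measurable_actionCost_resource base (hot t) measurable_const (hst t).2.2.2).const_mul ρ)
  · refine Finset.measurable_sum _ fun t _ => ?_
    exact (measurable_actionReward (hot t) (hst t).2.2.1).sub
      ((measurable_actionCost base (hot t) (hst t).2.2.1 i).const_mul ρ)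

variable [IsProbabilityMeasure D]

/-- The probability that the run is not good, or the outcomes do not concentrate. -/
lemma stochLaw_bad_le (hn : 1 ≤ n) (hT : 2 ≤ T) (hB : 0 < B) (hBT : B ≤ T)
    (hΛT : logFactor n T ≤ T) (hF : F.Nonempty)
    (hD : ∀ᵐ v ∂D, IsOutcome v) (hDd : ∀ᵐ v ∂D, ∀ e, v e i₀.succ = 0)
    {p : Finset (Fin n) → ℝ} (hp : ∀ S, 0 ≤ p S) (hp1 : ∑ S ∈ F, p S = 1) :
    stochLaw D {x | ¬ (GoodRun T F (T / B) (dummyBase T B i₀) x.1 x.2 ∧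
      ∀ k ≤ T, ∑ t ∈ Finset.range k, mixGap T F p (T / B) (dummyBase T B i₀) D x.1 x.2 t ≤
        4 * √(T * logFactor n T))} ≤ ENNReal.ofReal (1 / T) := by
  have hT1 : 1 ≤ T := by omega
  have hT' : (2 : ℝ) ≤ T := by exact_mod_cast hT
  have hn' : (1 : ℝ) ≤ n := by exact_mod_cast hn
  have hΛ := logFactor_pos hn hT1
  have hρ : 0 ≤ T / B := by positivity
  set base := dummyBase T B i₀
  set Λ := logFactor n T with hΛd
  set μ := √(Λ / T) with hμ
  have hμ0 : 0 < μ := Real.sqrt_pos.2 (by positivity)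
  have hμ1 : μ ≤ 1 := by
    rw [hμ, Real.sqrt_le_one]; exact (div_le_one (by linarith)).2 hΛT
  have hΛμ : Λ / μ = √(T * Λ) := by
    rw [div_eq_iff hμ0.ne', hμ, ← Real.sqrt_mul (by positivity)]
    have : T * Λ * (Λ / T) = Λ ^ 2 := by field_simp
    rw [this, Real.sqrt_sq hΛ.le]
  have hTμ : T * μ = √(T * Λ) := by
    rw [← hΛμ, eq_div_iff hμ0.ne', mul_assoc, hμ, Real.mul_self_sqrt (by positivity)]
    field_simp
  have h1 : stochLaw D {x | ¬ GoodRun T F (T / B) base x.1 x.2} ≤ ENNReal.ofReal (1 / (T : ℝ) ^ 2) := by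
    unfold stochLaw
    rw [← Set.compl_ofPred, Measure.prod_apply (measurableSet_goodRun _ _).compl]
    calc _ ≤ ∫⁻ _, ENNReal.ofReal (1 / (T : ℝ) ^ 2) ∂(outcomeLaw D) := by
          refine lintegral_mono_ae ?_
          filter_upwards [ae_outcomeLaw hD, ae_outcomeLaw hDd] with o ho ho0
          exact seedLaw_not_goodRun_le hn hT hρ (fun t _ => ho t) hF
            (fun t _ S _ i => actionCost_dummyBase_mem hn hT1 hB hBT (ho t) (ho0 t) S i) hΛT
      _ = _ := by simp
  have h2 : ∀ k ≤ T, stochLaw D {x | k * μ ^ 2 + 3 * Λ < ∑ t ∈ Finset.range k,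
      μ * mixGap T F p (T / B) base D x.1 x.2 t} ≤ ENNReal.ofReal (Real.exp (-(3 * Λ))) := by
    intro k hk
    unfold stochLaw
    rw [Measure.prod_apply_symm (measurableSet_lt measurable_const (Finset.measurable_sum _
      fun t _ => (measurable_mixGap p _ base measurable_fst measurable_snd t).const_mul μ))]
    calc _ ≤ ∫⁻ _, ENNReal.ofReal (Real.exp (-(3 * Λ))) ∂(seedLaw n) :=
          lintegral_mono fun ω => outcomeLaw_mixGap_le hn hT1 hB hBT hD hDd hp hp1 hρ ω hμ0.le hμ1
            hk _
      _ = _ := by simp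
  have hsub : {x : (ℕ → Outcome n d) × (ℕ → RoundSeed n) | ¬ (GoodRun T F (T / B) base x.1 x.2 ∧
      ∀ k ≤ T, ∑ t ∈ Finset.range k, mixGap T F p (T / B) base D x.1 x.2 t ≤ 4 * √(T * Λ))} ⊆
      {x | ¬ GoodRun T F (T / B) base x.1 x.2} ∪ ⋃ k ∈ Finset.range (T + 1),
        {x | k * μ ^ 2 + 3 * Λ < ∑ t ∈ Finset.range k, μ * mixGap T F p (T / B) base D x.1 x.2 t} := by
    intro x hx
    by_contra hcon
    simp only [Set.mem_iUnion, Set.mem_union, Finset.mem_range, not_exists, not_or,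
      Set.mem_ofPred_eq, not_lt, exists_prop, not_and, not_not] at hcon
    refine hx ⟨hcon.1, fun k hk => ?_⟩
    have h3 := hcon.2 k (by omega)
    rw [← Finset.mul_sum] at h3
    have hk' : (k : ℝ) ≤ T := by exact_mod_cast hk
    have h4 : k * μ ^ 2 + 3 * Λ ≤ μ * (4 * √(T * Λ)) := by
      have h5 : μ * √(T * Λ) = Λ := by rw [← hΛμ]; field_simp
      have h6 : k * μ ^ 2 ≤ T * μ ^ 2 := by gcongr
      have h7 : T * μ ^ 2 = μ * √(T * Λ) := by rw [← hTμ]; ring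
      linarith
    exact le_of_mul_le_mul_left (h3.trans h4) hμ0
  have hδ : Real.exp (-(3 * Λ)) ≤ 1 / (8 * (T : ℝ) ^ 3) := by
    have h0 : (0 : ℝ) < 2 * n * T := by positivity
    rw [Real.exp_neg, mul_comm, show Λ * 3 = Λ * (3 : ℕ) by norm_num, Real.exp_mul,
      Real.rpow_natCast, hΛd, logFactor, Real.exp_log h0, ← one_div]
    refine one_div_le_one_div_of_le (by positivity) ?_
    calc 8 * (T : ℝ) ^ 3 = (2 * 1 * (T : ℝ)) ^ 3 := by ring
      _ ≤ (2 * (n : ℝ) * T) ^ 3 := by gcongr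
  calc _ ≤ _ := measure_mono hsub
    _ ≤ ENNReal.ofReal (1 / (T : ℝ) ^ 2) + ∑ k ∈ Finset.range (T + 1),
        ENNReal.ofReal (1 / (8 * (T : ℝ) ^ 3)) := by
      refine (measure_union_le _ _).trans (add_le_add h1 ((measure_biUnion_finset_le _ _).trans
        (Finset.sum_le_sum fun k hk => (h2 k ?_).trans (ENNReal.ofReal_le_ofReal hδ))))
      simpa [Nat.lt_succ_iff] using hk
    _ = ENNReal.ofReal (1 / (T : ℝ) ^ 2 + (T + 1) * (1 / (8 * (T : ℝ) ^ 3))) := by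
      rw [Finset.sum_const, Finset.card_range, nsmul_eq_mul, ENNReal.ofReal_add (by positivity)
        (by positivity), ENNReal.ofReal_mul (by positivity)]
      congr 2
      rw [← ENNReal.ofReal_natCast]; push_cast; rfl
    _ ≤ _ := by
      refine ENNReal.ofReal_le_ofReal ?_
      have hT0 : (0 : ℝ) < T := by linarith
      have e1 : 1 / (T : ℝ) ^ 2 + (T + 1) * (1 / (8 * (T : ℝ) ^ 3)) =
          (8 * T + T + 1) / (8 * (T : ℝ) ^ 3) := by field_simp; ring
      rw [e1, div_le_div_iff₀ (by positivity) hT0]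
      nlinarith [mul_pos hT0 hT0]

lemma stochastic_bound (hn : 1 ≤ n) (hT : 1 ≤ T) (hB : 0 < B) (hBT : B ≤ T) (hS₀ : S₀ ∈ F)
    (hD : ∀ᵐ v ∂D, IsOutcome v) (hD0 : ∀ᵐ v ∂D, IsNullFor S₀ v)
    (hDd : ∀ᵐ v ∂D, ∀ e, v e i₀.succ = 0) :
    1 - 1 / (T : ℝ) ≤ (stochLaw D).real {x | OPTDP T B F i₀ D - stochReward T B F i₀ x ≤
      130 * (T / B * (reg n T + √(T * Real.log d)))} := by
  have : IsProbabilityMeasure (stochLaw D) := by unfold stochLaw; infer_instance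
  have : IsProbabilityMeasure unifLaw := inferInstance
  have hF : F.Nonempty := ⟨S₀, hS₀⟩
  rcases Nat.lt_or_ge T 2 with hT2 | hT2
  · have : T = 1 := by omega
    subst this
    simp
  have hreg := one_le_reg hn hT2
  have hTB : 1 ≤ T / B := (one_le_div hB).2 hBT
  have hsq := Real.sqrt_nonneg (T * Real.log d)
  suffices hbad : stochLaw D {x | OPTDP T B F i₀ D - stochReward T B F i₀ x ≤
      130 * (T / B * (reg n T + √(T * Real.log d)))}ᶜ ≤ ENNReal.ofReal (1 / T) by
    set G := {x : (ℕ → Outcome n d) × (ℕ → RoundSeed n) | OPTDP T B F i₀ D - stochReward T B F i₀ x ≤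
      130 * (T / B * (reg n T + √(T * Real.log d)))}
    have h1 : (stochLaw D).real Gᶜ ≤ 1 / T := ENNReal.toReal_le_of_le_ofReal (by positivity) hbad
    have h2 : (1 : ℝ) ≤ (stochLaw D).real G + (stochLaw D).real Gᶜ := by
      have := measureReal_union_le (μ := stochLaw D) G Gᶜ
      rwa [Set.union_compl_self, probReal_univ] at this
    linarith
  by_cases hbig : T ≤ n ∨ (T : ℝ) < logFactor n T
  · -- the horizon is within a constant factor of the regret term
    have h2 := le_two_mul_reg hn hT2 hbig
    have h3 : ∀ᵐ x ∂(stochLaw D), OPTDP T B F i₀ D - stochReward T B F i₀ x ≤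
        130 * (T / B * (reg n T + √(T * Real.log d))) := by
      filter_upwards [ae_stochLaw_outcome (ae_outcomeLaw hD)] with x hx
      have h4 : 0 ≤ stochReward T B F i₀ x := totalReward_nonneg T B _ (fun t _ => hx t) _
      have h5 := OPTDP_le (T := T) (B := B) (i₀ := i₀) hn hS₀ hD
      nlinarith
    rw [show stochLaw D _ = 0 from h3]
    exact bot_le
  · push Not at hbig
    obtain ⟨hnT, hΛT⟩ := hbig
    have : Nonempty (DynPolicy n d F) := ⟨⟨fun _ _ _ => S₀, fun _ _ _ => hS₀, fun t S => by
      by_cases h : S₀ = S <;> simp [h]⟩⟩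
    -- a nearly optimal policy, with a nearly optimal seed
    obtain ⟨π, hπ⟩ := exists_lt_of_lt_ciSup (show OPTDP T B F i₀ D - 1 < OPTDP T B F i₀ D by linarith)
    have hae : ∀ᵐ x ∂(unifLaw.prod (outcomeLaw D)), ∀ t, IsOutcome (x.2 t) :=
      Measure.quasiMeasurePreserving_snd.ae (ae_outcomeLaw hD)
    have hint : Integrable (fun x : ℝ × (ℕ → Outcome n d) =>
        totalReward T B (dummyBase T B i₀) x.2 (π.play x.1 x.2)) (unifLaw.prod (outcomeLaw D)) :=
      Integrable.of_bound (measurable_totalReward T B _ measurable_snd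
        π.measurable_play).aestronglyMeasurable T (hae.mono fun x hx => by
          rw [Real.norm_eq_abs, abs_of_nonneg (totalReward_nonneg T B _ (fun t _ => hx t) _)]
          exact totalReward_le hn T B _ (fun t _ => hx t) _)
    rw [integral_prod _ hint] at hπ
    obtain ⟨s, hs⟩ := exists_integral_le hint.integral_prod_left
    obtain ⟨p, hp, hp1, hpr, hpc⟩ := exists_fixed_distribution hS₀ (D := D) hn hT hB i₀ hD hD0 hDd
      (fun o => π.play s o) (fun t => (π.measurable_play t).comp
        (measurable_const.prodMk measurable_id)) (fun o t => π.play_mem s o t)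
      (fun t o o' h => π.play_congr s t h)
    refine le_trans ?_ (stochLaw_bad_le (i₀ := i₀) hn hT2 hB hBT hΛT hF hD hDd hp hp1)
    refine measure_mono_ae ?_
    filter_upwards [ae_stochLaw_outcome (ae_outcomeLaw hD), ae_stochLaw_outcome (ae_outcomeLaw hDd)]
      with x hx hx0 hbadx hgood
    refine hbadx ?_
    have h6 := reward_ge_of_goodRun hn hT hB hBT hD hp hp1 hpc hx hx0 hgood.1 hgood.2
    have h7 := runErr_le (d := d) hn hT2 hnT.le (ρ := T / B) (by positivity) le_rfl
    have h8 : √(T * logFactor n T) ≤ 2 * reg n T := by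
      refine le_trans (Real.sqrt_le_sqrt (mul_le_mul_of_nonneg_right ?_
        (logFactor_pos hn hT).le)) (sqrt_mul_logFactor_le hn hT2 hnT.le)
      have : (1 : ℝ) ≤ n := by exact_mod_cast hn
      nlinarith
    simp only [Set.mem_ofPred_eq, stochReward]
    set L := lagrangeReward T B F T (dummyBase T B i₀) x.1 x.2
    set q := √(T * Real.log d)
    set r := reg n T
    have h9 : (1 + T / B) * (4 * √(T * logFactor n T)) ≤ (1 + T / B) * (8 * r) :=
      mul_le_mul_of_nonneg_left (by linarith) (by linarith)
    have h10 : (1 + T / B) * (60 * r + 2 * q) ≤ (2 * (T / B)) * (60 * r + 2 * q) :=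
      mul_le_mul_of_nonneg_right (by linarith) (by linarith)
    have h11 : (T : ℝ) / B ≤ T / B * r := le_mul_of_one_le_right (by linarith) hreg
    have h12 : 0 ≤ T / B * q := mul_nonneg (by linarith) hsq
    nlinarith

end StochasticBound

/-! ### Fixed distributions in the adversarial version -/

section Resampling

variable {ι α : Type*} [Fintype ι] [DecidableEq ι] [Fintype α]

/-- Under a product distribution, a coordinate is independent of the functions that do not depend
on it. -/
lemma sum_prod_mul_eval {p : α → ℝ} (hp : ∑ x, p x = 1) (t : ι) (f : (ι → α) → ℝ)
    (hf : ∀ a x, f (Function.update a t x) = f a) (g : α → ℝ) :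
    ∑ a : ι → α, (∏ s, p (a s)) * (f a * g (a t)) =
      (∑ a : ι → α, (∏ s, p (a s)) * f a) * ∑ x, p x * g x := by
  -- exchange the coordinate with an independent copy
  let e : (ι → α) × α ≃ (ι → α) × α :=
    { toFun := fun y => (Function.update y.1 t y.2, y.1 t)
      invFun := fun y => (Function.update y.1 t y.2, y.1 t)
      left_inv := fun y => by simp
      right_inv := fun y => by simp }
  have h1 : ∀ (a : ι → α) x, (∏ s, p (Function.update a t x s)) * p (a t) = (∏ s, p (a s)) * p x := by
    intro a x
    rw [← Finset.mul_prod_erase _ _ (Finset.mem_univ t), ← Finset.mul_prod_erase Finset.univ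
      (fun s => p (a s)) (Finset.mem_univ t), Function.update_self,
      Finset.prod_congr rfl fun s hs => by rw [Function.update_of_ne (Finset.ne_of_mem_erase hs)]]
    ring
  calc ∑ a : ι → α, (∏ s, p (a s)) * (f a * g (a t))
      = ∑ y : (ι → α) × α, (∏ s, p (y.1 s)) * p y.2 * (f y.1 * g (y.1 t)) := by
        rw [Fintype.sum_prod_type]
        refine Finset.sum_congr rfl fun a _ => ?_
        simp only
        rw [← Finset.sum_mul, ← Finset.mul_sum, hp, mul_one]
    _ = ∑ y : (ι → α) × α, (∏ s, p (y.1 s)) * p y.2 * (f y.1 * g y.2) := by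
        rw [← Equiv.sum_comp e]
        refine Finset.sum_congr rfl fun y _ => ?_
        simp only [e, Equiv.coe_fn_mk, Function.update_self, hf]
        rw [h1]
    _ = _ := by
        rw [Fintype.sum_prod_type, Finset.sum_mul]
        refine Finset.sum_congr rfl fun a _ => ?_
        rw [Finset.mul_sum]
        exact Finset.sum_congr rfl fun x _ => by ring

end Resampling

/-- Summation by parts: a weighted sum with decreasing weights in `[0, 1]` is at most the largest
partial sum. -/
lemma sum_mul_le_of_antitone {T : ℕ} {w x : ℕ → ℝ} (hw0 : ∀ t < T, 0 ≤ w t) (hw1 : ∀ t < T, w t ≤ 1)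
    (hw : ∀ s t, s ≤ t → t < T → w t ≤ w s) {M : ℝ}
    (hM : ∀ k ≤ T, ∑ t ∈ Finset.range k, x t ≤ M) :
    ∑ t ∈ Finset.range T, w t * x t ≤ M := by
  have key : ∀ k ≤ T, ∀ v, 0 ≤ v → v ≤ 1 → (∀ t < k, v ≤ w t) →
      ∑ t ∈ Finset.range k, w t * x t ≤ M - v * (M - ∑ t ∈ Finset.range k, x t) := by
    intro k
    induction k with
    | zero =>
      intro _ v h0 h1 _
      have := hM 0 (Nat.zero_le _)
      simp only [Finset.range_zero, Finset.sum_empty] at this ⊢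
      nlinarith
    | succ k ih =>
      intro hk v h0 h1 hv
      have h2 := ih (by omega) (w k) (hw0 k (by omega)) (hw1 k (by omega))
        fun t ht => hw t k ht.le (by omega)
      have h3 := hM (k + 1) hk
      have h4 := hv k (by omega)
      rw [Finset.sum_range_succ] at h3 ⊢
      rw [Finset.sum_range_succ]
      nlinarith
  simpa using key T le_rfl 0 le_rfl zero_le_one fun t ht => hw0 t ht

variable {n d : ℕ}

/-- Expected reward in one round of the distribution `p` over the feasible actions. -/
def distReward {F : Finset (Finset (Fin n))} (p : F → ℝ) (v : Outcome n d) : ℝ :=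
  ∑ S : F, p S * actionReward v S

/-- Expected consumption in one round of the distribution `p` over the feasible actions. -/
def distCost {F : Finset (Finset (Fin n))} (p : F → ℝ) (v : Outcome n d) (i : Fin d) : ℝ :=
  ∑ S : F, p S * actionCost 0 v S i

lemma actionCost_zero_mem (hn : 1 ≤ n) {v : Outcome n d} (hv : IsOutcome v) (S : Finset (Fin n))
    (i : Fin d) : 0 ≤ actionCost 0 v S i ∧ actionCost 0 v S i ≤ 1 := by
  unfold actionCost
  rw [Pi.zero_apply, zero_add]
  exact ⟨Finset.sum_nonneg fun e _ => (hv e _).1,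
    (sum_outcome_le_one hv _ _).trans (card_div_le_one hn _)⟩

/-- The reward of a fixed distribution is a sum over the rounds, weighted with the probability that
the round is played. With the same weights, the consumptions respect the budget up to the
overshoot in the last round. -/
lemma exists_weights {F : Finset (Finset (Fin n))} {T : ℕ} {B : ℝ} (hB : 0 ≤ B) (hn : 1 ≤ n)
    {o : ℕ → Outcome n d} (ho : ∀ t < T, IsOutcome (o t)) {p : F → ℝ} (hp : ∀ S, 0 ≤ p S)
    (hp1 : ∑ S, p S = 1) :
    ∃ w : ℕ → ℝ, (∀ t < T, 0 ≤ w t) ∧ (∀ t < T, w t ≤ 1) ∧ (∀ s t, s ≤ t → t < T → w t ≤ w s) ∧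
      fixedDistReward T B F o p = ∑ t ∈ Finset.range T, w t * distReward p (o t) ∧
      ∀ i, ∑ t ∈ Finset.range T, w t * distCost p (o t) i ≤ B + 1 := by
  classical
  let act : (Fin T → F) → ℕ → Finset (Fin n) := fun a t =>
    if h : t < T then (a ⟨t, h⟩ : Finset (Fin n)) else ∅
  let alive : (Fin T → F) → ℕ → Prop := fun a t =>
    ∀ i, ∑ s ∈ Finset.range t, actionCost 0 (o s) (act a s) i ≤ B
  let w : ℕ → ℝ := fun t => ∑ a : Fin T → F, (∏ s, p (a s)) * if alive a t then 1 else 0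
  have hP0 : ∀ a : Fin T → F, 0 ≤ ∏ s, p (a s) := fun a => Finset.prod_nonneg fun s _ => hp _
  have hP1 : ∑ a : Fin T → F, ∏ s, p (a s) = 1 := by
    rw [← Fintype.piFinset_univ, ← Finset.prod_univ_sum]
    rw [hp1, Finset.prod_const_one]
  have hsplit : ∀ (t : ℕ) (ht : t < T) (g : Finset (Fin n) → ℝ),
      ∑ a : Fin T → F, (∏ s, p (a s)) * (if alive a t then g (act a t) else 0) =
        w t * ∑ S : F, p S * g S := by
    intro t ht g
    rw [← sum_prod_mul_eval hp1 (⟨t, ht⟩ : Fin T) (fun a => if alive a t then 1 else 0) ?_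
      (fun S => g S)]
    · refine Finset.sum_congr rfl fun a _ => ?_
      simp only [act, ht, dif_pos]
      split_ifs <;> simp
    · intro a x
      have : alive (Function.update a ⟨t, ht⟩ x) t ↔ alive a t := by
        refine forall_congr' fun i => ?_
        rw [Finset.sum_congr rfl fun s hs => ?_]
        have hs' := Finset.mem_range.1 hs
        simp only [act, hs'.trans ht, dif_pos]
        rw [Function.update_of_ne]
        simp [Fin.ext_iff, hs'.ne]
      simp only [this]
  have hsum : ∀ g : ℕ → Finset (Fin n) → ℝ,
      ∑ a : Fin T → F, (∏ s, p (a s)) * ∑ t ∈ Finset.range T, (if alive a t then g t (act a t) else 0) =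
        ∑ t ∈ Finset.range T, w t * ∑ S : F, p S * g t S := by
    intro g
    simp_rw [Finset.mul_sum (Finset.range T)]
    rw [Finset.sum_comm]
    exact Finset.sum_congr rfl fun t ht => by
      rw [hsplit t (Finset.mem_range.1 ht) (g t)]
  refine ⟨w, ?_, ?_, ?_, ?_, ?_⟩
  · exact fun t _ => Finset.sum_nonneg fun a _ => mul_nonneg (hP0 a) (by split_ifs <;> norm_num)
  · intro t _
    rw [← hP1]
    exact Finset.sum_le_sum fun a _ => mul_le_of_le_one_right (hP0 a) (by split_ifs <;> norm_num)
  · intro s t hst ht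
    refine Finset.sum_le_sum fun a _ => mul_le_mul_of_nonneg_left ?_ (hP0 a)
    by_cases h : alive a t
    · rw [if_pos h, if_pos]
      intro i
      refine (Finset.sum_le_sum_of_subset_of_nonneg (Finset.range_mono hst)
        fun r hr _ => ?_).trans (h i)
      exact (actionCost_zero_mem hn (ho r ((Finset.mem_range.1 hr).trans ht)) _ i).1
    · rw [if_neg h]; split_ifs <;> norm_num
  · have := hsum fun t S => actionReward (o t) S
    unfold distReward
    rw [← this]
    unfold fixedDistReward totalReward
    refine Finset.sum_congr rfl fun a _ => ?_
    congr 1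
  · intro i
    have := hsum fun t S => actionCost 0 (o t) S i
    unfold distCost
    rw [← this]
    calc _ ≤ ∑ a : Fin T → F, (∏ s, p (a s)) * (B + 1) := by
          refine Finset.sum_le_sum fun a _ => mul_le_mul_of_nonneg_left ?_ (hP0 a)
          exact sum_alive_le hB _ T (fun t ht => (actionCost_zero_mem hn (ho t ht) _ i).1)
            (fun t ht => (actionCost_zero_mem hn (ho t ht) _ i).2) (alive a) fun t _ h => h i
      _ = B + 1 := by rw [← Finset.sum_mul, hP1, one_mul]

/-! ### Rewards of good runs in the adversarial version -/

lemma runErr_mono {n d T k l : ℕ} {ρ : ℝ} (hρ : 0 ≤ ρ) (h : k ≤ l) :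
    runErr ρ n d T k ≤ runErr ρ n d T l := by
  unfold runErr
  gcongr

section Dist

variable {n d : ℕ} {F : Finset (Finset (Fin n))} {p : F → ℝ} {v : Outcome n d}

lemma distReward_nonneg (hp : ∀ S, 0 ≤ p S) (hv : IsOutcome v) : 0 ≤ distReward p v :=
  Finset.sum_nonneg fun S _ => mul_nonneg (hp S) (actionReward_nonneg hv S)

lemma distReward_le_one (hn : 1 ≤ n) (hp : ∀ S, 0 ≤ p S) (hp1 : ∑ S, p S = 1) (hv : IsOutcome v) :
    distReward p v ≤ 1 := by
  rw [← hp1]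
  exact Finset.sum_le_sum fun S _ => mul_le_of_le_one_right (hp S) (actionReward_le_one hn hv S)

lemma distCost_nonneg (hn : 1 ≤ n) (hp : ∀ S, 0 ≤ p S) (hv : IsOutcome v) (i : Fin d) :
    0 ≤ distCost p v i :=
  Finset.sum_nonneg fun S _ => mul_nonneg (hp S) (actionCost_zero_mem hn hv S i).1

end Dist

/-- A sum of entries `c t (I t)` is at most the sum over all indices. -/
lemma sum_choice_le {d k : ℕ} {c : ℕ → Fin d → ℝ} (I : ℕ → Fin d) (hc : ∀ t < k, ∀ i, 0 ≤ c t i)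
    {M : ℝ} (hM : ∀ i, ∑ t ∈ Finset.range k, c t i ≤ M) :
    ∑ t ∈ Finset.range k, c t (I t) ≤ d * M := by
  calc ∑ t ∈ Finset.range k, c t (I t) ≤ ∑ t ∈ Finset.range k, ∑ i, c t i :=
        Finset.sum_le_sum fun t ht => Finset.single_le_sum (f := fun i => c t i)
          (fun i _ => hc t (Finset.mem_range.1 ht) i) (Finset.mem_univ _)
    _ = ∑ i, ∑ t ∈ Finset.range k, c t i := Finset.sum_comm
    _ ≤ ∑ _i : Fin d, M := Finset.sum_le_sum fun i _ => hM i
    _ = d * M := by simp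

section Weights

variable {T : ℕ} {Y : ℝ} {w r : ℕ → ℝ}

/-- The rewards lost in a prefix are at most the total loss. -/
lemma le_sum_reward (hw1 : ∀ t < T, w t ≤ 1) (hr0 : ∀ t < T, 0 ≤ r t) (hr1 : ∀ t < T, r t ≤ 1)
    (hY : Y = ∑ t ∈ Finset.range T, w t * r t) {k : ℕ} (hk : k ≤ T) :
    k - (T - Y) ≤ ∑ t ∈ Finset.range k, r t := by
  have h1 : ∑ t ∈ Finset.range k, (1 - r t) ≤ ∑ t ∈ Finset.range T, (1 - r t) :=
    Finset.sum_le_sum_of_subset_of_nonneg (Finset.range_mono hk) fun t ht _ => by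
      linarith [hr1 t (Finset.mem_range.1 ht)]
  have h2 : ∑ t ∈ Finset.range T, (1 - r t) ≤ ∑ t ∈ Finset.range T, (1 - w t * r t) :=
    Finset.sum_le_sum fun t ht => by
      have ht' := Finset.mem_range.1 ht
      nlinarith [hw1 t ht', hr0 t ht']
  rw [Finset.sum_sub_distrib] at h1
  rw [Finset.sum_sub_distrib _ (fun t => w t * r t), ← hY] at h2
  simp only [Finset.sum_const, Finset.card_range, nsmul_eq_mul, mul_one] at h1 h2
  linarith

/-- If almost all of the maximal reward is collected, then rounds in the first half are played with
probability close to one. -/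
lemma le_weight (hw0 : ∀ t < T, 0 ≤ w t) (hw1 : ∀ t < T, w t ≤ 1)
    (hw : ∀ s t, s ≤ t → t < T → w t ≤ w s) (hr1 : ∀ t < T, r t ≤ 1)
    (hY : Y = ∑ t ∈ Finset.range T, w t * r t) {ε : ℝ} (hε : 0 ≤ ε) (hYε : (1 - ε) * T ≤ Y) {t : ℕ}
    (ht : 2 * t < T) : 1 - 2 * ε ≤ w t := by
  have h1 : Y ≤ ∑ s ∈ Finset.range T, w s := by
    rw [hY]
    exact Finset.sum_le_sum fun s hs => by
      have hs' := Finset.mem_range.1 hs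
      exact mul_le_of_le_one_right (hw0 s hs') (hr1 s hs')
  have h2 : ∑ s ∈ Finset.range T, w s ≤ ∑ s ∈ Finset.range T, (if s < t then 1 else w t) :=
    Finset.sum_le_sum fun s hs => by
      have hs' := Finset.mem_range.1 hs
      split_ifs with h
      · exact hw1 s hs'
      · exact hw t s (by omega) hs'
  have h3 : ∑ s ∈ Finset.range T, (if s < t then 1 else w t) = t + (T - t) * w t := by
    rw [← Finset.sum_range_add_sum_Ico _ (by omega : t ≤ T),
      Finset.sum_congr rfl fun s hs => if_pos (Finset.mem_range.1 hs),
      Finset.sum_congr (s₁ := Finset.Ico t T) rfl fun s hs =>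
        if_neg (not_lt.2 (Finset.mem_Ico.1 hs).1)]
    simp only [Finset.sum_const, Finset.card_range, Nat.card_Ico, nsmul_eq_mul, mul_one]
    rw [Nat.cast_sub (by omega)]
  have h4 : (2 : ℝ) * t < T := by exact_mod_cast ht
  by_contra hcon
  push Not at hcon
  have h6 : (T - t) * w t < (T - t) * (1 - 2 * ε) := mul_lt_mul_of_pos_left hcon (by linarith)
  nlinarith

/-- Consumption in a prefix in which the weights are bounded below. -/
lemma sum_cost_le_div {c : ℕ → ℝ} {k : ℕ} (hk : k ≤ T) (hw0 : ∀ t < T, 0 ≤ w t)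
    (hc : ∀ t < T, 0 ≤ c t) {v M : ℝ} (hv : 0 < v) (hvw : ∀ t < k, v ≤ w t)
    (hM : ∑ t ∈ Finset.range T, w t * c t ≤ M) : ∑ t ∈ Finset.range k, c t ≤ M / v := by
  rw [le_div_iff₀ hv, Finset.sum_mul]
  calc ∑ t ∈ Finset.range k, c t * v ≤ ∑ t ∈ Finset.range k, w t * c t :=
        Finset.sum_le_sum fun t ht => by
          have ht' := Finset.mem_range.1 ht
          nlinarith [hc t (by omega), hvw t ht']
    _ ≤ ∑ t ∈ Finset.range T, w t * c t :=
        Finset.sum_le_sum_of_subset_of_nonneg (Finset.range_mono hk) fun t ht _ =>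
          mul_nonneg (hw0 t (Finset.mem_range.1 ht)) (hc t (Finset.mem_range.1 ht))
    _ ≤ M := hM

end Weights

section Run

variable {n d : ℕ} [NeZero d] {T : ℕ} {F : Finset (Finset (Fin n))} {S₀ : Finset (Fin n)} {ρ : ℝ}
  {o : ℕ → Outcome n d} {ω : ℕ → RoundSeed n}

/-- Good runs have small regret against mixtures of the null action and a fixed distribution. -/
lemma GoodRun.mix (hgood : GoodRun T F ρ 0 o ω) (hS₀ : S₀ ∈ F) (hnull : ∀ t < T, IsNullFor S₀ (o t))
    {p : F → ℝ} (hp : ∀ S, 0 ≤ p S) (hp1 : ∑ S, p S = 1) {s : ℝ} (hs0 : 0 ≤ s) (hs1 : s ≤ 1) {k : ℕ}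
    (hk : k ≤ T) (i : Fin d) :
    s * ∑ t ∈ Finset.range k, (distReward p (o t) -
        ρ * distCost p (o t) (runResource T F ρ 0 o ω t)) - runErr ρ n d T k ≤
      ∑ t ∈ Finset.range k, actionReward (o t) (runAction T F ρ 0 o ω t) -
        ρ * ∑ t ∈ Finset.range k, actionCost 0 (o t) (runAction T F ρ 0 o ω t) i := by
  set M := ∑ t ∈ Finset.range k, actionReward (o t) (runAction T F ρ 0 o ω t) -
    ρ * ∑ t ∈ Finset.range k, actionCost 0 (o t) (runAction T F ρ 0 o ω t) i with hM
  have hg : ∀ S ∈ F, ∑ t ∈ Finset.range k, (actionReward (o t) S -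
      ρ * actionCost 0 (o t) S (runResource T F ρ 0 o ω t)) ≤ M + runErr ρ n d T k := by
    intro S hS
    have := hgood k hk S hS i
    rw [Finset.sum_sub_distrib (fun t => actionReward (o t) (runAction T F ρ 0 o ω t)),
      ← Finset.mul_sum, ← hM] at this
    linarith
  have h0 : 0 ≤ M + runErr ρ n d T k := by
    have := hg S₀ hS₀
    rwa [Finset.sum_eq_zero fun t ht => ?_] at this
    have h := hnull t (by have := Finset.mem_range.1 ht; omega)
    simp only [actionReward, actionCost, Pi.zero_apply, zero_add]
    rw [h 0, h]
    ring
  have h1 : ∑ t ∈ Finset.range k, (distReward p (o t) -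
      ρ * distCost p (o t) (runResource T F ρ 0 o ω t)) ≤ M + runErr ρ n d T k := by
    calc _ = ∑ S : F, p S * ∑ t ∈ Finset.range k, (actionReward (o t) S -
          ρ * actionCost 0 (o t) S (runResource T F ρ 0 o ω t)) := by
          simp_rw [Finset.mul_sum]
          rw [Finset.sum_comm]
          refine Finset.sum_congr rfl fun t _ => ?_
          unfold distReward distCost
          rw [Finset.mul_sum, ← Finset.sum_sub_distrib]
          exact Finset.sum_congr rfl fun S _ => by ring
      _ ≤ ∑ S : F, p S * (M + runErr ρ n d T k) :=
          Finset.sum_le_sum fun S _ => mul_le_mul_of_nonneg_left (hg S S.2) (hp S)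
      _ = _ := by rw [← Finset.sum_mul, hp1, one_mul]
  nlinarith

variable {B : ℝ} {p : F → ℝ} {w : ℕ → ℝ} {Y : ℝ}

/-- The basic lower bound: against the null action if the run stops early, and against the fixed
distribution otherwise. -/
lemma reward_ge_min (hn : 1 ≤ n) (ho : ∀ t < T, IsOutcome (o t)) (hgood : GoodRun T F ρ 0 o ω)
    (hS₀ : S₀ ∈ F) (hnull : ∀ t < T, IsNullFor S₀ (o t)) (hρ : 0 ≤ ρ)
    (hp : ∀ S, 0 ≤ p S) (hp1 : ∑ S, p S = 1)
    (hw0 : ∀ t < T, 0 ≤ w t) (hw1 : ∀ t < T, w t ≤ 1) (hw : ∀ s t, s ≤ t → t < T → w t ≤ w s)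
    (hY : Y = ∑ t ∈ Finset.range T, w t * distReward p (o t))
    (hc : ∀ i, ∑ t ∈ Finset.range T, w t * distCost p (o t) i ≤ B + 1) :
    min (ρ * B) (Y - d * (ρ * (B + 1))) - runErr ρ n d T T ≤
      totalReward T B 0 o (runAction T F ρ 0 o ω) := by
  set A := runAction T F ρ 0 o ω with hA
  set I := runResource T F ρ 0 o ω with hI
  have hcA : ∀ t < T, ∀ i, 0 ≤ actionCost 0 (o t) (A t) i := fun t ht i =>
    (actionCost_zero_mem hn (ho t ht) _ i).1
  obtain ⟨τ, hτ, hrew, -, hend⟩ := exists_stopping T B 0 o A hcA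
  rw [hrew]
  rcases hend with h | ⟨i, h⟩
  · subst h
    have h1 : ∑ t ∈ Finset.range τ, w t * (distReward p (o t) - ρ * distCost p (o t) (I t)) ≤
        ∑ t ∈ Finset.range τ, actionReward (o t) (A t) + runErr ρ n d τ τ := by
      refine sum_mul_le_of_antitone hw0 hw1 hw fun k hk => ?_
      have h2 := hgood.mix hS₀ hnull hp hp1 zero_le_one le_rfl hk (0 : Fin d)
      rw [one_mul] at h2
      have h3 : 0 ≤ ρ * ∑ t ∈ Finset.range k, actionCost 0 (o t) (A t) (0 : Fin d) :=
        mul_nonneg hρ (Finset.sum_nonneg fun t ht => hcA t (by have := Finset.mem_range.1 ht; omega) _)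
      have h4 : ∑ t ∈ Finset.range k, actionReward (o t) (A t) ≤
          ∑ t ∈ Finset.range τ, actionReward (o t) (A t) :=
        Finset.sum_le_sum_of_subset_of_nonneg (Finset.range_mono hk) fun t ht _ =>
          actionReward_nonneg (ho t (Finset.mem_range.1 ht)) _
      have h5 := runErr_mono (n := n) (d := d) (T := τ) hρ hk
      linarith
    have h6 : ∑ t ∈ Finset.range τ, w t * distCost p (o t) (I t) ≤ d * (B + 1) :=
      sum_choice_le (c := fun t i => w t * distCost p (o t) i) I
        (fun t ht i => mul_nonneg (hw0 t ht) (distCost_nonneg hn hp (ho t ht) i)) hc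
    have h7 : ∑ t ∈ Finset.range τ, w t * (distReward p (o t) - ρ * distCost p (o t) (I t)) =
        Y - ρ * ∑ t ∈ Finset.range τ, w t * distCost p (o t) (I t) := by
      rw [hY, Finset.mul_sum, ← Finset.sum_sub_distrib]
      exact Finset.sum_congr rfl fun t _ => by ring
    have h8 := mul_le_mul_of_nonneg_left h6 hρ
    have h9 := min_le_right (ρ * B) (Y - d * (ρ * (B + 1)))
    linarith
  · have h2 := hgood.mix hS₀ hnull hp hp1 le_rfl zero_le_one hτ i
    rw [zero_mul] at h2
    have h3 := mul_le_mul_of_nonneg_left h.le hρ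
    have h5 := runErr_mono (n := n) (d := d) (T := T) hρ hτ
    have h9 := min_le_left (ρ * B) (Y - d * (ρ * (B + 1)))
    linarith

/-- A refined lower bound if the fixed distribution collects most of the maximal reward: then a small
share `s` of it in the comparator pays for the part of the regret that grows with time. -/
lemma reward_ge_of_mixed_comparator (hn : 1 ≤ n) (hT : 1 ≤ T) (ho : ∀ t < T, IsOutcome (o t))
    (hgood : GoodRun T F ρ 0 o ω) (hS₀ : S₀ ∈ F) (hnull : ∀ t < T, IsNullFor S₀ (o t)) (hρ : 0 ≤ ρ)
    (hp : ∀ S, 0 ≤ p S) (hp1 : ∑ S, p S = 1)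
    (hw0 : ∀ t < T, 0 ≤ w t) (hw1 : ∀ t < T, w t ≤ 1) (hw : ∀ s t, s ≤ t → t < T → w t ≤ w s)
    (hY : Y = ∑ t ∈ Finset.range T, w t * distReward p (o t))
    (hc : ∀ i, ∑ t ∈ Finset.range T, w t * distCost p (o t) i ≤ B + 1)
    (hYT : 3 / 4 * T ≤ Y) {s E : ℝ} (hs0 : 0 ≤ s) (hs1 : s ≤ 1)
    (hE : ∀ k : ℕ, runErr ρ n d T k = E + k * s) :
    min (ρ * B - E - s * (T - Y + ρ * (d * (2 * (B + 1)))))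
        ((T / 2 : ℕ) - (T - Y) - ρ * (d * (2 * (B + 1))) - runErr ρ n d T T) ≤
      totalReward T B 0 o (runAction T F ρ 0 o ω) := by
  set A := runAction T F ρ 0 o ω
  set I := runResource T F ρ 0 o ω
  have hcA : ∀ t < T, ∀ i, 0 ≤ actionCost 0 (o t) (A t) i := fun t ht i =>
    (actionCost_zero_mem hn (ho t ht) _ i).1
  obtain ⟨τ, hτ, hrew, -, hend⟩ := exists_stopping T B 0 o A hcA
  have hr0 := fun t (ht : t < T) => distReward_nonneg hp (ho t ht)
  have hr1 := fun t (ht : t < T) => distReward_le_one hn hp hp1 (ho t ht)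
  have hx : ∀ k ≤ T / 2, k - (T - Y) - ρ * (d * (2 * (B + 1))) ≤
      ∑ t ∈ Finset.range k, (distReward p (o t) - ρ * distCost p (o t) (I t)) := by
    intro k hk
    have h1 := le_sum_reward hw1 hr0 hr1 hY (by omega : k ≤ T)
    have h2 : ∑ t ∈ Finset.range k, distCost p (o t) (I t) ≤ d * (2 * (B + 1)) := by
      refine sum_choice_le I (fun t ht i => distCost_nonneg hn hp (ho t (by omega)) i) fun i => ?_
      have := sum_cost_le_div (by omega : k ≤ T) hw0
        (fun t ht => distCost_nonneg hn hp (ho t ht) i) (v := 1 / 2) (by norm_num) (fun t ht => ?_) (hc i)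
      · linarith
      · have := le_weight hw0 hw1 hw hr1 hY (ε := 1 / 4) (by norm_num) (by linarith)
          (by omega : 2 * t < T)
        linarith
    rw [Finset.sum_sub_distrib, ← Finset.mul_sum]
    have := mul_le_mul_of_nonneg_left h2 hρ
    linarith
  rw [hrew]
  rcases le_or_gt τ (T / 2) with hτ2 | hτ2
  · obtain ⟨i, hi⟩ := hend.resolve_left (by omega)
    have h1 := hgood.mix hS₀ hnull hp hp1 hs0 hs1 hτ i
    have h2 := mul_le_mul_of_nonneg_left (hx τ hτ2) hs0
    have h3 := mul_le_mul_of_nonneg_left hi.le hρ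
    rw [hE] at h1
    refine (min_le_left _ _).trans ?_
    linarith
  · have h1 := hgood.mix hS₀ hnull hp hp1 zero_le_one le_rfl (by omega : T / 2 ≤ T) (0 : Fin d)
    have h2 := hx (T / 2) le_rfl
    have h3 : 0 ≤ ρ * ∑ t ∈ Finset.range (T / 2), actionCost 0 (o t) (A t) (0 : Fin d) :=
      mul_nonneg hρ (Finset.sum_nonneg fun t ht => hcA t (by have := Finset.mem_range.1 ht; omega) _)
    have h4 : ∑ t ∈ Finset.range (T / 2), actionReward (o t) (A t) ≤
        ∑ t ∈ Finset.range τ, actionReward (o t) (A t) :=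
      Finset.sum_le_sum_of_subset_of_nonneg (Finset.range_mono hτ2.le) fun t ht _ =>
        actionReward_nonneg (ho t (by have := Finset.mem_range.1 ht; omega)) _
    have h5 := runErr_mono (n := n) (d := d) (T := T) hρ (by omega : T / 2 ≤ T)
    refine (min_le_right _ _).trans ?_
    linarith

/-- A lower bound with a gain `a`, if the set of all atoms is feasible and nearly optimal. Then all
actions consume at most as much as this set, which exhausts the budget of resource `i` at a time
`Z i` that does not depend on the run; the run cannot stop at a time that is far from all `Z i`. -/
lemma reward_ge_of_gap (hn : 1 ≤ n) (hT : 1 ≤ T) (ho : ∀ t < T, IsOutcome (o t))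
    (hgood : GoodRun T F ρ 0 o ω) (hS₀ : S₀ ∈ F) (hnull : ∀ t < T, IsNullFor S₀ (o t)) (hρ : 0 ≤ ρ)
    (hF : Finset.univ ∈ F)
    (hr : ∀ k ≤ T, k - (T - Y) ≤ ∑ t ∈ Finset.range k, actionReward (o t) Finset.univ)
    {M : ℝ} (hD : ∀ i, ∑ t ∈ Finset.range (T / 2), actionCost 0 (o t) Finset.univ i ≤ M)
    {a b : ℝ} (hfree : ∀ i, (sInf {k | B < ∑ t ∈ Finset.range k, actionCost 0 (o t) Finset.univ i} : ℕ)
        ≤ b ∨ 4 * a ≤ (sInf {k | B < ∑ t ∈ Finset.range k, actionCost 0 (o t) Finset.univ i} : ℕ))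
    (h1 : ρ * B + a ≤ (T / 2 : ℕ) - (T - Y) - ρ * (d * M) - runErr ρ n d T T)
    (h2 : ρ * B + a ≤ 4 * a - (T - Y) - ρ * (d * M) - runErr ρ n d T T)
    (h3 : b < ρ * (2 * B - M) - runErr ρ n d T T) :
    ρ * B + a ≤ totalReward T B 0 o (runAction T F ρ 0 o ω) := by
  set A := runAction T F ρ 0 o ω
  set I := runResource T F ρ 0 o ω
  have hcA : ∀ t < T, ∀ i, 0 ≤ actionCost 0 (o t) (A t) i := fun t ht i =>
    (actionCost_zero_mem hn (ho t ht) _ i).1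
  have hcU : ∀ t < T, ∀ i, 0 ≤ actionCost 0 (o t) Finset.univ i := fun t ht i =>
    (actionCost_zero_mem hn (ho t ht) _ i).1
  have hcle : ∀ t < T, ∀ i, actionCost 0 (o t) (A t) i ≤ actionCost 0 (o t) Finset.univ i := by
    intro t ht i
    unfold actionCost
    gcongr
    · exact fun e _ _ => (ho t ht e _).1
    · exact Finset.subset_univ _
  obtain ⟨τ, hτ, hrew, -, hend⟩ := exists_stopping T B 0 o A hcA
  rw [hrew]
  -- comparison with the set of all atoms on a prefix
  have hU : ∀ k ≤ T / 2, k ≤ τ → k - (T - Y) - ρ * (d * M) - runErr ρ n d T T ≤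
      ∑ t ∈ Finset.range τ, actionReward (o t) (A t) := by
    intro k hk hkτ
    have e1 := hgood k (by omega) _ hF (0 : Fin d)
    rw [Finset.sum_sub_distrib, Finset.sum_sub_distrib, ← Finset.mul_sum, ← Finset.mul_sum] at e1
    have e2 : ∑ t ∈ Finset.range k, actionCost 0 (o t) Finset.univ (I t) ≤ d * M :=
      sum_choice_le (c := fun t i => actionCost 0 (o t) Finset.univ i) I
        (fun t ht i => hcU t (by omega) i) fun i =>
        (Finset.sum_le_sum_of_subset_of_nonneg (Finset.range_mono hk) fun t ht _ =>
          hcU t (by have := Finset.mem_range.1 ht; omega) i).trans (hD i)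
    have e3 := mul_le_mul_of_nonneg_left e2 hρ
    have e4 : 0 ≤ ρ * ∑ t ∈ Finset.range k, actionCost 0 (o t) (A t) (0 : Fin d) :=
      mul_nonneg hρ (Finset.sum_nonneg fun t ht => hcA t (by have := Finset.mem_range.1 ht; omega) _)
    have e5 : ∑ t ∈ Finset.range k, actionReward (o t) (A t) ≤
        ∑ t ∈ Finset.range τ, actionReward (o t) (A t) :=
      Finset.sum_le_sum_of_subset_of_nonneg (Finset.range_mono hkτ) fun t ht _ =>
        actionReward_nonneg (ho t (by have := Finset.mem_range.1 ht; omega)) _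
    have e6 := runErr_mono (n := n) (d := d) (T := T) hρ (by omega : k ≤ T)
    have e7 := hr k (by omega)
    linarith
  rcases lt_or_ge (T / 2) τ with hτ2 | hτ2
  · exact h1.trans (hU _ le_rfl hτ2.le)
  obtain ⟨i, hi⟩ := hend.resolve_left (by omega)
  set Zs := {k | B < ∑ t ∈ Finset.range k, actionCost 0 (o t) Finset.univ i}
  have hτZ : τ ∈ Zs := hi.trans_le (Finset.sum_le_sum fun t ht =>
    hcle t (by have := Finset.mem_range.1 ht; omega) i)
  have hZτ : sInf Zs ≤ τ := Nat.sInf_le hτZ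
  have hZ : B < ∑ t ∈ Finset.range (sInf Zs), actionCost 0 (o t) Finset.univ i :=
    Nat.sInf_mem ⟨τ, hτZ⟩
  rcases hfree i with hlow | hhigh
  · -- after `sInf Zs`, little can be consumed, so nearly the whole budget was consumed before
    exfalso
    set z := sInf Zs
    have e1 := hgood z (hZτ.trans hτ) _ hS₀ i
    rw [Finset.sum_eq_zero fun t ht => ?_] at e1
    swap
    · have h := hnull t (by have := Finset.mem_range.1 ht; omega)
      simp only [actionReward, actionCost, Pi.zero_apply, zero_add]
      rw [h 0, h]
      ring
    rw [Finset.sum_sub_distrib, ← Finset.mul_sum] at e1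
    have e2 : ∑ t ∈ Finset.range z, actionReward (o t) (A t) ≤ z := by
      calc _ ≤ ∑ t ∈ Finset.range z, (1 : ℝ) := Finset.sum_le_sum fun t ht =>
            actionReward_le_one hn (ho t (by have := Finset.mem_range.1 ht; omega)) _
        _ = z := by simp
    have e3 : ∑ t ∈ Finset.range τ, actionCost 0 (o t) (A t) i ≤
        ∑ t ∈ Finset.range z, actionCost 0 (o t) (A t) i + (M - B) := by
      rw [← Finset.sum_range_add_sum_Ico _ hZτ]
      have e4 : ∑ t ∈ Finset.Ico z τ, actionCost 0 (o t) (A t) i ≤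
          ∑ t ∈ Finset.Ico z τ, actionCost 0 (o t) Finset.univ i :=
        Finset.sum_le_sum fun t ht => hcle t (by have := (Finset.mem_Ico.1 ht).2; omega) i
      have e5 := Finset.sum_range_add_sum_Ico (fun t => actionCost 0 (o t) Finset.univ i) hZτ
      have e6 : ∑ t ∈ Finset.range τ, actionCost 0 (o t) Finset.univ i ≤ M :=
        (Finset.sum_le_sum_of_subset_of_nonneg (Finset.range_mono hτ2) fun t ht _ =>
          hcU t (by have := Finset.mem_range.1 ht; omega) i).trans (hD i)
      linarith
    have e7 : ρ * (2 * B - M) ≤ ρ * ∑ t ∈ Finset.range z, actionCost 0 (o t) (A t) i :=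
      mul_le_mul_of_nonneg_left (by linarith) hρ
    have e8 := runErr_mono (n := n) (d := d) (T := T) hρ (hZτ.trans hτ)
    linarith
  · have := hU _ (hZτ.trans hτ2) hZτ
    linarith

end Run

/-! ### Expected reward as a function of the guess -/

section GameValue

variable {n d : ℕ} [NeZero d]

/-- Expected reward of the game for the guess `G` of the benchmark. -/
def gameValue (T : ℕ) (B : ℝ) (F : Finset (Finset (Fin n))) (o : ℕ → Outcome n d) (G : ℝ) : ℝ :=
  ∫ ω, lagrangeReward T B F (G / (d + 1)) 0 o ω ∂(seedLaw n)

variable {T : ℕ} {B : ℝ} {F : Finset (Finset (Fin n))} {o : ℕ → Outcome n d}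

lemma measurable_lagrangeReward (T : ℕ) (B : ℝ) (F : Finset (Finset (Fin n))) (o : ℕ → Outcome n d)
    {α : Type*} [MeasurableSpace α] {T₀ : α → ℝ} {ω : α → ℕ → RoundSeed n} (hT₀ : Measurable T₀)
    (hω : Measurable ω) : Measurable fun a => lagrangeReward T B F (T₀ a) 0 o (ω a) := by
  simp only [lagrangeReward_eq]
  exact measurable_totalReward T B 0 measurable_const fun t =>
    (measurable_state T F (ρ := fun a => T₀ a / B) 0
      (o := fun _ => o) (hT₀.div_const B) measurable_const hω t).2.2.1

lemma measurable_gameValue (T : ℕ) (B : ℝ) (F : Finset (Finset (Fin n))) (o : ℕ → Outcome n d) :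
    Measurable (gameValue T B F o) :=
  (measurable_lagrangeReward T B F o (α := ℝ × (ℕ → RoundSeed n)) (T₀ := fun x => x.1 / (d + 1))
    (measurable_fst.div_const _) measurable_snd).stronglyMeasurable.integral_prod_right.measurable

lemma lagrangeReward_nonneg (ho : ∀ t < T, IsOutcome (o t)) (T₀ : ℝ) (ω : ℕ → RoundSeed n) :
    0 ≤ lagrangeReward T B F T₀ 0 o ω := totalReward_nonneg T B 0 ho _

lemma lagrangeReward_le (hn : 1 ≤ n) (ho : ∀ t < T, IsOutcome (o t)) (T₀ : ℝ)
    (ω : ℕ → RoundSeed n) : lagrangeReward T B F T₀ 0 o ω ≤ T := totalReward_le hn T B 0 ho _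

lemma abs_lagrangeReward_le (hn : 1 ≤ n) (ho : ∀ t < T, IsOutcome (o t)) (T₀ : ℝ)
    (ω : ℕ → RoundSeed n) : |lagrangeReward T B F T₀ 0 o ω| ≤ T :=
  (abs_of_nonneg (lagrangeReward_nonneg ho T₀ ω)).trans_le (lagrangeReward_le hn ho T₀ ω)

lemma gameValue_nonneg (ho : ∀ t < T, IsOutcome (o t)) (G : ℝ) : 0 ≤ gameValue T B F o G :=
  integral_nonneg fun _ => lagrangeReward_nonneg ho _ _

lemma gameValue_le (hn : 1 ≤ n) (ho : ∀ t < T, IsOutcome (o t)) (G : ℝ) :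
    gameValue T B F o G ≤ T := by
  calc gameValue T B F o G ≤ ∫ _, (T : ℝ) ∂(seedLaw n) :=
        integral_mono_of_nonneg (Filter.Eventually.of_forall fun _ => lagrangeReward_nonneg ho _ _)
          (integrable_const _) (Filter.Eventually.of_forall fun _ => lagrangeReward_le hn ho _ _)
    _ = T := by simp

/-- Lower bounds that hold on good runs hold in expectation, up to an additive constant. -/
lemma le_gameValue_of_goodRun (hn : 1 ≤ n) (hT : 2 ≤ T) (hB : 0 < B) (ho : ∀ t < T, IsOutcome (o t))
    (hF : F.Nonempty) (hΛT : logFactor n T ≤ T) {G : ℝ} (hG : 0 ≤ G) {L : ℝ}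
    (hL : ∀ ω, GoodRun T F (G / (d + 1) / B) 0 o ω →
      L ≤ totalReward T B 0 o (runAction T F (G / (d + 1) / B) 0 o ω)) :
    L - 1 ≤ gameValue T B F o G := by
  have hT' : (2 : ℝ) ≤ T := by exact_mod_cast hT
  rcases le_or_gt L 0 with hL0 | hL0
  · have := gameValue_nonneg (B := B) (F := F) ho G
    linarith
  have hbad := seedLaw_not_goodRun_le hn hT (ρ := G / (d + 1) / B) (by positivity) ho hF
    (base := 0) (fun t ht S _ i => actionCost_zero_mem hn (ho t ht) S i) hΛT
  set ρ := G / (d + 1) / B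
  set good : Set (ℕ → RoundSeed n) := {ω | GoodRun T F ρ 0 o ω}
  have hmeas : MeasurableSet good :=
    (measurable_const.prodMk measurable_id : Measurable fun ω : ℕ → RoundSeed n => (o, ω))
      (measurableSet_goodRun (T := T) (F := F) ρ 0)
  have hP : 1 - 1 / (T : ℝ) ^ 2 ≤ (seedLaw n).real good := by
    have h1 : (seedLaw n).real goodᶜ ≤ 1 / (T : ℝ) ^ 2 :=
      ENNReal.toReal_le_of_le_ofReal (by positivity) hbad
    rw [probReal_compl_eq_one_sub hmeas] at h1
    linarith
  have hLT : L ≤ T := by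
    by_contra hcon
    have : good = ∅ := by
      refine Set.eq_empty_of_forall_notMem fun ω hω => hcon ?_
      exact (hL ω hω).trans (totalReward_le hn T B 0 ho _)
    rw [this, measureReal_empty] at hP
    have : 1 / (T : ℝ) ^ 2 < 1 := by
      rw [div_lt_one (by positivity)]
      nlinarith
    linarith
  have h2 : L * (seedLaw n).real good ≤ gameValue T B F o G := by
    have h3 : ∫ ω, good.indicator (fun _ => L) ω ∂(seedLaw n) = L * (seedLaw n).real good := by
      rw [integral_indicator_const _ hmeas, smul_eq_mul, mul_comm]
    rw [← h3]
    have hint : Integrable (fun ω => lagrangeReward T B F (G / (d + 1)) 0 o ω) (seedLaw n) :=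
      integrable_of_abs_le (measurable_lagrangeReward T B F o measurable_const measurable_id) T fun ω => abs_lagrangeReward_le hn ho _ ω
    refine integral_mono ((integrable_const L).indicator hmeas) hint fun ω => ?_
    by_cases h : ω ∈ good
    · simp only [Set.indicator_of_mem h]
      exact hL ω h
    · simp only [Set.indicator_of_notMem h]
      exact lagrangeReward_nonneg ho _ ω
  have h4 : L * (1 - 1 / (T : ℝ) ^ 2) ≤ L * (seedLaw n).real good :=
    mul_le_mul_of_nonneg_left hP hL0.le
  have h5 : L * (1 / (T : ℝ) ^ 2) ≤ 1 := by
    rw [mul_one_div, div_le_one (by positivity)]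
    nlinarith
  linarith

lemma intervalIntegrable_gameValue (hn : 1 ≤ n) (ho : ∀ t < T, IsOutcome (o t)) (a b : ℝ) :
    IntervalIntegrable (fun x => gameValue T B F o (Real.exp x)) volume a b := by
  refine (intervalIntegrable_const (c := (T : ℝ))).mono_fun
    ((measurable_gameValue T B F o).comp Real.measurable_exp).aestronglyMeasurable
    (Filter.Eventually.of_forall fun x => ?_)
  simp only [Real.norm_eq_abs]
  rw [abs_of_nonneg (gameValue_nonneg ho _)]
  exact (gameValue_le hn ho _).trans (le_abs_self _)

/-- The guess is log-uniform: the average over the scale `κ ^ u` is an average over the logarithm of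
the guess, whatever the value of `κ` is. -/
lemma advExpectedReward_eq (hn : 1 ≤ n) (hT : 2 ≤ T) (ho : ∀ t < T, IsOutcome (o t)) {κ : ℝ}
    (hκ : 1 < κ) : advExpectedReward T B F κ o =
      (∫ x in (Real.log T / 2)..Real.log T, gameValue T B F o (Real.exp x)) / (Real.log T / 2) := by
  have hT' : (2 : ℝ) ≤ T := by exact_mod_cast hT
  have hT0 : (0 : ℝ) < T := by linarith
  have hlogT : 0 < Real.log T := Real.log_pos (by linarith)
  have hlogκ : 0 < Real.log κ := Real.log_pos hκ
  have hsq : 0 < √(T : ℝ) := Real.sqrt_pos.2 hT0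
  have hlogsq : Real.log √(T : ℝ) = Real.log T / 2 := Real.log_sqrt hT0.le
  set L := Real.logb κ (T / √(T : ℝ)) with hL
  have hLκ : L * Real.log κ = Real.log T / 2 := by
    rw [hL, Real.logb, div_mul_cancel₀ _ hlogκ.ne', Real.log_div hT0.ne' hsq.ne', hlogsq]
    ring
  have hL0 : 0 < L := by
    by_contra h
    push Not at h
    nlinarith
  have hvol : volume (Set.Icc 0 L) = ENNReal.ofReal L := by rw [Real.volume_Icc, sub_zero]
  unfold advExpectedReward
  have hmeas : Measurable fun x : ℝ × (ℕ → RoundSeed n) =>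
      lagrangeReward T B F (√(T : ℝ) * κ ^ x.1 / (d + 1)) 0 o x.2 :=
    measurable_lagrangeReward T B F o (by fun_prop) measurable_snd
  have hint : Integrable (fun x : ℝ × (ℕ → RoundSeed n) =>
      lagrangeReward T B F (√(T : ℝ) * κ ^ x.1 / (d + 1)) 0 o x.2)
      ((ProbabilityTheory.cond volume (Set.Icc 0 L)).prod (seedLaw n)) :=
    integrable_of_abs_le hmeas T fun x => abs_lagrangeReward_le hn ho _ _
  rw [integral_prod _ hint]
  change ∫ u, gameValue T B F o (√(T : ℝ) * κ ^ u) ∂(ProbabilityTheory.cond volume (Set.Icc 0 L)) = _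
  have hexp : ∀ u : ℝ, √(T : ℝ) * κ ^ u = Real.exp (Real.log κ * u + Real.log T / 2) := by
    intro u
    rw [Real.exp_add, ← hlogsq, Real.exp_log hsq, Real.rpow_def_of_pos (by linarith), mul_comm]
  simp_rw [hexp]
  rw [ProbabilityTheory.cond, integral_smul_measure, integral_Icc_eq_integral_Ioc,
    ← intervalIntegral.integral_of_le hL0.le,
    intervalIntegral.integral_comp_mul_add (fun x => gameValue T B F o (Real.exp x)) hlogκ.ne',
    hvol]
  rw [ENNReal.toReal_inv, ENNReal.toReal_ofReal hL0.le, smul_eq_mul, smul_eq_mul, mul_zero, zero_add,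
    show Real.log κ * L + Real.log T / 2 = Real.log T by rw [mul_comm, hLκ]; ring, ← hLκ]
  field_simp

/-- Integral of an affine function of the guess. -/
lemma le_integral_of_affine {f : ℝ → ℝ} {a b : ℝ} (hab : a ≤ b) (hf : IntervalIntegrable f volume a b)
    {α β : ℝ} (h : ∀ x ∈ Set.Icc a b, α + β * Real.exp x ≤ f x) :
    α * (b - a) + β * (Real.exp b - Real.exp a) ≤ ∫ x in a..b, f x := by
  have h1 : ∫ x in a..b, (α + β * Real.exp x) = α * (b - a) + β * (Real.exp b - Real.exp a) := by
    rw [intervalIntegral.integral_add (by simp) (by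
      exact (Continuous.intervalIntegrable (by fun_prop) _ _)),
      intervalIntegral.integral_const, intervalIntegral.integral_const_mul, integral_exp, smul_eq_mul]
    ring
  rw [← h1]
  exact intervalIntegral.integral_mono_on hab (Continuous.intervalIntegrable (by fun_prop) _ _) hf h

end GameValue

/-! ### Lower bounds for the expected reward -/

/-- An adversarial instance with a fixed distribution `p` over the actions, its expected reward `Y`
and the probabilities `w` with which it plays the rounds. -/
structure Benchmark {n d : ℕ} (T : ℕ) (B : ℝ) (F : Finset (Finset (Fin n))) (S₀ : Finset (Fin n))
    (o : ℕ → Outcome n d) (p : F → ℝ) (w : ℕ → ℝ) (Y : ℝ) : Prop where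
  one_le_n : 1 ≤ n
  two_le_T : 2 ≤ T
  B_pos : 0 < B
  n_le_T : n ≤ T
  logFactor_le_T : logFactor n T ≤ T
  mem : S₀ ∈ F
  isOutcome : ∀ t < T, IsOutcome (o t)
  isNull : ∀ t < T, IsNullFor S₀ (o t)
  p_nonneg : ∀ S, 0 ≤ p S
  sum_p : ∑ S, p S = 1
  w_nonneg : ∀ t < T, 0 ≤ w t
  w_le_one : ∀ t < T, w t ≤ 1
  w_anti : ∀ s t, s ≤ t → t < T → w t ≤ w s
  Y_eq : Y = ∑ t ∈ Finset.range T, w t * distReward p (o t)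
  cost_le : ∀ i, ∑ t ∈ Finset.range T, w t * distCost p (o t) i ≤ B + 1

/-- Constant of the regret bound. -/
def regConst (d : ℕ) : ℝ := 52 + 4 * √(Real.log d)

lemma regConst_ge (d : ℕ) : 52 ≤ regConst d := by
  unfold regConst
  have := Real.sqrt_nonneg (Real.log d)
  linarith

lemma sqrt_le_two_mul_reg {n T : ℕ} (hn : 1 ≤ n) (hT : 2 ≤ T) : √(T : ℝ) ≤ 2 * reg n T := by
  have hT' : (2 : ℝ) ≤ T := by exact_mod_cast hT
  have hn' : (1 : ℝ) ≤ n := by exact_mod_cast hn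
  have hlog := half_lt_log hT
  unfold reg
  rw [Real.sqrt_le_left (by positivity), mul_pow, Real.sq_sqrt (by positivity)]
  have : (T : ℝ) * (1 / 2) ≤ n * T * Real.log T := by
    refine mul_le_mul ?_ hlog.le (by norm_num) (by positivity)
    nlinarith
  linarith

lemma runErr_le_reg {n d T k : ℕ} (hn : 1 ≤ n) (hT : 2 ≤ T) (hnT : n ≤ T) {ρ : ℝ} (hρ : 0 ≤ ρ)
    (hk : k ≤ T) : runErr ρ n d T k ≤ (1 + ρ) * (regConst d * reg n T) := by
  refine (runErr_le hn hT hnT hρ hk).trans (mul_le_mul_of_nonneg_left ?_ (by linarith))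
  unfold regConst
  have h1 := sqrt_le_two_mul_reg hn hT
  rw [Real.sqrt_mul (Nat.cast_nonneg T)]
  nlinarith [Real.sqrt_nonneg (Real.log d)]

section Bounds

variable {n d : ℕ} {T : ℕ} {B : ℝ} {F : Finset (Finset (Fin n))} {S₀ : Finset (Fin n)}
  {o : ℕ → Outcome n d} {p : F → ℝ} {w : ℕ → ℝ} {Y : ℝ}

lemma Benchmark.Y_nonneg (h : Benchmark T B F S₀ o p w Y) : 0 ≤ Y := by
  rw [h.Y_eq]
  exact Finset.sum_nonneg fun t ht => mul_nonneg (h.w_nonneg t (Finset.mem_range.1 ht))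
    (distReward_nonneg h.p_nonneg (h.isOutcome t (Finset.mem_range.1 ht)))

lemma Benchmark.Y_le (h : Benchmark T B F S₀ o p w Y) : Y ≤ T := by
  have := le_sum_reward h.w_le_one
    (fun t ht => distReward_nonneg h.p_nonneg (h.isOutcome t ht))
    (fun t ht => distReward_le_one h.one_le_n h.p_nonneg h.sum_p (h.isOutcome t ht)) h.Y_eq
    (Nat.zero_le T)
  simp at this
  linarith

variable [NeZero d]

/-- The basic bound. It rises linearly in the guess until the guess is the benchmark, and falls
linearly afterwards. -/
lemma Benchmark.gameValue_ge_min (h : Benchmark T B F S₀ o p w Y) {G : ℝ} (hG : 0 ≤ G) :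
    min (G / (d + 1)) (Y - d * (G / (d + 1))) - (regConst d + d + 1) * reg n T -
      (regConst d + d + 1) * (reg n T / B) * G ≤ gameValue T B F o G := by
  have hB := h.B_pos
  have hreg := one_le_reg h.one_le_n h.two_le_T
  have hK := regConst_ge d
  have hd : (0 : ℝ) ≤ d := Nat.cast_nonneg d
  set ρ := G / (d + 1) / B with hρd
  have hρ : 0 ≤ ρ := by positivity
  have hρB : ρ * B = G / (d + 1) := by rw [hρd]; field_simp
  have hρG : ρ ≤ G / B := by
    rw [hρd]
    gcongr
    exact div_le_self hG (by linarith)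
  refine le_trans ?_ (le_gameValue_of_goodRun h.one_le_n h.two_le_T hB h.isOutcome ⟨S₀, h.mem⟩
    h.logFactor_le_T hG fun ω hω => reward_ge_min h.one_le_n h.isOutcome hω h.mem h.isNull hρ
      h.p_nonneg h.sum_p h.w_nonneg h.w_le_one h.w_anti h.Y_eq h.cost_le)
  have h1 := runErr_le_reg (d := d) h.one_le_n h.two_le_T h.n_le_T hρ (le_refl T)
  have h2 : min (G / (d + 1)) (Y - d * (G / (d + 1))) - d * ρ ≤
      min (ρ * B) (Y - d * (ρ * (B + 1))) := by
    rw [mul_add ρ, hρB, mul_one]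
    refine le_min ?_ ?_
    · have := min_le_left (G / (d + 1)) (Y - d * (G / (d + 1)))
      have : 0 ≤ d * ρ := by positivity
      linarith
    · have := min_le_right (G / (d + 1)) (Y - d * (G / (d + 1)))
      linarith
  have h3 : ρ * reg n T ≤ reg n T / B * G := by
    calc ρ * reg n T ≤ G / B * reg n T := by gcongr
      _ = _ := by ring
  have h4 : ρ ≤ ρ * reg n T := le_mul_of_one_le_right hρ hreg
  nlinarith [mul_le_mul_of_nonneg_left h3 (show 0 ≤ regConst d by linarith),
    mul_le_mul_of_nonneg_left (h4.trans h3) hd]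

/-- The part of the regret bound that does not grow with time is of lower order if there are many
atoms. -/
lemma early_error_le {n T d : ℕ} (hn : 1 ≤ n) (hT : 2 ≤ T) (hnT : n ≤ T)
    (hlog : Real.log T ^ 2 ≤ n) :
    2 * √(2 * n * T / logFactor n T) + 12 * √(T * logFactor n T) + 2 * √(T * Real.log d) ≤
      regConst d * (reg n T / Real.log T) ∧ 1 ≤ reg n T / Real.log T := by
  have hT' : (2 : ℝ) ≤ T := by exact_mod_cast hT
  have hT0 : (0 : ℝ) < T := by linarith
  have hn' : (1 : ℝ) ≤ n := by exact_mod_cast hn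
  have hlT := half_lt_log hT
  have hl0 : 0 < Real.log T := by linarith
  set R := reg n T with hR
  set l := Real.log T with hl
  have hRl : √(T * l) ≤ R / l := by
    rw [le_div_iff₀ hl0, hR, reg, ← hl]
    nth_rw 2 [← Real.sqrt_sq hl0.le]
    rw [← Real.sqrt_mul (by positivity)]
    refine Real.sqrt_le_sqrt ?_
    have : 0 ≤ (T : ℝ) * l := by positivity
    nlinarith
  have hR0 : 0 ≤ R := Real.sqrt_nonneg _
  have hE1 : √(2 * n * T / logFactor n T) ≤ 2 * (R / l) := by
    have hΛ : l ≤ logFactor n T := Real.log_le_log hT0 (by nlinarith)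
    rw [Real.sqrt_le_left (by positivity), mul_pow, div_pow, hR, reg, ← hl,
      Real.sq_sqrt (by positivity)]
    calc 2 * n * T / logFactor n T ≤ 2 * n * T / l := by gcongr
      _ ≤ 2 ^ 2 * (n * T * l / l ^ 2) := by
        rw [show (2 : ℝ) ^ 2 * (n * T * l / l ^ 2) = 4 * n * T / l by field_simp; norm_num]
        gcongr; norm_num
  have hE2 : √(T * logFactor n T) ≤ 2 * (R / l) := by
    refine le_trans ?_ (mul_le_mul_of_nonneg_left hRl zero_le_two)
    have h3 := logFactor_le hn hT hnT
    rw [Real.sqrt_le_left (by positivity), mul_pow, Real.sq_sqrt (by positivity)]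
    nlinarith
  have hE3 : √(T * Real.log d) ≤ 2 * √(Real.log d) * (R / l) := by
    rw [Real.sqrt_mul hT0.le, mul_comm (√(T : ℝ)), mul_comm (2 : ℝ), mul_assoc]
    refine mul_le_mul_of_nonneg_left ?_ (Real.sqrt_nonneg _)
    refine le_trans ?_ (mul_le_mul_of_nonneg_left hRl zero_le_two)
    rw [Real.sqrt_le_left (by positivity), mul_pow, Real.sq_sqrt (by positivity)]
    nlinarith
  refine ⟨?_, ?_⟩
  · rw [regConst]
    have : 0 ≤ R / l := by positivity
    linarith
  · refine le_trans ?_ hRl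
    rw [Real.one_le_sqrt]; nlinarith

/-- The part of the regret bound that grows with time. -/
lemma late_error_le {n T : ℕ} (hn : 1 ≤ n) (hT : 2 ≤ T) (hnT : n ≤ T) :
    12 * √(n * logFactor n T / T) * T ≤ 24 * reg n T := by
  have hT0 : (0 : ℝ) ≤ T := Nat.cast_nonneg T
  have h5 : √(n * logFactor n T / T) * T = √(n * T * logFactor n T) := by
    have hΛ := logFactor_pos hn (by omega : 1 ≤ T)
    nth_rw 2 [← Real.sqrt_sq hT0]
    rw [← Real.sqrt_mul (by positivity)]
    congr 1
    field_simp
  have h6 := sqrt_mul_logFactor_le hn hT hnT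
  rw [mul_assoc, h5]
  linarith

/-- Arithmetic of the refined bound: `R` is the regret term, `l` the logarithm, `X` the guess divided
by `d + 1`, and `C` the consumption of the comparator. -/
lemma refined_bound_arith {K R l t B Y G X ρ e s C d : ℝ} (hK : 52 ≤ K) (hd : 1 ≤ d) (hR : 1 ≤ R)
    (hl : 1 / 2 < l) (ht : 0 < t) (hB : 0 < B) (hY0 : 0 ≤ Y) (hYt : Y ≤ t) (hG : 0 ≤ G) (hGt : G ≤ t)
    (hρ : 0 ≤ ρ) (hρR : ρ * R ≤ R / B * G) (he : e ≤ K * (R / l))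
    (hst : s * t ≤ 24 * ((1 + ρ) * R)) (hC : C ≤ 4 * G) (hC0 : 0 ≤ C) (hRl : 1 ≤ R / l) :
    X - (K + 1) * (R / l + R * ((t - Y) / t)) - (4 * K + 200 * d) * (R / t + R / B) * G + 1 ≤
      X - (1 + ρ) * e - s * (t - Y + C) := by
  have hRG0 : 0 ≤ R / t * G := by positivity
  have hRB0 : 0 ≤ R / B * G := by positivity
  have b3 : 0 ≤ (t - Y) / t := div_nonneg (by linarith) ht.le
  have hδ0 : 0 ≤ R * ((t - Y) / t) := mul_nonneg (by linarith) b3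
  have a1 : (1 + ρ) * e ≤ K * (R / l) + 2 * K * (R / B * G) := by
    have : ρ * (R / l) ≤ 2 * (ρ * R) := by
      rw [← mul_div_assoc, div_le_iff₀ (by linarith)]
      nlinarith [mul_nonneg hρ (by linarith : 0 ≤ R)]
    calc (1 + ρ) * e ≤ (1 + ρ) * (K * (R / l)) := by gcongr
      _ = K * (R / l) + K * (ρ * (R / l)) := by ring
      _ ≤ K * (R / l) + K * (2 * (R / B * G)) := by
        have := this.trans (mul_le_mul_of_nonneg_left hρR zero_le_two)
        gcongr
      _ = _ := by ring
  have a2 : s * (t - Y) ≤ 24 * (R * ((t - Y) / t)) + 24 * (R / B * G) := by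
    have b1 : s * (t - Y) = (s * t) * ((t - Y) / t) := by field_simp
    have b2 : (t - Y) / t ≤ 1 := (div_le_one ht).2 (by linarith)
    rw [b1]
    calc (s * t) * ((t - Y) / t) ≤ (24 * ((1 + ρ) * R)) * ((t - Y) / t) := by gcongr
      _ = 24 * (R * ((t - Y) / t)) + 24 * (ρ * R) * ((t - Y) / t) := by ring
      _ ≤ 24 * (R * ((t - Y) / t)) + 24 * (ρ * R) * 1 := by gcongr
      _ ≤ _ := by linarith
  have a3 : s * C ≤ 96 * (R / t * G) + 96 * (R / B * G) := by
    have b1 : s ≤ 24 * ((1 + ρ) * R) / t := by rw [le_div_iff₀ ht]; exact hst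
    calc s * C ≤ 24 * ((1 + ρ) * R) / t * (4 * G) := by gcongr
      _ = 96 * (R / t * G) + 96 * (ρ * R) * (G / t) := by ring
      _ ≤ 96 * (R / t * G) + 96 * (ρ * R) * 1 := by
        gcongr
        rw [div_le_one ht]; linarith
      _ ≤ _ := by linarith
  have a4 : 96 * (R / t * G) ≤ (4 * K + 200 * d) * (R / t * G) :=
    mul_le_mul_of_nonneg_right (by linarith) hRG0
  have a5 : (2 * K + 120) * (R / B * G) ≤ (4 * K + 200 * d) * (R / B * G) :=
    mul_le_mul_of_nonneg_right (by linarith) hRB0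
  have a6 : 24 * (R * ((t - Y) / t)) ≤ (K + 1) * (R * ((t - Y) / t)) :=
    mul_le_mul_of_nonneg_right (by linarith) hδ0
  have a7 : (K + 1) * (R / l + R * ((t - Y) / t)) = K * (R / l) + R / l +
      (K + 1) * (R * ((t - Y) / t)) := by ring
  have a8 : (4 * K + 200 * d) * (R / t + R / B) * G = (4 * K + 200 * d) * (R / t * G) +
      (4 * K + 200 * d) * (R / B * G) := by ring
  have a9 : s * (t - Y + C) = s * (t - Y) + s * C := by ring
  rw [a7, a8, a9]
  linarith

/-- Consequences of a small regret term for the size of the error. -/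
lemma small_error {n T d : ℕ} [NeZero d] {B σ G : ℝ} (hn : 1 ≤ n) (hT : 2 ≤ T) (hB : 0 < B)
    (hσ : 64 * regConst d * σ ≤ 1) (hσT : reg n T ≤ σ * T) (hσB : reg n T ≤ σ * B) (hG : 0 ≤ G)
    (hGT : G ≤ T) :
    0 < σ ∧ σ ≤ 1 / 3328 ∧ 64 ≤ (T : ℝ) ∧ 1 ≤ B ∧
      (1 + G / (d + 1) / B) * (regConst d * reg n T) ≤ T / 32 ∧
      (1 + G / (d + 1) / B) * reg n T ≤ 2 * σ * T ∧
      G / (d + 1) / B * (d * (2 * (B + 1))) ≤ 4 * G := by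
  have hreg := one_le_reg hn hT
  have hK := regConst_ge d
  have hd : (1 : ℝ) ≤ d := by exact_mod_cast NeZero.one_le
  have hσ0 : 0 < σ := by
    by_contra hcon
    push Not at hcon
    nlinarith
  have hσ1 : σ ≤ 1 / 3328 := by nlinarith
  have hB1 : 1 ≤ B := by nlinarith
  set ρ := G / (d + 1) / B with hρd
  have hρB : ρ * B = G / (d + 1) := by rw [hρd]; field_simp
  have hT₀G : G / (d + 1) ≤ G := div_le_self hG (by linarith)
  have hρR : ρ * reg n T ≤ σ * T := by
    calc ρ * reg n T ≤ ρ * (σ * B) := by gcongr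
      _ = σ * (G / (d + 1)) := by rw [← hρB]; ring
      _ ≤ σ * T := by gcongr; linarith
  have h1 : (1 + ρ) * reg n T ≤ 2 * σ * T := by linarith
  refine ⟨hσ0, hσ1, by nlinarith, hB1, ?_, h1, ?_⟩
  · calc (1 + ρ) * (regConst d * reg n T) = regConst d * ((1 + ρ) * reg n T) := by ring
      _ ≤ regConst d * (2 * σ * T) := by gcongr
      _ = (64 * regConst d * σ) * (T / 32) := by ring
      _ ≤ 1 * (T / 32) := by gcongr
      _ = _ := one_mul _
  · calc ρ * (d * (2 * (B + 1))) ≤ ρ * (d * (4 * B)) := by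
          have : 2 * (B + 1) ≤ 4 * B := by linarith
          gcongr
      _ = 4 * (d * (G / (d + 1))) := by rw [← hρB]; ring
      _ ≤ 4 * G := by
        have : d * (G / (d + 1)) ≤ G := by
          rw [← mul_div_assoc, div_le_iff₀ (by linarith)]; nlinarith
        linarith

/-- A refined bound for many atoms, if the benchmark is close to the horizon: the part of the regret
that does not grow with time is small, and the other part is compensated. -/
lemma Benchmark.gameValue_ge_of_log_sq_le (h : Benchmark T B F S₀ o p w Y)
    (hlog : Real.log T ^ 2 ≤ n) (hYT : 3 / 4 * T ≤ Y) {σ : ℝ} (hσ : 64 * regConst d * σ ≤ 1)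
    (hσT : reg n T ≤ σ * T) (hσB : reg n T ≤ σ * B) {G : ℝ} (hG : 0 ≤ G) (hGT : G ≤ T / 64) :
    G / (d + 1) - (regConst d + 1) * (reg n T / Real.log T + reg n T * ((T - Y) / T)) -
      (4 * regConst d + 200 * d) * (reg n T / T + reg n T / B) * G ≤ gameValue T B F o G := by
  have hn := h.one_le_n
  have hT := h.two_le_T
  have hB := h.B_pos
  have hreg := one_le_reg hn hT
  have hd : (1 : ℝ) ≤ d := by exact_mod_cast NeZero.one_le
  have hT0 : (0 : ℝ) < T := by have : (2 : ℝ) ≤ T := by exact_mod_cast hT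
                               linarith
  have hYle := h.Y_le
  obtain ⟨-, hσ1, hT64, hB1, hErr, hρR3, hcost⟩ :=
    small_error hn hT hB hσ hσT hσB hG (by linarith : G ≤ T)
  obtain ⟨heR, hRl1⟩ := early_error_le (d := d) hn hT h.n_le_T hlog
  have hgR := late_error_le hn hT h.n_le_T
  have hT₀G : G / (d + 1) ≤ G := div_le_self hG (by linarith)
  obtain ⟨ρ, hρd⟩ : ∃ ρ, ρ = G / (d + 1) / B := ⟨_, rfl⟩
  obtain ⟨e, he⟩ : ∃ e, e = 2 * √(2 * n * T / logFactor n T) + 12 * √(T * logFactor n T) +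
    2 * √(T * Real.log d) := ⟨_, rfl⟩
  obtain ⟨g, hg⟩ : ∃ g, g = 12 * √(n * logFactor n T / T) := ⟨_, rfl⟩
  rw [← hρd] at hErr hρR3 hcost
  rw [← he] at heR
  rw [← hg] at hgR
  have hρ : 0 ≤ ρ := by rw [hρd]; positivity
  have hρB : ρ * B = G / (d + 1) := by rw [hρd]; field_simp
  have hρR : ρ * reg n T ≤ reg n T / B * G := by
    calc ρ * reg n T ≤ G / B * reg n T := by rw [hρd]; gcongr
      _ = _ := by ring
  have hg0 : 0 ≤ g := by rw [hg]; positivity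
  have he0 : 0 ≤ e := by rw [he]; positivity
  have hsT : (1 + ρ) * g * T ≤ 24 * ((1 + ρ) * reg n T) := by
    calc (1 + ρ) * g * T = (1 + ρ) * (g * T) := by ring
      _ ≤ (1 + ρ) * (24 * reg n T) := by gcongr
      _ = _ := by ring
  have hs1 : (1 + ρ) * g ≤ 1 := by
    have : (1 + ρ) * g * T ≤ 1 * T := by nlinarith
    exact le_of_mul_le_mul_right this hT0
  have hs0 : 0 ≤ (1 + ρ) * g := by positivity
  have hcost0 : 0 ≤ ρ * (d * (2 * (B + 1))) := by positivity
  have hgood := le_gameValue_of_goodRun (G := G) hn hT hB h.isOutcome ⟨S₀, h.mem⟩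
    h.logFactor_le_T hG fun ω hω => reward_ge_of_mixed_comparator hn (by omega) h.isOutcome hω h.mem
      h.isNull (by rw [← hρd]; exact hρ) h.p_nonneg h.sum_p h.w_nonneg h.w_le_one h.w_anti h.Y_eq
      h.cost_le hYT hs0 hs1 (E := (1 + ρ) * e) (fun k => by rw [runErr, he, hg, hρd]; ring)
  rw [← hρd] at hgood
  refine le_trans ?_ hgood
  have hmain := refined_bound_arith (X := G / (d + 1)) (regConst_ge d) hd hreg (half_lt_log hT) hT0 hB
    h.Y_nonneg hYle hG (by linarith) hρ hρR heR hsT hcost hcost0 hRl1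
  have hlate : ρ * B ≤ (T / 2 : ℕ) - (T - Y) - ρ * (d * (2 * (B + 1))) - runErr ρ n d T T := by
    have b1 := (runErr_le_reg (d := d) hn hT h.n_le_T hρ (le_refl T)).trans hErr
    have b2 : ((T : ℝ) - 1) / 2 ≤ (T / 2 : ℕ) := by
      have : T ≤ 2 * (T / 2) + 1 := by omega
      have : (T : ℝ) ≤ 2 * (T / 2 : ℕ) + 1 := by exact_mod_cast this
      linarith
    rw [hρB]
    linarith
  have hpos : 0 ≤ (1 + ρ) * e + (1 + ρ) * g * (T - Y + ρ * (d * (2 * (B + 1)))) := by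
    have : 0 ≤ (1 + ρ) * g * (T - Y + ρ * (d * (2 * (B + 1)))) := mul_nonneg hs0 (by linarith)
    have : 0 ≤ (1 + ρ) * e := by positivity
    linarith
  rw [← hρB] at hmain
  rw [← hρB]
  have hmin := le_min hmain (by linarith [hmain, hlate, hpos] :
    ρ * B - (regConst d + 1) * (reg n T / Real.log T + reg n T * ((T - Y) / T)) -
      (4 * regConst d + 200 * d) * (reg n T / T + reg n T / B) * G + 1 ≤
      (T / 2 : ℕ) - (T - Y) - ρ * (d * (2 * (B + 1))) - runErr ρ n d T T)
  linarith

end Bounds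

/-! ### A gain for few atoms and a nearly maximal benchmark -/

/-- The scales `a q ^ j` with small `q` are so far apart that one of them is far from all of the `d`
given points. -/
lemma exists_free_scale {d : ℕ} (z : Fin d → ℝ) {a₀ : ℝ} (ha₀ : 0 < a₀) :
    ∃ a, a₀ * (1 / (8 * ((d : ℝ) + 1))) ^ d ≤ a ∧ a ≤ a₀ ∧
      ∀ i, z i ≤ a / (2 * (d + 1)) ∨ 4 * a ≤ z i := by
  set q : ℝ := 1 / (8 * ((d : ℝ) + 1)) with hq
  have hq0 : 0 < q := by positivity
  have hq1 : q ≤ 1 := by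
    rw [hq, div_le_one (by positivity)]; linarith
  suffices h : ∃ j : Fin (d + 1), ∀ i, z i ≤ a₀ * q ^ (j : ℕ) / (2 * (d + 1)) ∨
      4 * (a₀ * q ^ (j : ℕ)) ≤ z i by
    obtain ⟨j, hj⟩ := h
    refine ⟨a₀ * q ^ (j : ℕ), ?_, ?_, hj⟩
    · exact mul_le_mul_of_nonneg_left (pow_le_pow_of_le_one hq0.le hq1 (by omega)) ha₀.le
    · exact mul_le_of_le_one_right ha₀.le (pow_le_one₀ hq0.le hq1)
  -- There are `d + 1` scales and `d` points, and no point is close to two of the scales.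
  by_contra! hcon
  choose f hf using hcon
  obtain ⟨j, k, hjk, hfjk⟩ := Fintype.exists_ne_map_eq_of_card_lt f (by simp)
  have key : ∀ j k : Fin (d + 1), j < k → f j = f k → False := by
    intro j k hlt heq
    have h1 := (hf j).1
    have h2 := (hf k).2
    rw [heq] at h1
    have h3 : q ^ (k : ℕ) ≤ q ^ ((j : ℕ) + 1) :=
      pow_le_pow_of_le_one hq0.le hq1 (Nat.succ_le_of_lt hlt)
    have h4 : 4 * (a₀ * q ^ ((j : ℕ) + 1)) = a₀ * q ^ (j : ℕ) / (2 * (d + 1)) := by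
      rw [pow_succ, hq]; field_simp; norm_num
    have h5 : a₀ * q ^ (k : ℕ) ≤ a₀ * q ^ ((j : ℕ) + 1) := mul_le_mul_of_nonneg_left h3 ha₀.le
    linarith
  rcases lt_or_gt_of_ne hjk with h | h
  · exact key j k h hfjk
  · exact key k j h hfjk.symm

section

variable {n d : ℕ} {F : Finset (Finset (Fin n))} {p : F → ℝ} {v : Outcome n d}

open Classical in
/-- Probability of the set of all atoms. -/
def univProb (p : F → ℝ) : ℝ := ∑ S : F, if (S : Finset (Fin n)) = Finset.univ then p S else 0

/-- Each atom contributes at most `1 / n`, so an action without some atom loses at least `1 / n`. -/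
lemma distReward_le_univProb (hn : 1 ≤ n) (hp : ∀ S, 0 ≤ p S) (hp1 : ∑ S, p S = 1)
    (hv : IsOutcome v) : distReward p v ≤ 1 - (1 - univProb p) / n := by
  classical
  have hn' : (0 : ℝ) < n := by exact_mod_cast hn
  have h1 : ∀ S : F, p S * actionReward v S ≤
      p S - (p S - if (S : Finset (Fin n)) = Finset.univ then p S else 0) / n := by
    intro S
    by_cases h : (S : Finset (Fin n)) = Finset.univ
    · rw [if_pos h, sub_self, zero_div, sub_zero]
      exact mul_le_of_le_one_right (hp S) (actionReward_le_one hn hv S)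
    · rw [if_neg h, sub_zero]
      have hcard : (S : Finset (Fin n)).card + 1 ≤ n := by
        have := Finset.card_lt_univ_of_notMem (s := (S : Finset (Fin n)))
          (Classical.choose_spec (not_forall.1 fun hall => h (Finset.eq_univ_iff_forall.2 hall)))
        simpa using this
      have h2 : ((S : Finset (Fin n)).card : ℝ) / n ≤ 1 - 1 / n := by
        rw [div_le_iff₀ hn', sub_mul, one_mul, one_div, inv_mul_cancel₀ hn'.ne']
        have : ((S : Finset (Fin n)).card : ℝ) + 1 ≤ n := by exact_mod_cast hcard
        linarith
      calc p S * actionReward v S ≤ p S * (1 - 1 / n) :=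
            mul_le_mul_of_nonneg_left ((sum_outcome_le_one hv S 0).trans h2) (hp S)
        _ = _ := by ring
  calc distReward p v ≤ _ := Finset.sum_le_sum fun S _ => h1 S
    _ = _ := by
      rw [Finset.sum_sub_distrib, ← Finset.sum_div, Finset.sum_sub_distrib, hp1]
      rfl

lemma univProb_mul_le_distCost (hn : 1 ≤ n) (hp : ∀ S, 0 ≤ p S) (hv : IsOutcome v) (i : Fin d) :
    univProb p * actionCost 0 v Finset.univ i ≤ distCost p v i := by
  classical
  unfold univProb distCost
  rw [Finset.sum_mul]
  refine Finset.sum_le_sum fun S _ => ?_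
  split_ifs with h
  · rw [h]
  · rw [zero_mul]
    exact mul_nonneg (hp S) (actionCost_zero_mem hn hv S i).1

lemma univ_mem_of_univProb_pos (h : 0 < univProb p) : Finset.univ ∈ F := by
  classical
  by_contra hcon
  refine h.ne' (Finset.sum_eq_zero fun S _ => if_neg fun hS => hcon ?_)
  rw [← hS]; exact S.2

lemma distReward_le_univ (hp : ∀ S, 0 ≤ p S) (hp1 : ∑ S, p S = 1) (hv : IsOutcome v) :
    distReward p v ≤ actionReward v Finset.univ := by
  rw [← one_mul (actionReward v Finset.univ), ← hp1, Finset.sum_mul]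
  refine Finset.sum_le_sum fun S _ => mul_le_mul_of_nonneg_left ?_ (hp S)
  exact Finset.sum_le_sum_of_subset_of_nonneg (Finset.subset_univ _) fun e _ _ => (hv e 0).1

end

/-- The smallest scale of the gain, relative to the horizon. -/
def gainConst (d : ℕ) : ℝ := 1 / 64 * (1 / (8 * ((d : ℝ) + 1))) ^ d

lemma gainConst_pos (d : ℕ) : 0 < gainConst d := by unfold gainConst; positivity

lemma gainConst_le (d : ℕ) : gainConst d ≤ 1 / 64 := by
  unfold gainConst
  refine mul_le_of_le_one_right (by norm_num) (pow_le_one₀ (by positivity) ?_)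
  rw [div_le_one (by positivity)]
  linarith

section Gain

variable {n d : ℕ} {T : ℕ} {B : ℝ} {F : Finset (Finset (Fin n))} {S₀ : Finset (Fin n)}
  {o : ℕ → Outcome n d} {p : F → ℝ} {w : ℕ → ℝ} {Y : ℝ}

/-- If there are few atoms and the benchmark is close to the horizon, then the set of all atoms is
feasible and respects the budget in the first half of the rounds, up to a small factor. -/
lemma Benchmark.univ_near_optimal (h : Benchmark T B F S₀ o p w Y) {θ : ℝ} (hθ0 : 0 < θ)
    (hθ1 : θ ≤ 1 / 4096) (hYn : n * (T - Y) ≤ θ * T) (hBσ : 1 ≤ θ * B) :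
    Finset.univ ∈ F ∧ T - Y ≤ θ * T ∧
      ∀ i, ∑ t ∈ Finset.range (T / 2), actionCost 0 (o t) Finset.univ i ≤ (1 + 8 * θ) * B := by
  have hn := h.one_le_n
  have hT := h.two_le_T
  have hB := h.B_pos
  have hT0 : (0 : ℝ) < T := by have : (2 : ℝ) ≤ T := by exact_mod_cast hT
                               linarith
  have hn' : (1 : ℝ) ≤ n := by exact_mod_cast hn
  have hYle := h.Y_le
  have hr1 := fun t (ht : t < T) => distReward_le_one hn h.p_nonneg h.sum_p (h.isOutcome t ht)
  have hr0 := fun t (ht : t < T) => distReward_nonneg h.p_nonneg (h.isOutcome t ht)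
  -- the set of all atoms is played with probability close to one
  have hP : 1 - θ ≤ univProb p := by
    have h1 : Y ≤ ∑ t ∈ Finset.range T, (1 - (1 - univProb p) / n) := by
      rw [h.Y_eq]
      refine Finset.sum_le_sum fun t ht => ?_
      have ht' := Finset.mem_range.1 ht
      exact (mul_le_of_le_one_left (hr0 t ht') (h.w_le_one t ht')).trans
        (distReward_le_univProb hn h.p_nonneg h.sum_p (h.isOutcome t ht'))
    rw [Finset.sum_const, Finset.card_range, nsmul_eq_mul] at h1
    have h2 : n * Y ≤ T * (n - (1 - univProb p)) := by
      calc n * Y ≤ n * (T * (1 - (1 - univProb p) / n)) := by gcongr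
        _ = _ := by field_simp
    have h3 : (1 - univProb p) * T ≤ θ * T := by linarith
    have := le_of_mul_le_mul_right h3 hT0
    linarith
  have hF : Finset.univ ∈ F := univ_mem_of_univProb_pos (p := p) (by linarith)
  have hYθ : T - Y ≤ θ * T := by nlinarith
  have hw : ∀ t, 2 * t < T → 1 - 2 * θ ≤ w t := fun t ht =>
    le_weight h.w_nonneg h.w_le_one h.w_anti hr1 h.Y_eq hθ0.le (by linarith) ht
  refine ⟨hF, hYθ, fun i => ?_⟩
  have h1 := sum_cost_le_div (by omega : T / 2 ≤ T) h.w_nonneg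
    (fun t ht => distCost_nonneg hn h.p_nonneg (h.isOutcome t ht) i) (v := 1 - 2 * θ) (by linarith)
    (fun t ht => hw t (by omega)) (h.cost_le i)
  have h2 : univProb p * ∑ t ∈ Finset.range (T / 2), actionCost 0 (o t) Finset.univ i ≤
      ∑ t ∈ Finset.range (T / 2), distCost p (o t) i := by
    rw [Finset.mul_sum]
    exact Finset.sum_le_sum fun t ht => univProb_mul_le_distCost hn h.p_nonneg
      (h.isOutcome t (by have := Finset.mem_range.1 ht; omega)) i
  rw [le_div_iff₀ (by linarith)] at h1
  set s := ∑ t ∈ Finset.range (T / 2), actionCost 0 (o t) Finset.univ i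
  have hs0 : 0 ≤ s := Finset.sum_nonneg fun t ht => (actionCost_zero_mem hn
    (h.isOutcome t (by have := Finset.mem_range.1 ht; omega)) _ i).1
  have h3 : (1 - θ) * s ≤ univProb p * s := mul_le_mul_of_nonneg_right hP hs0
  have h4 : (1 - 2 * θ) * ((1 - θ) * s) ≤ (1 + θ) * B := by nlinarith
  have h5 : (1 - 3 * θ) * s ≤ (1 + θ) * B := by nlinarith [mul_nonneg (sq_nonneg θ) hs0]
  have h6 : (1 + θ) * B ≤ (1 - 3 * θ) * ((1 + 8 * θ) * B) := by
    have : 0 ≤ θ * B * (4 - 24 * θ) := mul_nonneg (by positivity) (by linarith)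
    nlinarith
  exact le_of_mul_le_mul_left (h5.trans h6) (by linarith)

/-- If there are few atoms and the benchmark is close to the horizon, then the game has a gain of the
order of the horizon for guesses at some scale. -/
lemma Benchmark.exists_gain [NeZero d] (h : Benchmark T B F S₀ o p w Y) {θ σ : ℝ}
    (hθ : θ = gainConst d / (32 * (d + 1))) (hσθ : σ ≤ θ) (hσ : 64 * regConst d * σ ≤ θ)
    (hYn : n * (T - Y) ≤ θ * T) (hσT : reg n T ≤ σ * T) (hσB : reg n T ≤ σ * B) :
    ∃ a, gainConst d * T ≤ a ∧ a ≤ T / 64 ∧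
      ∀ G, a ≤ G → G ≤ 2 * a → G / (d + 1) + a - 1 ≤ gameValue T B F o G := by
  have hn := h.one_le_n
  have hT := h.two_le_T
  have hB := h.B_pos
  have hreg := one_le_reg hn hT
  have hd : (1 : ℝ) ≤ d := by exact_mod_cast NeZero.one_le
  have hYle := h.Y_le
  have hc0 := gainConst_pos d
  have hc1 := gainConst_le d
  have hθ0 : 0 < θ := by rw [hθ]; positivity
  have hθc : θ * (32 * (d + 1)) = gainConst d := by rw [hθ]; field_simp
  have hθ1 : θ ≤ 1 / 4096 := by nlinarith
  have hr1 := fun t (ht : t < T) => distReward_le_one hn h.p_nonneg h.sum_p (h.isOutcome t ht)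
  have hr0 := fun t (ht : t < T) => distReward_nonneg h.p_nonneg (h.isOutcome t ht)
  have hBσ : 1 ≤ θ * B := by nlinarith
  obtain ⟨hF, hYθ, hD⟩ := h.univ_near_optimal hθ0 hθ1 hYn hBσ
  have hr : ∀ k ≤ T, k - (T - Y) ≤ ∑ t ∈ Finset.range k, actionReward (o t) Finset.univ := by
    intro k hk
    refine (le_sum_reward h.w_le_one hr0 hr1 h.Y_eq hk).trans (Finset.sum_le_sum fun t ht => ?_)
    exact distReward_le_univ h.p_nonneg h.sum_p
      (h.isOutcome t (by have := Finset.mem_range.1 ht; omega))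
  obtain ⟨a, ha1, ha2, hfree⟩ := exists_free_scale (fun i => ((sInf {k | B < ∑ t ∈ Finset.range k,
    actionCost 0 (o t) Finset.univ i} : ℕ) : ℝ)) (show (0 : ℝ) < T / 64 by positivity)
  have hac : gainConst d * T ≤ a := by
    refine le_trans (le_of_eq ?_) ha1
    unfold gainConst; ring
  have ha0 : 0 < a := lt_of_lt_of_le (by positivity) hac
  have haθ : θ * T * (32 * (d + 1)) ≤ a := by
    calc θ * T * (32 * (d + 1)) = gainConst d * T := by rw [← hθc]; ring
      _ ≤ a := hac
  refine ⟨a, hac, ha2, fun G hG1 hG2 => ?_⟩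
  have hG0 : 0 ≤ G := ha0.le.trans hG1
  obtain ⟨-, -, hT64, -, -, hρR3, -⟩ :=
    small_error (d := d) hn hT hB (hσ.trans (by linarith)) hσT hσB hG0 (by linarith : G ≤ T)
  obtain ⟨ρ, hρd⟩ : ∃ ρ, ρ = G / (d + 1) / B := ⟨_, rfl⟩
  rw [← hρd] at hρR3
  have hρ : 0 ≤ ρ := by rw [hρd]; positivity
  have hρB : ρ * B = G / (d + 1) := by rw [hρd]; field_simp
  have hErr : runErr ρ n d T T ≤ θ * T := by
    have hK := regConst_ge d
    refine (runErr_le_reg (d := d) hn hT h.n_le_T hρ (le_refl T)).trans ?_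
    calc (1 + ρ) * (regConst d * reg n T) = regConst d * ((1 + ρ) * reg n T) := by ring
      _ ≤ regConst d * (2 * σ * T) := by gcongr
      _ = (64 * regConst d * σ) * (T / 32) := by ring
      _ ≤ θ * (T / 32) := by gcongr
      _ ≤ θ * T := by nlinarith
  have hdT₀ : d * (ρ * B) + ρ * B = G := by rw [hρB]; field_simp
  have hT₀0 : 0 ≤ ρ * B := by positivity
  have hθT : 64 * (θ * T) ≤ a := by nlinarith
  have hM : ρ * (d * ((1 + 8 * θ) * B)) ≤ d * (ρ * B) + a / 8 := by
    have : 8 * θ * (d * (ρ * B)) ≤ 8 * (1 / 4096) * (2 * a) := by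
      have : d * (ρ * B) ≤ 2 * a := by linarith
      gcongr
    calc ρ * (d * ((1 + 8 * θ) * B)) = d * (ρ * B) + 8 * θ * (d * (ρ * B)) := by ring
      _ ≤ _ := by linarith
  have hT2 : ((T : ℝ) - 1) / 2 ≤ (T / 2 : ℕ) := by
    have : T ≤ 2 * (T / 2) + 1 := by omega
    have : (T : ℝ) ≤ 2 * (T / 2 : ℕ) + 1 := by exact_mod_cast this
    linarith
  have n3 : a / (2 * (d + 1)) < ρ * (2 * B - (1 + 8 * θ) * B) - runErr ρ n d T T := by
    have e1 : ρ * (2 * B - (1 + 8 * θ) * B) = (1 - 8 * θ) * (ρ * B) := by ring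
    have e2 : a / (d + 1) ≤ ρ * B := by rw [hρB]; gcongr
    have e3 : θ * T ≤ a / (d + 1) / 32 := by
      rw [div_div, le_div_iff₀ (by positivity)]; linarith
    have e4 : a / (2 * (d + 1)) = a / (d + 1) / 2 := by rw [div_div, mul_comm]
    have e5 : 0 < a / (d + 1) := by positivity
    have e6 : (1 - 8 * (1 / 4096)) * (a / (d + 1)) ≤ (1 - 8 * θ) * (ρ * B) := by
      gcongr
      linarith
    rw [e1, e4]
    linarith
  have n1 : ρ * B + a ≤ (T / 2 : ℕ) - (T - Y) - ρ * (d * ((1 + 8 * θ) * B)) - runErr ρ n d T T := by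
    linarith
  have n2 : ρ * B + a ≤ 4 * a - (T - Y) - ρ * (d * ((1 + 8 * θ) * B)) - runErr ρ n d T T := by
    linarith
  have hgood : ∀ ω, GoodRun T F ρ 0 o ω → ρ * B + a ≤
      totalReward T B 0 o (runAction T F ρ 0 o ω) := fun ω hω =>
    reward_ge_of_gap hn (by omega) h.isOutcome hω h.mem h.isNull hρ hF hr hD hfree n1 n2 n3
  rw [← hρB]
  rw [hρd] at hgood ⊢
  exact le_gameValue_of_goodRun (G := G) hn hT hB h.isOutcome ⟨S₀, h.mem⟩ h.logFactor_le_T hG0 hgood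

end Gain

/-! ### Averaging over the guesses -/

section Average

variable {n d : ℕ} [NeZero d] {T : ℕ} {B : ℝ} {F : Finset (Finset (Fin n))} {S₀ : Finset (Fin n)}
  {o : ℕ → Outcome n d} {p : F → ℝ} {w : ℕ → ℝ} {Y : ℝ}

/-- Integral of the expected reward over the logarithm of the guess. -/
def guessIntegral (T : ℕ) (B : ℝ) (F : Finset (Finset (Fin n))) (o : ℕ → Outcome n d) : ℝ :=
  ∫ x in (Real.log T / 2)..Real.log T, gameValue T B F o (Real.exp x)

/-- Constant of the basic bound of the expected reward. -/
def baseConst (d : ℕ) : ℝ := regConst d + d + 1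

lemma baseConst_ge (d : ℕ) : 53 ≤ baseConst d := by
  unfold baseConst
  have := regConst_ge d
  have : (0 : ℝ) ≤ d := Nat.cast_nonneg d
  linarith

/-- The tangent bound of the logarithm: a logarithmic loss is absorbed by an arbitrarily small
linear gain. -/
lemma mul_log_div_le {R Y α : ℝ} (hR : 0 < R) (hY : 0 < Y) (hα : 0 < α) :
    R * Real.log (Y / R) ≤ α * Y + R * |Real.log α| := by
  have h1 : Real.log (Y / R) = Real.log (α * (Y / R)) - Real.log α := by
    rw [Real.log_mul hα.ne' (by positivity)]; ring
  have h2 := Real.log_le_sub_one_of_pos (show 0 < α * (Y / R) by positivity)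
  have h3 := neg_abs_le (Real.log α)
  have h4 : Real.log (Y / R) ≤ α * (Y / R) + |Real.log α| := by linarith
  calc R * Real.log (Y / R) ≤ R * (α * (Y / R) + |Real.log α|) := by gcongr
    _ = _ := by field_simp

lemma sqrt_le_reg {n T : ℕ} (hn : 1 ≤ n) (hT : 3 ≤ T) : √(T : ℝ) ≤ reg n T := by
  have hn' : (1 : ℝ) ≤ n := by exact_mod_cast hn
  have hT' : (3 : ℝ) ≤ T := by exact_mod_cast hT
  have hlog : 1 ≤ Real.log T := by
    rw [Real.le_log_iff_exp_le (by linarith)]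
    have := Real.exp_one_lt_d9
    linarith
  refine Real.sqrt_le_sqrt ?_
  calc (T : ℝ) = 1 * T * 1 := by ring
    _ ≤ n * T * Real.log T := by gcongr

/-- The guesses below the benchmark. -/
lemma le_integral_below {f : ℝ → ℝ} {R Y D κ Λ : ℝ} (hR : 0 < R) (hRY : R ≤ Y)
    (hf : IntervalIntegrable f volume (Real.log R) (Real.log Y)) (hΛ : 0 ≤ Λ)
    (h : ∀ G, R ≤ G → G ≤ Y → G / D - κ - Λ * G ≤ f (Real.log G)) :
    (Y - R) / D - Λ * Y - κ * Real.log (Y / R) ≤ ∫ x in (Real.log R)..(Real.log Y), f x := by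
  have hY : 0 < Y := hR.trans_le hRY
  have hlog := Real.log_le_log hR hRY
  have h1 := le_integral_of_affine hlog hf (α := -κ) (β := 1 / D - Λ) fun x hx => by
    have h2 := h (Real.exp x) ((Real.log_le_iff_le_exp hR).1 hx.1)
      ((Real.le_log_iff_exp_le hY).1 hx.2)
    rw [Real.log_exp] at h2
    refine le_trans (le_of_eq ?_) h2
    ring
  rw [Real.exp_log hR, Real.exp_log hY] at h1
  rw [Real.log_div hY.ne' hR.ne']
  refine le_trans ?_ h1
  have : 0 ≤ Λ * R := by positivity
  have e : -κ * (Real.log Y - Real.log R) + (1 / D - Λ) * (Y - R) =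
      (Y - R) / D - Λ * Y - κ * (Real.log Y - Real.log R) + Λ * R := by ring
  rw [e]
  linarith

/-- The guesses above the benchmark. -/
lemma Benchmark.le_integral_above (h : Benchmark T B F S₀ o p w Y) (hY : 0 < Y) :
    min ((T : ℝ) - Y) (Y / (2 * d)) / (4 * (d + 1)) - baseConst d * reg n T * (1 + Y / B) ≤
      ∫ x in (Real.log Y)..(Real.log T), gameValue T B F o (Real.exp x) := by
  have hd : (1 : ℝ) ≤ d := by exact_mod_cast NeZero.one_le
  have hB := h.B_pos
  have hR := one_le_reg h.one_le_n h.two_le_T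
  have hK := baseConst_ge d
  set g := min ((T : ℝ) - Y) (Y / (2 * d))
  have hg0 : 0 ≤ g := le_min (by linarith [h.Y_le]) (by positivity)
  have hg1 : g ≤ Y / (2 * d) := min_le_right _ _
  have hgY : g ≤ Y := hg1.trans (div_le_self hY.le (by linarith))
  have hgT : Y + g ≤ T := by have := min_le_left ((T : ℝ) - Y) (Y / (2 * d)); linarith
  have hY' : 0 < Y + g := by linarith
  have hint := fun a b => intervalIntegrable_gameValue (B := B) (F := F) h.one_le_n h.isOutcome a b
  have hl1 : Real.log Y ≤ Real.log (Y + g) := Real.log_le_log hY (by linarith)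
  have hl2 : Real.log (Y + g) ≤ Real.log T := Real.log_le_log hY' hgT
  rw [← intervalIntegral.integral_add_adjacent_intervals (hint _ (Real.log (Y + g))) (hint _ _)]
  have hrest : 0 ≤ ∫ x in (Real.log (Y + g))..(Real.log T), gameValue T B F o (Real.exp x) :=
    intervalIntegral.integral_nonneg hl2 fun x _ => gameValue_nonneg h.isOutcome _
  have h1 := le_integral_of_affine hl1 (hint _ _)
    (α := Y / (2 * (d + 1)) - baseConst d * reg n T) (β := -(baseConst d * (reg n T / B)))
    fun x hx => by
      have h2 := h.gameValue_ge_min (Real.exp_pos x).le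
      have hx1 := (Real.log_le_iff_le_exp hY).1 hx.1
      have hx2 := (Real.le_log_iff_exp_le hY').1 hx.2
      set G := Real.exp x
      have hG : G * (2 * d) ≤ Y * (2 * d) + Y := by
        have : g * (2 * d) ≤ Y := by rwa [le_div_iff₀ (by linarith)] at hg1
        nlinarith
      have h3 : Y / (2 * (d + 1)) ≤ min (G / (d + 1)) (Y - d * (G / (d + 1))) := by
        refine le_min ?_ ?_
        · calc Y / (2 * (d + 1)) ≤ Y / (d + 1) := by gcongr; linarith
            _ ≤ G / (d + 1) := by gcongr
        · rw [← mul_div_assoc, div_le_iff₀ (by positivity), sub_mul, div_mul_eq_mul_div,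
            le_sub_iff_add_le]
          have : d * G * (2 * (d + 1)) / (d + 1) = 2 * d * G := by field_simp
          rw [this]; linarith
      have e : baseConst d = regConst d + d + 1 := rfl
      rw [← e] at h2
      linarith
  rw [Real.exp_log hY, Real.exp_log hY', add_sub_cancel_left, ← Real.log_div hY'.ne' hY.ne'] at h1
  have hlow : g / (2 * Y) ≤ Real.log ((Y + g) / Y) := by
    have h4 := Real.one_sub_inv_le_log_of_pos (show 0 < (Y + g) / Y by positivity)
    refine le_trans ?_ h4
    rw [inv_div, div_le_iff₀ (by positivity)]
    have : (1 - Y / (Y + g)) * (2 * Y) = g * (2 * Y) / (Y + g) := by field_simp; ring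
    rw [this, le_div_iff₀ hY']
    nlinarith
  have hup : Real.log ((Y + g) / Y) ≤ 1 := by
    have h4 := Real.log_le_sub_one_of_pos (show 0 < (Y + g) / Y by positivity)
    refine h4.trans ?_
    rw [sub_le_iff_le_add, div_le_iff₀ hY]
    linarith
  set l := Real.log ((Y + g) / Y)
  have h5 : g / (4 * (d + 1)) ≤ Y / (2 * (d + 1)) * l := by
    calc g / (4 * (d + 1)) = Y / (2 * (d + 1)) * (g / (2 * Y)) := by field_simp; norm_num
      _ ≤ _ := by gcongr
  have h6 : baseConst d * reg n T * l ≤ baseConst d * reg n T * 1 := by gcongr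
  have h7 : baseConst d * (reg n T / B) * g ≤ baseConst d * (reg n T / B) * Y := by gcongr
  have h8 : baseConst d * reg n T * (1 + Y / B) =
      baseConst d * reg n T * 1 + baseConst d * (reg n T / B) * Y := by ring
  rw [h8]
  have h9 : (Y / (2 * (d + 1)) - baseConst d * reg n T) * l =
      Y / (2 * (d + 1)) * l - baseConst d * reg n T * l := by ring
  rw [h9] at h1
  linarith

/-- The guesses below and above the benchmark together. -/
lemma Benchmark.le_guessIntegral (h : Benchmark T B F S₀ o p w Y) (hT : 3 ≤ T) (hRY : reg n T ≤ Y)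
    {L : ℝ} (hL : L ≤ ∫ x in (Real.log (reg n T))..(Real.log Y), gameValue T B F o (Real.exp x)) :
    (d + 1) * L + min ((T : ℝ) - Y) (Y / (2 * d)) / 4 -
      (d + 1) * baseConst d * (reg n T * (1 + Y / B)) ≤ (d + 1) * guessIntegral T B F o := by
  have hR := one_le_reg h.one_le_n h.two_le_T
  have hY : 0 < Y := by linarith
  have hT0 : (0 : ℝ) < T := by have := h.Y_le; linarith
  have hint := fun a b => intervalIntegrable_gameValue (B := B) (F := F) h.one_le_n h.isOutcome a b
  have hl : Real.log T / 2 ≤ Real.log (reg n T) := by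
    rw [← Real.log_sqrt hT0.le]
    exact Real.log_le_log (Real.sqrt_pos.2 hT0) (sqrt_le_reg h.one_le_n hT)
  have h0 : 0 ≤ ∫ x in (Real.log T / 2)..(Real.log (reg n T)), gameValue T B F o (Real.exp x) :=
    intervalIntegral.integral_nonneg hl fun x _ => gameValue_nonneg h.isOutcome _
  have h2 := h.le_integral_above hY
  have h3 : guessIntegral T B F o =
      (∫ x in (Real.log T / 2)..(Real.log (reg n T)), gameValue T B F o (Real.exp x)) +
      (∫ x in (Real.log (reg n T))..(Real.log Y), gameValue T B F o (Real.exp x)) +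
      ∫ x in (Real.log Y)..(Real.log T), gameValue T B F o (Real.exp x) := by
    rw [intervalIntegral.integral_add_adjacent_intervals (hint _ _) (hint _ _),
      intervalIntegral.integral_add_adjacent_intervals (hint _ _) (hint _ _)]
    rfl
  have hd : (0 : ℝ) < d + 1 := by positivity
  have h4 : L + (min ((T : ℝ) - Y) (Y / (2 * d)) / (4 * (d + 1)) -
      baseConst d * reg n T * (1 + Y / B)) ≤ guessIntegral T B F o := by linarith
  refine le_trans (le_of_eq ?_) (mul_le_mul_of_nonneg_left h4 hd.le)
  field_simp
  ring

lemma Benchmark.gameValue_ge_of_le (h : Benchmark T B F S₀ o p w Y) {G : ℝ} (hG : 0 ≤ G)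
    (hGY : G ≤ Y) : G / (d + 1) - baseConst d * reg n T - baseConst d * (reg n T / B) * G ≤
      gameValue T B F o G := by
  have h1 := h.gameValue_ge_min hG
  rwa [min_eq_left] at h1
  have : d * (G / (d + 1)) + G / (d + 1) = G := by field_simp
  linarith

/-- Without a refined bound, the loss is logarithmic. -/
lemma Benchmark.le_guessIntegral_log (h : Benchmark T B F S₀ o p w Y) (hT : 3 ≤ T)
    (hRY : reg n T ≤ Y) :
    Y + min ((T : ℝ) - Y) (Y / (2 * d)) / 4 - (d + 1) * baseConst d *
      (reg n T * Real.log (Y / reg n T)) - 3 * (d + 1) * baseConst d * (reg n T * (1 + Y / B)) ≤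
      (d + 1) * guessIntegral T B F o := by
  have hR := one_le_reg h.one_le_n h.two_le_T
  have hK := baseConst_ge d
  have hB := h.B_pos
  have hY : 0 < Y := by linarith
  have h1 := h.le_guessIntegral hT hRY (le_integral_below (D := (d : ℝ) + 1)
    (κ := baseConst d * reg n T) (Λ := baseConst d * (reg n T / B)) (by linarith) hRY
    (intervalIntegrable_gameValue h.one_le_n h.isOutcome _ _) (by positivity) fun G hG1 hG2 => by
      rw [Real.exp_log (by linarith)]
      exact h.gameValue_ge_of_le (by linarith) hG2)
  refine le_trans ?_ h1
  have e1 : (d + 1) * ((Y - reg n T) / (d + 1) - baseConst d * (reg n T / B) * Y -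
      baseConst d * reg n T * Real.log (Y / reg n T)) = Y - reg n T -
      (d + 1) * baseConst d * (reg n T * (Y / B)) -
      (d + 1) * baseConst d * (reg n T * Real.log (Y / reg n T)) := by field_simp
  rw [e1]
  have e2 : reg n T ≤ (d + 1) * baseConst d * reg n T := by
    have : 1 ≤ (d + 1) * baseConst d := by nlinarith
    nlinarith
  have e3 : 0 ≤ (d + 1) * baseConst d * (reg n T * (Y / B)) := by positivity
  have e4 : (d + 1) * baseConst d * (reg n T * (1 + Y / B)) = (d + 1) * baseConst d * reg n T +
      (d + 1) * baseConst d * (reg n T * (Y / B)) := by ring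
  have e5 : 3 * (d + 1) * baseConst d * (reg n T * (1 + Y / B)) =
      3 * ((d + 1) * baseConst d * reg n T + (d + 1) * baseConst d * (reg n T * (Y / B))) := by ring
  rw [e4, e5]
  linarith

end Average

/-! ### Removing the logarithmic loss -/

section Cases

variable {n d : ℕ} [NeZero d] {T : ℕ} {B : ℝ} {F : Finset (Finset (Fin n))} {S₀ : Finset (Fin n)}
  {o : ℕ → Outcome n d} {p : F → ℝ} {w : ℕ → ℝ} {Y : ℝ}

/-- The logarithmic loss is absorbed if the benchmark is far from the horizon. -/
lemma Benchmark.le_guessIntegral_of_le (h : Benchmark T B F S₀ o p w Y) (hT : 3 ≤ T)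
    (hRY : reg n T ≤ Y) (hYT : Y ≤ 3 / 4 * T) :
    Y - ((d + 1) * baseConst d) * (|Real.log (1 / (12 * d * ((d + 1) * baseConst d)))| + 3) *
      (reg n T * (1 + Y / B)) ≤ (d + 1) * guessIntegral T B F o := by
  have hR := one_le_reg h.one_le_n h.two_le_T
  have hK := baseConst_ge d
  have hB := h.B_pos
  have hY : 0 < Y := by linarith
  have hd : (1 : ℝ) ≤ d := by exact_mod_cast NeZero.one_le
  have h1 := h.le_guessIntegral_log hT hRY
  have hg : Y / (3 * d) ≤ min ((T : ℝ) - Y) (Y / (2 * d)) := by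
    refine le_min ?_ (by gcongr; norm_num)
    calc Y / (3 * d) ≤ Y / 3 := by gcongr; linarith
      _ ≤ T - Y := by linarith
  obtain ⟨Q, hQ⟩ : ∃ Q, Q = ((d : ℝ) + 1) * baseConst d := ⟨_, rfl⟩
  have hQ0 : 0 < Q := by rw [hQ]; positivity
  rw [mul_assoc 3 ((d : ℝ) + 1) (baseConst d), ← hQ] at h1
  rw [← hQ]
  have h2 := mul_le_mul_of_nonneg_left (mul_log_div_le (by linarith : 0 < reg n T) hY
    (show 0 < 1 / (12 * d * Q) by positivity)) hQ0.le
  set A := |Real.log (1 / (12 * d * Q))|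
  have h3 : Q * (1 / (12 * d * Q) * Y + reg n T * A) = Y / (3 * d) / 4 + Q * A * reg n T := by
    field_simp; ring
  rw [h3] at h2
  have h4 : Q * A * reg n T ≤ Q * A * (reg n T * (1 + Y / B)) := by
    have : 0 ≤ A := abs_nonneg _
    have : 0 ≤ Y / B := by positivity
    gcongr
    nlinarith
  have h5 : Q * (A + 3) * (reg n T * (1 + Y / B)) = Q * A * (reg n T * (1 + Y / B)) +
    3 * Q * (reg n T * (1 + Y / B)) := by ring
  rw [h5]
  linarith

/-- The logarithmic loss is absorbed if there are few atoms and the distance of the benchmark to the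
horizon is not too small. -/
lemma Benchmark.le_guessIntegral_of_lt_log_sq (h : Benchmark T B F S₀ o p w Y) (hT : 3 ≤ T)
    (hRY : reg n T ≤ Y) (hYT : 3 / 4 * T ≤ Y) {θ : ℝ} (hθ : θ ≤ 1 / (4 * d)) (hθ0 : 0 ≤ θ)
    (hYn : θ * T ≤ n * (T - Y)) (hn : (n : ℝ) ≤ Real.log T ^ 2)
    (hlog : Real.log T ^ 9 ≤ (θ / (4 * ((d + 1) * baseConst d))) ^ 2 * T) :
    Y - 3 * ((d + 1) * baseConst d) * (reg n T * (1 + Y / B)) ≤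
      (d + 1) * guessIntegral T B F o := by
  have hR := one_le_reg h.one_le_n h.two_le_T
  have hK := baseConst_ge d
  have hY : 0 < Y := by linarith
  have hd : (1 : ℝ) ≤ d := by exact_mod_cast NeZero.one_le
  have hn1 : (1 : ℝ) ≤ n := by exact_mod_cast h.one_le_n
  have hT' : (3 : ℝ) ≤ T := by exact_mod_cast hT
  have h1 := h.le_guessIntegral_log hT hRY
  obtain ⟨Q, hQ⟩ : ∃ Q, Q = ((d : ℝ) + 1) * baseConst d := ⟨_, rfl⟩
  have hQ0 : 0 < Q := by rw [hQ]; positivity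
  rw [mul_assoc 3 ((d : ℝ) + 1) (baseConst d), ← hQ] at h1
  rw [← hQ] at hlog ⊢
  have hg : θ * T / n ≤ min ((T : ℝ) - Y) (Y / (2 * d)) := by
    refine le_min ?_ ?_
    · rw [div_le_iff₀ (by linarith)]; linarith
    · calc θ * T / n ≤ θ * T := div_le_self (by positivity) hn1
        _ ≤ 1 / (4 * d) * T := by gcongr
        _ = (T / 2) / (2 * d) := by field_simp; norm_num
        _ ≤ Y / (2 * d) := by gcongr; linarith
  have hll : Real.log (Y / reg n T) ≤ Real.log T := by
    refine Real.log_le_log (by positivity) ?_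
    exact (div_le_self hY.le hR).trans h.Y_le
  have hsq : n * reg n T * Real.log T ≤ θ / (4 * Q) * T := by
    refine abs_le_of_sq_le_sq' ?_ (by positivity) |>.2
    have : reg n T ^ 2 = n * T * Real.log T := Real.sq_sqrt (by positivity)
    calc (n * reg n T * Real.log T) ^ 2 = n ^ 2 * reg n T ^ 2 * Real.log T ^ 2 := by ring
      _ = (n : ℝ) ^ 3 * Real.log T ^ 3 * T := by rw [this]; ring
      _ ≤ (Real.log T ^ 2) ^ 3 * Real.log T ^ 3 * T := by gcongr
      _ = Real.log T ^ 9 * T := by ring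
      _ ≤ (θ / (4 * Q)) ^ 2 * T * T := by gcongr
      _ = _ := by ring
  have h2 : Q * (reg n T * Real.log (Y / reg n T)) ≤ θ * T / n / 4 := by
    calc Q * (reg n T * Real.log (Y / reg n T)) ≤ Q * (reg n T * Real.log T) := by gcongr
      _ = Q * (n * reg n T * Real.log T) / n := by field_simp
      _ ≤ Q * (θ / (4 * Q) * T) / n := by gcongr
      _ = _ := by field_simp
  linarith

/-- The logarithmic loss is absorbed by the gain of the guesses below the benchmark if the benchmark
is very close to the horizon. -/
lemma Benchmark.le_guessIntegral_of_gain (h : Benchmark T B F S₀ o p w Y) (hT : 3 ≤ T)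
    (hYT : 3 / 4 * T ≤ Y) {θ σ : ℝ}
    (hθ : θ = gainConst d / (32 * (d + 1))) (hσθ : σ ≤ θ) (hσ : 64 * regConst d * σ ≤ θ)
    (hYn : n * (T - Y) ≤ θ * T) (hσT : reg n T ≤ σ * T) (hσB : reg n T ≤ σ * B) :
    Y - ((d + 1) * baseConst d) * (|Real.log (gainConst d / ((d + 1) * baseConst d))| + 5) *
      (reg n T * (1 + Y / B)) ≤ (d + 1) * guessIntegral T B F o := by
  have hR := one_le_reg h.one_le_n h.two_le_T
  have hK := baseConst_ge d
  have hB := h.B_pos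
  have hT' : (3 : ℝ) ≤ T := by exact_mod_cast hT
  have hY : 0 < Y := by linarith
  have hd : (1 : ℝ) ≤ d := by exact_mod_cast NeZero.one_le
  have hgc := gainConst_pos d
  obtain ⟨a, ha1, ha2, ha⟩ := h.exists_gain hθ hσθ hσ hYn hσT hσB
  have ha0 : 0 < a := lt_of_lt_of_le (by positivity) ha1
  have hRa : reg n T ≤ a := by
    refine hσT.trans (le_trans ?_ ha1)
    have : θ ≤ gainConst d := by
      rw [hθ]; exact div_le_self hgc.le (by linarith)
    gcongr
    linarith
  have haY : 2 * a ≤ Y := by linarith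
  have hint := fun a b => intervalIntegrable_gameValue (B := B) (F := F) h.one_le_n h.isOutcome a b
  have hbelow : ∀ G, reg n T ≤ G → G ≤ Y → G / ((d : ℝ) + 1) - baseConst d * reg n T -
      baseConst d * (reg n T / B) * G ≤ gameValue T B F o (Real.exp (Real.log G)) :=
    fun G hG1 hG2 => by
      rw [Real.exp_log (by linarith)]
      exact h.gameValue_ge_of_le (by linarith) hG2
  have i1 := le_integral_below (by linarith) hRa (hint _ _) (by positivity)
    fun G hG1 hG2 => hbelow G hG1 (by linarith)
  have i3 := le_integral_below (by linarith) haY (hint _ _) (by positivity)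
    fun G hG1 hG2 => hbelow G (by linarith) hG2
  have i2 := le_integral_of_affine (Real.log_le_log ha0 (by linarith : a ≤ 2 * a)) (hint _ _)
    (α := a - 1) (β := 1 / (d + 1)) fun x hx => by
      refine le_trans (le_of_eq ?_) (ha _ ((Real.log_le_iff_le_exp ha0).1 hx.1)
        ((Real.le_log_iff_exp_le (by linarith)).1 hx.2))
      ring
  rw [Real.exp_log ha0, Real.exp_log (by linarith), Real.log_mul two_ne_zero ha0.ne',
    add_sub_cancel_right] at i2
  have e0 : Real.log (a / reg n T) + Real.log (Y / (2 * a)) ≤ Real.log (Y / reg n T) := by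
    rw [← Real.log_mul (by positivity) (by positivity)]
    refine Real.log_le_log (by positivity) ?_
    have : a / reg n T * (Y / (2 * a)) = Y / reg n T / 2 := by field_simp
    rw [this]
    exact half_le_self (by positivity)
  have hsplit := intervalIntegral.integral_add_adjacent_intervals
    (hint (Real.log (reg n T)) (Real.log a)) (hint _ (Real.log (2 * a)))
  have hsplit2 := intervalIntegral.integral_add_adjacent_intervals
    (hint (Real.log (reg n T)) (Real.log (2 * a))) (hint _ (Real.log Y))
  rw [← Real.log_mul two_ne_zero ha0.ne'] at i2
  have hl2 := Real.log_two_gt_d9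
  have hl2' := Real.log_two_lt_d9
  obtain ⟨K, hKe⟩ : ∃ K, K = baseConst d := ⟨_, rfl⟩
  rw [← hKe] at i1 i3 hK ⊢
  have hd1 : 0 < (d : ℝ) + 1 := by linarith
  have hL : (Y - reg n T) / (d + 1) - 2 * (K * (reg n T / B) * Y) -
      K * reg n T * Real.log (Y / reg n T) + (a / 2 - 1) ≤
      ∫ x in (Real.log (reg n T))..(Real.log Y), gameValue T B F o (Real.exp x) := by
    have f1 : (Y - reg n T) / (d + 1) =
      (a - reg n T) / (d + 1) + 1 / (d + 1) * (2 * a - a) + (Y - 2 * a) / (d + 1) := by ring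
    have f2 : K * (reg n T / B) * a ≤ K * (reg n T / B) * Y := by gcongr; linarith
    have f3 := mul_le_mul_of_nonneg_left e0 (show 0 ≤ K * reg n T by positivity)
    have f4 : a / 2 - 1 ≤ (a - 1) * Real.log 2 := by
      have : a * (1 / 2) ≤ a * Real.log 2 := by gcongr; linarith
      linarith
    rw [mul_add] at f3
    linarith
  have h1 := h.le_guessIntegral hT (hRa.trans (by linarith)) hL
  rw [← hKe] at h1
  have hg : 0 ≤ min ((T : ℝ) - Y) (Y / (2 * d)) := le_min (by linarith [h.Y_le]) (by positivity)
  obtain ⟨Q, hQ⟩ : ∃ Q, Q = ((d : ℝ) + 1) * K := ⟨_, rfl⟩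
  have hQ0 : (d : ℝ) + 1 ≤ Q := by
    rw [hQ]; exact le_mul_of_one_le_right hd1.le (by linarith)
  have hQ1 : 0 < Q := by linarith
  rw [← hQ] at h1 ⊢
  have h2 := mul_le_mul_of_nonneg_left (mul_log_div_le (by linarith : 0 < reg n T) hY
    (show 0 < gainConst d / Q by positivity)) hQ1.le
  set A := |Real.log (gainConst d / Q)|
  have h3 : Q * (gainConst d / Q * Y + reg n T * A) = gainConst d * Y + Q * A * reg n T := by
    field_simp
  rw [h3] at h2
  have h4 : gainConst d * Y ≤ (d + 1) * (a / 2) := by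
    have : gainConst d * Y ≤ gainConst d * T := by gcongr; exact h.Y_le
    calc gainConst d * Y ≤ 2 * (a / 2) := by linarith
      _ ≤ (d + 1) * (a / 2) := by gcongr; linarith
  have h5 : (d + 1) * ((Y - reg n T) / (d + 1) - 2 * (K * (reg n T / B) * Y) -
      K * reg n T * Real.log (Y / reg n T) + (a / 2 - 1)) = Y - reg n T -
      2 * (Q * (reg n T * (Y / B))) - Q * (reg n T * Real.log (Y / reg n T)) +
      (d + 1) * (a / 2) - (d + 1) := by
    rw [hQ]; field_simp; ring
  rw [h5] at h1
  have h6 : (d : ℝ) + 1 ≤ Q * reg n T := hQ0.trans (le_mul_of_one_le_right hQ1.le hR)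
  have h7 : reg n T ≤ Q * reg n T := le_mul_of_one_le_left (by linarith) (by linarith)
  have h8 : 0 ≤ Q * (reg n T * (Y / B)) := by positivity
  have h9 : Q * A * (reg n T * (Y / B)) ≥ 0 := by have := abs_nonneg (Real.log (gainConst d / Q))
                                                  positivity
  have h10 : Q * (reg n T * (1 + Y / B)) = Q * reg n T + Q * (reg n T * (Y / B)) := by ring
  have h11 : Q * (A + 5) * (reg n T * (1 + Y / B)) = Q * A * reg n T +
    Q * A * (reg n T * (Y / B)) + 5 * (Q * reg n T + Q * (reg n T * (Y / B))) := by ring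
  rw [h10] at h1
  rw [h11]
  linarith

/-- The logarithmic loss does not arise if there are many atoms and the benchmark is close to the
horizon. -/
lemma Benchmark.le_guessIntegral_of_log_sq_le (h : Benchmark T B F S₀ o p w Y) (hT : 3 ≤ T)
    (hRY : reg n T ≤ Y) (hYT : 3 / 4 * T ≤ Y) (hlog : Real.log T ^ 2 ≤ n) {σ : ℝ}
    (hσ : 64 * regConst d * σ ≤ 1) (hσT : reg n T ≤ σ * T) (hσB : reg n T ≤ σ * B) :
    Y - ((d + 1) * (regConst d + 1) *
      (|Real.log (1 / (8 * d * ((d + 1) * (regConst d + 1))))| + 1) +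
        (d + 1) * (4 * regConst d + 200 * d + 66 * baseConst d)) *
      (reg n T * (1 + Y / B)) ≤ (d + 1) * guessIntegral T B F o := by
  have hR := one_le_reg h.one_le_n h.two_le_T
  have hK := baseConst_ge d
  have hK2 := regConst_ge d
  have hB := h.B_pos
  have hT' : (3 : ℝ) ≤ T := by exact_mod_cast hT
  have hY : 0 < Y := by linarith
  have hYle := h.Y_le
  have hd : (1 : ℝ) ≤ d := by exact_mod_cast NeZero.one_le
  have hlT : 0 < Real.log T := Real.log_pos (by linarith)
  have hint := fun a b => intervalIntegrable_gameValue (B := B) (F := F) h.one_le_n h.isOutcome a b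
  obtain ⟨K, hKe⟩ : ∃ K, K = baseConst d := ⟨_, rfl⟩
  obtain ⟨K₄, hK₄⟩ : ∃ K₄, K₄ = 4 * regConst d + 200 * d + 64 * K := ⟨_, rfl⟩
  obtain ⟨ε, hε⟩ : ∃ ε, ε = ((T : ℝ) - Y) / T := ⟨_, rfl⟩
  have hε0 : 0 ≤ ε := by rw [hε]; exact div_nonneg (by linarith) (by linarith)
  have hε1 : ε ≤ 1 := by rw [hε]; exact div_le_one_of_le₀ (by linarith) (by linarith)
  rw [← hKe] at hK
  have hL := le_integral_below (D := (d : ℝ) + 1)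
    (κ := (regConst d + 1) * (reg n T / Real.log T + reg n T * ε))
    (Λ := K₄ * (reg n T / T + reg n T / B)) (by linarith) hRY (hint _ _)
    (by rw [hK₄]; positivity) fun G hG1 hG2 => by
      rw [Real.exp_log (by linarith)]
      have hG : 0 ≤ G := by linarith
      rcases le_total G (T / 64) with hGT | hGT
      · refine le_trans ?_ (h.gameValue_ge_of_log_sq_le hlog hYT hσ hσT hσB hG hGT)
        rw [← hε]
        have : (4 * regConst d + 200 * d) * (reg n T / T + reg n T / B) * G ≤
            K₄ * (reg n T / T + reg n T / B) * G := by
          gcongr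
          rw [hK₄]; linarith
        linarith
      · refine le_trans ?_ (h.gameValue_ge_of_le hG hG2)
        rw [← hKe]
        have q1 : reg n T ≤ 64 * (reg n T / T * G) := by
          have : reg n T = 64 * (reg n T / T * (T / 64)) := by field_simp
          calc reg n T = 64 * (reg n T / T * (T / 64)) := this
            _ ≤ _ := by gcongr
        have q2 : K * reg n T ≤ K * (64 * (reg n T / T * G)) := by gcongr
        have q3 : 0 ≤ (regConst d + 1) * (reg n T / Real.log T + reg n T * ε) := by positivity
        have q4 : K * (64 * (reg n T / T * G)) + K * (reg n T / B) * G ≤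
            K₄ * (reg n T / T + reg n T / B) * G := by
          have e1 : K₄ * (reg n T / T + reg n T / B) * G =
            K * (64 * (reg n T / T * G)) + K * (reg n T / B) * G +
            ((4 * regConst d + 200 * d) * (reg n T / T * G) +
              (4 * regConst d + 200 * d + 63 * K) * (reg n T / B * G)) := by rw [hK₄]; ring
          rw [e1]
          have : 0 ≤ (4 * regConst d + 200 * d) * (reg n T / T * G) +
              (4 * regConst d + 200 * d + 63 * K) * (reg n T / B * G) := by positivity
          linarith
        linarith
  have h1 := h.le_guessIntegral hT hRY hL
  rw [← hKe] at h1
  have hg : ε * Y / (2 * d) ≤ min ((T : ℝ) - Y) (Y / (2 * d)) := by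
    refine le_min ?_ ?_
    · have : ε * T = T - Y := by rw [hε]; field_simp
      calc ε * Y / (2 * d) ≤ ε * Y := div_le_self (by positivity) (by linarith)
        _ ≤ ε * T := by gcongr
        _ = T - Y := this
    · gcongr
      nlinarith
  obtain ⟨Q, hQ⟩ : ∃ Q, Q = ((d : ℝ) + 1) * (regConst d + 1) := ⟨_, rfl⟩
  have hQ1 : 0 < Q := by rw [hQ]; positivity
  have h2 := mul_le_mul_of_nonneg_left (mul_log_div_le (by linarith : 0 < reg n T) hY
    (show 0 < 1 / (8 * d * Q) by positivity)) (show 0 ≤ Q * ε by positivity)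
  rw [← hQ, ← hKe]
  set A := |Real.log (1 / (8 * d * Q))|
  have h3 : Q * ε * (1 / (8 * d * Q) * Y + reg n T * A) =
      ε * Y / (2 * d) / 4 + ε * (Q * A * reg n T) := by field_simp; ring
  rw [h3] at h2
  have h3' : ε * (Q * A * reg n T) ≤ 1 * (Q * A * reg n T) := by gcongr
  have hll : Real.log (Y / reg n T) ≤ Real.log T :=
    Real.log_le_log (by positivity) ((div_le_self hY.le hR).trans hYle)
  have h4 : Q * (reg n T / Real.log T * Real.log (Y / reg n T)) ≤ Q * reg n T := by
    calc Q * (reg n T / Real.log T * Real.log (Y / reg n T)) ≤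
        Q * (reg n T / Real.log T * Real.log T) := by gcongr
      _ = Q * reg n T := by field_simp
  have h5 : (d + 1) * ((Y - reg n T) / (d + 1) - K₄ * (reg n T / T + reg n T / B) * Y -
      (regConst d + 1) * (reg n T / Real.log T + reg n T * ε) * Real.log (Y / reg n T)) =
      Y - reg n T - (d + 1) * K₄ * (reg n T / T * Y) - (d + 1) * K₄ * (reg n T * (Y / B)) -
      Q * (reg n T / Real.log T * Real.log (Y / reg n T)) -
      Q * ε * (reg n T * Real.log (Y / reg n T)) := by
    rw [hQ]
    have : (d + 1) * ((Y - reg n T) / (d + 1)) = Y - reg n T := by field_simp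
    linear_combination this
  rw [h5] at h1
  have h6 : (d + 1) * K₄ * (reg n T / T * Y) ≤ (d + 1) * K₄ * reg n T := by
    have : 0 ≤ K₄ := by rw [hK₄]; positivity
    gcongr
    calc reg n T / T * Y ≤ reg n T / T * T := by gcongr
      _ = reg n T := by field_simp
  set X := reg n T * (Y / B)
  have h7 : reg n T * (1 + Y / B) = reg n T + X := by ring
  rw [h7] at h1 ⊢
  have h8 : reg n T ≤ (d + 1) * K * reg n T := by
    have : 1 ≤ (d + 1) * K := one_le_mul_of_one_le_of_one_le (by linarith) (by linarith)
    exact le_mul_of_one_le_left (by linarith) this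
  have h9 : 0 ≤ Q * A * X := by positivity
  have h10 : 0 ≤ Q * X := by positivity
  have h11 : 0 ≤ (d + 1) * K * X := by positivity
  have h12 : (Q * (A + 1) + (d + 1) * (4 * regConst d + 200 * d + 66 * K)) * (reg n T + X) =
      Q * A * reg n T + Q * A * X + Q * reg n T + Q * X + (d + 1) * K₄ * reg n T +
      (d + 1) * K₄ * X + 2 * ((d + 1) * K * reg n T) + 2 * ((d + 1) * K * X) := by
    rw [hK₄]; ring
  rw [h12]
  linarith

/-- For long horizons the average over the guesses attains the benchmark up to the regret. -/
lemma exists_guessIntegral_ge (d : ℕ) [NeZero d] : ∃ C σ T₁ : ℝ, 0 ≤ C ∧ 0 < σ ∧ 3 ≤ T₁ ∧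
    ∀ {n T : ℕ} {B : ℝ} {F : Finset (Finset (Fin n))} {S₀ : Finset (Fin n)}
      {o : ℕ → Outcome n d} {p : F → ℝ} {w : ℕ → ℝ} {Y : ℝ}, Benchmark T B F S₀ o p w Y →
      T₁ ≤ T → reg n T ≤ Y → reg n T ≤ σ * T → reg n T ≤ σ * B →
      Y - C * (reg n T * (1 + Y / B)) ≤ (d + 1) * guessIntegral T B F o := by
  have hd : (1 : ℝ) ≤ d := by exact_mod_cast NeZero.one_le
  have hgc := gainConst_pos d
  have hgc1 := gainConst_le d
  have hK := baseConst_ge d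
  have hK2 := regConst_ge d
  obtain ⟨θ, hθ⟩ : ∃ θ, θ = gainConst d / (32 * ((d : ℝ) + 1)) := ⟨_, rfl⟩
  have hθ0 : 0 < θ := by rw [hθ]; positivity
  have hθ1 : θ ≤ 1 / (4 * d) := by
    rw [hθ, div_le_div_iff₀ (by positivity) (by positivity)]; nlinarith
  have hθ2 : θ ≤ 1 := hθ1.trans (div_le_one_of_le₀ (by linarith) (by linarith))
  obtain ⟨σ, hσ⟩ : ∃ σ, σ = θ / (64 * regConst d) := ⟨_, rfl⟩
  have hσ0 : 0 < σ := by rw [hσ]; positivity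
  have hσ1 : 64 * regConst d * σ = θ := by rw [hσ]; field_simp
  have hσ2 : σ ≤ θ := by rw [hσ]; exact div_le_self hθ0.le (by linarith)
  have hlit := (Real.isLittleO_pow_log_id_atTop (n := 9)).def
    (show 0 < (θ / (4 * (((d : ℝ) + 1) * baseConst d))) ^ 2 by positivity)
  obtain ⟨T₁, hT₁⟩ := Filter.eventually_atTop.1 hlit
  have hC1 : 0 ≤ ((d : ℝ) + 1) * baseConst d *
      (|Real.log (1 / (12 * d * ((d + 1) * baseConst d)))| + 3) := by positivity
  have hC2 : 0 ≤ 3 * (((d : ℝ) + 1) * baseConst d) := by positivity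
  have hC3 : 0 ≤ ((d : ℝ) + 1) * baseConst d *
      (|Real.log (gainConst d / ((d + 1) * baseConst d))| + 5) := by positivity
  have hC4 : 0 ≤ ((d : ℝ) + 1) * (regConst d + 1) *
      (|Real.log (1 / (8 * d * ((d + 1) * (regConst d + 1))))| + 1) +
        (d + 1) * (4 * regConst d + 200 * d + 66 * baseConst d) := by positivity
  set C₁ := ((d : ℝ) + 1) * baseConst d *
      (|Real.log (1 / (12 * d * ((d + 1) * baseConst d)))| + 3)
  set C₂ := 3 * (((d : ℝ) + 1) * baseConst d)
  set C₃ := ((d : ℝ) + 1) * baseConst d *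
      (|Real.log (gainConst d / ((d + 1) * baseConst d))| + 5)
  set C₄ := ((d : ℝ) + 1) * (regConst d + 1) *
      (|Real.log (1 / (8 * d * ((d + 1) * (regConst d + 1))))| + 1) +
        (d + 1) * (4 * regConst d + 200 * d + 66 * baseConst d)
  refine ⟨C₁ + C₂ + C₃ + C₄, σ, max T₁ 3, by positivity, hσ0, le_max_right _ _, ?_⟩
  intro n T B F S₀ o p w Y h hT hRY hσT hσB
  have hT3 : 3 ≤ T := by exact_mod_cast (le_max_right _ _).trans hT
  have hR := one_le_reg h.one_le_n h.two_le_T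
  have hB := h.B_pos
  have hE : 0 ≤ reg n T * (1 + Y / B) := by have := h.Y_nonneg; positivity
  have key : ∀ c, c ≤ C₁ + C₂ + C₃ + C₄ →
      Y - c * (reg n T * (1 + Y / B)) ≤ (d + 1) * guessIntegral T B F o →
      Y - (C₁ + C₂ + C₃ + C₄) * (reg n T * (1 + Y / B)) ≤ (d + 1) * guessIntegral T B F o :=
    fun c hc h1 => le_trans (by gcongr) h1
  rcases le_total Y (3 / 4 * T) with hY1 | hY1
  · exact key C₁ (by linarith) (h.le_guessIntegral_of_le hT3 hRY hY1)
  rcases le_total ((n : ℝ) * (T - Y)) (θ * T) with hYn | hYn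
  · exact key C₃ (by linarith)
      (h.le_guessIntegral_of_gain hT3 hY1 hθ hσ2 hσ1.le hYn hσT hσB)
  rcases le_total (n : ℝ) (Real.log T ^ 2) with hn | hn
  · refine key C₂ (by linarith)
      (h.le_guessIntegral_of_lt_log_sq hT3 hRY hY1 hθ1 hθ0.le hYn hn ?_)
    have h1 := hT₁ T ((le_max_left _ _).trans hT)
    simp only [id, Real.norm_eq_abs, Nat.abs_cast] at h1
    exact (le_abs_self _).trans h1
  · exact key C₄ (by linarith)
      (h.le_guessIntegral_of_log_sq_le hT3 hRY hY1 hn (hσ1.le.trans hθ2) hσT hσB)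

end Cases

/-! ### The adversarial version -/

section Adversarial

variable {n d : ℕ} {T : ℕ} {B : ℝ} {F : Finset (Finset (Fin n))} {o : ℕ → Outcome n d}

lemma fixedDistReward_le (hB : 0 ≤ B) (hn : 1 ≤ n) (ho : ∀ t < T, IsOutcome (o t)) {p : F → ℝ}
    (hp : p ∈ stdSimplex ℝ F) : fixedDistReward T B F o p ≤ T := by
  obtain ⟨w, hw0, hw1, -, hY, -⟩ := exists_weights hB hn ho hp.1 hp.2
  rw [hY]
  calc ∑ t ∈ Finset.range T, w t * distReward p (o t) ≤ ∑ _t ∈ Finset.range T, (1 : ℝ) := by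
        refine Finset.sum_le_sum fun t ht => ?_
        have ht' := Finset.mem_range.1 ht
        exact mul_le_one₀ (hw1 t ht') (distReward_nonneg hp.1 (ho t ht'))
          (distReward_le_one hn hp.1 hp.2 (ho t ht'))
    _ = T := by simp

lemma bddAbove_fixedDistReward (hB : 0 ≤ B) (hn : 1 ≤ n) (ho : ∀ t < T, IsOutcome (o t)) :
    BddAbove (Set.range fun p : stdSimplex ℝ F => fixedDistReward T B F o p) :=
  ⟨T, by rintro _ ⟨p, rfl⟩; exact fixedDistReward_le hB hn ho p.2⟩

variable [NeZero d]

lemma advExpectedReward_nonneg (ho : ∀ t < T, IsOutcome (o t)) (κ : ℝ) :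
    0 ≤ advExpectedReward T B F κ o :=
  integral_nonneg fun _ => by
    simp only [Pi.zero_apply, lagrangeReward, totalReward]
    refine Finset.sum_nonneg fun t ht => ?_
    split_ifs
    · exact Finset.sum_nonneg fun e _ => (ho t (Finset.mem_range.1 ht) e 0).1
    · exact le_rfl

/-- The guarantee of the adversarial version in terms of the integral over the guesses. -/
lemma exists_sub_le_guessIntegral (d : ℕ) [NeZero d] : ∃ C : ℝ, 0 < C ∧
    ∀ {n T : ℕ} {B : ℝ} {F : Finset (Finset (Fin n))} {S₀ : Finset (Fin n)}
      {o : ℕ → Outcome n d}, 1 ≤ n → 2 ≤ T → 0 < B → S₀ ∈ F →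
      (∀ t < T, IsOutcome (o t)) → (∀ t < T, IsNullFor S₀ (o t)) →
      C * reg n T < OPTFD T B F o → C * reg n T < d * B →
      OPTFD T B F o - C * (reg n T * (1 + OPTFD T B F o / (d * B))) ≤
        (d + 1) * guessIntegral T B F o := by
  have hd : (1 : ℝ) ≤ d := by exact_mod_cast NeZero.one_le
  obtain ⟨C₀, σ, T₁, hC₀, hσ, hT₁, key⟩ := exists_guessIntegral_ge d
  -- The first three summands turn the hypotheses into `reg ≤ σ T`, `reg ≤ σ B` and `T₁ ≤ T`; the
  -- fourth allows for a distribution that is optimal only up to `reg`.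
  refine ⟨1 / σ + d / σ + 2 * T₁ + 1 + C₀ * d, by positivity, ?_⟩
  have g1 : 0 < 1 / σ := by positivity
  have g2 : 0 < d / σ := by positivity
  have g3 : C₀ ≤ C₀ * d := le_mul_of_one_le_right hC₀ hd
  obtain ⟨C, hC⟩ : ∃ C, C = 1 / σ + d / σ + 2 * T₁ + 1 + C₀ * d := ⟨_, rfl⟩
  rw [← hC]
  intro n T B F S₀ o hn hT hB hS₀ ho hnull hX hBC
  have hR := one_le_reg hn hT
  have hT' : (2 : ℝ) ≤ T := by exact_mod_cast hT
  obtain ⟨R, hRe⟩ : ∃ R, R = reg n T := ⟨_, rfl⟩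
  rw [← hRe] at hR hX hBC ⊢
  have hbdd := bddAbove_fixedDistReward (F := F) hB.le hn ho
  have hne : Nonempty (stdSimplex ℝ F) := ⟨⟨_, single_mem_stdSimplex ℝ ⟨S₀, hS₀⟩⟩⟩
  have hXT : OPTFD T B F o ≤ T := ciSup_le fun p => fixedDistReward_le hB.le hn ho p.2
  have hCR : ∀ c, c ≤ C → c * R ≤ C * R := fun c hc => by gcongr
  have hRT : R ≤ σ * T := by
    have h1 := hCR (1 / σ) (by linarith)
    rw [one_div_mul_eq_div] at h1
    have h2 : R / σ ≤ T := by linarith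
    rwa [div_le_iff₀' hσ] at h2
  have hRB : R ≤ σ * B := by
    have h1 := hCR (d / σ) (by linarith)
    have h2 : d * (R / σ) ≤ d * B := by
      calc d * (R / σ) = d / σ * R := by ring
        _ ≤ d * B := by linarith
    have h3 := le_of_mul_le_mul_left h2 (by linarith)
    rwa [div_le_iff₀' hσ] at h3
  have h2R : 2 * R < T := by linarith [hCR 2 (by linarith)]
  have hTT₁ : T₁ ≤ T := by
    have h1 := sqrt_le_two_mul_reg hn hT
    rw [← hRe] at h1
    have h2 := hCR (2 * T₁) (by linarith)
    have h3 : T₁ * √(T : ℝ) ≤ √(T : ℝ) * √(T : ℝ) := by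
      rw [Real.mul_self_sqrt (by linarith)]
      calc T₁ * √(T : ℝ) ≤ T₁ * (2 * R) := by gcongr
        _ ≤ T := by linarith
    have h4 := le_of_mul_le_mul_right h3 (Real.sqrt_pos.2 (by linarith))
    refine h4.trans ?_
    rw [Real.sqrt_le_left (by linarith)]
    nlinarith
  have hnT : ¬ (T ≤ n ∨ (T : ℝ) < logFactor n T) := fun h1 => by
    have := le_two_mul_reg hn hT h1
    rw [← hRe] at this
    linarith
  rw [not_or, not_le, not_lt] at hnT
  obtain ⟨p, hp⟩ := exists_lt_of_lt_ciSup (show OPTFD T B F o - R < OPTFD T B F o by linarith)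
  have hYX : fixedDistReward T B F o p ≤ OPTFD T B F o := le_ciSup hbdd p
  obtain ⟨w, hw0, hw1, hw, hY, hcost⟩ := exists_weights hB.le hn ho p.2.1 p.2.2
  have hbench : Benchmark T B F S₀ o p w (fixedDistReward T B F o p) :=
    ⟨hn, hT, hB, hnT.1.le, hnT.2, hS₀, ho, hnull, p.2.1, p.2.2, hw0, hw1, hw, hY, hcost⟩
  have hRY : R ≤ fixedDistReward T B F o p := by linarith [hCR 2 (by linarith)]
  have h1 := key hbench hTT₁ (hRe ▸ hRY) (hRe ▸ hRT) (hRe ▸ hRB)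
  rw [← hRe] at h1
  set X := OPTFD T B F o
  set Y := fixedDistReward T B F o p
  have hX0 : 0 < X := by linarith
  have h2 : C₀ * (R * (1 + Y / B)) ≤ C₀ * (R * (1 + X / B)) := by gcongr
  have h3 : C * (R * (1 + X / (d * B))) = C * R + C * R * (X / (d * B)) := by ring
  have h4 : C₀ * (R * (1 + X / B)) = C₀ * R + C₀ * d * R * (X / (d * B)) := by field_simp
  have h5 : C₀ * d * R * (X / (d * B)) ≤ C * R * (X / (d * B)) := by
    gcongr; linarith
  have h6 := hCR (1 + C₀) (by linarith)
  rw [h3]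
  linarith

lemma adversarial_bound (d : ℕ) [NeZero d] : ∃ C : ℝ, 0 < C ∧
    ∀ {n T : ℕ} {B κ : ℝ} {F : Finset (Finset (Fin n))} {S₀ : Finset (Fin n)}
      {o : ℕ → Outcome n d}, 1 ≤ n → 2 ≤ T → 0 < B → 1 < κ → S₀ ∈ F →
      (∀ t < T, IsOutcome (o t)) → (∀ t < T, IsNullFor S₀ (o t)) → 0 < OPTFD T B F o →
      (1 - C * reg n T * (1 / OPTFD T B F o + 1 / (d * B))) /
          (1 / 2 * ((d : ℝ) + 1) * Real.log T) ≤
        advExpectedReward T B F κ o / OPTFD T B F o := by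
  have hd : (1 : ℝ) ≤ d := by exact_mod_cast NeZero.one_le
  obtain ⟨C, hC, key⟩ := exists_sub_le_guessIntegral d
  refine ⟨C, hC, fun {n T B κ F S₀ o} hn hT hB hκ hS₀ ho hnull hX => ?_⟩
  have hlog : 0 < Real.log T := by linarith [half_lt_log hT]
  have hR : 0 < C * reg n T := mul_pos hC (by linarith [one_le_reg hn hT])
  -- Otherwise the left-hand side is not positive.
  by_cases hpos : C * reg n T < OPTFD T B F o ∧ C * reg n T < d * B
  · have h1 := key hn hT hB hS₀ ho hnull hpos.1 hpos.2
    have h2 : advExpectedReward T B F κ o = guessIntegral T B F o / (Real.log T / 2) :=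
      advExpectedReward_eq hn hT ho hκ
    rw [h2, div_le_div_iff₀ (by positivity) hX]
    calc (1 - C * reg n T * (1 / OPTFD T B F o + 1 / (d * B))) * OPTFD T B F o =
        OPTFD T B F o - C * (reg n T * (1 + OPTFD T B F o / (d * B))) := by field_simp
      _ ≤ (d + 1) * guessIntegral T B F o := h1
      _ = _ := by field_simp
  · refine le_trans ?_ (div_nonneg (advExpectedReward_nonneg ho κ) hX.le)
    refine div_nonpos_of_nonpos_of_nonneg ?_ (by positivity)
    rw [mul_add, mul_one_div, mul_one_div, sub_nonpos]
    have p1 : 0 ≤ C * reg n T / OPTFD T B F o := by positivity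
    have p2 : 0 ≤ C * reg n T / (d * B) := by positivity
    rcases not_and_or.1 hpos with h1 | h1
    · have := (one_le_div hX).2 (not_lt.1 h1)
      linarith
    · have := (one_le_div (by positivity : 0 < (d : ℝ) * B)).2 (not_lt.1 h1)
      linarith

end Adversarial

end SemiBwK

end

open SemiBwK in
theorem corollary7p2 :
    -- (C1), the stochastic version
    (∃ C : ℝ, 0 < C ∧
      ∀ (n d T : ℕ) [NeZero d] (B : ℝ) (F : Finset (Finset (Fin n))) (S₀ : Finset (Fin n))
        (i₀ : Fin d) (D : Measure (Outcome n d)) [IsProbabilityMeasure D],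
        1 ≤ n → 1 ≤ T → 0 < B → B ≤ T → S₀ ∈ F →
        (∀ᵐ o ∂D, IsOutcome o) →
        (∀ᵐ o ∂D, IsNullFor S₀ o) →
        (∀ᵐ o ∂D, ∀ e, o e i₀.succ = 0) →
        1 - 1 / (T : ℝ) ≤
          (stochLaw D).real {x | OPTDP T B F i₀ D - stochReward T B F i₀ x ≤
            C * (T / B * (reg n T + √(T * Real.log d)))}) ∧
    -- (C2), the adversarial version
    (∀ (d : ℕ) [NeZero d], ∃ C : ℝ, 0 < C ∧
      ∀ (n T : ℕ) (B κ : ℝ) (F : Finset (Finset (Fin n))) (S₀ : Finset (Fin n))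
        (o : ℕ → Outcome n d),
        1 ≤ n → 2 ≤ T → 0 < B → B ≤ T → 1 < κ → S₀ ∈ F →
        (∀ t < T, IsOutcome (o t)) →
        (∀ t < T, IsNullFor S₀ (o t)) →
        0 < OPTFD T B F o →
        (1 - C * reg n T * (1 / OPTFD T B F o + 1 / (d * B))) /
            (1 / 2 * ((d : ℝ) + 1) * Real.log T) ≤
          advExpectedReward T B F κ o / OPTFD T B F o) := by
  refine ⟨⟨130, by norm_num, ?_⟩, fun d _ => ?_⟩
  · intro n d T _ B F S₀ i₀ D _ hn hT hB hBT hS₀ hD hD0 hDd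
    exact stochastic_bound hn hT hB hBT hS₀ hD hD0 hDd
  · obtain ⟨C, hC, h⟩ := adversarial_bound d
    exact ⟨C, hC, fun n T B κ F S₀ o hn hT hB _ hκ hS₀ ho hnull hX =>
      h hn hT hB hκ hS₀ ho hnull hX⟩
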